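/- **Theorem (linear Koszul duality).** Let $(X,\mathcal O_X)$ be either (a) a commutative ringed space, in which case "module" below means any sheaf of $\mathcal O_X$-modules, or (b) a scheme, in which case all dg-modules below are required to have quasi-coherent components. Let $n\ge 0$ and let $\mathcal X=(\cdots 0\to\mathcal V^{-n}\to\cdots\to\mathcal V^0\to 0\cdots)$ be a complex of locally free $\mathcal O_X$-modules of finite rank, placed in internal degree $2$ (and cohomological degrees $[-n,0]$). Let $\mathcal Y=\mathcal X^\vee[-1]$ as a bigraded module (internal degree $-2$), with differential $d(y)(v)=(-1)^{|y|}y(dv)$, and let $$\mathcal T=\mathrm{Sym}_{\mathcal O_X}(\mathcal X),\qquad \mathcal S=\mathrm{Sym}_{\mathcal O_X}(\mathcal Y)$$ be the graded-symmetric algebras with respect to the cohomological degree (odd elements have square zero), which are bigraded dg-algebras. A dg-module over $\mathcal T$ or $\mathcal S$ is a bigraded one, with differential of bidegree $(1,0)$. Let $\mathcal C(\mathcal T\text{-}\mathsf{Mod}_-)$ be the category of $\mathcal T$-dg-modules whose internal degree is bounded above, uniformly in the cohomological degree, and $\mathcal D(\mathcal T\text{-}\mathsf{Mod}_-)$ its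 derived category (the localization at quasi-isomorphisms, with distinguished triangles given by cones); similarly for $\mathcal S$. Put $(\mathcal T^\vee)^i_j=\mathcal Hom_{\mathcal O_X}(\mathcal T^{-i}_{-j},\mathcal O_X)$ with $(d\phi)(t)=(-1)^{|\phi|+1}\phi(dt)$ and $(t\cdot\phi)(t')=(-1)^{|t||\phi|}\phi(tt')$. For a $\mathcal T$-dg-module $\mathcal M$ let $\mathscr A(\mathcal M)=\mathcal S\otimes_{\mathcal O_X}\mathcal M$, with $\mathcal S$ acting by left multiplication on $\mathcal S$, and for an $\mathcal S$-dg-module $\mathcal N$ let $\mathscr B(\mathcal N)=\mathcal T^\vee\otimes_{\mathcal O_X}\mathcal N$, with $\mathcal T$ acting on $\mathcal T^\vee$, where the differentials are given, in terms of any local homogeneous basis $(x_\alpha)$ of $\mathcal X$ and the dual basis $(x_\alpha^*)$, by $$d(s\otimes m)=ds\otimes m+(-1)^{|s|}s\otimes dm+(-1)^{|s|}\sum_\alpha s\,x_\alpha^*\otimes x_\alpha m,$$ $$d(\phi\otimes n)=d\phi\otimes n+(-1)^{|\phi|}\phi\otimes dn+(-1)^{|\phi|}\sum_\alpha \phi(x_\alpha\cdot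 -)\otimes x_\alpha^* n .$$ Then $\mathscr A$ and $\mathscr B$ are well-defined functors between $\mathcal T$-dg-modules and $\mathcal S$-dg-modules, and: 1. they restrict to functors $\mathscr A:\mathcal C(\mathcal T\text{-}\mathsf{Mod}_-)\to\mathcal C(\mathcal S\text{-}\mathsf{Mod}_-)$ and $\mathscr B:\mathcal C(\mathcal S\text{-}\mathsf{Mod}_-)\to\mathcal C(\mathcal T\text{-}\mathsf{Mod}_-)$, which are exact, i.e. they preserve short exact sequences and quasi-isomorphisms; hence they induce functors $\overline{\mathscr A}:\mathcal D(\mathcal T\text{-}\mathsf{Mod}_-)\to\mathcal D(\mathcal S\text{-}\mathsf{Mod}_-)$ and $\overline{\mathscr B}:\mathcal D(\mathcal S\text{-}\mathsf{Mod}_-)\to\mathcal D(\mathcal T\text{-}\mathsf{Mod}_-)$; 2. $\overline{\mathscr A}$ and $\overline{\mathscr B}$ are equivalences of triangulated categories, quasi-inverse to each other. -/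

import Mathlib

universe u
open CategoryTheory Limits TopologicalSpace Opposite MonoidalCategory

namespace LinearKoszul
open scoped DirectSum
section GradedSymmetricAlgebra

variable (R : Type u) [CommRing R] (V : ℤ → Type u) [∀ i, AddCommGroup (V i)] [∀ i, Module R (V i)]

open scoped Classical in
noncomputable def tgen (i : ℤ) : V i →ₗ[R] TensorAlgebra R (⨁ i, V i) :=
  (TensorAlgebra.ι R).comp (DirectSum.lof R ℤ V i)

/-- The relations of the graded-symmetric algebra: `x y = (-1)^(i j) y x` for `x`, `y` homogeneous of
degrees `i`, `j`, and `x x = 0` for `x` of odd degree. -/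
inductive SymRel : TensorAlgebra R (⨁ i, V i) → TensorAlgebra R (⨁ i, V i) → Prop
  | comm (i j : ℤ) (x : V i) (y : V j) :
      SymRel (tgen R V i x * tgen R V j y)
        ((i * j).negOnePow • (tgen R V j y * tgen R V i x))
  | sq (i : ℤ) (hi : Odd i) (x : V i) : SymRel (tgen R V i x * tgen R V i x) 0

/-- The graded-symmetric algebra `Sym_R(V)` of a graded `R`-module `V`. -/
def GSym : Type u := RingQuot (SymRel R V)

noncomputable instance : Ring (GSym R V) := inferInstanceAs (Ring (RingQuot (SymRel R V)))
noncomputable instance : Algebra R (GSym R V) :=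
  inferInstanceAs (Algebra R (RingQuot (SymRel R V)))

namespace GSym

/-- The canonical map from the degree `i` part of `V` to `Sym_R(V)`. -/
noncomputable def gen (i : ℤ) : V i →ₗ[R] GSym R V :=
  (RingQuot.mkAlgHom R (SymRel R V)).toLinearMap.comp (tgen R V i)

variable {R V}

lemma gen_mul_gen (i j : ℤ) (x : V i) (y : V j) :
    gen R V i x * gen R V j y = (i * j).negOnePow • (gen R V j y * gen R V i x) := by
  have := RingQuot.mkAlgHom_rel R (SymRel.comm (R := R) i j x y)
  rw [Units.smul_def, map_zsmul, map_mul, map_mul] at this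
  rw [Units.smul_def]
  exact this

lemma gen_mul_self (i : ℤ) (hi : Odd i) (x : V i) : gen R V i x * gen R V i x = 0 := by
  have := RingQuot.mkAlgHom_rel R (SymRel.sq (R := R) i hi x)
  rw [map_mul, map_zero] at this
  exact this

section lift
variable {A : Type u} [Ring A] [Algebra R A] (f : ∀ i, V i →ₗ[R] A)
  (hc : ∀ i j x y, f i x * f j y = (i * j).negOnePow • (f j y * f i x))
  (hs : ∀ i, Odd i → ∀ x, f i x * f i x = 0)

open scoped Classical in
noncomputable def lift : GSym R V →ₐ[R] A :=
  RingQuot.liftAlgHom R ⟨TensorAlgebra.lift R (DirectSum.toModule R ℤ A f), by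
    have key : ∀ i x, TensorAlgebra.lift R (DirectSum.toModule R ℤ A f) (tgen R V i x) = f i x := by
      intro i x; simp [tgen]
    rintro _ _ (⟨i, j, x, y⟩ | ⟨i, hi, x⟩)
    · rw [Units.smul_def, map_zsmul, map_mul, map_mul, key, key, hc, Units.smul_def]
    · rw [map_mul, key, hs i hi, map_zero]⟩

lemma lift_gen (i : ℤ) (x : V i) : lift f hc hs (gen R V i x) = f i x := by
  change RingQuot.liftAlgHom R _ (RingQuot.mkAlgHom R (SymRel R V) (tgen R V i x)) = _
  rw [RingQuot.liftAlgHom_mkAlgHom_apply]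
  simp [tgen]
end lift

/-- The product of a list of homogeneous generators. -/
noncomputable def mon (l : List (Σ i, V i)) : GSym R V :=
  (l.map fun v => gen R V v.1 v.2).prod

variable (R V) in
/-- The bihomogeneous part of `Sym_R(V)` of cohomological degree `p` and internal degree `q`, when all
of `V` is placed in internal degree `w`: it is spanned by the products of generators whose degrees
sum to `p` and whose number times `w` is `q`. -/
noncomputable def piece (w p q : ℤ) : Submodule R (GSym R V) :=
  Submodule.span R {z | ∃ l : List (Σ i, V i),
    (l.map Sigma.fst).sum = p ∧ w * l.length = q ∧ mon l = z}

lemma mon_mem (w : ℤ) (l : List (Σ i, V i)) {p q : ℤ} (hp : (l.map Sigma.fst).sum = p)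
    (hq : w * l.length = q) : (mon l : GSym R V) ∈ piece R V w p q :=
  Submodule.subset_span ⟨l, hp, hq, rfl⟩

lemma gen_mem (w i : ℤ) (x : V i) : gen R V i x ∈ piece R V w i w := by
  simpa [mon] using mon_mem (R := R) w [⟨i, x⟩] (p := i) (q := w) (by simp) (by simp)

lemma one_mem (w : ℤ) : (1 : GSym R V) ∈ piece R V w 0 0 := by
  simpa [mon] using mon_mem (R := R) (V := V) w [] (p := 0) (q := 0) (by simp) (by simp)

lemma mul_mem (w : ℤ) {a b p i j q : ℤ} (h : a + b = p) (h' : i + j = q) {x y : GSym R V}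
    (hx : x ∈ piece R V w a i) (hy : y ∈ piece R V w b j) : x * y ∈ piece R V w p q := by
  subst h h'
  induction hx using Submodule.span_induction with
  | mem x hx =>
    obtain ⟨l, h1, h2, rfl⟩ := hx
    induction hy using Submodule.span_induction with
    | mem y hy =>
      obtain ⟨l', h1', h2', rfl⟩ := hy
      have := mon_mem (R := R) w (l ++ l') (p := a + b) (q := i + j) (by simp [h1, h1'])
        (by simp [← h2, ← h2', mul_add])
      simpa [mon] using this
    | zero => simp
    | add y z _ _ hy hz => rw [mul_add]; exact add_mem hy hz
    | smul r y _ hy => rw [Algebra.mul_smul_comm]; exact Submodule.smul_mem _ _ hy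
  | zero => simp
  | add y z _ _ hy hz => rw [add_mul]; exact add_mem hy hz
  | smul r y _ hy => rw [Algebra.smul_mul_assoc]; exact Submodule.smul_mem _ _ hy

lemma mat_comm {A : Type u} [Ring A] (i j : ℤ) {x y dx dy : A}
    (h1 : x * y = (i * j).negOnePow • (y * x))
    (h2 : x * dy = (i * (j + 1)).negOnePow • (dy * x))
    (h3 : dx * y = ((i + 1) * j).negOnePow • (y * dx)) :
    !![i.negOnePow • x, dx; 0, x] * !![j.negOnePow • y, dy; 0, y] =
      (i * j).negOnePow • (!![j.negOnePow • y, dy; 0, y] * !![i.negOnePow • x, dx; 0, x]) := by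
  rcases Int.even_or_odd i with hi | hi <;> rcases Int.even_or_odd j with hj | hj <;>
  simp only [Int.negOnePow_even, Int.negOnePow_odd, hi, hj, Int.even_mul, Int.odd_mul, true_or,
    or_true, and_self, Even.add_one, Odd.add_one, one_smul, Units.neg_smul] at h1 h2 h3 ⊢ <;>
  simp [h1, h2, h3, add_comm]

lemma mat_sq {A : Type u} [Ring A] (i : ℤ) (hi : Odd i) {x dx : A} (h1 : x * x = 0)
    (h2 : x * dx = (i * (i + 1)).negOnePow • (dx * x)) :
    !![i.negOnePow • x, dx; 0, x] * !![i.negOnePow • x, dx; 0, x] = 0 := by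
  rw [Int.negOnePow_even _ (Int.even_mul_succ_self i), one_smul] at h2
  ext a b
  fin_cases a <;> fin_cases b <;> simp [h1, h2, Int.negOnePow_odd _ hi]

section differential
variable (δ : ∀ i, V i →ₗ[R] V (i + 1))

/-- On a generator `x` of degree `i`, the matrix with diagonal `(-1)^i x`, `x` and upper right entry
`δ x`. -/
noncomputable def dmat (i : ℤ) : V i →ₗ[R] Matrix (Fin 2) (Fin 2) (GSym R V) where
  toFun x := !![i.negOnePow • gen R V i x, gen R V (i + 1) (δ i x); 0, gen R V i x]
  map_add' x y := by ext a b; fin_cases a <;> fin_cases b <;> simp [smul_add]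
  map_smul' r x := by
    ext a b; fin_cases a <;> fin_cases b <;> simp [Units.smul_def]

/-- The algebra map to upper triangular matrices whose upper right entry is the graded derivation
extending `δ`; on a homogeneous `x` the diagonal entries are `(-1)^|x| x` and `x`. -/
noncomputable def dHom : GSym R V →ₐ[R] Matrix (Fin 2) (Fin 2) (GSym R V) :=
  lift (dmat δ)
    (fun i j x y => mat_comm i j (gen_mul_gen i j x y) (gen_mul_gen i (j + 1) x (δ j y))
      (gen_mul_gen (i + 1) j (δ i x) y))
    (fun i hi x => mat_sq i hi (gen_mul_self i hi x) (gen_mul_gen i (i + 1) x (δ i x)))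

lemma dHom_gen (i : ℤ) (x : V i) : dHom δ (gen R V i x) =
    !![i.negOnePow • gen R V i x, gen R V (i + 1) (δ i x); 0, gen R V i x] :=
  lift_gen _ _ _ i x

/-- The unique graded derivation of `Sym_R(V)` that extends `δ` (see `d_gen` and `d_mul`). -/
noncomputable def d : GSym R V →ₗ[R] GSym R V where
  toFun z := dHom δ z 0 1
  map_add' x y := by simp
  map_smul' r x := by simp

lemma mon_cons (v : Σ i, V i) (l : List (Σ i, V i)) :
    (mon (v :: l) : GSym R V) = gen R V v.1 v.2 * mon l := by simp [mon]

lemma dHom_mon (l : List (Σ i, V i)) : dHom δ (mon l : GSym R V) 1 1 = mon l ∧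
    dHom δ (mon l : GSym R V) 1 0 = 0 ∧
    dHom δ (mon l : GSym R V) 0 0 = (l.map Sigma.fst).sum.negOnePow • mon l := by
  induction l with
  | nil => simp [mon]
  | cons v l ih =>
    rw [mon_cons, map_mul, dHom_gen]
    refine ⟨by simp [Matrix.mul_apply, ih], by simp [Matrix.mul_apply, ih], ?_⟩
    rw [List.map_cons, List.sum_cons, Int.negOnePow_add, mul_smul]
    rcases Int.even_or_odd v.1 with hi | hi <;>
    rcases Int.even_or_odd (l.map Sigma.fst).sum with hj | hj <;>
    simp [Matrix.mul_apply, ih, Int.negOnePow_even, Int.negOnePow_odd, hi, hj]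

lemma d_mon_cons (v : Σ i, V i) (l : List (Σ i, V i)) :
    d δ (mon (v :: l) : GSym R V) = gen R V (v.1 + 1) (δ v.1 v.2) * mon l +
      v.1.negOnePow • (gen R V v.1 v.2 * d δ (mon l)) := by
  rw [mon_cons]
  change dHom δ _ 0 1 = _ + _ • (_ * dHom δ (mon l) 0 1)
  rw [map_mul, dHom_gen]
  rcases Int.even_or_odd v.1 with hi | hi <;>
  simp [Matrix.mul_apply, dHom_mon δ l, add_comm, Int.negOnePow_even, Int.negOnePow_odd, hi]

lemma d_one : d δ (1 : GSym R V) = 0 := by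
  change dHom δ _ 0 1 = 0
  simp

lemma d_gen (i : ℤ) (x : V i) : d δ (gen R V i x) = gen R V (i + 1) (δ i x) := by
  change dHom δ _ 0 1 = _
  simp [dHom_gen]

lemma d_mul (w : ℤ) {a i b j : ℤ} {x y : GSym R V} (hx : x ∈ piece R V w a i)
    (hy : y ∈ piece R V w b j) :
    d δ (x * y) = d δ x * y + a.negOnePow • (x * d δ y) := by
  have h : dHom δ x 0 0 = a.negOnePow • x := by
    induction hx using Submodule.span_induction with
    | mem x hx => obtain ⟨l, h1, h2, rfl⟩ := hx; rw [(dHom_mon δ l).2.2, h1]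
    | zero => simp
    | add y z _ _ hy hz => simp [hy, hz, smul_add]
    | smul r y _ hy => simp [hy, Units.smul_def]
  have h' : dHom δ y 1 1 = y := by
    induction hy using Submodule.span_induction with
    | mem x hx => obtain ⟨l, h1, h2, rfl⟩ := hx; rw [(dHom_mon δ l).1]
    | zero => simp
    | add y z _ _ hy hz => simp [hy, hz]
    | smul r y _ hy => simp [hy]
  change dHom δ _ 0 1 = dHom δ _ 0 1 * _ + _ • (_ * dHom δ _ 0 1)
  rcases Int.even_or_odd a with hi | hi <;>
  simp [Matrix.mul_apply, h, h', add_comm, Int.negOnePow_even, Int.negOnePow_odd, hi]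

lemma d_mem (w : ℤ) {a i a' : ℤ} (h : a + 1 = a') {x : GSym R V} (hx : x ∈ piece R V w a i) :
    d δ x ∈ piece R V w a' i := by
  induction hx using Submodule.span_induction with
  | zero => simp
  | add y z _ _ hy hz => rw [map_add]; exact add_mem hy hz
  | smul r y _ hy => rw [map_smul]; exact Submodule.smul_mem _ _ hy
  | mem x hx =>
    obtain ⟨l, h1, h2, rfl⟩ := hx
    induction l generalizing a i a' with
    | nil =>
      have : (mon [] : GSym R V) = 1 := by simp [mon]
      rw [this, d_one]; exact zero_mem _
    | cons v l ih =>
      rw [d_mon_cons]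
      simp only [List.map_cons, List.sum_cons, List.length_cons, Nat.cast_add, Nat.cast_one] at h1 h2
      refine add_mem (mul_mem w (b := (l.map Sigma.fst).sum) (j := w * l.length) ?_ ?_
        (gen_mem w _ _) (mon_mem w l rfl rfl)) ?_
      · omega
      · rw [← h2]; ring
      rw [Units.smul_def]
      refine zsmul_mem (mul_mem w ?_ ?_ (gen_mem w _ _) (ih (a' := (l.map Sigma.fst).sum + 1) rfl rfl rfl)) _
      · omega
      · rw [← h2]; ring

lemma d_d (hδ : ∀ i x, δ (i + 1) (δ i x) = 0) {w a i : ℤ} {x : GSym R V}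
    (hx : x ∈ piece R V w a i) : d δ (d δ x) = 0 := by
  induction hx using Submodule.span_induction with
  | zero => simp
  | add y z _ _ hy hz => rw [map_add, map_add, hy, hz, add_zero]
  | smul r y _ hy => rw [map_smul, map_smul, hy, smul_zero]
  | mem x hx =>
    obtain ⟨l, h1, h2, rfl⟩ := hx
    clear h1 h2
    induction l with
    | nil =>
      have : (mon [] : GSym R V) = 1 := by simp [mon]
      rw [this, d_one, map_zero]
    | cons v l ih =>
      have hl := mon_mem (R := R) w l rfl rfl
      rw [d_mon_cons, map_add, d_mul δ w (gen_mem w _ _) hl, d_gen, hδ, map_zero, zero_mul, zero_add,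
        Units.smul_def (v.1.negOnePow), map_zsmul,
        d_mul δ w (gen_mem w _ _) (d_mem δ w rfl hl), ih, mul_zero, smul_zero, add_zero,
        d_gen, ← Units.smul_def, Int.negOnePow_succ]
      simp
end differential

section map
variable {R' : Type u} [CommRing R'] {V' : ℤ → Type u} [∀ i, AddCommGroup (V' i)]
  [∀ i, Module R' (V' i)] (φ : R →+* R') (f : ∀ i, V i →ₛₗ[φ] V' i)

/-- Functoriality of the graded-symmetric algebra, along a change of the base ring. -/
noncomputable def map : GSym R V →+* GSym R' V' :=
  letI : Algebra R (GSym R' V') := Algebra.compHom _ φ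
  (lift (A := GSym R' V')
    (fun i =>
      { toFun x := gen R' V' i (f i x)
        map_add' := by simp
        map_smul' r x := by simp; rfl })
    (fun i j x y => gen_mul_gen i j (f i x) (f j y))
    (fun i hi x => gen_mul_self i hi (f i x))).toRingHom

lemma map_gen (i : ℤ) (x : V i) : map φ f (gen R V i x) = gen R' V' i (f i x) := by
  let : Algebra R (GSym R' V') := Algebra.compHom _ φ
  exact lift_gen _ _ _ i x

lemma map_smul (r : R) (x : GSym R V) : map φ f (r • x) = φ r • map φ f x := by
  let : Algebra R (GSym R' V') := Algebra.compHom _ φ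
  exact _root_.map_smul (lift (A := GSym R' V') _ _ _) r x

lemma map_mon (l : List (Σ i, V i)) :
    map φ f (mon l) = mon (l.map fun v => ⟨v.1, f v.1 v.2⟩) := by
  simp [mon, map_list_prod, Function.comp_def, map_gen]

lemma map_mem {w p q : ℤ} {x : GSym R V} (hx : x ∈ piece R V w p q) :
    map φ f x ∈ piece R' V' w p q := by
  induction hx using Submodule.span_induction with
  | mem x hx =>
    obtain ⟨l, h1, h2, rfl⟩ := hx
    rw [map_mon]
    exact mon_mem w _ (by simpa [Function.comp_def] using h1) (by simpa using h2)
  | zero => simp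
  | add y z _ _ hy hz => rw [map_add]; exact add_mem hy hz
  | smul r y _ hy => rw [map_smul]; exact Submodule.smul_mem _ _ hy

lemma map_d (δ : ∀ i, V i →ₗ[R] V (i + 1)) (δ' : ∀ i, V' i →ₗ[R'] V' (i + 1))
    (h : ∀ i x, f (i + 1) (δ i x) = δ' i (f i x)) {w p q : ℤ} {x : GSym R V}
    (hx : x ∈ piece R V w p q) : map φ f (d δ x) = d δ' (map φ f x) := by
  induction hx using Submodule.span_induction with
  | mem x hx =>
    obtain ⟨l, h1, h2, rfl⟩ := hx
    clear h1 h2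
    induction l with
    | nil =>
      have : (mon [] : GSym R V) = 1 := by simp [mon]
      rw [this, d_one, map_one, d_one, map_zero]
    | cons v l ih =>
      rw [map_mon, List.map_cons, d_mon_cons, d_mon_cons, map_add, map_mul, map_gen, h, map_mon,
        Units.smul_def, Units.smul_def, map_zsmul, map_mul, map_gen, ih, map_mon]
  | zero => simp
  | add y z _ _ hy hz => simp [hy, hz]
  | smul r y _ hy => simp [map_smul, hy]

lemma map_ext {A : Type u} [Ring A] (g h : GSym R V →+* A)
    (h1 : ∀ r : R, g (algebraMap R _ r) = h (algebraMap R _ r))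
    (h2 : ∀ i x, g (gen R V i x) = h (gen R V i x)) {w p q : ℤ} {x : GSym R V}
    (hx : x ∈ piece R V w p q) : g x = h x := by
  induction hx using Submodule.span_induction with
  | mem x hx =>
    obtain ⟨l, -, -, rfl⟩ := hx
    simp [mon, map_list_prod, Function.comp_def, h2]
  | zero => simp
  | add y z _ _ hy hz => simp [hy, hz]
  | smul r y _ hy => simp [Algebra.smul_def, h1, hy]
end map
end GSym
end GradedSymmetricAlgebra
section Presheaf
variable {X : TopCat.{u}} (O : Sheaf (Opens.grothendieckTopology X) CommRingCat.{u})

/-- The sheaf of commutative rings `O`, as a sheaf of rings. -/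
abbrev RS : Sheaf (Opens.grothendieckTopology X) RingCat.{u} :=
  (sheafCompose _ (forget₂ CommRingCat.{u} RingCat.{u})).obj O

/-- Presheaves of `O`-modules. -/
abbrev PMod := PresheafOfModules.{u} (O.obj ⋙ forget₂ CommRingCat.{u} RingCat.{u})
/-- Sheaves of `O`-modules. -/
abbrev Mod := SheafOfModules.{u} (RS O)

/-- The ring of sections of `O` over `U`. -/
abbrev Fn (U : Opens X) : Type u := O.obj.obj (op U)

/-- Restriction of functions. -/
abbrev resFn {U V : Opens X} (h : V ≤ U) : Fn O U →+* Fn O V := (O.obj.map (homOfLE h).op).hom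

variable {O}

/-- The sections over `U` of a presheaf of modules. -/
abbrev Sec (F : PMod O) (U : Opens X) : Type u := F.obj (op U)

/-- Restriction of sections. -/
noncomputable def res (F : PMod O) {U V : Opens X} (h : V ≤ U) : Sec F U →ₛₗ[resFn O h] Sec F V :=
  F.restrictₛₗ (homOfLE h).op

lemma res_res (F : PMod O) {U V W : Opens X} (h : V ≤ U) (h' : W ≤ V) (x : Sec F U) :
    res F h' (res F h x) = res F (h'.trans h) x :=
  (F.map_comp_apply (homOfLE h).op (homOfLE h').op x).symm

lemma res_refl (F : PMod O) {U : Opens X} (x : Sec F U) : res F le_rfl x = x := by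
  have := F.map_id (op U)
  change F.map (𝟙 (op U)) x = x
  rw [this]; rfl

lemma resFn_resFn {U V W : Opens X} (h : V ≤ U) (h' : W ≤ V) (x : Fn O U) :
    resFn O h' (resFn O h x) = resFn O (h'.trans h) x := by
  change _ = (O.obj.map ((homOfLE h).op ≫ (homOfLE h').op)).hom x
  rw [O.obj.map_comp]; rfl

lemma resFn_refl {U : Opens X} (x : Fn O U) : resFn O le_rfl x = x := by
  change (O.obj.map (𝟙 (op U))).hom x = x
  rw [O.obj.map_id]; rfl

/-- The map on sections over `U` induced by a morphism of presheaves of modules. -/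
def secMap {F G : PMod O} (f : F ⟶ G) (U : Opens X) : Sec F U →ₗ[Fn O U] Sec G U :=
  (f.app (op U)).hom

lemma secMap_res {F G : PMod O} (f : F ⟶ G) {U V : Opens X} (h : V ≤ U) (x : Sec F U) :
    secMap f V (res F h x) = res G h (secMap f U x) :=
  PresheafOfModules.naturality_apply f (homOfLE h).op x

@[simp] lemma secMap_comp {F G H : PMod O} (f : F ⟶ G) (g : G ⟶ H) (U : Opens X) (x : Sec F U) :
    secMap (f ≫ g) U x = secMap g U (secMap f U x) := rfl
@[simp] lemma secMap_id (F : PMod O) (U : Opens X) (x : Sec F U) :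
    secMap (𝟙 F) U x = x := rfl
@[simp] lemma secMap_zero (F G : PMod O) (U : Opens X) (x : Sec F U) :
    secMap (0 : F ⟶ G) U x = 0 := rfl

/-- A presheaf of modules from modules `F U` and restriction maps. -/
noncomputable def mkPMod (F : Opens X → Type u) [∀ U, AddCommGroup (F U)] [∀ U, Module (Fn O U) (F U)]
    (r : ∀ {U V : Opens X} (h : V ≤ U), F U →ₛₗ[resFn O h] F V)
    (r_refl : ∀ {U : Opens X} (x : F U), r le_rfl x = x)
    (r_r : ∀ {U V W : Opens X} (h : V ≤ U) (h' : W ≤ V) (x : F U),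
      r h' (r h x) = r (h'.trans h) x) : PMod O where
  obj U := ModuleCat.of (Fn O U.unop) (F U.unop)
  map {U V} f := ModuleCat.ofHom
      (Y := (ModuleCat.restrictScalars (O.obj.map f).hom).obj (ModuleCat.of (Fn O V.unop) (F V.unop)))
    { toFun := fun x ↦ r (leOfHom f.unop) x
      map_add' := map_add _
      map_smul' := fun a x ↦ (r (leOfHom f.unop)).map_smulₛₗ a x }
  map_id U := by ext x; exact r_refl x
  map_comp f g := by ext x; exact (r_r _ _ _).symm

/-- A morphism of presheaves of modules from maps compatible with restriction. -/
noncomputable def mkHom {F G : PMod O} (f : ∀ U, Sec F U →ₗ[Fn O U] Sec G U)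
    (hf : ∀ {U V : Opens X} (h : V ≤ U) (x : Sec F U), f V (res F h x) = res G h (f U x)) :
    F ⟶ G where
  app U := ModuleCat.ofHom (f U.unop)
  naturality {U V} g := by
    ext x
    exact hf (leOfHom g.unop) x

noncomputable def sheafifyAux (R : Sheaf (Opens.grothendieckTopology X) RingCat.{u})
    (F : PresheafOfModules.{u} R.obj) : SheafOfModules.{u} R :=
  (PresheafOfModules.sheafification (𝟙 R.obj)).obj F
noncomputable def unitAux (R : Sheaf (Opens.grothendieckTopology X) RingCat.{u})
    (F : PresheafOfModules.{u} R.obj) : F ⟶ (sheafifyAux R F).val :=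
  (PresheafOfModules.sheafificationAdjunction (𝟙 R.obj)).unit.app F
/-- The sheafification of a presheaf of modules. -/
noncomputable def shf (F : PMod O) : Mod O := sheafifyAux (RS O) F
/-- The canonical map from a presheaf of modules to its sheafification. -/
noncomputable def toShf (F : PMod O) : F ⟶ (shf F).val := unitAux (RS O) F

/-- A section over `U` of the dual of `F`: a morphism from the restriction of `F` to `U` to the
restriction of `O` to `U`. -/
@[ext] structure DualSec (F : PMod O) (U : Opens X) where
  app (W : Opens X) (h : W ≤ U) : Sec F W →ₗ[Fn O W] Fn O W
  app_res (W W' : Opens X) (h : W ≤ U) (h' : W' ≤ W) (x : Sec F W) :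
    app W' (h'.trans h) (res F h' x) = resFn O h' (app W h x)

namespace DualSec
variable {F : PMod O} {U : Opens X}
instance : Zero (DualSec F U) := ⟨⟨fun _ _ => 0, by simp⟩⟩
instance : Add (DualSec F U) := ⟨fun a b => ⟨fun W h => a.app W h + b.app W h, by
  intros; simp only [LinearMap.add_apply, app_res, map_add, *]⟩⟩
instance : Neg (DualSec F U) := ⟨fun a => ⟨fun W h => - a.app W h, by
  intros; simp only [LinearMap.neg_apply, app_res, map_neg, *]⟩⟩
instance : SMul (Fn O U) (DualSec F U) := ⟨fun r a => ⟨fun W h => resFn O h r • a.app W h, by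
  intros; simp only [LinearMap.smul_apply, app_res, smul_eq_mul, map_mul, resFn_resFn, *]⟩⟩
@[simp] lemma add_app (a b : DualSec F U) (W h) : (a + b).app W h = a.app W h + b.app W h := rfl
@[simp] lemma zero_app (W h) : (0 : DualSec F U).app W h = 0 := rfl
@[simp] lemma neg_app (a : DualSec F U) (W h) : (-a).app W h = -a.app W h := rfl
@[simp] lemma smul_app (r : Fn O U) (a : DualSec F U) (W h) :
    (r • a).app W h = resFn O h r • a.app W h := rfl
instance : AddCommGroup (DualSec F U) where
  add_assoc _ _ _ := by ext : 3; simp [add_assoc]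
  zero_add _ := by ext : 3; simp
  add_zero _ := by ext : 3; simp
  nsmul := nsmulRec
  zsmul := zsmulRec
  neg_add_cancel _ := by ext : 3; simp
  add_comm _ _ := by ext : 3; simp [add_comm]
instance : Module (Fn O U) (DualSec F U) where
  one_smul _ := by ext : 3; simp
  mul_smul _ _ _ := by ext : 3; simp [mul_smul]
  smul_zero _ := by ext : 3; simp
  smul_add _ _ _ := by ext : 3; simp
  add_smul _ _ _ := by ext : 3; simp [add_smul]
  zero_smul _ := by ext : 3; simp
def restr {V : Opens X} (h : V ≤ U) : DualSec F U →ₛₗ[resFn O h] DualSec F V where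
  toFun a := ⟨fun W hW => a.app W (hW.trans h), fun _ _ _ h' x => a.app_res _ _ _ h' x⟩
  map_add' _ _ := rfl
  map_smul' r a := by ext : 3; simp only [smul_app, resFn_resFn]
end DualSec

/-- The dual `Hom_O(F, O)` of a presheaf of modules (the internal Hom; a sheaf, which depends only on
the sheafification of `F`). -/
noncomputable def dual (F : PMod O) : PMod O :=
  mkPMod (fun U => DualSec F U) DualSec.restr (fun _ => rfl) (fun _ _ _ => rfl)

/-- Evaluation of a section of the dual of `F` over `U` on sections of `F` over smaller opens. -/
def ev {F : PMod O} {U : Opens X} (φ : Sec (dual F) U) {W : Opens X} (h : W ≤ U) :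
    Sec F W →ₗ[Fn O W] Fn O W :=
  DualSec.app φ W h

/-- The transpose of a morphism. -/
noncomputable def dualMap {F G : PMod O} (f : F ⟶ G) : dual G ⟶ dual F :=
  mkHom (fun U =>
    { toFun φ := (⟨fun W h => (DualSec.app φ W h).comp (secMap f W), by
        intro W W' h h' x
        simp only [LinearMap.comp_apply, secMap_res]
        exact DualSec.app_res φ _ _ _ _ _⟩ : DualSec F U)
      map_add' _ _ := rfl
      map_smul' _ _ := rfl }) (fun _ _ => rfl)

lemma dualMap_zero (F G : PMod O) : dualMap (0 : F ⟶ G) = 0 := by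
  ext U φ
  refine DualSec.ext (funext fun W => funext fun h => ?_)
  exact LinearMap.comp_zero _

lemma dualMap_comp {F G H : PMod O} (f : F ⟶ G) (g : G ⟶ H) :
  dualMap (f ≫ g) = dualMap g ≫ dualMap f := rfl

lemma secMap_smul {F G : PMod O} (k : ℤˣ) (f : F ⟶ G) (U : Opens X) (x : Sec F U) :
    secMap (k • f) U x = k • secMap f U x := by
  rcases Int.units_eq_one_or k with rfl | rfl
  · simp
  · simp [Units.neg_smul]; rfl

/-- The forgetful functor from sheaves to presheaves of modules. -/
def toP : Mod O ⥤ PMod O := SheafOfModules.forget (RS O)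

instance : (toP (O := O)).Additive := inferInstanceAs (SheafOfModules.forget (RS O)).Additive

/-- The complex `V^∨[-1]`: its term of degree `k` is the dual of `V^(1-k)`, and its differential is
`(d y)(v) = (-1)^|y| y(d v)`, where `|y| = k` is the degree of `y` in this complex. -/
noncomputable def dualComplex (V : CochainComplex (Mod O) ℤ) : CochainComplex (PMod O) ℤ where
  X k := dual (toP.obj (V.X (1 - k)))
  d k l := k.negOnePow • dualMap (toP.map (V.d (1 - l) (1 - k)))
  shape k l h := by
    rw [V.shape _ _ (by simp only [ComplexShape.up_Rel] at h ⊢; omega), Functor.map_zero,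
      dualMap_zero, smul_zero]
  d_comp_d' k l m _ _ := by
    rw [Linear.units_smul_comp, Linear.comp_units_smul, ← dualMap_comp, ← Functor.map_comp,
      V.d_comp_d, Functor.map_zero, dualMap_zero, smul_zero, smul_zero]

variable (O) in
/-- A bigraded presheaf of dg-algebras over `O`: `obj p q` is the part of cohomological degree `p` and
internal degree `q`, the differential has bidegree `(1, 0)`, the product is additive in both degrees
and the differential is a derivation with respect to the cohomological degree. (A sheaf of modules
over such a presheaf of algebras is the same thing as a sheaf of modules over its sheafification.) -/
structure DGAlg where
  obj : ℤ → ℤ → PMod O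
  d {a a' : ℤ} (h : a + 1 = a') (i : ℤ) : obj a i ⟶ obj a' i
  mul {a b p i j q : ℤ} (h : a + b = p) (h' : i + j = q) (U : Opens X) :
    Sec (obj a i) U →ₗ[Fn O U] Sec (obj b j) U →ₗ[Fn O U] Sec (obj p q) U
  one (U : Opens X) : Sec (obj 0 0) U
  mul_res {a b p i j q : ℤ} (h : a + b = p) (h' : i + j = q) {U V : Opens X} (hV : V ≤ U)
    (x : Sec (obj a i) U) (y : Sec (obj b j) U) :
    mul h h' V (res _ hV x) (res _ hV y) = res _ hV (mul h h' U x y)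
  one_res {U V : Opens X} (hV : V ≤ U) : res _ hV (one U) = one V
  one_mul {a i : ℤ} (U : Opens X) (x : Sec (obj a i) U) :
    mul (zero_add a) (zero_add i) U (one U) x = x
  mul_one {a i : ℤ} (U : Opens X) (x : Sec (obj a i) U) :
    mul (add_zero a) (add_zero i) U x (one U) = x
  mul_assoc {a b c ab bc p i j k ij jk q : ℤ} (h₁ : a + b = ab) (h₂ : ab + c = p)
    (h₃ : b + c = bc) (h₄ : a + bc = p) (h₁' : i + j = ij) (h₂' : ij + k = q)
    (h₃' : j + k = jk) (h₄' : i + jk = q) (U : Opens X)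
    (x : Sec (obj a i) U) (y : Sec (obj b j) U) (z : Sec (obj c k) U) :
    mul h₂ h₂' U (mul h₁ h₁' U x y) z = mul h₄ h₄' U x (mul h₃ h₃' U y z)
  d_d {a a' a'' : ℤ} (h : a + 1 = a') (h' : a' + 1 = a'') (i : ℤ) : d h i ≫ d h' i = 0
  leibniz {a b p a' b' p' i j q : ℤ} (h : a + b = p) (ha : a + 1 = a') (hb : b + 1 = b')
    (hp : p + 1 = p') (h₁ : a' + b = p') (h₂ : a + b' = p') (h' : i + j = q) (U : Opens X)
    (x : Sec (obj a i) U) (y : Sec (obj b j) U) :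
    secMap (d hp q) U (mul h h' U x y) =
      mul h₁ h' U (secMap (d ha i) U x) y + a.negOnePow • mul h₂ h' U x (secMap (d hb j) U y)

section Sym
variable (w : ℤ) (V : CochainComplex (PMod O) ℤ)

/-- The graded-symmetric algebra over `O(U)` of the sections of `V` over `U`. -/
abbrev SymSec (U : Opens X) : Type u := GSym (Fn O U) (fun i => Sec (V.X i) U)

/-- Restriction of sections of the presheaf of graded-symmetric algebras. -/
noncomputable def symRes {U W : Opens X} (h : W ≤ U) : SymSec V U →+* SymSec V W :=
  GSym.map (resFn O h) (fun i => res (V.X i) h)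

/-- The differential on sections of the graded-symmetric algebra of a complex. -/
noncomputable def symD (U : Opens X) : SymSec V U →ₗ[Fn O U] SymSec V U :=
  GSym.d (fun i => secMap (V.d i (i + 1)) U)

/-- The part of bidegree `(p, q)` of `SymSec V U`. -/
noncomputable abbrev SymPiece (p q : ℤ) (U : Opens X) : Submodule (Fn O U) (SymSec V U) :=
  GSym.piece (Fn O U) (fun i => Sec (V.X i) U) w p q

noncomputable def symPieceRes (p q : ℤ) {U W : Opens X} (h : W ≤ U) :
    SymPiece w V p q U →ₛₗ[resFn O h] SymPiece w V p q W where
  toFun x := ⟨symRes V h x.1, GSym.map_mem _ _ x.2⟩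
  map_add' _ _ := Subtype.ext (map_add _ _ _)
  map_smul' r x := Subtype.ext (GSym.map_smul _ _ r x.1)

lemma symRes_refl {p q : ℤ} {U : Opens X} (x : SymPiece w V p q U) :
    symRes V le_rfl x.1 = x.1 := by
  refine GSym.map_ext (symRes V le_rfl) (RingHom.id _) ?_ ?_ x.2
  · intro r
    rw [Algebra.algebraMap_eq_smul_one, symRes, GSym.map_smul, resFn_refl, map_one]; rfl
  · intro i x
    rw [symRes, GSym.map_gen, res_refl]; rfl

lemma symRes_symRes {p q : ℤ} {U W Z : Opens X} (h : W ≤ U) (h' : Z ≤ W)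
    (x : SymPiece w V p q U) :
    symRes V h' (symRes V h x.1) = symRes V (h'.trans h) x.1 := by
  refine GSym.map_ext ((symRes V h').comp (symRes V h)) (symRes V (h'.trans h)) ?_ ?_ x.2
  · intro r
    simp only [RingHom.comp_apply, Algebra.algebraMap_eq_smul_one, symRes, GSym.map_smul,
      resFn_resFn, map_one]
  · intro i x
    simp only [RingHom.comp_apply, symRes, GSym.map_gen, res_res]

/-- The presheaf of modules `U ↦ Sym(V(U))`, in bidegree `(p, q)`. -/
noncomputable def symObj (p q : ℤ) : PMod O :=
  mkPMod (fun U => SymPiece w V p q U) (symPieceRes w V p q)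
    (fun x => Subtype.ext (symRes_refl w V x))
    (fun h h' x => Subtype.ext (symRes_symRes w V h h' x))

/-- The bigraded dg-algebra `Sym_O(V)` of a complex `V` placed in internal degree `w`, as the presheaf
`U ↦ Sym(V(U))` over `O`. -/
noncomputable def symAlg : DGAlg O where
  obj := symObj w V
  d {a a'} h i := mkHom (fun U =>
    { toFun x := (⟨symD V U x.1, GSym.d_mem _ w h x.2⟩ : SymPiece w V a' i U)
      map_add' x y := Subtype.ext (map_add (symD V U) x.1 y.1)
      map_smul' r x := Subtype.ext (map_smul (symD V U) r x.1) })
    (fun {U W} h x => Subtype.ext (GSym.map_d _ _ _ _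
      (fun i x => (secMap_res (V.d i (i + 1)) h x).symm) x.2).symm)
  mul {a b p i j q} h h' U := LinearMap.mk₂ (Fn O U)
    (fun (x : SymPiece w V a i U) (y : SymPiece w V b j U) =>
      (⟨x.1 * y.1, GSym.mul_mem w h h' x.2 y.2⟩ : SymPiece w V p q U))
    (fun x y z => Subtype.ext (add_mul x.1 y.1 z.1))
    (fun r x y => Subtype.ext (Algebra.smul_mul_assoc r x.1 y.1))
    (fun x y z => Subtype.ext (mul_add x.1 y.1 z.1))
    (fun r x y => Subtype.ext (Algebra.mul_smul_comm r x.1 y.1))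
  one U := (⟨1, GSym.one_mem w⟩ : SymPiece w V 0 0 U)
  mul_res h h' U W hW x y := Subtype.ext (map_mul (symRes V hW) x.1 y.1).symm
  one_res hW := Subtype.ext (map_one (symRes V hW))
  one_mul U x := Subtype.ext (one_mul x.1)
  mul_one U x := Subtype.ext (mul_one x.1)
  mul_assoc _ _ _ _ _ _ _ _ U x y z := Subtype.ext (mul_assoc x.1 y.1 z.1)
  d_d {a a' a''} h h' i := by
    ext U x
    exact Subtype.ext (GSym.d_d _ (fun i x => by
      rw [← secMap_comp, V.d_comp_d, secMap_zero]) x.2)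
  leibniz h ha hb hp h₁ h₂ h' U x y := Subtype.ext (GSym.d_mul _ w x.2 y.2)

/-- A section of `V`, as a section of `Sym_O(V)`. -/
noncomputable def symGen (i : ℤ) (U : Opens X) (x : Sec (V.X i) U) :
    Sec ((symAlg w V).obj i w) U :=
  (⟨GSym.gen (Fn O U) (fun i => Sec (V.X i) U) i x, GSym.gen_mem (V := fun i => Sec (V.X i) U) w i x⟩ : SymPiece w V i w U)
end Sym
end Presheaf

section DGModules
variable {X : TopCat.{u}} {O : Sheaf (Opens.grothendieckTopology X) CommRingCat.{u}}

/-- The sections over `U` of a sheaf of modules. -/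
abbrev SSec (M : Mod O) (U : Opens X) : Type u := Sec (toP.obj M) U

/-- The map on sections over `U` induced by a morphism of sheaves of modules. -/
abbrev sMap {M N : Mod O} (f : M ⟶ N) (U : Opens X) : SSec M U →ₗ[Fn O U] SSec N U :=
  secMap (toP.map f) U

lemma sMap_comp {M N P : Mod O} (f : M ⟶ N) (g : N ⟶ P) (U : Opens X) (x : SSec M U) :
    sMap (f ≫ g) U x = sMap g U (sMap f U x) := rfl
lemma sMap_id (M : Mod O) (U : Opens X) (x : SSec M U) : sMap (𝟙 M) U x = x := rfl
lemma sMap_add {M N : Mod O} (f g : M ⟶ N) (U : Opens X) (x : SSec M U) :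
    sMap (f + g) U x = sMap f U x + sMap g U x := rfl
lemma sMap_neg {M N : Mod O} (f : M ⟶ N) (U : Opens X) (x : SSec M U) :
    sMap (-f) U x = -sMap f U x := rfl
lemma sMap_zero (M N : Mod O) (U : Opens X) (x : SSec M U) :
    sMap (0 : M ⟶ N) U x = 0 := rfl
lemma sMap_res {M N : Mod O} (f : M ⟶ N) {U V : Opens X} (h : V ≤ U) (x : SSec M U) :
    sMap f V (res _ h x) = res _ h (sMap f U x) := secMap_res _ h x

/-- A bigraded dg-module over `𝒜`: for each internal degree `j` a complex `cx j` of sheaves of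
`O`-modules, and an action of `𝒜` which is additive in both degrees, compatible with restriction,
unital, associative, and satisfies `d (x m) = (d x) m + (-1)^|x| x (d m)`. -/
structure DGMod (𝒜 : DGAlg O) where
  cx : ℤ → CochainComplex (Mod O) ℤ
  act {a b p i j q : ℤ} (h : a + b = p) (h' : i + j = q) (U : Opens X) :
    Sec (𝒜.obj a i) U →ₗ[Fn O U] SSec ((cx j).X b) U →ₗ[Fn O U] SSec ((cx q).X p) U
  act_res {a b p i j q : ℤ} (h : a + b = p) (h' : i + j = q) {U V : Opens X} (hV : V ≤ U)
    (x : Sec (𝒜.obj a i) U) (m : SSec ((cx j).X b) U) :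
    act h h' V (res _ hV x) (res _ hV m) = res _ hV (act h h' U x m)
  one_act {b j : ℤ} (U : Opens X) (m : SSec ((cx j).X b) U) :
    act (zero_add b) (zero_add j) U (𝒜.one U) m = m
  mul_act {a b c ab bc p i j k ij jk q : ℤ} (h₁ : a + b = ab) (h₂ : ab + c = p)
    (h₃ : b + c = bc) (h₄ : a + bc = p) (h₁' : i + j = ij) (h₂' : ij + k = q)
    (h₃' : j + k = jk) (h₄' : i + jk = q) (U : Opens X)
    (x : Sec (𝒜.obj a i) U) (y : Sec (𝒜.obj b j) U) (m : SSec ((cx k).X c) U) :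
    act h₂ h₂' U (𝒜.mul h₁ h₁' U x y) m = act h₄ h₄' U x (act h₃ h₃' U y m)
  leibniz {a b p a' b' p' i j q : ℤ} (h : a + b = p) (ha : a + 1 = a') (hb : b + 1 = b')
    (hp : p + 1 = p') (h₁ : a' + b = p') (h₂ : a + b' = p') (h' : i + j = q) (U : Opens X)
    (x : Sec (𝒜.obj a i) U) (m : SSec ((cx j).X b) U) :
    sMap ((cx q).d p p') U (act h h' U x m) =
      act h₁ h' U (secMap (𝒜.d ha i) U x) m +
        a.negOnePow • act h₂ h' U x (sMap ((cx j).d b b') U m)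

namespace DGMod
variable {𝒜 : DGAlg O}

/-- Morphisms of dg-modules: families of morphisms of complexes that commute with the action. -/
@[ext] structure Hom (M N : DGMod 𝒜) where
  f (j : ℤ) : M.cx j ⟶ N.cx j
  map_act {a b p i j q : ℤ} (h : a + b = p) (h' : i + j = q) (U : Opens X)
    (x : Sec (𝒜.obj a i) U) (m : SSec ((M.cx j).X b) U) :
    sMap ((f q).f p) U (M.act h h' U x m) = N.act h h' U x (sMap ((f j).f b) U m)

instance : Category (DGMod 𝒜) where
  Hom := Hom
  id M := ⟨fun j => 𝟙 _, by intros; rfl⟩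
  comp f g := ⟨fun j => f.f j ≫ g.f j, by
    intro a b p i j q h h' U x m
    simp only [HomologicalComplex.comp_f, sMap_comp, f.map_act, g.map_act]⟩

@[simp] lemma id_f (M : DGMod 𝒜) (j : ℤ) : Hom.f (𝟙 M) j = 𝟙 (M.cx j) := rfl
@[simp] lemma comp_f {M N P : DGMod 𝒜} (f : M ⟶ N) (g : N ⟶ P) (j : ℤ) :
    (f ≫ g).f j = f.f j ≫ g.f j := rfl
@[ext] lemma hom_ext {M N : DGMod 𝒜} {f g : M ⟶ N} (h : ∀ j, f.f j = g.f j) : f = g :=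
  Hom.ext (funext h)


section shift
variable (M : DGMod 𝒜)

/-- The action on the shift `M[1]`: a section `x` of degree `a` acts by `(-1)^a x`. -/
noncomputable def shiftAct {a b p i j q : ℤ} (h : a + b = p) (h' : i + j = q) (U : Opens X) :
    Sec (𝒜.obj a i) U →ₗ[Fn O U] SSec ((M.cx j).X (b + 1)) U →ₗ[Fn O U]
      SSec ((M.cx q).X (p + 1)) U :=
  a.negOnePow • M.act (b := b + 1) (p := p + 1) (by omega) h' U

lemma shiftAct_apply {a b p i j q : ℤ} (h : a + b = p) (h' : i + j = q) (U : Opens X)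
    (x : Sec (𝒜.obj a i) U) (m : SSec ((M.cx j).X (b + 1)) U) :
    M.shiftAct h h' U x m =
      a.negOnePow • M.act (b := b + 1) (p := p + 1) (by omega) h' U x m := rfl

lemma map_unit_smul {R S : Type u} [CommRing R] [CommRing S] {σ : R →+* S} {A B : Type u}
    [AddCommGroup A] [AddCommGroup B] [Module R A] [Module S B] (f : A →ₛₗ[σ] B) (k : ℤˣ) (x : A) :
    f (k • x) = k • f x := by
  rw [Units.smul_def, map_zsmul, Units.smul_def]

lemma shiftAct_mul {a b c ab bc p i j k ij jk q : ℤ} (h₁ : a + b = ab) (h₂ : ab + c = p)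
    (h₃ : b + c = bc) (h₄ : a + bc = p) (h₁' : i + j = ij) (h₂' : ij + k = q)
    (h₃' : j + k = jk) (h₄' : i + jk = q) (U : Opens X)
    (x : Sec (𝒜.obj a i) U) (y : Sec (𝒜.obj b j) U) (m : SSec ((M.cx k).X (c + 1)) U) :
    M.shiftAct h₂ h₂' U (𝒜.mul h₁ h₁' U x y) m =
      M.shiftAct h₄ h₄' U x (M.shiftAct h₃ h₃' U y m) := by
  simp only [shiftAct_apply]
  rw [M.mul_act (c := c + 1) (bc := bc + 1) h₁ _ (by omega) (by omega) h₁' h₂' h₃' h₄' U x y m,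
    map_unit_smul, smul_smul, ← Int.negOnePow_add, h₁]

lemma shiftAct_leibniz {a b p a' b' p' i j q : ℤ} (h : a + b = p) (ha : a + 1 = a')
    (hb : b + 1 = b') (hp : p + 1 = p') (h₁ : a' + b = p') (h₂ : a + b' = p') (h' : i + j = q)
    (U : Opens X) (x : Sec (𝒜.obj a i) U) (m : SSec ((M.cx j).X (b + 1)) U) :
    secMap ((1 : ℤ).negOnePow • toP.map ((M.cx q).d (p + 1) (p' + 1))) U
      (M.shiftAct h h' U x m) =
      M.shiftAct h₁ h' U (secMap (𝒜.d ha i) U x) m + a.negOnePow • M.shiftAct h₂ h' U x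
        (secMap ((1 : ℤ).negOnePow • toP.map ((M.cx j).d (b + 1) (b' + 1))) U m) := by
  obtain rfl := ha
  have := M.leibniz (b := b + 1) (p := p + 1) (b' := b' + 1) (p' := p' + 1) (by omega) rfl
      (by omega) (by omega) (by omega) (by omega) h' U x m
  simp only [shiftAct_apply]
  rw [secMap_smul, secMap_smul, map_unit_smul, this, map_unit_smul]
  rcases Int.even_or_odd a with ha | ha <;>
  simp [Int.negOnePow_even, Int.negOnePow_odd, ha]

/-- The shift `M[1]` in the cohomological degree; the differential changes its sign. -/
noncomputable def shiftObj : DGMod 𝒜 where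
  cx j := (CochainComplex.shiftFunctor (Mod O) 1).obj (M.cx j)
  act h h' U := M.shiftAct h h' U
  act_res {a b p i j q} h h' U V hV x m :=
    (congrArg (a.negOnePow • ·) (M.act_res (b := b + 1) _ h' hV x m)).trans
      (map_unit_smul (res (toP.obj ((M.cx q).X (p + 1))) hV) _ _).symm
  one_act {b j} U m := by
    refine (M.shiftAct_apply _ _ U (𝒜.one U) m).trans ?_
    rw [Int.negOnePow_zero, one_smul]
    exact M.one_act (b := b + 1) U m
  mul_act h₁ h₂ h₃ h₄ h₁' h₂' h₃' h₄' U x y m :=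
    M.shiftAct_mul h₁ h₂ h₃ h₄ h₁' h₂' h₃' h₄' U x y m
  leibniz h ha hb hp h₁ h₂ h' U x m :=
    M.shiftAct_leibniz h ha hb hp h₁ h₂ h' U x m

/-- The shift functor. -/
noncomputable def shiftFunctor (𝒜 : DGAlg O) : DGMod 𝒜 ⥤ DGMod 𝒜 where
  obj M := M.shiftObj
  map f := ⟨fun j => (CochainComplex.shiftFunctor (Mod O) 1).map (f.f j), by
    intro a b p i j q h h' U x m
    refine (map_unit_smul (sMap ((f.f q).f (p + 1)) U) _ _).trans ?_
    exact congrArg (a.negOnePow • ·) (f.map_act (b := b + 1) (p := p + 1) _ h' U x m)⟩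

end shift

end DGMod
end DGModules

section DGModules
variable {X : TopCat.{u}} {O : Sheaf (Opens.grothendieckTopology X) CommRingCat.{u}}
namespace DGMod
variable {𝒜 : DGAlg O}
section cone
open CochainComplex CochainComplex.HomComplex

section
variable {K L : CochainComplex (Mod O) ℤ} (φ : K ⟶ L)

/-- The components of the structure maps of the mapping cone of a morphism of complexes. -/
noncomputable def cFst (b : ℤ) : (mappingCone φ).X b ⟶ K.X (b + 1) :=
  (mappingCone.fst φ).1.v b (b + 1) rfl
noncomputable def cSnd (b : ℤ) : (mappingCone φ).X b ⟶ L.X b :=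
  (mappingCone.snd φ).v b b (add_zero b)
noncomputable def cInl (b : ℤ) : K.X (b + 1) ⟶ (mappingCone φ).X b :=
  (mappingCone.inl φ).v (b + 1) b (by omega)
noncomputable def cInr (b : ℤ) : L.X b ⟶ (mappingCone φ).X b := (mappingCone.inr φ).f b

variable {U : Opens X} (b : ℤ)
lemma cFst_cInl (x : SSec (K.X (b + 1)) U) : sMap (cFst φ b) U (sMap (cInl φ b) U x) = x := by
  have : cInl φ b ≫ cFst φ b = 𝟙 _ := mappingCone.inl_v_fst_v φ _ _ _
  rw [← sMap_comp, this, sMap_id]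
lemma cSnd_cInl (x : SSec (K.X (b + 1)) U) : sMap (cSnd φ b) U (sMap (cInl φ b) U x) = 0 := by
  have : cInl φ b ≫ cSnd φ b = 0 := mappingCone.inl_v_snd_v φ _ _ _
  rw [← sMap_comp, this, sMap_zero]
lemma cFst_cInr (x : SSec (L.X b) U) : sMap (cFst φ b) U (sMap (cInr φ b) U x) = 0 := by
  have : cInr φ b ≫ cFst φ b = 0 := mappingCone.inr_f_fst_v φ _ _ _
  rw [← sMap_comp, this, sMap_zero]
lemma cSnd_cInr (x : SSec (L.X b) U) : sMap (cSnd φ b) U (sMap (cInr φ b) U x) = x := by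
  have : cInr φ b ≫ cSnd φ b = 𝟙 _ := mappingCone.inr_f_snd_v φ _
  rw [← sMap_comp, this, sMap_id]
variable {b}
lemma c_ext {m m' : SSec ((mappingCone φ).X b) U}
    (h₁ : sMap (cFst φ b) U m = sMap (cFst φ b) U m')
    (h₂ : sMap (cSnd φ b) U m = sMap (cSnd φ b) U m') : m = m' := by
  have : cFst φ b ≫ cInl φ b + cSnd φ b ≫ cInr φ b = 𝟙 _ := mappingCone.id_X φ b (b + 1) rfl
  rw [← sMap_id _ U m, ← sMap_id _ U m', ← this, sMap_add,
    sMap_add, sMap_comp, sMap_comp, sMap_comp, sMap_comp, h₁, h₂]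
lemma cFst_d (m : SSec ((mappingCone φ).X b) U) :
    sMap (cFst φ (b + 1)) U (sMap ((mappingCone φ).d b (b + 1)) U m) =
      -sMap (K.d (b + 1) (b + 1 + 1)) U (sMap (cFst φ b) U m) := by
  have : (mappingCone φ).d b (b + 1) ≫ cFst φ (b + 1) = -cFst φ b ≫ K.d (b + 1) (b + 1 + 1) :=
    mappingCone.d_fst_v φ b (b + 1) (b + 1 + 1) rfl rfl
  rw [← sMap_comp, this]; rfl
lemma cSnd_d (m : SSec ((mappingCone φ).X b) U) :
    sMap (cSnd φ (b + 1)) U (sMap ((mappingCone φ).d b (b + 1)) U m) =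
      sMap (φ.f (b + 1)) U (sMap (cFst φ b) U m) + sMap (L.d b (b + 1)) U (sMap (cSnd φ b) U m) := by
  have : (mappingCone φ).d b (b + 1) ≫ cSnd φ (b + 1) =
    cFst φ b ≫ φ.f (b + 1) + cSnd φ b ≫ L.d b (b + 1) := mappingCone.d_snd_v φ b (b + 1) rfl
  rw [← sMap_comp, this]; rfl
end

variable {M N : DGMod 𝒜} (f : M ⟶ N)

/-- The action on the cone of `f : M ⟶ N`, as on `M[1] ⊕ N`. -/
noncomputable def coneAct {a b p i j q : ℤ} (h : a + b = p) (h' : i + j = q) (U : Opens X) :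
    Sec (𝒜.obj a i) U →ₗ[Fn O U] SSec ((mappingCone (f.f j)).X b) U →ₗ[Fn O U]
      SSec ((mappingCone (f.f q)).X p) U :=
  ((M.shiftAct h h' U).compl₂ (sMap (cFst (f.f j) b) U)).compr₂ (sMap (cInl (f.f q) p) U) +
    ((N.act h h' U).compl₂ (sMap (cSnd (f.f j) b) U)).compr₂ (sMap (cInr (f.f q) p) U)

section
variable {a b p i j q : ℤ} (h : a + b = p) (h' : i + j = q) (U : Opens X)
    (x : Sec (𝒜.obj a i) U) (m : SSec ((mappingCone (f.f j)).X b) U)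

lemma coneAct_apply : coneAct f h h' U x m =
      sMap (cInl (f.f q) p) U (M.shiftAct h h' U x (sMap (cFst (f.f j) b) U m)) +
      sMap (cInr (f.f q) p) U (N.act h h' U x (sMap (cSnd (f.f j) b) U m)) := rfl

lemma cFst_act : sMap (cFst (f.f q) p) U (coneAct f h h' U x m) =
      M.shiftAct h h' U x (sMap (cFst (f.f j) b) U m) := by
  rw [coneAct_apply, map_add, cFst_cInl, cFst_cInr, add_zero]

lemma cSnd_act : sMap (cSnd (f.f q) p) U (coneAct f h h' U x m) =
      N.act h h' U x (sMap (cSnd (f.f j) b) U m) := by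
  rw [coneAct_apply, map_add, cSnd_cInl, cSnd_cInr, zero_add]
end

lemma coneAct_res {a b p i j q : ℤ} (h : a + b = p) (h' : i + j = q) {U V : Opens X} (hV : V ≤ U)
    (x : Sec (𝒜.obj a i) U) (m : SSec ((mappingCone (f.f j)).X b) U) :
    coneAct f h h' V (res _ hV x) (res _ hV m) = res _ hV (coneAct f h h' U x m) := by
  apply c_ext
  · rw [cFst_act, sMap_res, sMap_res, cFst_act, shiftAct_apply, shiftAct_apply, M.act_res,
      map_unit_smul]
  · rw [cSnd_act, sMap_res, sMap_res, cSnd_act, N.act_res]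

lemma coneAct_leibniz {a b i j q : ℤ} (h₁ : a + 1 + b = a + b + 1) (h₂ : a + (b + 1) = a + b + 1)
    (h' : i + j = q) (U : Opens X)
    (x : Sec (𝒜.obj a i) U) (m : SSec ((mappingCone (f.f j)).X b) U) :
    sMap ((mappingCone (f.f q)).d (a + b) (a + b + 1)) U (coneAct f rfl h' U x m) =
      coneAct f h₁ h' U (secMap (𝒜.d rfl i) U x) m +
        a.negOnePow • coneAct f h₂ h' U x (sMap ((mappingCone (f.f j)).d b (b + 1)) U m) := by
  apply c_ext
  · rw [cFst_d, cFst_act, map_add, map_unit_smul, cFst_act, cFst_act, cFst_d]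
    have := M.shiftAct_leibniz rfl rfl rfl rfl h₁ h₂ h' U x (sMap (cFst (f.f j) b) U m)
    rw [secMap_smul, secMap_smul] at this
    simpa using this
  · rw [cSnd_d, cSnd_act, map_add, map_unit_smul, cSnd_act, cSnd_act,
      cSnd_d, map_add, smul_add, N.leibniz rfl rfl rfl rfl h₁ h₂ h', cFst_act, shiftAct_apply]
    have h₃ := f.map_act h₂ h' U x (sMap (cFst (f.f j) b) U m)
    have h₄ := map_unit_smul (sMap ((f.f q).f (a + b + 1)) U) a.negOnePow
      (M.act h₂ h' U x (sMap (cFst (f.f j) b) U m))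
    have h₅ := h₄.trans (congrArg (a.negOnePow • ·) h₃)
    exact (congrArg (· + _) h₅).trans (add_left_comm _ _ _)

lemma shiftAct_one (M : DGMod 𝒜) {b j : ℤ} (U : Opens X) (m : SSec ((M.cx j).X (b + 1)) U) :
    M.shiftAct (zero_add b) (zero_add j) U (𝒜.one U) m = m := by
  rw [shiftAct_apply, Int.negOnePow_zero, one_smul, M.one_act]

lemma coneAct_one {b j : ℤ} (U : Opens X) (m : SSec ((mappingCone (f.f j)).X b) U) :
    coneAct f (zero_add b) (zero_add j) U (𝒜.one U) m = m := by
  apply c_ext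
  · rw [cFst_act, shiftAct_one]
  · rw [cSnd_act, N.one_act]

/-- The cone of a morphism of dg-modules. -/
noncomputable def cone : DGMod 𝒜 where
  cx j := mappingCone (f.f j)
  act h h' U := coneAct f h h' U
  act_res h h' U V hV x m := coneAct_res f h h' hV x m
  one_act U m := coneAct_one f U m
  mul_act h₁ h₂ h₃ h₄ h₁' h₂' h₃' h₄' U x y m := by
    apply c_ext
    · rw [cFst_act, cFst_act, cFst_act, M.shiftAct_mul h₁ h₂ h₃ h₄ h₁' h₂' h₃' h₄']
    · rw [cSnd_act, cSnd_act, cSnd_act, N.mul_act h₁ h₂ h₃ h₄ h₁' h₂' h₃' h₄']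
  leibniz {a b p a' b' p' i j q} h ha hb hp h₁ h₂ h' U x m := by
    subst ha hb hp h
    exact coneAct_leibniz f h₁ h₂ h' U x m

/-- The inclusion of `N` in the cone of `f : M ⟶ N`. -/
noncomputable def coneInr : N ⟶ cone f where
  f j := mappingCone.inr (f.f j)
  map_act {a b p i j q} h h' U x m := by
    change sMap (cInr (f.f q) p) U _ = coneAct f h h' U x (sMap (cInr (f.f j) b) U m)
    apply c_ext
    · rw [cFst_cInr, cFst_act, cFst_cInr, map_zero]
    · rw [cSnd_cInr, cSnd_act, cSnd_cInr]

/-- The components of the connecting map of the mapping cone. -/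
noncomputable def cProj {K L : CochainComplex (Mod O) ℤ} (φ : K ⟶ L) (p : ℤ) :
    (mappingCone φ).X p ⟶ K.X (p + 1) := (mappingCone.triangle φ).mor₃.f p

lemma cProj_eq {K L : CochainComplex (Mod O) ℤ} (φ : K ⟶ L) (p : ℤ) : cProj φ p = -cFst φ p := by
  have h : cFst φ p ≫ cInl φ p + cSnd φ p ≫ cInr φ p = 𝟙 _ := mappingCone.id_X φ p (p + 1) rfl
  have h₁ : cInl φ p ≫ cProj φ p = -𝟙 _ :=
    mappingCone.inl_v_triangle_mor₃_f φ (p + 1) p (by omega)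
  have h₂ : cInr φ p ≫ cProj φ p = 0 := mappingCone.inr_f_triangle_mor₃_f φ p
  rw [← Category.id_comp (cProj φ p), ← h, Preadditive.add_comp, Category.assoc, Category.assoc,
    h₁, h₂, comp_zero, add_zero, Preadditive.comp_neg, Category.comp_id]

lemma cProj_act {a b p i j q : ℤ} (h : a + b = p) (h' : i + j = q) (U : Opens X)
    (x : Sec (𝒜.obj a i) U) (m : SSec ((mappingCone (f.f j)).X b) U) :
    sMap (cProj (f.f q) p) U (coneAct f h h' U x m) =
      M.shiftAct h h' U x (sMap (cProj (f.f j) b) U m) := by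
  rw [cProj_eq, cProj_eq, sMap_neg, sMap_neg, map_neg, cFst_act]

/-- The connecting map from the cone of `f : M ⟶ N` to `M[1]`. -/
noncomputable def coneProj : cone f ⟶ M.shiftObj where
  f j := (mappingCone.triangle (f.f j)).mor₃
  map_act h h' U x m := by
    exact cProj_act f h h' U x m
end cone
end DGMod
end DGModules

section Derived
variable {X : TopCat.{u}} {O : Sheaf (Opens.grothendieckTopology X) CommRingCat.{u}}

/-- The dg-modules whose internal degree is bounded above, uniformly in the cohomological degree, and
whose components all satisfy the property `P` of `O`-modules. -/
def minus (𝒜 : DGAlg O) (P : ObjectProperty (Mod O)) : ObjectProperty (DGMod 𝒜) := fun M =>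
  (∃ N : ℤ, ∀ j, N < j → ∀ i, IsZero ((M.cx j).X i)) ∧ ∀ j i, P ((M.cx j).X i)

/-- The full subcategory `C(𝒜-Mod_-)`. -/
abbrev CMinus (𝒜 : DGAlg O) (P : ObjectProperty (Mod O)) : Type (u + 1) :=
  (minus 𝒜 P).FullSubcategory

/-- The quasi-isomorphisms of `C(𝒜-Mod_-)`. -/
def qis (𝒜 : DGAlg O) (P : ObjectProperty (Mod O)) : MorphismProperty (CMinus 𝒜 P) :=
  fun _ _ f => ∀ j, QuasiIso (f.hom.f j)

/-- The derived category `D(𝒜-Mod_-)`: the localization of `C(𝒜-Mod_-)` at the quasi-isomorphisms. -/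
abbrev DMinus (𝒜 : DGAlg O) (P : ObjectProperty (Mod O)) := (qis 𝒜 P).Localization

variable {𝒜 ℬ : DGAlg O} {P : ObjectProperty (Mod O)}

/-- The localization functor. -/
abbrev toD : CMinus 𝒜 P ⥤ DMinus 𝒜 P := (qis 𝒜 P).Q

lemma minus_shift (M : DGMod 𝒜) (hM : minus 𝒜 P M) : minus 𝒜 P M.shiftObj := by
  obtain ⟨⟨N, hN⟩, h⟩ := hM
  exact ⟨⟨N, fun j hj i => hN j hj (i + 1)⟩, fun j i => h j (i + 1)⟩

/-- The shift of `C(𝒜-Mod_-)`. -/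
noncomputable def shiftMinus (𝒜 : DGAlg O) (P : ObjectProperty (Mod O)) :
    CMinus 𝒜 P ⥤ CMinus 𝒜 P :=
  (minus 𝒜 P).lift ((minus 𝒜 P).ι ⋙ DGMod.shiftFunctor 𝒜) fun M => minus_shift _ M.property

lemma quasiIso_shift {K L : CochainComplex (Mod O) ℤ} (f : K ⟶ L) (hf : QuasiIso f) :
    QuasiIso ((CochainComplex.shiftFunctor (Mod O) 1).map f) :=
  (CochainComplex.quasiIso_shift_iff f 1).2 hf

/-- The functor sends quasi-isomorphisms to quasi-isomorphisms. -/
def PreservesQis (F : CMinus 𝒜 P ⥤ CMinus ℬ P) : Prop :=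
  ∀ ⦃M N : CMinus 𝒜 P⦄ (f : M ⟶ N), qis 𝒜 P f → qis ℬ P (F.map f)

/-- The functor on derived categories induced by a functor that preserves quasi-isomorphisms. -/
noncomputable def derived (F : CMinus 𝒜 P ⥤ CMinus ℬ P) (hF : PreservesQis F) : DMinus 𝒜 P ⥤ DMinus ℬ P :=
  Localization.Construction.lift (F ⋙ toD) fun _ _ f hf =>
    Localization.inverts (qis ℬ P).Q (qis ℬ P) _ (hF f hf)

/-- The shift of `D(𝒜-Mod_-)`. -/
noncomputable def shiftD (𝒜 : DGAlg O) (P : ObjectProperty (Mod O)) : DMinus 𝒜 P ⥤ DMinus 𝒜 P :=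
  derived (shiftMinus 𝒜 P) fun _ _ f hf j => quasiIso_shift (f.hom.f j) (hf j)

/-- The distinguished triangles `A ⟶ B ⟶ C ⟶ A[1]` of `D(𝒜-Mod_-)`: those isomorphic to the image of
`M ⟶ N ⟶ cone φ ⟶ M[1]` for a morphism `φ : M ⟶ N` of `C(𝒜-Mod_-)`. -/
def Distinguished {A B C : DMinus 𝒜 P} (f : A ⟶ B) (g : B ⟶ C) (h : C ⟶ (shiftD 𝒜 P).obj A) :
    Prop :=
  ∃ (M N K : CMinus 𝒜 P) (φ : M ⟶ N) (e : K.obj ≅ DGMod.cone φ.hom)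
    (a : A ≅ toD.obj M) (b : B ≅ toD.obj N) (c : C ≅ toD.obj K),
    f ≫ b.hom = a.hom ≫ toD.map φ ∧
    g ≫ c.hom = b.hom ≫ toD.map (ObjectProperty.homMk (DGMod.coneInr φ.hom ≫ e.inv)) ∧
    h ≫ (shiftD 𝒜 P).map a.hom =
      c.hom ≫ toD.map (Y := (shiftMinus 𝒜 P).obj M)
        (ObjectProperty.homMk (e.hom ≫ DGMod.coneProj φ.hom))

/-- The functor is triangulated: it commutes with the shifts up to an isomorphism which makes it send
distinguished triangles to distinguished triangles. -/
def IsTriangulated (F : DMinus 𝒜 P ⥤ DMinus ℬ P) : Prop :=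
  ∃ η : shiftD 𝒜 P ⋙ F ≅ F ⋙ shiftD ℬ P,
    ∀ ⦃A B C : DMinus 𝒜 P⦄ (f : A ⟶ B) (g : B ⟶ C) (h : C ⟶ (shiftD 𝒜 P).obj A),
      Distinguished f g h → Distinguished (F.map f) (F.map g) (F.map h ≫ η.hom.app A)

/-- The sequence `0 ⟶ L ⟶ M ⟶ N ⟶ 0` is exact (in each bidegree). -/
def ShortExact {L M N : CMinus 𝒜 P} (f : L ⟶ M) (g : M ⟶ N) : Prop :=
  ∀ j i, ∃ w : (f.hom.f j).f i ≫ (g.hom.f j).f i = 0,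
    (ShortComplex.mk ((f.hom.f j).f i) ((g.hom.f j).f i) w).ShortExact

/-- The functor sends short exact sequences to short exact sequences. -/
def PreservesShortExact (F : CMinus 𝒜 P ⥤ CMinus ℬ P) : Prop :=
  ∀ ⦃L M N : CMinus 𝒜 P⦄ (f : L ⟶ M) (g : M ⟶ N), ShortExact f g →
    ShortExact (F.map f) (F.map g)

/-- The restriction of a functor on dg-modules to the subcategories `C(-_-)`. -/
def restrictMinus (F : DGMod 𝒜 ⥤ DGMod ℬ) (h : ∀ M, minus 𝒜 P M → minus ℬ P (F.obj M)) :
    CMinus 𝒜 P ⥤ CMinus ℬ P :=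
  (minus ℬ P).lift ((minus 𝒜 P).ι ⋙ F) fun M => h _ M.property
end Derived

section Koszul
variable {X : TopCat.{u}} {O : Sheaf (Opens.grothendieckTopology X) CommRingCat.{u}}

/-- The decompositions of a bidegree `(p, q)` as a sum of bidegrees `(a, i)` and `(b, j)`. -/
structure BiIdx (p q : ℤ) where
  (a b i j : ℤ)
  hab : a + b = p
  hij : i + j = q

/-- The part of bidegree `(p, q)` of the tensor product over `O` of a bigraded presheaf of modules `P`
and a dg-module `M`: the direct sum of the sheaves `P^a_i ⊗ M^b_j` with `a + b = p`, `i + j = q`. -/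
noncomputable def gtensor (P : ℤ → ℤ → PMod O) {𝒜 : DGAlg O} (M : DGMod 𝒜) (p q : ℤ) : Mod O :=
  ∐ fun k : BiIdx p q => shf (P k.a k.i ⊗ toP.obj ((M.cx k.j).X k.b))

/-- The section `s ⊗ m` of the presheaf tensor product. -/
noncomputable def pureTensor (F G : PMod O) (U : Opens X) :
    Sec F U →ₗ[Fn O U] Sec G U →ₗ[Fn O U] Sec (F ⊗ G) U :=
  TensorProduct.mk (Fn O U) (Sec F U) (Sec G U)

/-- The section `s ⊗ m` of `P ⊗ M`. -/
noncomputable def gtmul (P : ℤ → ℤ → PMod O) {𝒜 : DGAlg O} (M : DGMod 𝒜) {a b p i j q : ℤ}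
    (h : a + b = p) (h' : i + j = q) (U : Opens X) (s : Sec (P a i) U) (m : SSec ((M.cx j).X b) U) :
    SSec (gtensor P M p q) U :=
  sMap (Sigma.ι (fun k : BiIdx p q => shf (P k.a k.i ⊗ toP.obj ((M.cx k.j).X k.b)))
      ⟨a, b, i, j, h, h'⟩) U
    (secMap (toShf (P a i ⊗ toP.obj ((M.cx j).X b))) U (pureTensor _ _ U s m))

/-- A functor from dg-modules over `𝒜` to dg-modules over `ℬ` which on underlying bigraded
`O`-modules is `M ↦ P ⊗ M`. -/
structure TensorFunctor (P : ℤ → ℤ → PMod O) (𝒜 ℬ : DGAlg O) where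
  F : DGMod 𝒜 ⥤ DGMod ℬ
  iso (M : DGMod 𝒜) (p q : ℤ) : gtensor P M p q ≅ ((F.obj M).cx q).X p
  map_iso {M N : DGMod 𝒜} (f : M ⟶ N) {a b p i j q : ℤ} (h : a + b = p) (h' : i + j = q)
    (U : Opens X) (s : Sec (P a i) U) (m : SSec ((M.cx j).X b) U) :
    sMap (((F.map f).f q).f p) U (sMap (iso M p q).hom U (gtmul P M h h' U s m)) =
      sMap (iso N p q).hom U (gtmul P N h h' U s (sMap ((f.f j).f b) U m))

/-- The section `s ⊗ m` of the image of `M` under a functor of the form `M ↦ P ⊗ M`. -/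
noncomputable def TensorFunctor.tm {P : ℤ → ℤ → PMod O} {𝒜 ℬ : DGAlg O} (Φ : TensorFunctor P 𝒜 ℬ)
    (M : DGMod 𝒜) {a b p i j q : ℤ} (h : a + b = p) (h' : i + j = q) (U : Opens X)
    (s : Sec (P a i) U) (m : SSec ((M.cx j).X b) U) : SSec (((Φ.F.obj M).cx q).X p) U :=
  sMap (Φ.iso M p q).hom U (gtmul P M h h' U s m)

section dgdual
variable (𝒜 : DGAlg O)

/-- The bigraded dual `𝒜^∨`: its part of bidegree `(p, q)` is the dual of the part of `𝒜` of bidegree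
`(-p, -q)`. -/
noncomputable def dgDual (p q : ℤ) : PMod O := dual (𝒜.obj (-p) (-q))

/-- The differential of `𝒜^∨`: `(d φ)(t) = (-1)^(|φ|+1) φ(d t)`. -/
noncomputable def dgDualD {a a' : ℤ} (h : a + 1 = a') (i : ℤ) : dgDual 𝒜 a i ⟶ dgDual 𝒜 a' i :=
  (a + 1).negOnePow • dualMap (𝒜.d (a := -a') (a' := -a) (by omega) (-i))

/-- The section `φ(x · -)` of `𝒜^∨`. -/
noncomputable def precomp {a c p i l q : ℤ} (h : a + c = p) (h' : i + l = q) (U : Opens X)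
    (x : Sec (𝒜.obj c l) U) (φ : Sec (dgDual 𝒜 a i) U) : Sec (dgDual 𝒜 p q) U :=
  (⟨fun W hW => (ev φ hW).comp
      (𝒜.mul (a := c) (b := -p) (p := -a) (i := l) (j := -q) (q := -i) (by omega) (by omega) W
        (res _ hW x)), by
    intro W W' hW hW' t
    simp only [LinearMap.comp_apply]
    rw [← res_res _ hW hW', 𝒜.mul_res]
    exact DualSec.app_res φ W W' hW hW' _⟩ : DualSec (𝒜.obj (-p) (-q)) U)

/-- The action of `𝒜` on `𝒜^∨`: `(t · φ)(t') = (-1)^(|t||φ|) φ(t t')`. -/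
noncomputable def dualAct {a c p i l q : ℤ} (h : c + a = p) (h' : l + i = q) (U : Opens X)
    (t : Sec (𝒜.obj c l) U) (φ : Sec (dgDual 𝒜 a i) U) : Sec (dgDual 𝒜 p q) U :=
  (c * a).negOnePow • precomp 𝒜 (by omega) (by omega) U t φ
end dgdual

/-- A complex of locally free sheaves of finite rank concentrated in degrees `[-n, 0]`. -/
structure IsFiniteLocallyFree (n : ℕ) (𝒳 : CochainComplex (Mod O) ℤ) : Prop where
  isZero (i : ℤ) (hi : i ∉ Set.Icc (-n : ℤ) 0) : IsZero (𝒳.X i)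
  locallyFree (i : ℤ) : ∃ q : SheafOfModules.LocalGeneratorsData.{u} (𝒳.X i),
    q.IsLocallyFreeData ∧ q.IsFiniteType

/-- The dg-algebra `𝒯 = Sym(𝒳)`, where `𝒳` is placed in internal degree `2`. -/
noncomputable def algT (𝒳 : CochainComplex (Mod O) ℤ) : DGAlg O :=
  symAlg 2 ((toP.mapHomologicalComplex (ComplexShape.up ℤ)).obj 𝒳)

/-- The dg-algebra `𝒮 = Sym(𝒴)`, where `𝒴 = 𝒳^∨[-1]` is placed in internal degree `-2`. -/
noncomputable def algS (𝒳 : CochainComplex (Mod O) ℤ) : DGAlg O :=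
  symAlg (-2) (dualComplex 𝒳)

/-- A homogeneous basis of `𝒳` over `U` and the dual basis of `𝒴`: the sections `x k α` of `𝒳^(1-k)`
and the dual sections `y k α` of `𝒴^k`. -/
structure LocalFrame (𝒳 : CochainComplex (Mod O) ℤ) (U : Opens X) where
  r : ℤ → ℕ
  x (k : ℤ) : Fin (r k) → SSec (𝒳.X (1 - k)) U
  y (k : ℤ) : Fin (r k) → Sec ((dualComplex 𝒳).X k) U
  expand (k : ℤ) (W : Opens X) (h : W ≤ U) (v : SSec (𝒳.X (1 - k)) W) :
    ∑ α, ev (F := toP.obj (𝒳.X (1 - k))) (y k α) h v • res _ h (x k α) = v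
  dual (k : ℤ) (α β : Fin (r k)) :
    ev (F := toP.obj (𝒳.X (1 - k))) (y k α) le_rfl (x k β) = if α = β then 1 else 0

namespace LocalFrame
variable {𝒳 : CochainComplex (Mod O) ℤ} {U : Opens X} (E : LocalFrame 𝒳 U)

/-- The basis elements of `𝒳`, as sections of `𝒯`. -/
noncomputable def xT (k : ℤ) (α : Fin (E.r k)) : Sec ((algT 𝒳).obj (1 - k) 2) U :=
  symGen 2 ((toP.mapHomologicalComplex (ComplexShape.up ℤ)).obj 𝒳) (1 - k) U (E.x k α)
/-- The dual basis elements, as sections of `𝒮`. -/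
noncomputable def yS (k : ℤ) (α : Fin (E.r k)) : Sec ((algS 𝒳).obj k (-2)) U :=
  symGen (-2) (dualComplex 𝒳) k U (E.y k α)
end LocalFrame

/-- The functor `𝒜(M) = 𝒮 ⊗ M`: the action of `𝒮` is left multiplication on `𝒮`, and, wherever `𝒳`
has a basis `x_α` with dual basis `y_α`,
`d (s ⊗ m) = d s ⊗ m + (-1)^|s| s ⊗ d m + (-1)^|s| ∑ s y_α ⊗ x_α m`.
Since such bases exist locally, this determines the functor up to a unique isomorphism compatible
with the identification of the underlying bigraded modules with `𝒮 ⊗ M`. -/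
structure KoszulA (n : ℕ) (𝒳 : CochainComplex (Mod O) ℤ) extends
    TensorFunctor (algS 𝒳).obj (algT 𝒳) (algS 𝒳) where
  act_tm (M : DGMod (algT 𝒳)) {c a b ca p p' l i j li q q' : ℤ} (h : a + b = p) (h' : i + j = q)
    (h₁ : c + p = p') (h₁' : l + q = q') (h₂ : c + a = ca) (h₂' : l + i = li) (h₃ : ca + b = p')
    (h₃' : li + j = q') (U : Opens X) (t : Sec ((algS 𝒳).obj c l) U)
    (s : Sec ((algS 𝒳).obj a i) U) (m : SSec ((M.cx j).X b) U) :
    (F.obj M).act h₁ h₁' U t (toTensorFunctor.tm M h h' U s m) =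
      toTensorFunctor.tm M h₃ h₃' U ((algS 𝒳).mul h₂ h₂' U t s) m
  d_tm (M : DGMod (algT 𝒳)) {a b p i j q : ℤ} (h : a + b = p) (h' : i + j = q)
    (U : Opens X) (E : LocalFrame 𝒳 U) (s : Sec ((algS 𝒳).obj a i) U) (m : SSec ((M.cx j).X b) U) :
    sMap (((F.obj M).cx q).d p (p + 1)) U (toTensorFunctor.tm M h h' U s m) =
      toTensorFunctor.tm M (a := a + 1) (by omega) h' U (secMap ((algS 𝒳).d rfl i) U s) m +
      a.negOnePow • toTensorFunctor.tm M (b := b + 1) (by omega) h' U s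
        (sMap ((M.cx j).d b (b + 1)) U m) +
      a.negOnePow • ∑ k ∈ Finset.Icc (1 : ℤ) (n + 1), ∑ α,
        toTensorFunctor.tm M (a := a + k) (b := 1 - k + b) (i := i + -2) (j := 2 + j)
          (by omega) (by omega) U
          ((algS 𝒳).mul rfl rfl U s (E.yS k α)) (M.act rfl rfl U (E.xT k α) m)

/-- The functor `ℬ(N) = 𝒯^∨ ⊗ N`: the action of `𝒯` comes from its action on `𝒯^∨`, and, wherever `𝒳`
has a basis `x_α` with dual basis `y_α`,
`d (φ ⊗ n) = d φ ⊗ n + (-1)^|φ| φ ⊗ d n + (-1)^|φ| ∑ φ(x_α · -) ⊗ y_α n`.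
This again determines the functor up to a unique isomorphism. -/
structure KoszulB (n : ℕ) (𝒳 : CochainComplex (Mod O) ℤ) extends
    TensorFunctor (dgDual (algT 𝒳)) (algS 𝒳) (algT 𝒳) where
  act_tm (N : DGMod (algS 𝒳)) {c a b ca p p' l i j li q q' : ℤ} (h : a + b = p) (h' : i + j = q)
    (h₁ : c + p = p') (h₁' : l + q = q') (h₂ : c + a = ca) (h₂' : l + i = li) (h₃ : ca + b = p')
    (h₃' : li + j = q') (U : Opens X) (t : Sec ((algT 𝒳).obj c l) U)
    (φ : Sec (dgDual (algT 𝒳) a i) U) (m : SSec ((N.cx j).X b) U) :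
    (F.obj N).act h₁ h₁' U t (toTensorFunctor.tm N h h' U φ m) =
      toTensorFunctor.tm N h₃ h₃' U (dualAct (algT 𝒳) h₂ h₂' U t φ) m
  d_tm (N : DGMod (algS 𝒳)) {a b p i j q : ℤ} (h : a + b = p) (h' : i + j = q)
    (U : Opens X) (E : LocalFrame 𝒳 U) (φ : Sec (dgDual (algT 𝒳) a i) U)
    (m : SSec ((N.cx j).X b) U) :
    sMap (((F.obj N).cx q).d p (p + 1)) U (toTensorFunctor.tm N h h' U φ m) =
      toTensorFunctor.tm N (a := a + 1) (by omega) h' U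
        (secMap (dgDualD (algT 𝒳) rfl i) U φ) m +
      a.negOnePow • toTensorFunctor.tm N (b := b + 1) (by omega) h' U φ
        (sMap ((N.cx j).d b (b + 1)) U m) +
      a.negOnePow • ∑ k ∈ Finset.Icc (1 : ℤ) (n + 1), ∑ α,
        toTensorFunctor.tm N (a := a + (1 - k)) (b := k + b) (i := i + 2) (j := -2 + j)
          (by omega) (by omega) U
          (precomp (algT 𝒳) rfl rfl U (E.xT k α) φ) (N.act rfl rfl U (E.yS k α) m)

/-- Linear Koszul duality for dg-modules with components in `P`: the functors `𝒜` and `ℬ` exist, they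
restrict to the subcategories of dg-modules with internal degree bounded above, are exact there (they
preserve short exact sequences and quasi-isomorphisms), and the functors that they induce on derived
categories are triangulated and mutually quasi-inverse. -/
def KoszulDuality (n : ℕ) (𝒳 : CochainComplex (Mod O) ℤ) (P : ObjectProperty (Mod O)) : Prop :=
  Nonempty (KoszulA n 𝒳) ∧ Nonempty (KoszulB n 𝒳) ∧
  ∀ (A : KoszulA n 𝒳) (B : KoszulB n 𝒳),
    ∃ (hA : ∀ M, minus (algT 𝒳) P M → minus (algS 𝒳) P (A.F.obj M))
      (hB : ∀ N, minus (algS 𝒳) P N → minus (algT 𝒳) P (B.F.obj N)),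
      PreservesShortExact (restrictMinus A.F hA) ∧ PreservesShortExact (restrictMinus B.F hB) ∧
      ∃ (qA : PreservesQis (restrictMinus A.F hA)) (qB : PreservesQis (restrictMinus B.F hB)),
        IsTriangulated (derived (restrictMinus A.F hA) qA) ∧
        IsTriangulated (derived (restrictMinus B.F hB) qB) ∧
        Nonempty (derived (restrictMinus A.F hA) qA ⋙ derived (restrictMinus B.F hB) qB ≅
          𝟭 (DMinus (algT 𝒳) P)) ∧
        Nonempty (derived (restrictMinus B.F hB) qB ⋙ derived (restrictMinus A.F hA) qA ≅
          𝟭 (DMinus (algS 𝒳) P))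
end Koszul
end LinearKoszul

/-!
# Proof of linear Koszul duality

**The functors.** Both `𝒜` and `ℬ` have the form `M ↦ P ⊗ M` with a differential twisted by
`∑ R e ⊗ Z e`, where `e` runs through a local frame of `𝒳`, the `R e` are operators on `P` and the `Z e`
are elements of the algebra acting on `M`. For `𝒜` these are right multiplication by `e^*` on `𝒮` and
the generator `e` of `𝒯`; for `ℬ` they are `φ ↦ φ(e · -)` on `𝒯^∨` and the generator `e^*` of `𝒮`. What is
needed to twist is collected in the structure `Twist`: the sum does not depend on the frame
(`LocalFrame.casimir_indep`), it is closed (`LocalFrame.casimir_closed`), and its square vanishes since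
its terms cancel in pairs (`Twist.double_sum`). The twisting data `twA` and `twB` then give the existence
of `𝒜` and `ℬ`, and every other statement about the two functors is proved for functors given by twisting
data.

**Coordinates.** Over a frame, the Poincaré-Birkhoff-Witt theorem for graded-symmetric algebras, proved
by letting the algebra act on the free module on the exponents (`HBasis.toEnd`), gives a basis of
monomials of `𝒮` and of `𝒯`, and thus a dual basis of `𝒯^∨` (`PBasis.monBasis`, `MonBasis.dualBasis`).
If the internal degree of `M` is bounded above, a section of `P ⊗ M` is therefore a finite sum of basis
sections times coefficients in `M` (`MonBasis.sum_coord`), and the twisted differential is triangular in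
these coordinates, with the differential of `M` on the diagonal (`Twist.IsTwisted.coord_d`). This gives
boundedness, exactness and the preservation of acyclicity. As the functors commute with shifts and cones
(`shiftHom`, `coneHom`), they preserve quasi-isomorphisms, and the derived functors are triangulated
(`Twist.IsTwisted.preservesQis`, `Twist.IsTwisted.isTriangulated`).

**Quasi-inverses.** The counit `𝒮 ⊗ 𝒯^∨ ⊗ N ⟶ N` sends `s ⊗ φ ⊗ n` to `± φ(1) s n`, and the value of the
unit `M ⟶ 𝒯^∨ ⊗ 𝒮 ⊗ M` at `m` is characterized by its pairing with each section `t` of `𝒯`, which is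
`± 1 ⊗ t m`. That they are quasi-isomorphisms is the acyclicity of the Koszul complex: over a frame, the
composites decompose into copies of `N` or `M` indexed by pairs of exponents, for a monomial of `𝒮` and an
element of the basis of `𝒯^∨`. The part of the twist which moves the last variable that occurs from one
exponent to the other is plus or minus the identity between these copies, and it matches all pairs of
exponents except the trivial one (`exists_lead`). With respect to a suitable order the rest of the
differential is strictly triangular, so Gaussian elimination (`CellComplex.exists_eq`) reduces every
cocycle to the trivial pair, on which the counit and the unit are isomorphisms (`quasiIso_counit`,
`quasiIso_unit`).

**Quasi-coherence.** By the decomposition into coordinates, the components of `𝒜(M)` and `ℬ(N)` are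
locally direct summands of finite sums of components of `M` and `N`, and on a scheme this implies that
they are quasi-coherent (`isQuasicoherent_of_isLocalSummand`).
-/

namespace LinearKoszul
set_option linter.unusedSectionVars false

/-! ### Sections of sheaves of modules -/

section SheafBasics
variable {X : TopCat.{u}} {O : Sheaf (Opens.grothendieckTopology X) CommRingCat.{u}}

lemma sec_ext (F : Mod O) {U : Opens X} {x y : SSec F U}
    (h : ∀ p ∈ U, ∃ (W : Opens X) (hW : W ≤ U), p ∈ W ∧ res (toP.obj F) hW x = res (toP.obj F) hW y) :
    x = y := by
  choose W hW hp hx using h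
  refine TopCat.Sheaf.eq_of_locally_eq' (⟨F.val.presheaf, F.isSheaf⟩ : TopCat.Sheaf Ab X)
    (fun p : U => W p.1 p.2) U (fun p => homOfLE (hW p.1 p.2)) ?_ x y (fun p => hx p.1 p.2)
  intro p hpU
  exact Opens.mem_iSup.2 ⟨⟨p, hpU⟩, hp p hpU⟩

/-- A property `Q` of sections which is stable under restriction, has at most one solution over each
open subset, and has local solutions, has a solution over `U`. -/
lemma exists_glue (F : Mod O) {U : Opens X} (Q : ∀ W : Opens X, W ≤ U → SSec F W → Prop)
    (hres : ∀ (W : Opens X) (hW : W ≤ U) (V : Opens X) (hV : V ≤ W) (x : SSec F W), Q W hW x →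
      Q V (hV.trans hW) (res _ hV x))
    (huniq : ∀ (W : Opens X) (hW : W ≤ U) (x y : SSec F W), Q W hW x → Q W hW y → x = y)
    (hex : ∀ p ∈ U, ∃ (W : Opens X) (hW : W ≤ U), p ∈ W ∧ ∃ x, Q W hW x) :
    ∃ s : SSec F U, ∀ (W : Opens X) (hW : W ≤ U) (x : SSec F W), Q W hW x → res _ hW s = x := by
  choose W hW hp t ht using hex
  obtain ⟨(s : SSec F U), hs, -⟩ := TopCat.Sheaf.existsUnique_gluing'
    (⟨F.val.presheaf, F.isSheaf⟩ : TopCat.Sheaf Ab X)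
    (fun p : U => W p.1 p.2) U (fun p => homOfLE (hW p.1 p.2))
    (fun p hpU => Opens.mem_iSup.2 ⟨⟨p, hpU⟩, hp p hpU⟩) (fun p => t p.1 p.2) (by
      intro p q
      exact huniq _ ((inf_le_left).trans (hW p.1 p.2)) _ _
        (hres _ _ _ inf_le_left _ (ht p.1 p.2)) (hres _ (hW q.1 q.2) _ inf_le_right _ (ht q.1 q.2)))
  refine ⟨s, fun V hV x hx => sec_ext F fun p hpV => ?_⟩
  have hpU := hV hpV
  refine ⟨V ⊓ W p hpU, inf_le_left, ⟨hpV, hp p hpU⟩, ?_⟩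
  have h1 : res (toP.obj F) (hW p hpU) s = t p hpU := hs ⟨p, hpU⟩
  have h2 := huniq _ (inf_le_left.trans hV) _ _ (hres _ _ _ inf_le_left _ hx)
    (hres _ (hW p hpU) _ (inf_le_right : V ⊓ W p hpU ≤ _) _ (ht p hpU))
  rw [h2, ← h1, res_res, res_res]

lemma hom_ext_sMap {M N : Mod O} {f g : M ⟶ N} (h : ∀ U x, sMap f U x = sMap g U x) : f = g := by
  refine SheafOfModules.hom_ext ?_
  ext U x
  exact h U.unop x

/-- A morphism of sheaves of modules from maps on sections. -/
noncomputable def mkSHom {M N : Mod O} (f : ∀ U, SSec M U →ₗ[Fn O U] SSec N U)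
    (hf : ∀ {U V : Opens X} (h : V ≤ U) (x : SSec M U), f V (res _ h x) = res _ h (f U x)) : M ⟶ N :=
  ⟨mkHom (F := toP.obj M) (G := toP.obj N) f hf⟩

lemma isIso_of_bijective {M N : Mod O} (f : M ⟶ N) (h : ∀ U, Function.Bijective (sMap f U)) :
    IsIso f := by
  let g : N ⟶ M := mkSHom (fun U => (LinearEquiv.ofBijective (sMap f U) (h U)).symm.toLinearMap) (by
    intro U V hV x
    apply (h V).1
    have := LinearEquiv.apply_ofBijective_symm_apply (h := h U) (sMap f U) x
    have h2 := LinearEquiv.apply_ofBijective_symm_apply (h := h V) (sMap f V) (res _ hV x)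
    refine h2.trans ?_
    rw [sMap_res]
    exact congrArg _ this.symm)
  refine ⟨g, hom_ext_sMap fun U x => ?_, hom_ext_sMap fun U x => ?_⟩
  · exact LinearEquiv.ofBijective_symm_apply_apply (h := h U) (sMap f U) x
  · exact LinearEquiv.apply_ofBijective_symm_apply (h := h U) (sMap f U) x

lemma iso_hom_inv {M N : Mod O} (e : M ≅ N) (U : Opens X) (x : SSec N U) :
    sMap e.hom U (sMap e.inv U x) = x := by rw [← sMap_comp, e.inv_hom_id, sMap_id]
lemma iso_inv_hom {M N : Mod O} (e : M ≅ N) (U : Opens X) (x : SSec M U) :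
    sMap e.inv U (sMap e.hom U x) = x := by rw [← sMap_comp, e.hom_inv_id, sMap_id]

lemma subsingleton_of_isZero {M : Mod O} (h : IsZero M) (U : Opens X) (x : SSec M U) : x = 0 := by
  have : 𝟙 M = 0 := h.eq_of_src _ _
  rw [← sMap_id M U x, this, sMap_zero]

lemma isZero_of_sections {M : Mod O} (h : ∀ U (x : SSec M U), x = 0) : IsZero M := by
  rw [IsZero.iff_id_eq_zero]
  exact hom_ext_sMap fun U x => (h U _).trans (h U _).symm

lemma epi_of_locally_surjective {M N : Mod O} (f : M ⟶ N)
    (h : ∀ U (x : SSec N U), ∀ p ∈ U, ∃ (W : Opens X) (hW : W ≤ U), p ∈ W ∧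
      ∃ y, sMap f W y = res _ hW x) : Epi f := by
  refine ⟨fun {P} g k e => hom_ext_sMap fun U x => sec_ext P fun p hp => ?_⟩
  obtain ⟨W, hW, hpW, y, hy⟩ := h U x p hp
  refine ⟨W, hW, hpW, ?_⟩
  rw [← sMap_res, ← sMap_res, ← hy, ← sMap_comp, ← sMap_comp, e]

lemma exists_res_eq_zero_of_toShf (F : PMod O) {U : Opens X} (x : Sec F U)
    (h : secMap (toShf F) U x = 0) : ∀ p ∈ U, ∃ (W : Opens X) (hW : W ≤ U), p ∈ W ∧
      res F hW x = 0 := by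
  intro p hp
  have hinj : Presheaf.IsLocallyInjective (Opens.grothendieckTopology X)
      ((PresheafOfModules.toPresheaf _).map (toShf F)) := by
    exact inferInstanceAs (Presheaf.IsLocallyInjective (Opens.grothendieckTopology X)
      (CategoryTheory.toSheafify (Opens.grothendieckTopology X) F.presheaf))
  have := (hinj.equalizerSieve_mem (X := op U) x (0 : Sec F U) (h.trans (map_zero _).symm)) p hp
  obtain ⟨W, g, hW, hpW⟩ := this
  exact ⟨W, leOfHom g, hpW, hW.trans (map_zero (res F (leOfHom g)))⟩

/-- The presheaf cokernel of a morphism of sheaves of modules. -/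
noncomputable def pCoker {M N : Mod O} (f : M ⟶ N) : PMod O :=
  mkPMod (fun U => SSec N U ⧸ LinearMap.range (sMap f U))
    (fun {U V} h => Submodule.mapQ _ _ (res (toP.obj N) h) (by
      rintro _ ⟨y, rfl⟩
      exact ⟨res _ h y, sMap_res f h y⟩))
    (by
      intro U x
      obtain ⟨x, rfl⟩ := Submodule.Quotient.mk_surjective _ x
      exact congrArg _ (res_refl _ x))
    (by
      intro U V W h h' x
      obtain ⟨x, rfl⟩ := Submodule.Quotient.mk_surjective _ x
      exact congrArg _ (res_res _ h h' x))

/-- An epimorphism of sheaves is locally surjective on sections, as the sheafification of its presheaf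
cokernel vanishes. -/
lemma locally_surjective_of_epi {M N : Mod O} (f : M ⟶ N) [Epi f] (U : Opens X) (x : SSec N U) :
    ∀ p ∈ U, ∃ (W : Opens X) (hW : W ≤ U), p ∈ W ∧ ∃ y, sMap f W y = res _ hW x := by
  let q : toP.obj N ⟶ pCoker f := mkHom (fun U => Submodule.mkQ _) (fun _ _ => rfl)
  let g : N ⟶ shf (pCoker f) := ⟨q ≫ toShf (pCoker f)⟩
  have hg : g = 0 := by
    rw [← cancel_epi f]
    refine hom_ext_sMap fun V y => ?_
    have : secMap q V (sMap f V y) = 0 := (Submodule.Quotient.mk_eq_zero _).2 ⟨y, rfl⟩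
    change secMap (toShf (pCoker f)) V (secMap q V (sMap f V y)) = 0
    rw [this, map_zero]
  have hx : secMap (toShf (pCoker f)) U (secMap q U x) = 0 := by
    change sMap g U x = 0
    rw [hg]; rfl
  intro p hp
  obtain ⟨W, hW, hpW, h⟩ := exists_res_eq_zero_of_toShf _ _ hx p hp
  obtain ⟨y, hy⟩ := (Submodule.Quotient.mk_eq_zero _).1 h
  exact ⟨W, hW, hpW, y, hy⟩

lemma sMap_injective_of_mono {M N : Mod O} (f : M ⟶ N) [Mono f] (U : Opens X) :
    Function.Injective (sMap f U) := by
  have : Mono ((SheafOfModules.evaluation (RS O) (op U)).map f) := inferInstance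
  exact (ModuleCat.mono_iff_injective _).1 this

lemma mono_of_injective {M N : Mod O} (f : M ⟶ N) (h : ∀ U, Function.Injective (sMap f U)) :
    Mono f := by
  refine ⟨fun {P} g k e => hom_ext_sMap fun U x => h U ?_⟩
  rw [← sMap_comp, ← sMap_comp, e]

lemma exists_kernel_lift {M N : Mod O} (f : M ⟶ N) {U : Opens X} (x : SSec M U)
    (h : sMap f U x = 0) : ∃ y, sMap (kernel.ι f) U y = x := by
  let S := ShortComplex.mk (kernel.ι f) f (kernel.condition f)
  have hS : S.Exact := ShortComplex.exact_kernel f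
  have : (SheafOfModules.evaluation (RS O) (op U)).PreservesZeroMorphisms := ⟨fun _ _ => rfl⟩
  have := hS.map_of_mono_of_preservesKernel (SheafOfModules.evaluation (RS O) (op U))
    (inferInstanceAs (Mono (kernel.ι f))) inferInstance
  rw [ShortComplex.moduleCat_exact_iff] at this
  exact this x h

/-- Exactness of a short complex of sheaves in terms of sections: cycles are locally boundaries. -/
lemma exact_iff_sections (S : ShortComplex (Mod O)) : S.Exact ↔
    ∀ U (z : SSec S.X₂ U), sMap S.g U z = 0 → ∀ p ∈ U, ∃ (W : Opens X) (hW : W ≤ U), p ∈ W ∧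
      ∃ y, sMap S.f W y = res _ hW z := by
  rw [S.exact_iff_epi_kernel_lift]
  constructor
  · intro h U z hz p hp
    obtain ⟨k, hk⟩ := exists_kernel_lift S.g z hz
    obtain ⟨W, hW, hpW, y, hy⟩ := locally_surjective_of_epi (kernel.lift S.g S.f S.zero) U k p hp
    refine ⟨W, hW, hpW, y, ?_⟩
    rw [← hk, ← sMap_res, ← hy, ← sMap_comp, kernel.lift_ι]
  · intro h
    refine epi_of_locally_surjective _ fun U k p hp => ?_
    obtain ⟨W, hW, hpW, y, hy⟩ := h U (sMap (kernel.ι S.g) U k)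
      (by rw [← sMap_comp, kernel.condition, sMap_zero]) p hp
    refine ⟨W, hW, hpW, y, sMap_injective_of_mono (kernel.ι S.g) W ?_⟩
    rw [← sMap_comp, kernel.lift_ι, hy, sMap_res]

lemma acyclic_iff_sections (K : CochainComplex (Mod O) ℤ) : K.Acyclic ↔
    ∀ (i : ℤ) (U : Opens X) (z : SSec (K.X (i + 1)) U), sMap (K.d (i + 1) (i + 1 + 1)) U z = 0 →
      ∀ p ∈ U, ∃ (W : Opens X) (hW : W ≤ U), p ∈ W ∧ ∃ y, sMap (K.d i (i + 1)) W y = res _ hW z := by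
  have : K.Acyclic ↔ ∀ i : ℤ, K.ExactAt (i + 1) :=
    ⟨fun h i => h _, fun h i => by simpa using h (i - 1)⟩
  rw [this]
  refine forall_congr' fun i => ?_
  rw [HomologicalComplex.exactAt_iff' K i (i + 1) (i + 1 + 1) (by simp) (by simp),
    exact_iff_sections]
  rfl

lemma quasiIso_iff_acyclic_mappingCone {K L : CochainComplex (Mod O) ℤ} (f : K ⟶ L) :
    QuasiIso f ↔ (CochainComplex.mappingCone f).Acyclic := by
  have h1 : QuasiIso f ↔ HomotopyCategory.quasiIso (Mod O) (ComplexShape.up ℤ)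
      ((HomotopyCategory.quotient _ _).map f) := by
    rw [HomotopyCategory.quotient_map_mem_quasiIso_iff, HomologicalComplex.mem_quasiIso_iff]
  rw [h1, HomotopyCategory.quasiIso_eq_trW_subcategoryAcyclic]
  exact ((HomotopyCategory.subcategoryAcyclic (Mod O)).trW_iff_of_distinguished _
      (HomotopyCategory.mappingCone_triangleh_distinguished f)).trans
    (HomotopyCategory.quotient_obj_mem_subcategoryAcyclic_iff_acyclic _)

lemma acyclic_of_iso {K L : CochainComplex (Mod O) ℤ} (e : K ≅ L) (h : K.Acyclic) : L.Acyclic :=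
  fun i => HomologicalComplex.ExactAt.of_iso (h i) e

open DGMod in
/-- A morphism of complexes is a quasi-isomorphism if it is injective and surjective on cohomology,
locally on sections. -/
lemma quasiIso_of_sections {K L : CochainComplex (Mod O) ℤ} (f : K ⟶ L)
    (hinj : ∀ (i : ℤ) (U : Opens X) (z : SSec (K.X (i + 1)) U) (l : SSec (L.X i) U),
      sMap (K.d (i + 1) (i + 1 + 1)) U z = 0 → sMap (f.f (i + 1)) U z = sMap (L.d i (i + 1)) U l →
      ∀ p ∈ U, ∃ (W : Opens X) (hW : W ≤ U), p ∈ W ∧ ∃ y, sMap (K.d i (i + 1)) W y = res _ hW z)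
    (hsurj : ∀ (i : ℤ) (U : Opens X) (l : SSec (L.X (i + 1)) U),
      sMap (L.d (i + 1) (i + 1 + 1)) U l = 0 →
      ∀ p ∈ U, ∃ (W : Opens X) (hW : W ≤ U), p ∈ W ∧ ∃ (k : SSec (K.X (i + 1)) W)
        (l' : SSec (L.X i) W), sMap (K.d (i + 1) (i + 1 + 1)) W k = 0 ∧
        res _ hW l = sMap (f.f (i + 1)) W k + sMap (L.d i (i + 1)) W l') : QuasiIso f := by
  -- the components of a cocycle of the cone are a cocycle `x` of `K` and a primitive `-l` of its image
  rw [quasiIso_iff_acyclic_mappingCone, acyclic_iff_sections]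
  intro i U z hz p hp
  have h1 := cFst_d f z
  have h2 := cSnd_d f z
  rw [hz, map_zero] at h1 h2
  obtain ⟨x, hx⟩ : ∃ x, x = sMap (cFst f (i + 1)) U z := ⟨_, rfl⟩
  obtain ⟨l, hl⟩ : ∃ l, l = sMap (cSnd f (i + 1)) U z := ⟨_, rfl⟩
  rw [← hx] at h1 h2
  rw [← hl] at h2
  obtain ⟨W, hW, hpW, w, hw⟩ := hinj (i + 1) U x (-l) (neg_eq_zero.1 h1.symm)
    (by rw [map_neg]; exact eq_neg_of_add_eq_zero_left h2.symm) p hp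
  have h3 : sMap (L.d (i + 1) (i + 1 + 1)) W (res _ hW l + sMap (f.f (i + 1)) W w) = 0 := by
    have h4 : sMap (L.d (i + 1) (i + 1 + 1)) W (sMap (f.f (i + 1)) W w) =
        sMap (f.f (i + 1 + 1)) W (sMap (K.d (i + 1) (i + 1 + 1)) W w) := by
      rw [← sMap_comp, f.comm, sMap_comp]
    rw [map_add, sMap_res, h4, hw, sMap_res, ← map_add]
    exact (congrArg _ ((add_comm _ _).trans h2.symm)).trans (map_zero _)
  obtain ⟨V, hV, hpV, k, l', hk, hl'⟩ := hsurj i W _ h3 p hpW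
  refine ⟨V, hV.trans hW, hpV, sMap (cInl f i) V (k - res _ hV w) + sMap (cInr f i) V l', ?_⟩
  apply c_ext
  · rw [cFst_d, sMap_res, map_add, cFst_cInl, cFst_cInr, add_zero, map_sub, hk, zero_sub, neg_neg,
      sMap_res, hw, res_res, hx]
  · rw [cSnd_d, sMap_res, map_add, map_add, map_add, cFst_cInl, cFst_cInr, cSnd_cInl, cSnd_cInr,
      map_zero, add_zero, zero_add, map_sub, sMap_res, ← hl, sub_add_eq_add_sub, ← hl', map_add, res_res,
      add_sub_cancel_right]

end SheafBasics

/-! ### Local morphisms and bilinear maps -/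

section LocalMaps
variable {X : TopCat.{u}} {O : Sheaf (Opens.grothendieckTopology X) CommRingCat.{u}}

/-- A section over `U` of the internal Hom of `F` and `G`: linear maps on the sections over the open
subsets of `U`, compatible with restriction. -/
@[ext] structure LHom (U : Opens X) (F G : PMod O) where
  app (V : Opens X) (h : V ≤ U) : Sec F V →ₗ[Fn O V] Sec G V
  app_res {V W : Opens X} (h : V ≤ U) (hW : W ≤ V) (x : Sec F V) :
    app W (hW.trans h) (res F hW x) = res G hW (app V h x)

/-- A section over `U` of the presheaf of bilinear maps from `F` and `F'` to `G`. -/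
@[ext] structure LBil (U : Opens X) (F F' G : PMod O) where
  app (V : Opens X) (h : V ≤ U) : Sec F V →ₗ[Fn O V] Sec F' V →ₗ[Fn O V] Sec G V
  app_res {V W : Opens X} (h : V ≤ U) (hW : W ≤ V) (x : Sec F V) (y : Sec F' V) :
    app W (hW.trans h) (res F hW x) (res F' hW y) = res G hW (app V h x y)

namespace LHom
variable {U : Opens X} {F G H : PMod O}

/-- The restriction of a global morphism. -/
def ofHom (U : Opens X) (f : F ⟶ G) : LHom U F G := ⟨fun V _ => secMap f V, fun _ h x => secMap_res f h x⟩

/-- Composition of local morphisms. -/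
def comp (g : LHom U G H) (f : LHom U F G) : LHom U F H :=
  ⟨fun V h => (g.app V h).comp (f.app V h), fun h hW x => by
    simp only [LinearMap.comp_apply, f.app_res h, g.app_res h]⟩

/-- Restriction to a smaller open subset. -/
def restr (f : LHom U F G) {W : Opens X} (h : W ≤ U) : LHom W F G :=
  ⟨fun V hV => f.app V (hV.trans h), fun hV hW x => f.app_res (hV.trans h) hW x⟩

instance : Zero (LHom U F G) := ⟨⟨fun _ _ => 0, by simp⟩⟩
instance : Add (LHom U F G) := ⟨fun f g => ⟨fun V h => f.app V h + g.app V h, fun h hW x => by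
  simp only [LinearMap.add_apply, app_res f h, app_res g h, map_add]⟩⟩
instance : SMul ℤˣ (LHom U F G) := ⟨fun k f => ⟨fun V h => k • f.app V h, fun h hW x => by
  simp only [LinearMap.smul_apply, app_res f h, DGMod.map_unit_smul]⟩⟩
@[simp] lemma zero_app (V : Opens X) (h : V ≤ U) (x : Sec F V) : (0 : LHom U F G).app V h x = 0 := rfl
@[simp] lemma add_app (f g : LHom U F G) (V : Opens X) (h : V ≤ U) (x : Sec F V) :
    (f + g).app V h x = f.app V h x + g.app V h x := rfl
@[simp] lemma smul_app (k : ℤˣ) (f : LHom U F G) (V : Opens X) (h : V ≤ U) (x : Sec F V) :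
    (k • f).app V h x = k • f.app V h x := rfl
@[simp] lemma ofHom_app (f : F ⟶ G) (V : Opens X) (h : V ≤ U) (x : Sec F V) :
    (ofHom U f).app V h x = secMap f V x := rfl
@[simp] lemma comp_app (g : LHom U G H) (f : LHom U F G) (V : Opens X) (h : V ≤ U) (x : Sec F V) :
    (g.comp f).app V h x = g.app V h (f.app V h x) := rfl
end LHom

namespace LBil
variable {U : Opens X} {F F' G : PMod O}
instance : Zero (LBil U F F' G) := ⟨⟨fun _ _ => 0, by simp⟩⟩
@[simp] lemma zero_app (V : Opens X) (h : V ≤ U) (x : Sec F V) (y : Sec F' V) :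
    (0 : LBil U F F' G).app V h x y = 0 := rfl
end LBil

/-- The global morphism defined by a local morphism over the whole space. -/
noncomputable def LHom.toHom {M N : Mod O} (f : LHom ⊤ (toP.obj M) (toP.obj N)) : M ⟶ N :=
  mkSHom (fun V => f.app V le_top) (fun h x => f.app_res le_top h x)

section jstar
variable (U : Opens X)

/-- The sections over `V` of the extension to the whole space of the restriction of `G` to `U`. -/
def JSec (G : PMod O) (V : Opens X) : Type u := Sec G (V ⊓ U)
instance (G : PMod O) (V : Opens X) : AddCommGroup (JSec U G V) :=
  inferInstanceAs (AddCommGroup (Sec G (V ⊓ U)))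
instance (G : PMod O) (V : Opens X) : Module (Fn O V) (JSec U G V) :=
  Module.compHom (Sec G (V ⊓ U)) (resFn O (inf_le_left : V ⊓ U ≤ V))

/-- The direct image `j_* j^* G` for the inclusion `j` of the open subset `U`. -/
noncomputable def jP (G : PMod O) : PMod O :=
  mkPMod (JSec U G) (fun {V W} h =>
    { toFun := fun x => res G (inf_le_inf_right U h) x
      map_add' := map_add _
      map_smul' := fun r (x : Sec G (V ⊓ U)) => by
        have := (res G (inf_le_inf_right U h)).map_smulₛₗ (resFn O (inf_le_left : V ⊓ U ≤ V) r) x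
        refine this.trans ?_
        rw [resFn_resFn, ← resFn_resFn h inf_le_left]
        rfl })
    (fun x => res_refl G x) (fun h h' x => res_res G _ _ x)

lemma jP_isSheaf (G : Mod O) :
    Presheaf.IsSheaf (Opens.grothendieckTopology X) (jP U (toP.obj G)).presheaf := by
  refine (TopCat.Presheaf.isSheaf_iff_isSheafUniqueGluing (X := X)
    (jP U (toP.obj G)).presheaf).2 ?_
  intro ι V sf hsf
  let sf' : ∀ i, SSec G (V i ⊓ U) := sf
  obtain ⟨s, hs, hu⟩ := TopCat.Sheaf.existsUnique_gluing'
    (⟨G.val.presheaf, G.isSheaf⟩ : TopCat.Sheaf Ab X)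
    (fun i => V i ⊓ U) (iSup V ⊓ U) (fun i => homOfLE (inf_le_inf_right U (le_iSup V i)))
    (by rw [iSup_inf_eq]) sf' (by
      intro i j
      have h : (V i ⊓ U) ⊓ (V j ⊓ U) ≤ (V i ⊓ V j) ⊓ U :=
        le_inf (inf_le_inf inf_le_left inf_le_left) (inf_le_left.trans inf_le_right)
      have := congrArg (fun x => res (toP.obj G) h x) (hsf i j)
      exact (res_res (toP.obj G) _ h (sf' i)).symm.trans
        (this.trans (res_res (toP.obj G) _ h (sf' j))))
  exact ⟨s, hs, hu⟩

/-- The sheaf `j_* j^* G` for the inclusion `j` of the open subset `U`. -/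
noncomputable def jS (G : Mod O) : Mod O := ⟨jP U (toP.obj G), jP_isSheaf U G⟩

/-- A local morphism from `F` to `G` over `U`, as a morphism to `j_* j^* G`. -/
noncomputable def LHom.toJ {U : Opens X} {F : PMod O} {G : Mod O} (f : LHom U F (toP.obj G)) :
    F ⟶ toP.obj (jS U G) :=
  mkHom (fun V =>
    { toFun := fun x => (f.app (V ⊓ U) inf_le_right (res F inf_le_left x) : SSec G (V ⊓ U))
      map_add' := fun x y => by
        rw [map_add]; exact map_add (f.app (V ⊓ U) inf_le_right) _ _
      map_smul' := fun r x => by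
        have := (res F (inf_le_left : V ⊓ U ≤ V)).map_smulₛₗ r x
        rw [this]; exact map_smul (f.app (V ⊓ U) inf_le_right) _ _ })
    (fun {V W} h x => by
      refine Eq.trans ?_ (f.app_res inf_le_right (inf_le_inf_right U h) _)
      change f.app _ _ _ = _
      rw [res_res, res_res])

lemma LHom.toJ_injective {U : Opens X} {F : PMod O} {G : Mod O} {f g : LHom U F (toP.obj G)}
    (h : f.toJ = g.toJ) : f = g := by
  ext V hV x
  have h1 : secMap f.toJ V x = secMap g.toJ V x := by rw [h]
  have hle : V ≤ V ⊓ U := le_inf le_rfl hV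
  have h2 := congrArg (fun y => res (toP.obj G) hle y) h1
  have h3 (f : LHom U F (toP.obj G)) : res (toP.obj G) hle (secMap f.toJ V x) = f.app V hV x := by
    refine (f.app_res inf_le_right hle _).symm.trans ?_
    rw [res_res, res_refl]
  exact (h3 f).symm.trans (h2.trans (h3 g))

/-- The local morphism over `U` defined by a morphism to `j_* j^* G`. -/
noncomputable def ofJ {U : Opens X} {F : PMod O} {G : Mod O} (f : F ⟶ toP.obj (jS U G)) :
    LHom U F (toP.obj G) where
  app V h :=
    { toFun := fun x => res (toP.obj G) (le_inf le_rfl h : V ≤ V ⊓ U) (secMap f V x)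
      map_add' := fun x y => by rw [map_add]; exact map_add (res (toP.obj G) _) _ _
      map_smul' := fun r x => by
        rw [map_smul]
        refine ((res (toP.obj G) (le_inf le_rfl h : V ≤ V ⊓ U)).map_smulₛₗ
          (resFn O (inf_le_left : V ⊓ U ≤ V) r) (secMap f V x)).trans ?_
        rw [resFn_resFn, resFn_refl]; rfl }
  app_res {V W} h hW x := by
    refine (congrArg (res (toP.obj G) (le_inf le_rfl (hW.trans h) : W ≤ W ⊓ U))
      (secMap_res f hW x)).trans ?_
    let y : SSec G (V ⊓ U) := secMap f V x
    exact (res_res (toP.obj G) (inf_le_inf_right U hW) _ y).trans (res_res (toP.obj G) _ _ y).symm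

end jstar

section
variable (R : Sheaf (Opens.grothendieckTopology X) RingCat.{u}) (F : PresheafOfModules.{u} R.obj)
  (G : SheafOfModules.{u} R)

lemma sheafifyAux_lift (f : F ⟶ G.val) : ∃ g : sheafifyAux R F ⟶ G, unitAux R F ≫ g.val = f :=
  ⟨((PresheafOfModules.sheafificationAdjunction (𝟙 R.obj)).homEquiv F G).symm f,
    ((PresheafOfModules.sheafificationAdjunction (𝟙 R.obj)).homEquiv_unit
      (f := ((PresheafOfModules.sheafificationAdjunction (𝟙 R.obj)).homEquiv F G).symm f)).symm.trans
      (Equiv.apply_symm_apply _ _)⟩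

lemma sheafifyAux_ext (f g : sheafifyAux R F ⟶ G) (h : unitAux R F ≫ f.val = unitAux R F ≫ g.val) :
    f = g :=
  ((PresheafOfModules.sheafificationAdjunction (𝟙 R.obj)).homEquiv F G).injective
    (((PresheafOfModules.sheafificationAdjunction (𝟙 R.obj)).homEquiv_unit (f := f)).trans
      (h.trans ((PresheafOfModules.sheafificationAdjunction (𝟙 R.obj)).homEquiv_unit (f := g)).symm))
end

/-- The morphism from the sheafification defined by a morphism to a sheaf. -/
noncomputable def shfLift {F : PMod O} {G : Mod O} (f : F ⟶ toP.obj G) : shf F ⟶ G :=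
  (sheafifyAux_lift (RS O) F G f).choose

lemma toShf_shfLift {F : PMod O} {G : Mod O} (f : F ⟶ toP.obj G) (U : Opens X) (x : Sec F U) :
    sMap (shfLift f) U (secMap (G := toP.obj (shf F)) (toShf F) U x) = secMap f U x :=
  congrArg (fun φ : F ⟶ toP.obj G => secMap φ U x)
  (sheafifyAux_lift (RS O) F G f).choose_spec

lemma shf_hom_ext {F : PMod O} {G : Mod O} {f g : shf F ⟶ G}
    (h : ∀ U x, sMap f U (secMap (G := toP.obj (shf F)) (toShf F) U x) = sMap g U (secMap (G := toP.obj (shf F)) (toShf F) U x)) : f = g := by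
  refine sheafifyAux_ext (RS O) F G f g ?_
  ext U x
  exact h U.unop x

lemma tensor_hom_ext {F F' G : PMod O} {f g : F ⊗ F' ⟶ G}
    (h : ∀ U x y, secMap f U (pureTensor F F' U x y) = secMap g U (pureTensor F F' U x y)) :
    f = g := by
  ext U x
  revert x
  have : (f.app U).hom = (g.app U).hom := TensorProduct.ext' (fun x y => h U.unop x y)
  intro x
  exact congrArg (fun (l : _ →ₗ[_] _) => l x) this

/-- The bilinear map on sections over `V` underlying `tensorLift`. -/
noncomputable def tensorLiftAux {U : Opens X} {F F' : PMod O} {G : Mod O}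
    (β : LBil U F F' (toP.obj G)) (V : Opens X) :
    Sec F V →ₗ[Fn O V] Sec F' V →ₗ[Fn O V] JSec U (toP.obj G) V :=
  LinearMap.mk₂ (Fn O V)
      (fun x y => (β.app (V ⊓ U) inf_le_right (res F inf_le_left x) (res F' inf_le_left y) :
        SSec G (V ⊓ U)))
      (fun x x' y => by rw [map_add, map_add]; rfl)
      (fun r x y => by
        rw [(res F (inf_le_left : V ⊓ U ≤ V)).map_smulₛₗ r x, map_smul]; rfl)
      (fun x y y' => by rw [map_add, map_add]; rfl)
      (fun r x y => by
        rw [(res F' (inf_le_left : V ⊓ U ≤ V)).map_smulₛₗ r y, map_smul]; rfl)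

/-- The morphism from the presheaf tensor product defined by a local bilinear map over `U`. -/
noncomputable def tensorLift {U : Opens X} {F F' : PMod O} {G : Mod O}
    (β : LBil U F F' (toP.obj G)) : F ⊗ F' ⟶ toP.obj (jS U G) :=
  mkHom (F := F ⊗ F') (fun V => TensorProduct.lift (tensorLiftAux β V))
    (by
      intro V W h x
      induction x using TensorProduct.induction_on with
      | zero =>
        exact (congrArg _ (map_zero (res (F ⊗ F') h))).trans ((map_zero _).trans
          ((congrArg _ (map_zero (TensorProduct.lift (tensorLiftAux β V)))).trans
            (map_zero (res (toP.obj (jS U G)) h))).symm)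
      | tmul x y =>
        refine Eq.trans ?_ (β.app_res inf_le_right (inf_le_inf_right U h) _ _)
        change β.app (W ⊓ U) inf_le_right (res F inf_le_left (res F h x))
          (res F' inf_le_left (res F' h y)) = _
        rw [res_res, res_res, res_res, res_res]
      | add x y hx hy =>
        refine (congrArg _ (map_add (res (F ⊗ F') h) x y)).trans ((map_add _ _ _).trans ?_)
        refine (congrArg₂ (· + ·) hx hy).trans ?_
        exact ((congrArg _ (map_add (TensorProduct.lift (tensorLiftAux β V)) x y)).trans
          (map_add (res (toP.obj (jS U G)) h) _ _)).symm)

lemma tensorLift_pure {U : Opens X} {F F' : PMod O} {G : Mod O}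
    (β : LBil U F F' (toP.obj G)) (V : Opens X) (x : Sec F V) (y : Sec F' V) :
    secMap (tensorLift β) V (pureTensor F F' V x y) =
      (β.app (V ⊓ U) inf_le_right (res F inf_le_left x) (res F' inf_le_left y) :
        SSec G (V ⊓ U)) := rfl

end LocalMaps

section GTensor
variable {X : TopCat.{u}} {O : Sheaf (Opens.grothendieckTopology X) CommRingCat.{u}}
variable {P : ℤ → ℤ → PMod O} {𝒜 : DGAlg O} {M : DGMod 𝒜} {p q : ℤ}

lemma gtensor_hom_ext {G : Mod O} {f g : gtensor P M p q ⟶ G}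
    (h : ∀ {a b i j : ℤ} (h : a + b = p) (h' : i + j = q) (V : Opens X) (s : Sec (P a i) V)
      (m : SSec ((M.cx j).X b) V), sMap f V (gtmul P M h h' V s m) = sMap g V (gtmul P M h h' V s m)) :
    f = g := by
  refine Sigma.hom_ext _ _ fun ⟨a, b, i, j, hp, hq⟩ => shf_hom_ext fun U x => ?_
  have : toShf _ ≫ (Sigma.ι (fun k : BiIdx p q => shf (P k.a k.i ⊗ toP.obj ((M.cx k.j).X k.b)))
      ⟨a, b, i, j, hp, hq⟩ ≫ f).val = toShf _ ≫ (Sigma.ι (fun k : BiIdx p q =>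
      shf (P k.a k.i ⊗ toP.obj ((M.cx k.j).X k.b))) ⟨a, b, i, j, hp, hq⟩ ≫ g).val :=
    tensor_hom_ext fun V s m => h hp hq V s m
  exact congrArg (fun φ => secMap φ U x) this

lemma gtmul_res {a b i j : ℤ} (h : a + b = p) (h' : i + j = q) {U V : Opens X} (hV : V ≤ U)
    (s : Sec (P a i) U) (m : SSec ((M.cx j).X b) U) :
    gtmul P M h h' V (res _ hV s) (res _ hV m) = res _ hV (gtmul P M h h' U s m) := by
  refine Eq.trans ?_ (sMap_res (Sigma.ι (fun k : BiIdx p q =>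
    shf (P k.a k.i ⊗ toP.obj ((M.cx k.j).X k.b))) ⟨a, b, i, j, h, h'⟩) hV _)
  exact congrArg _ (secMap_res (toShf (P a i ⊗ toP.obj ((M.cx j).X b))) hV (pureTensor _ _ U s m))

lemma gt_ext {U : Opens X} {G : Mod O} {f g : LHom U (toP.obj (gtensor P M p q)) (toP.obj G)}
    (h : ∀ {a b i j : ℤ} (h : a + b = p) (h' : i + j = q) (V : Opens X) (hV : V ≤ U)
      (s : Sec (P a i) V) (m : SSec ((M.cx j).X b) V),
      f.app V hV (gtmul P M h h' V s m) = g.app V hV (gtmul P M h h' V s m)) : f = g := by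
  apply LHom.toJ_injective
  have : (⟨f.toJ⟩ : gtensor P M p q ⟶ jS U G) = ⟨g.toJ⟩ := by
    apply gtensor_hom_ext
    intro a b i j h₁ h₂ V s m
    have key (f : LHom U (toP.obj (gtensor P M p q)) (toP.obj G)) :
        sMap (⟨f.toJ⟩ : gtensor P M p q ⟶ jS U G) V (gtmul P M h₁ h₂ V s m) =
        (f.app (V ⊓ U) inf_le_right (gtmul P M h₁ h₂ (V ⊓ U) (res _ inf_le_left s)
          (res _ inf_le_left m)) : SSec G (V ⊓ U)) := by
      exact congrArg (f.app (V ⊓ U) inf_le_right) (gtmul_res h₁ h₂ _ s m).symm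
    exact (key f).trans ((h h₁ h₂ _ inf_le_right _ _).trans (key g).symm)
  exact congrArg SheafOfModules.Hom.val this

/-- The local morphism from `P ⊗ M` defined by local bilinear maps. -/
noncomputable def gtLift {U : Opens X} {G : Mod O}
    (β : ∀ k : BiIdx p q, LBil U (P k.a k.i) (toP.obj ((M.cx k.j).X k.b)) (toP.obj G)) :
    LHom U (toP.obj (gtensor P M p q)) (toP.obj G) :=
  ofJ (toP.map (Sigma.desc (C := Mod O) fun k : BiIdx p q => shfLift (tensorLift (β k))))

lemma gtLift_gtmul {U : Opens X} {G : Mod O}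
    (β : ∀ k : BiIdx p q, LBil U (P k.a k.i) (toP.obj ((M.cx k.j).X k.b)) (toP.obj G))
    {a b i j : ℤ} (h : a + b = p) (h' : i + j = q) (V : Opens X) (hV : V ≤ U)
    (s : Sec (P a i) V) (m : SSec ((M.cx j).X b) V) :
    (gtLift β).app V hV (gtmul P M h h' V s m) = (β ⟨a, b, i, j, h, h'⟩).app V hV s m := by
  have h1 : sMap (Sigma.desc (C := Mod O) fun k : BiIdx p q => shfLift (tensorLift (β k))) V
      (gtmul P M h h' V s m) = secMap (tensorLift (β ⟨a, b, i, j, h, h'⟩)) V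
        (pureTensor _ _ V s m) := by
    have h3 := Sigma.ι_desc (C := Mod O) (fun k : BiIdx p q => shfLift (tensorLift (β k)))
      ⟨a, b, i, j, h, h'⟩
    refine Eq.trans ?_ (toShf_shfLift (tensorLift (β ⟨a, b, i, j, h, h'⟩)) V (pureTensor _ _ V s m))
    rw [← h3]
    rfl
  have hle : V ≤ V ⊓ U := le_inf le_rfl hV
  have h2 := (β ⟨a, b, i, j, h, h'⟩).app_res inf_le_right hle (res _ inf_le_left s)
    (res _ inf_le_left m)
  rw [res_res, res_res, res_refl, res_refl] at h2
  exact (congrArg (res (toP.obj G) hle) (h1.trans (tensorLift_pure _ _ _ _))).trans h2.symm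

end GTensor

/-! ### Monomial bases of graded-symmetric algebras -/

section PBW

/-- A homogeneous basis of a graded module, with index set `J`: the basis vector of index `j` is
`e (deg j) j`, its dual vector is `c (deg j) j`, and the values of `e` and `c` in other degrees are
zero by convention. -/
structure HBasis (R : Type u) [CommRing R] (V : ℤ → Type u) [∀ i, AddCommGroup (V i)]
    [∀ i, Module R (V i)] {J : Type} [Fintype J] [LinearOrder J] (deg : J → ℤ) where
  e (i : ℤ) : J → V i
  c (i : ℤ) : J → (V i →ₗ[R] R)
  e_eq_zero {i : ℤ} {j : J} : deg j ≠ i → e i j = 0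
  c_eq_zero {i : ℤ} {j : J} : deg j ≠ i → c i j = 0
  dual {i : ℤ} {j : J} (j' : J) : deg j = i → c i j' (e i j) = if j' = j then 1 else 0
  expand (i : ℤ) (v : V i) : ∑ j, c i j v • e i j = v

variable {J : Type} [Fintype J] [LinearOrder J] (deg : J → ℤ)

/-- The exponents of the nonzero monomials: the exponent of an odd variable is at most `1`. -/
def Adm (γ : J → ℕ) : Prop := ∀ j, Odd (deg j) → γ j ≤ 1

/-- The exponent of the variable `j`. -/
def ex (j : J) : J → ℕ := Pi.single j 1

/-- The total degree of a monomial. -/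
def tdeg (γ : J → ℕ) : ℤ := ∑ j, deg j * γ j

/-- The length of a monomial. -/
def len (γ : J → ℕ) : ℕ := ∑ j, γ j

/-- The sign of the permutation that sorts the variable `j` times the monomial `γ`. -/
def sgn (j : J) (γ : J → ℕ) : ℤˣ := (deg j * ∑ i with i < j, deg i * γ i).negOnePow

lemma tdeg_add (γ γ' : J → ℕ) : tdeg deg (γ + γ') = tdeg deg γ + tdeg deg γ' := by
  simp [tdeg, mul_add, Finset.sum_add_distrib]
lemma tdeg_ex (j : J) : tdeg deg (ex j) = deg j := by
  simp [tdeg, ex, Pi.single_apply]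
lemma tdeg_zero : tdeg deg (0 : J → ℕ) = 0 := by simp [tdeg]
lemma len_add (γ γ' : J → ℕ) : len (γ + γ') = len γ + len γ' := by
  simp [len, Finset.sum_add_distrib]
lemma len_ex (j : J) : len (ex j) = 1 := by simp [len, ex]
lemma len_zero : len (0 : J → ℕ) = 0 := by simp [len]

variable {deg} in
lemma Adm.of_le {γ γ' : J → ℕ} (h : Adm deg γ') (hle : γ ≤ γ') : Adm deg γ :=
  fun j hj => (hle j).trans (h j hj)
lemma adm_zero : Adm deg (0 : J → ℕ) := fun _ _ => Nat.zero_le _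

lemma exists_eq_add_ex {γ : J → ℕ} (h : γ ≠ 0) : ∃ j γ', γ = γ' + ex j := by
  obtain ⟨j, hj⟩ := Function.ne_iff.1 h
  refine ⟨j, γ - ex j, ?_⟩
  funext i
  by_cases hi : i = j
  · subst hi
    have : γ i ≠ 0 := hj
    simp [ex]; omega
  · simp [ex, hi]

lemma exp_induction {motive : (J → ℕ) → Prop} (zero : motive 0)
    (step : ∀ γ j, motive γ → motive (γ + ex j)) (γ : J → ℕ) : motive γ := by
  obtain ⟨n, hn⟩ : ∃ n, n = len γ := ⟨_, rfl⟩
  induction n generalizing γ with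
  | zero =>
    have : γ = 0 := by
      funext j
      exact Finset.sum_eq_zero_iff.1 hn.symm j (Finset.mem_univ j)
    exact this ▸ zero
  | succ n ih =>
    obtain ⟨j, γ', rfl⟩ := exists_eq_add_ex (γ := γ) (by rintro rfl; simp [len_zero] at hn)
    exact step _ _ (ih _ (by rw [len_add, len_ex] at hn; omega))

lemma sgn_add_ex_of_lt {i j : J} (h : i < j) (γ : J → ℕ) :
    sgn deg j (γ + ex i) = (deg i * deg j).negOnePow * sgn deg j γ := by
  rw [sgn, sgn, ← Int.negOnePow_add]
  congr 1
  have : ∑ k with k < j, deg k * ((γ + ex i) k : ℤ) = (∑ k with k < j, deg k * (γ k : ℤ)) + deg i := by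
    simp [mul_add, Finset.sum_add_distrib, ex, Pi.single_apply, h]
  rw [this]; ring

lemma sgn_add_ex_of_le {i j : J} (h : j ≤ i) (γ : J → ℕ) :
    sgn deg j (γ + ex i) = sgn deg j γ := by
  have : ∑ k with k < j, deg k * ((γ + ex i) k : ℤ) = ∑ k with k < j, deg k * (γ k : ℤ) := by
    refine Finset.sum_congr rfl fun k hk => ?_
    have : k ≠ i := ((Finset.mem_filter.1 hk).2.trans_le h).ne
    simp [ex, this]
  rw [sgn, sgn, this]

/-- The signs of the multiplications by two different variables, in the two orders, differ by the sign for
exchanging the variables. -/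
lemma sgn_comm {i j : J} (h : i ≠ j) (γ : J → ℕ) :
    sgn deg i (γ + ex j) * sgn deg j γ =
      (deg i * deg j).negOnePow * (sgn deg j (γ + ex i) * sgn deg i γ) := by
  rcases lt_or_gt_of_ne h with h | h
  · rw [sgn_add_ex_of_le deg h.le, sgn_add_ex_of_lt deg h, ← mul_assoc, ← mul_assoc,
      Int.units_mul_self, one_mul, mul_comm]
  · rw [sgn_add_ex_of_le deg h.le, sgn_add_ex_of_lt deg h, mul_comm (deg i), mul_assoc,
      mul_comm (sgn deg i γ)]

section Model
variable (R : Type u) [CommRing R]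

open scoped Classical in
/-- Left multiplication by the variable `j` on the free module on the exponents. -/
noncomputable def mulX (j : J) : Module.End R ((J → ℕ) →₀ R) :=
  Finsupp.lift _ R _ fun γ => if Adm deg (γ + ex j) then
    sgn deg j γ • Finsupp.single (γ + ex j) (1 : R) else 0

open scoped Classical in
lemma mulX_single (j : J) (γ : J → ℕ) : mulX deg R j (Finsupp.single γ 1) =
    if Adm deg (γ + ex j) then sgn deg j γ • Finsupp.single (γ + ex j) (1 : R) else 0 := by
  simp [mulX]

lemma end_ext {f g : Module.End R ((J → ℕ) →₀ R)}
    (h : ∀ γ, f (Finsupp.single γ 1) = g (Finsupp.single γ 1)) : f = g :=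
  Finsupp.lhom_ext' fun γ => LinearMap.ext_ring (h γ)

open scoped Classical in
lemma mulX_mulX_single (i j : J) (γ : J → ℕ) :
    mulX deg R i (mulX deg R j (Finsupp.single γ 1)) = if Adm deg (γ + ex j + ex i) then
      (sgn deg i (γ + ex j) * sgn deg j γ) • Finsupp.single (γ + ex j + ex i) (1 : R) else 0 := by
  rw [mulX_single]
  by_cases h : Adm deg (γ + ex j + ex i)
  · rw [if_pos (h.of_le (le_self_add)), if_pos h, Units.smul_def, map_zsmul, mulX_single, if_pos h,
      ← Units.smul_def, smul_smul, mul_comm]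
  · rw [if_neg h]
    split_ifs
    · rw [Units.smul_def, map_zsmul, mulX_single, if_neg h, smul_zero]
    · rw [map_zero]

lemma mulX_sq {j : J} (h : Odd (deg j)) : mulX deg R j * mulX deg R j = 0 := by
  classical
  refine end_ext R fun γ => ?_
  rw [Module.End.mul_apply, mulX_mulX_single, if_neg]
  · rfl
  · intro H
    have := H j h
    simp [ex] at this

lemma mulX_comm (i j : J) : mulX deg R i * mulX deg R j =
    (deg i * deg j).negOnePow • (mulX deg R j * mulX deg R i) := by
  classical
  rcases eq_or_ne i j with rfl | h
  · rcases Int.even_or_odd (deg i) with hi | hi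
    · rw [Int.negOnePow_even _ (hi.mul_left _), one_smul]
    · rw [mulX_sq deg R hi, smul_zero]
  refine end_ext R fun γ => ?_
  rw [Module.End.mul_apply, LinearMap.smul_apply, Module.End.mul_apply, mulX_mulX_single,
    mulX_mulX_single, add_right_comm]
  split_ifs
  · rw [smul_smul, sgn_comm deg h]
  · rw [smul_zero]
end Model

section
variable {deg}
variable {R : Type u} [CommRing R] {V : ℤ → Type u} [∀ i, AddCommGroup (V i)]
    [∀ i, Module R (V i)] (b : HBasis R V deg)

namespace HBasis
open GSym

/-- The action of the graded-symmetric algebra on the free module on the exponents. -/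
noncomputable def toEnd : GSym R V →ₐ[R] Module.End R ((J → ℕ) →₀ R) :=
  GSym.lift (fun i => ∑ j, (b.c i j).smulRight (mulX deg R j))
    (by
      intro i k x y
      simp only [LinearMap.sum_apply, LinearMap.smulRight_apply]
      rw [Finset.sum_mul_sum, Finset.sum_mul_sum, Finset.sum_comm, Units.smul_def, Finset.smul_sum]
      refine Finset.sum_congr rfl fun j _ => ?_
      rw [Finset.smul_sum]
      refine Finset.sum_congr rfl fun l _ => ?_
      by_cases hl : deg l = i
      · by_cases hj : deg j = k
        · rw [smul_mul_smul_comm, smul_mul_smul_comm, mulX_comm deg R l j, hl, hj, Units.smul_def,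
            smul_comm, mul_comm (b.c i l x)]
        · simp [b.c_eq_zero hj]
      · simp [b.c_eq_zero hl])
    (by
      intro i hi x
      simp only [LinearMap.sum_apply, LinearMap.smulRight_apply]
      rw [Finset.sum_mul_sum, ← Finset.sum_product']
      refine Finset.sum_involution (fun p _ => p.swap) ?_ ?_ (by simp) (by simp)
      · rintro ⟨j, l⟩ -
        dsimp only [Prod.swap]
        by_cases hl : deg l = i
        · by_cases hj : deg j = i
          · rw [smul_mul_smul_comm, smul_mul_smul_comm, mulX_comm deg R l j, hl, hj,
              Int.negOnePow_odd _ (hi.mul hi), mul_comm (b.c i l x)]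
            refine (smul_add _ _ _).symm.trans ((congrArg _ (LinearMap.ext fun z => ?_)).trans
              (smul_zero (_ : R)))
            exact (congrArg (_ + ·) (neg_one_smul ℤ _)).trans (add_neg_cancel _)
          · simp [b.c_eq_zero hj]
        · simp [b.c_eq_zero hl]
      · rintro ⟨j, l⟩ - hne heq
        obtain rfl : l = j := by simpa using congrArg Prod.fst heq
        apply hne
        by_cases hl : deg l = i
        · rw [smul_mul_smul_comm, mulX_sq deg R (hl ▸ hi), smul_zero]
        · simp [b.c_eq_zero hl])

lemma toEnd_gen (i : ℤ) (v : V i) :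
    b.toEnd (gen R V i v) = ∑ j, b.c i j v • mulX deg R j := by
  rw [toEnd, lift_gen]
  simp only [LinearMap.sum_apply, LinearMap.smulRight_apply]

/-- The generator of index `j`. -/
noncomputable def var (j : J) : GSym R V := gen R V (deg j) (b.e (deg j) j)

lemma toEnd_var (j : J) : b.toEnd (b.var j) = mulX deg R j := by
  rw [var, toEnd_gen]
  simp [b.dual _ rfl]

lemma gen_eq (i : ℤ) (v : V i) : gen R V i v = ∑ j, b.c i j v • b.var j := by
  conv_lhs => rw [← b.expand i v]
  rw [map_sum]
  refine Finset.sum_congr rfl fun j _ => ?_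
  rw [_root_.map_smul]
  by_cases hj : deg j = i
  · subst hj; rfl
  · simp [b.c_eq_zero hj]

lemma var_mul_var (i j : J) :
    b.var i * b.var j = (deg i * deg j).negOnePow • (b.var j * b.var i) := gen_mul_gen _ _ _ _
lemma var_sq {j : J} (h : Odd (deg j)) : b.var j * b.var j = 0 := gen_mul_self _ h _

lemma var_mul_pow (i j : J) (n : ℕ) :
    b.var j * b.var i ^ n = (deg j * (deg i * n)).negOnePow • (b.var i ^ n * b.var j) := by
  induction n with
  | zero => simp
  | succ n ih =>
    rw [pow_succ, ← mul_assoc, ih, smul_mul_assoc, mul_assoc, b.var_mul_var j i, mul_smul_comm,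
      smul_smul, ← Int.negOnePow_add, mul_assoc]
    congr 2
    push_cast; ring

/-- The product of the powers of the variables in the list `l`. -/
noncomputable def lmon (l : List J) (γ : J → ℕ) : GSym R V := (l.map fun j => b.var j ^ γ j).prod

/-- The monomial of exponent `γ`. -/
noncomputable def pbw (γ : J → ℕ) : GSym R V := b.lmon (Finset.univ.sort (· ≤ ·)) γ

lemma lmon_congr (l : List J) {γ γ' : J → ℕ} (h : ∀ j ∈ l, γ j = γ' j) : b.lmon l γ = b.lmon l γ' := by
  rw [lmon, lmon]
  congr 1
  exact List.map_congr_left fun j hj => by rw [h j hj]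

lemma var_mul_lmon (j : J) (l : List J) (hl : l.Pairwise (· < ·)) (hj : j ∈ l) (γ : J → ℕ) :
    b.var j * b.lmon l γ =
      (deg j * ((l.filter (· < j)).map fun i => deg i * γ i).sum).negOnePow • b.lmon l (γ + ex j) := by
  induction l with
  | nil => simp at hj
  | cons i l ih =>
    rw [List.pairwise_cons] at hl
    change _ * (b.var i ^ γ i * b.lmon l γ) = _ • (b.var i ^ (γ + ex j) i * b.lmon l (γ + ex j))
    rcases eq_or_ne j i with rfl | hne
    · have h1 : (j :: l).filter (· < j) = [] := by
        simpa using fun x hx => (hl.1 x hx).le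
      have h2 : b.lmon l (γ + ex j) = b.lmon l γ :=
        b.lmon_congr l fun k hk => by simp [ex, (hl.1 k hk).ne']
      rw [h1, h2]
      simp [← mul_assoc, ← pow_succ', ex]
    · have hj' : j ∈ l := by simpa [hne] using hj
      have hlt : i < j := hl.1 j hj'
      have h1 : (i :: l).filter (· < j) = i :: l.filter (· < j) := by simp [hlt]
      have h2 : (γ + ex j) i = γ i := by simp [ex, hne.symm]
      rw [h1, h2, ← mul_assoc, var_mul_pow, smul_mul_assoc, mul_assoc, ih hl.2 hj', mul_smul_comm,
        smul_smul, ← Int.negOnePow_add, List.map_cons, List.sum_cons, mul_add]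

lemma pbw_zero : b.pbw 0 = 1 := by simp [pbw, lmon]

lemma var_mul_pbw (j : J) (γ : J → ℕ) : b.var j * b.pbw γ = sgn deg j γ • b.pbw (γ + ex j) := by
  rw [pbw, pbw, b.var_mul_lmon j _ (Finset.sortedLT_sort _).pairwise (by simp), sgn]
  congr 4
  have h1 : ((Finset.univ.sort (· ≤ ·)).filter (· < j)).Nodup :=
    (Finset.sort_nodup _ _).filter _
  rw [← List.sum_toFinset _ h1]
  congr 1
  ext i; simp

lemma pbw_add_ex (j : J) (γ : J → ℕ) : b.pbw (γ + ex j) = sgn deg j γ • (b.var j * b.pbw γ) := by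
  rw [var_mul_pbw, smul_smul, Int.units_mul_self, one_smul]

lemma pbw_eq_zero {γ : J → ℕ} (h : ¬ Adm deg γ) : b.pbw γ = 0 := by
  simp only [Adm, not_forall, not_le] at h
  obtain ⟨j, hj, h2⟩ := h
  have : γ = (fun i => γ i - (ex j + ex j) i) + ex j + ex j := by
    funext i
    by_cases hi : i = j
    · subst hi; simp [ex]; omega
    · simp [ex, hi]
  rw [this, pbw_add_ex, pbw_add_ex, mul_smul_comm, ← mul_assoc, b.var_sq hj, zero_mul, smul_zero,
    smul_zero]

open scoped Classical in
lemma toEnd_pbw (γ : J → ℕ) : b.toEnd (b.pbw γ) (Finsupp.single 0 1) =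
    if Adm deg γ then Finsupp.single γ 1 else 0 := by
  induction γ using exp_induction with
  | zero => rw [pbw_zero, map_one, if_pos (adm_zero deg)]; rfl
  | step γ j ih =>
    rw [pbw_add_ex, Units.smul_def, map_zsmul, map_mul, toEnd_var, LinearMap.smul_apply,
      Module.End.mul_apply, ih]
    by_cases h : Adm deg γ
    · rw [if_pos h, mulX_single]
      split_ifs
      · rw [← Units.smul_def, smul_smul, Int.units_mul_self, one_smul]
      · rw [smul_zero]
    · rw [if_neg h, map_zero, smul_zero, if_neg fun h' => h (h'.of_le le_self_add)]

/-- The coefficient of the monomial of exponent `γ`. -/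
noncomputable def coef (γ : J → ℕ) : GSym R V →ₗ[R] R :=
  (Finsupp.lapply γ).comp ((LinearMap.applyₗ (Finsupp.single 0 1)).comp b.toEnd.toLinearMap)

open scoped Classical in
lemma coef_pbw (γ γ' : J → ℕ) : b.coef γ (b.pbw γ') = if γ = γ' ∧ Adm deg γ then 1 else 0 := by
  change (b.toEnd (b.pbw γ') (Finsupp.single 0 1)) γ = _
  rw [toEnd_pbw]
  by_cases h : Adm deg γ'
  · rw [if_pos h, Finsupp.single_apply]
    by_cases h2 : γ' = γ
    · subst h2; simp [h]
    · rw [if_neg h2, if_neg fun h3 => h2 h3.1.symm]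
  · rw [if_neg h, if_neg]
    · rfl
    · rintro ⟨rfl, h'⟩; exact h h'

lemma pbw_mem (w : ℤ) (γ : J → ℕ) : b.pbw γ ∈ piece R V w (tdeg deg γ) (w * len γ) := by
  induction γ using exp_induction with
  | zero => simpa [pbw_zero, tdeg_zero, len_zero] using one_mem w
  | step γ j ih =>
    rw [pbw_add_ex, Units.smul_def]
    refine zsmul_mem (mul_mem w ?_ ?_ (gen_mem w (deg j) _) ih) _
    · rw [tdeg_add, tdeg_ex, add_comm]
    · rw [len_add, len_ex]; push_cast; ring

lemma mon_mem_span (l : List (Σ i, V i)) : mon l ∈ Submodule.span R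
    {z | ∃ γ, Adm deg γ ∧ tdeg deg γ = (l.map Sigma.fst).sum ∧ len γ = l.length ∧ b.pbw γ = z} := by
  induction l with
  | nil =>
    exact Submodule.subset_span ⟨0, adm_zero deg, by simp [tdeg_zero], by simp [len_zero],
      by rw [pbw_zero]; simp [mon]⟩
  | cons v l ih =>
    rw [mon_cons, b.gen_eq, Finset.sum_mul]
    refine Submodule.sum_mem _ fun j _ => ?_
    by_cases hj : deg j = v.1
    · rw [smul_mul_assoc]
      refine Submodule.smul_mem _ _ ?_
      obtain ⟨z, hz⟩ : ∃ z, z = (mon l : GSym R V) := ⟨_, rfl⟩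
      rw [← hz] at ih ⊢
      clear hz
      induction ih using Submodule.span_induction with
      | mem z hz =>
        obtain ⟨γ, -, h1, h2, rfl⟩ := hz
        rw [var_mul_pbw, Units.smul_def]
        refine zsmul_mem ?_ _
        by_cases h : Adm deg (γ + ex j)
        · exact Submodule.subset_span ⟨_, h, by rw [tdeg_add, tdeg_ex, h1, hj]; simp [add_comm],
            by rw [len_add, len_ex, h2]; simp, rfl⟩
        · rw [b.pbw_eq_zero h]; exact zero_mem _
      | zero => rw [mul_zero]; exact zero_mem _
      | add y z _ _ hy hz => rw [mul_add]; exact add_mem hy hz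
      | smul r y _ hy => rw [mul_smul_comm]; exact Submodule.smul_mem _ _ hy
    · rw [b.c_eq_zero hj]; simp

end HBasis
end

lemma finite_len_le (N : ℕ) : {γ : J → ℕ | len γ ≤ N}.Finite := by
  refine (Set.finite_Iic (fun _ : J => N)).subset fun γ hγ j => ?_
  exact (Finset.single_le_sum (fun _ _ => Nat.zero_le _) (Finset.mem_univ j)).trans hγ

end PBW

/-! ### Twisted differentials -/

section GTensor
variable {X : TopCat.{u}} {O : Sheaf (Opens.grothendieckTopology X) CommRingCat.{u}}

namespace LHom
variable {U : Opens X} {F G H : PMod O}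
instance : SMul (Fn O U) (LHom U F G) := ⟨fun r f => ⟨fun V h => resFn O h r • f.app V h,
  fun h hW x => by
    simp only [LinearMap.smul_apply, app_res f h, LinearMap.map_smulₛₗ, resFn_resFn]⟩⟩
@[simp] lemma fn_smul_app (r : Fn O U) (f : LHom U F G) (V : Opens X) (h : V ≤ U) (x : Sec F V) :
    (r • f).app V h x = resFn O h r • f.app V h x := rfl
@[simp] lemma restr_app (f : LHom U F G) {W : Opens X} (h : W ≤ U) (V : Opens X) (hV : V ≤ W)
    (x : Sec F V) : (f.restr h).app V hV x = f.app V (hV.trans h) x := rfl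
end LHom

variable {P : ℤ → ℤ → PMod O} {𝒜 : DGAlg O} {M : DGMod 𝒜} {p q : ℤ}

variable (P M) in
/-- The product `gtmul` as a bilinear map. -/
noncomputable def gtmulL {a b p i j q : ℤ} (h : a + b = p) (h' : i + j = q) (U : Opens X) :
    Sec (P a i) U →ₗ[Fn O U] SSec ((M.cx j).X b) U →ₗ[Fn O U] SSec (gtensor P M p q) U :=
  (pureTensor (P a i) (toP.obj ((M.cx j).X b)) U).compr₂
    ((sMap (Sigma.ι (fun k : BiIdx p q => shf (P k.a k.i ⊗ toP.obj ((M.cx k.j).X k.b)))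
      ⟨a, b, i, j, h, h'⟩) U).comp
      (secMap (G := toP.obj (shf (P a i ⊗ toP.obj ((M.cx j).X b)))) (toShf _) U))

lemma gtmul_eq {a b p i j q : ℤ} (h : a + b = p) (h' : i + j = q) (U : Opens X)
    (s : Sec (P a i) U) (m : SSec ((M.cx j).X b) U) :
    gtmul P M h h' U s m = gtmulL P M h h' U s m := rfl

lemma gtmulL_res {a b i j : ℤ} (h : a + b = p) (h' : i + j = q) {U V : Opens X} (hV : V ≤ U)
    (s : Sec (P a i) U) (m : SSec ((M.cx j).X b) U) :
    gtmulL P M h h' V (res _ hV s) (res _ hV m) = res _ hV (gtmulL P M h h' U s m) :=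
  gtmul_res h h' hV s m
end GTensor

section Twist
variable {X : TopCat.{u}} {O : Sheaf (Opens.grothendieckTopology X) CommRingCat.{u}}

/-- The restriction of a frame to a smaller open subset. -/
noncomputable abbrev LocalFrame.restr {𝒳 : CochainComplex (Mod O) ℤ} {U : Opens X} (E : LocalFrame 𝒳 U)
    {V : Opens X} (hV : V ≤ U) : LocalFrame 𝒳 V where
  r := E.r
  x k α := res _ hV (E.x k α)
  y k α := res _ hV (E.y k α)
  expand k W h v := by
    refine Eq.trans ?_ (E.expand k W (h.trans hV) v)
    refine Finset.sum_congr rfl fun α _ => ?_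
    rw [res_res]; rfl
  dual k α β := by
    refine (DualSec.app_res (E.y k α) U V le_rfl hV (E.x k β)).trans ?_
    refine (congrArg (resFn O hV) (E.dual k α β)).trans ?_
    split_ifs
    · exact map_one _
    · exact map_zero _

/-- The indices of the elements of a frame in the degrees in which the complex may be nonzero. -/
noncomputable def LocalFrame.idx (n : ℕ) {𝒳 : CochainComplex (Mod O) ℤ} {U : Opens X} (E : LocalFrame 𝒳 U) :
    Finset (Σ k, Fin (E.r k)) := (Finset.Icc (1 : ℤ) (n + 1)).sigma fun _ => Finset.univ

/-- Every point has a neighbourhood over which the complex has a frame. -/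
def HasFrames (𝒳 : CochainComplex (Mod O) ℤ) : Prop :=
  ∀ p : X, ∃ W : Opens X, p ∈ W ∧ Nonempty (LocalFrame 𝒳 W)

lemma frame_ext {𝒳 : CochainComplex (Mod O) ℤ} (hF : HasFrames 𝒳) {G : Mod O} {V : Opens X}
    {x y : SSec G V} (h : ∀ (W : Opens X) (hW : W ≤ V), LocalFrame 𝒳 W →
      res (toP.obj G) hW x = res (toP.obj G) hW y) : x = y := by
  refine sec_ext G fun p hp => ?_
  obtain ⟨W, hpW, ⟨E⟩⟩ := hF p
  exact ⟨V ⊓ W, inf_le_left, ⟨hp, hpW⟩, h _ _ (E.restr inf_le_right)⟩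

/-- The data needed to twist the differential of `P ⊗ M` for dg-modules `M` over `𝒜`, so that it
becomes a dg-module over `ℬ`: a bigraded left `ℬ`-dg-module `P`, and for the elements `e` of each frame
of `𝒳` operators `R e` on `P` and elements `Z e` of `𝒜` such that `∑ R e ⊗ Z e` does not depend on
the frame and is a Maurer-Cartan element. The operator `dR e` is the commutator of `R e` with the
differential. -/
structure Twist (n : ℕ) (𝒳 : CochainComplex (Mod O) ℤ) (P : ℤ → ℤ → PMod O) (𝒜 ℬ : DGAlg O) where
  dP {a a' : ℤ} (h : a + 1 = a') (i : ℤ) : P a i ⟶ P a' i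
  dP_dP {a a' a'' : ℤ} (h : a + 1 = a') (h' : a' + 1 = a'') (i : ℤ) : dP h i ≫ dP h' i = 0
  lact {c a p l i q : ℤ} (h : c + a = p) (h' : l + i = q) (U : Opens X) :
    Sec (ℬ.obj c l) U →ₗ[Fn O U] Sec (P a i) U →ₗ[Fn O U] Sec (P p q) U
  lact_res {c a p l i q : ℤ} (h : c + a = p) (h' : l + i = q) {U V : Opens X} (hV : V ≤ U)
    (x : Sec (ℬ.obj c l) U) (s : Sec (P a i) U) :
    lact h h' V (res _ hV x) (res _ hV s) = res _ hV (lact h h' U x s)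
  one_lact {b j : ℤ} (U : Opens X) (s : Sec (P b j) U) :
    lact (zero_add b) (zero_add j) U (ℬ.one U) s = s
  mul_lact {a b c ab bc p i j k ij jk q : ℤ} (h₁ : a + b = ab) (h₂ : ab + c = p)
    (h₃ : b + c = bc) (h₄ : a + bc = p) (h₁' : i + j = ij) (h₂' : ij + k = q)
    (h₃' : j + k = jk) (h₄' : i + jk = q) (U : Opens X)
    (x : Sec (ℬ.obj a i) U) (y : Sec (ℬ.obj b j) U) (s : Sec (P c k) U) :
    lact h₂ h₂' U (ℬ.mul h₁ h₁' U x y) s = lact h₄ h₄' U x (lact h₃ h₃' U y s)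
  leibniz {a b p a' b' p' i j q : ℤ} (h : a + b = p) (ha : a + 1 = a') (hb : b + 1 = b')
    (hp : p + 1 = p') (h₁ : a' + b = p') (h₂ : a + b' = p') (h' : i + j = q) (U : Opens X)
    (x : Sec (ℬ.obj a i) U) (s : Sec (P b j) U) :
    secMap (dP hp q) U (lact h h' U x s) =
      lact h₁ h' U (secMap (ℬ.d ha i) U x) s +
        a.negOnePow • lact h₂ h' U x (secMap (dP hb j) U s)
  ε : ℤ → ℤ
  ε' : ℤ → ℤ
  hε (k : ℤ) : ε k + ε' k = 1
  w : ℤ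
  w' : ℤ
  hw : w + w' = 0
  Z {U : Opens X} (E : LocalFrame 𝒳 U) (e : Σ k, Fin (E.r k)) : Sec (𝒜.obj (ε' e.1) w') U
  Z_res {U V : Opens X} (E : LocalFrame 𝒳 U) (hV : V ≤ U) (e : Σ k, Fin (E.r k)) :
    Z (E.restr hV) e = res _ hV (Z E e)
  Z_comm {U : Opens X} (E : LocalFrame 𝒳 U) (e f : Σ k, Fin (E.r k)) {c l : ℤ}
    (h : ε' e.1 + ε' f.1 = c) (h₁ : ε' f.1 + ε' e.1 = c) (h' : w' + w' = l) :
    𝒜.mul h h' U (Z E e) (Z E f) = (ε' e.1 * ε' f.1).negOnePow • 𝒜.mul h₁ h' U (Z E f) (Z E e)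
  Z_sq {U : Opens X} (E : LocalFrame 𝒳 U) (e : Σ k, Fin (E.r k)) {c l : ℤ} (he : Odd (ε' e.1))
    (h : ε' e.1 + ε' e.1 = c) (h' : w' + w' = l) : 𝒜.mul h h' U (Z E e) (Z E e) = 0
  R {U : Opens X} (E : LocalFrame 𝒳 U) (e : Σ k, Fin (E.r k)) {a p i q : ℤ} (h : a + ε e.1 = p)
    (h' : i + w = q) : Sec (P a i) U →ₗ[Fn O U] Sec (P p q) U
  dR {U : Opens X} (E : LocalFrame 𝒳 U) (e : Σ k, Fin (E.r k)) {a p i q : ℤ} (h : a + ε e.1 + 1 = p)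
    (h' : i + w = q) : Sec (P a i) U →ₗ[Fn O U] Sec (P p q) U
  R_res {U V : Opens X} (E : LocalFrame 𝒳 U) (hV : V ≤ U) (e : Σ k, Fin (E.r k)) {a p i q : ℤ}
    (h : a + ε e.1 = p) (h' : i + w = q) (s : Sec (P a i) U) :
    R (E.restr hV) e h h' (res _ hV s) = res _ hV (R E e h h' s)
  R_comm {U : Opens X} (E : LocalFrame 𝒳 U) (e f : Σ k, Fin (E.r k)) {a p p₁ p₂ i q q₁ : ℤ}
    (h₁ : a + ε e.1 = p₁) (h₂ : a + ε f.1 = p₂) (h₃ : p₁ + ε f.1 = p) (h₄ : p₂ + ε e.1 = p)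
    (h₁' : i + w = q₁) (h₂' : q₁ + w = q) (s : Sec (P a i) U) :
    R E f h₃ h₂' (R E e h₁ h₁' s) = (ε e.1 * ε f.1).negOnePow • R E e h₄ h₂' (R E f h₂ h₁' s)
  R_sq {U : Opens X} (E : LocalFrame 𝒳 U) (e : Σ k, Fin (E.r k)) (he : Odd (ε e.1))
    {a p p₁ i q q₁ : ℤ} (h₁ : a + ε e.1 = p₁) (h₃ : p₁ + ε e.1 = p)
    (h₁' : i + w = q₁) (h₂' : q₁ + w = q) (s : Sec (P a i) U) :
    R E e h₃ h₂' (R E e h₁ h₁' s) = 0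
  d_R {U : Opens X} (E : LocalFrame 𝒳 U) (e : Σ k, Fin (E.r k)) {a a' p p' i q : ℤ}
    (ha : a + 1 = a') (hp : p + 1 = p') (h : a + ε e.1 = p) (h₁ : a' + ε e.1 = p')
    (h₂ : a + ε e.1 + 1 = p') (h' : i + w = q) (s : Sec (P a i) U) :
    secMap (dP hp q) U (R E e h h' s) =
      R E e h₁ h' (secMap (dP ha i) U s) + a.negOnePow • dR E e h₂ h' s
  R_lact {U : Opens X} (E : LocalFrame 𝒳 U) (e : Σ k, Fin (E.r k)) {c a p p₁ p₂ l i q q₁ q₂ : ℤ}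
    (h₁ : c + a = p₁) (h₂ : p₁ + ε e.1 = p) (h₃ : a + ε e.1 = p₂) (h₄ : c + p₂ = p)
    (h₁' : l + i = q₁) (h₂' : q₁ + w = q) (h₃' : i + w = q₂) (h₄' : l + q₂ = q)
    (x : Sec (ℬ.obj c l) U) (s : Sec (P a i) U) :
    R E e h₂ h₂' (lact h₁ h₁' U x s) = lact h₄ h₄' U x (R E e h₃ h₃' s)
  indep {U : Opens X} (E E' : LocalFrame 𝒳 U) {a i : ℤ} (s : Sec (P a i) U) {G : Type u}
    [AddCommGroup G] [Module (Fn O U) G]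
    (β : ∀ {p c : ℤ} (_ : p + c = a + 1),
      Sec (P p (i + w)) U →ₗ[Fn O U] Sec (𝒜.obj c w') U →ₗ[Fn O U] G) :
    ∑ e ∈ E.idx n, β (by have := hε e.1; omega) (R E e rfl rfl s) (Z E e) =
      ∑ e ∈ E'.idx n, β (by have := hε e.1; omega) (R E' e rfl rfl s) (Z E' e)
  closed {U : Opens X} (E : LocalFrame 𝒳 U) {a i : ℤ} (s : Sec (P a i) U) {G : Type u}
    [AddCommGroup G] [Module (Fn O U) G]
    (β : ∀ {p c : ℤ} (_ : p + c = a + 2),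
      Sec (P p (i + w)) U →ₗ[Fn O U] Sec (𝒜.obj c w') U →ₗ[Fn O U] G) :
    ∑ e ∈ E.idx n, (β (by have := hε e.1; omega) (dR E e rfl rfl s) (Z E e) +
      (ε e.1).negOnePow • β (by have := hε e.1; omega) (R E e rfl rfl s)
        (secMap (𝒜.d (a := ε' e.1) rfl w') U (Z E e))) = 0

namespace Twist
variable {n : ℕ} {𝒳 : CochainComplex (Mod O) ℤ} {P : ℤ → ℤ → PMod O} {𝒜 ℬ : DGAlg O}
  (D : Twist n 𝒳 P 𝒜 ℬ) {M : DGMod 𝒜} {p p' q a b i j : ℤ}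

/-- The section `∑ R e s ⊗ Z e m`, computed in a frame. -/
noncomputable def tw {U : Opens X} (E : LocalFrame 𝒳 U) (h : a + b + 1 = p) (h' : i + j = q)
    (s : Sec (P a i) U) (m : SSec ((M.cx j).X b) U) : SSec (gtensor P M p q) U :=
  ∑ e ∈ E.idx n, gtmulL P M (by have := D.hε e.1; omega) (by have := D.hw; omega) U
    (D.R E e rfl rfl s) (M.act rfl rfl U (D.Z E e) m)

lemma tw_indep {U : Opens X} (E E' : LocalFrame 𝒳 U) (h : a + b + 1 = p) (h' : i + j = q)
    (s : Sec (P a i) U) (m : SSec ((M.cx j).X b) U) : D.tw E h h' s m = D.tw E' h h' s m :=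
  D.indep E E' s (G := SSec (gtensor P M p q) U) (fun {p₁ c} h₁ =>
    (gtmulL P M (b := c + b) (j := D.w' + j) (by omega) (by have := D.hw; omega) U).compl₂
      ((M.act rfl rfl U).flip m))

lemma tw_res {U V : Opens X} (hV : V ≤ U) (E : LocalFrame 𝒳 U) (h : a + b + 1 = p) (h' : i + j = q)
    (s : Sec (P a i) U) (m : SSec ((M.cx j).X b) U) :
    D.tw (E.restr hV) h h' (res _ hV s) (res _ hV m) = res _ hV (D.tw E h h' s m) := by
  rw [tw, tw, map_sum]
  refine Finset.sum_congr rfl fun e _ => ?_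
  rw [← gtmulL_res, ← M.act_res, ← D.R_res]
  exact congrArg (fun z => gtmulL P M _ _ V _ (M.act rfl rfl V z _)) (D.Z_res E hV e)

variable (hF : HasFrames 𝒳)

include hF in
/-- The sections computed in frames over small open subsets glue, as they do not depend on the frame. -/
lemma exists_twist {U : Opens X} (h : a + b + 1 = p) (h' : i + j = q)
    (s : Sec (P a i) U) (m : SSec ((M.cx j).X b) U) : ∃ t : SSec (gtensor P M p q) U,
      ∀ (W : Opens X) (hW : W ≤ U) (E : LocalFrame 𝒳 W),
        res _ hW t = D.tw E h h' (res _ hW s) (res _ hW m) := by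
  refine (exists_glue (gtensor P M p q) (U := U) (fun W hW x =>
    ∃ E : LocalFrame 𝒳 W, x = D.tw E h h' (res _ hW s) (res _ hW m)) ?_ ?_ ?_).imp
    fun t ht W hW E => ht W hW _ ⟨E, rfl⟩
  · rintro W hW V hV _ ⟨E, rfl⟩
    exact ⟨E.restr hV, by rw [← tw_res, res_res, res_res]⟩
  · rintro W hW _ _ ⟨E, rfl⟩ ⟨E', rfl⟩
    exact D.tw_indep _ _ _ _ _ _
  · intro p hp
    obtain ⟨W, hpW, ⟨E⟩⟩ := hF p
    exact ⟨U ⊓ W, inf_le_left, ⟨hp, hpW⟩, _, E.restr inf_le_right, rfl⟩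

/-- The twisting term of the differential. -/
noncomputable def twist {U : Opens X} (h : a + b + 1 = p) (h' : i + j = q)
    (s : Sec (P a i) U) (m : SSec ((M.cx j).X b) U) : SSec (gtensor P M p q) U :=
  (D.exists_twist hF h h' s m).choose

lemma twist_res {U : Opens X} (h : a + b + 1 = p) (h' : i + j = q)
    (s : Sec (P a i) U) (m : SSec ((M.cx j).X b) U) {W : Opens X} (hW : W ≤ U) (E : LocalFrame 𝒳 W) :
    res _ hW (D.twist hF h h' s m) = D.tw E h h' (res _ hW s) (res _ hW m) :=
  (D.exists_twist hF h h' s m).choose_spec W hW E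

lemma twist_eq {U : Opens X} (h : a + b + 1 = p) (h' : i + j = q)
    (s : Sec (P a i) U) (m : SSec ((M.cx j).X b) U) (E : LocalFrame 𝒳 U) :
    D.twist hF h h' s m = D.tw E h h' s m := by
  have := D.twist_res hF h h' s m le_rfl E
  rwa [res_refl, res_refl, res_refl] at this

/-- The differential on elements of the form `s ⊗ m`. -/
noncomputable def diffBil (h : a + b = p) (h₁ : p + 1 = p') (h' : i + j = q) (M : DGMod 𝒜) :
    LBil ⊤ (P a i) (toP.obj ((M.cx j).X b)) (toP.obj (gtensor P M p' q)) where
  app V _ := LinearMap.mk₂ (Fn O V) (fun s m =>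
      gtmulL P M (a := a + 1) (b := b) (by omega) h' V (secMap (D.dP rfl i) V s) m +
      a.negOnePow • gtmulL P M (a := a) (b := b + 1) (by omega) h' V s
        (sMap ((M.cx j).d b (b + 1)) V m) +
      a.negOnePow • D.twist hF (by omega) h' s m)
    (by
      intro s s' m
      have : D.twist hF (p := p') (by omega) h' (s + s') m = D.twist hF (by omega) h' s m +
          D.twist hF (by omega) h' s' m :=
        frame_ext hF fun W hW E => by
          rw [map_add, twist_res _ _ _ _ _ _ _ E, twist_res _ _ _ _ _ _ _ E,
            twist_res _ _ _ _ _ _ _ E, map_add]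
          simp [tw, Finset.sum_add_distrib]
      simp only [this, map_add, LinearMap.add_apply, smul_add]
      abel)
    (by
      intro r s m
      have : D.twist hF (p := p') (by omega) h' (r • s) m = r • D.twist hF (by omega) h' s m :=
        frame_ext hF fun W hW E => by
          rw [LinearMap.map_smulₛₗ, twist_res _ _ _ _ _ _ _ E,
            twist_res _ _ _ _ _ _ _ E, LinearMap.map_smulₛₗ]
          simp [tw, Finset.smul_sum]
      simp only [this, map_smul, LinearMap.smul_apply, smul_add, smul_comm r])
    (by
      intro s m m'
      have : D.twist hF (p := p') (by omega) h' s (m + m') = D.twist hF (by omega) h' s m +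
          D.twist hF (by omega) h' s m' :=
        frame_ext hF fun W hW E => by
          rw [map_add, twist_res _ _ _ _ _ _ _ E, twist_res _ _ _ _ _ _ _ E,
            twist_res _ _ _ _ _ _ _ E, map_add]
          simp [tw, Finset.sum_add_distrib]
      simp only [this, map_add, smul_add]
      abel)
    (by
      intro r s m
      have : D.twist hF (p := p') (by omega) h' s (r • m) = r • D.twist hF (by omega) h' s m :=
        frame_ext hF fun W hW E => by
          rw [LinearMap.map_smulₛₗ, twist_res _ _ _ _ _ _ _ E,
            twist_res _ _ _ _ _ _ _ E, LinearMap.map_smulₛₗ]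
          simp [tw, Finset.smul_sum]
      simp only [this, map_smul, smul_add, smul_comm r])
  app_res {V W} h hW s m := by
    have : D.twist hF (p := p') (by omega) h' (res _ hW s) (res _ hW m) =
        res _ hW (D.twist hF (by omega) h' s m) :=
      frame_ext hF fun W' hW' E => by
        rw [res_res, twist_res _ _ _ _ _ _ _ E, twist_res _ _ _ _ _ _ _ E, res_res, res_res]
    simp only [LinearMap.mk₂_apply, this, map_add, DGMod.map_unit_smul, ← gtmulL_res, ← secMap_res]

/-- The differential on `P ⊗ M`. -/
noncomputable def diff (h₁ : p + 1 = p') (q : ℤ) (M : DGMod 𝒜) : gtensor P M p q ⟶ gtensor P M p' q :=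
  (gtLift (P := P) (M := M) fun k => D.diffBil hF k.hab h₁ k.hij M).toHom

lemma diff_gtmul (h : a + b = p) (h₁ : p + 1 = p') (h' : i + j = q) {V : Opens X}
    (E : LocalFrame 𝒳 V) (s : Sec (P a i) V) (m : SSec ((M.cx j).X b) V) :
    sMap (D.diff hF h₁ q M) V (gtmulL P M h h' V s m) =
      gtmulL P M (a := a + 1) (b := b) (by omega) h' V (secMap (D.dP rfl i) V s) m +
      a.negOnePow • gtmulL P M (a := a) (b := b + 1) (by omega) h' V s
        (sMap ((M.cx j).d b (b + 1)) V m) +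
      a.negOnePow • D.tw E (by omega) h' s m := by
  rw [← D.twist_eq hF]
  exact gtLift_gtmul (fun k => D.diffBil hF k.hab h₁ k.hij M) h h' V le_top s m

end Twist
end Twist

/-! ### The dg-modules and functors defined by twisting data -/

section Twist
variable {X : TopCat.{u}} {O : Sheaf (Opens.grothendieckTopology X) CommRingCat.{u}}

/-- Two local morphisms from `P ⊗ M` are equal if they agree on the elements `s ⊗ m` over the open
subsets over which the complex has a frame. -/
lemma gt_ext_frame {𝒳 : CochainComplex (Mod O) ℤ} (hF : HasFrames 𝒳) {P : ℤ → ℤ → PMod O}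
    {𝒜 : DGAlg O} {M : DGMod 𝒜} {p q : ℤ} {U : Opens X} {G : Mod O}
    {f g : LHom U (toP.obj (gtensor P M p q)) (toP.obj G)}
    (h : ∀ {a b i j : ℤ} (h : a + b = p) (h' : i + j = q) (V : Opens X) (hV : V ≤ U)
      (_ : LocalFrame 𝒳 V) (s : Sec (P a i) V) (m : SSec ((M.cx j).X b) V),
      f.app V hV (gtmulL P M h h' V s m) = g.app V hV (gtmulL P M h h' V s m)) : f = g := by
  refine gt_ext fun {a b i j} h₁ h₂ V hV s m => frame_ext hF fun W hW E => ?_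
  rw [gtmul_eq, ← f.app_res hV, ← g.app_res hV, ← gtmulL_res]
  exact h h₁ h₂ W _ E _ _

lemma hom_ext_frame {𝒳 : CochainComplex (Mod O) ℤ} (hF : HasFrames 𝒳) {P : ℤ → ℤ → PMod O}
    {𝒜 : DGAlg O} {M : DGMod 𝒜} {p q : ℤ} {G : Mod O} {f g : gtensor P M p q ⟶ G}
    (h : ∀ {a b i j : ℤ} (h : a + b = p) (h' : i + j = q) (V : Opens X)
      (_ : LocalFrame 𝒳 V) (s : Sec (P a i) V) (m : SSec ((M.cx j).X b) V),
      sMap f V (gtmulL P M h h' V s m) = sMap g V (gtmulL P M h h' V s m)) : f = g := by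
  have : LHom.ofHom ⊤ (toP.map f) = LHom.ofHom ⊤ (toP.map g) :=
    gt_ext_frame hF fun h₁ h₂ V _ E s m => h h₁ h₂ V E s m
  exact hom_ext_sMap fun U x => congrArg (fun φ => LHom.app φ U le_top x) this

namespace Twist
variable {n : ℕ} {𝒳 : CochainComplex (Mod O) ℤ} {P : ℤ → ℤ → PMod O} {𝒜 ℬ : DGAlg O}
  (D : Twist n 𝒳 P 𝒜 ℬ) {M : DGMod 𝒜} {p p' q a b i j : ℤ}

lemma cell_eq {U : Opens X} (E : LocalFrame 𝒳 U) (e : Σ k, Fin (E.r k)) {a₁ i₁ b₁ j₁ : ℤ}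
    (h₁ : a + D.ε e.1 = a₁) (h₂ : i + D.w = i₁) (h₃ : D.ε' e.1 + b = b₁) (h₄ : D.w' + j = j₁)
    (h : a₁ + b₁ = p) (h' : i₁ + j₁ = q) (s : Sec (P a i) U) (m : SSec ((M.cx j).X b) U) :
    gtmulL P M h h' U (D.R E e h₁ h₂ s) (M.act h₃ h₄ U (D.Z E e) m) =
      gtmulL P M (by omega) (by omega) U (D.R E e rfl rfl s) (M.act rfl rfl U (D.Z E e) m) := by
  subst h₁ h₂ h₃ h₄; rfl

/-- The terms of the square of the twist for `(e, f)` and `(f, e)` cancel: one of the operators and the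
elements of the algebra anticommute where the other commute, because `ε e + ε' e = 1`. -/
lemma cell_swap {U : Opens X} (E : LocalFrame 𝒳 U) (e f : Σ k, Fin (E.r k)) (s : Sec (P a i) U)
    (m : SSec ((M.cx j).X b) U) (h : a + D.ε e.1 + D.ε f.1 + (D.ε' f.1 + (D.ε' e.1 + b)) = p)
    (h' : i + D.w + D.w + (D.w' + (D.w' + j)) = q) :
    gtmulL P M (p := p) (q := q) (by omega) (by omega) U (D.R E e rfl rfl (D.R E f rfl rfl s))
        (M.act rfl rfl U (D.Z E e) (M.act rfl rfl U (D.Z E f) m)) =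
      (1 + D.ε e.1 + D.ε f.1).negOnePow •
      gtmulL P M h h' U (D.R E f rfl rfl (D.R E e rfl rfl s))
        (M.act rfl rfl U (D.Z E f) (M.act rfl rfl U (D.Z E e) m)) := by
  have h1 := D.R_comm E f e (a := a) (p := a + D.ε e.1 + D.ε f.1) (i := i) rfl rfl (by omega) rfl rfl rfl s
  rw [← D.cell_eq E e (a₁ := a + D.ε e.1 + D.ε f.1) (b₁ := D.ε' f.1 + (D.ε' e.1 + b))
    (by omega) rfl (by omega) rfl h h', h1,
    ← M.mul_act (ab := D.ε' e.1 + D.ε' f.1) rfl (by omega) rfl (by omega) rfl (by omega) rfl rfl,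
    ← M.mul_act (ab := D.ε' e.1 + D.ε' f.1) (add_comm _ _) (by omega) rfl (by omega) rfl (by omega) rfl rfl,
    D.Z_comm E e f rfl (add_comm _ _) rfl]
  simp only [DGMod.map_unit_smul, LinearMap.smul_apply]
  rw [smul_smul, ← Int.negOnePow_add]
  congr 1
  have h4 := D.hε e.1
  have h5 := D.hε f.1
  rw [Int.negOnePow_eq_iff, show D.ε' e.1 = 1 - D.ε e.1 by omega, show D.ε' f.1 = 1 - D.ε f.1 by omega]
  exact ⟨D.ε e.1 * D.ε f.1 - D.ε e.1 - D.ε f.1, by ring⟩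

/-- The term of the square of the twist for `(e, e)` vanishes: either `R e` or `Z e` is odd. -/
lemma cell_diag {U : Opens X} (E : LocalFrame 𝒳 U) (e : Σ k, Fin (E.r k)) (s : Sec (P a i) U)
    (m : SSec ((M.cx j).X b) U) (h : a + D.ε e.1 + D.ε e.1 + (D.ε' e.1 + (D.ε' e.1 + b)) = p)
    (h' : i + D.w + D.w + (D.w' + (D.w' + j)) = q) :
      gtmulL P M h h' U (D.R E e rfl rfl (D.R E e rfl rfl s))
        (M.act rfl rfl U (D.Z E e) (M.act rfl rfl U (D.Z E e) m)) = 0 := by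
  rcases Int.even_or_odd (D.ε e.1) with h1 | h1
  · rw [← M.mul_act (ab := D.ε' e.1 + D.ε' e.1) rfl (by omega) rfl (by omega) rfl (by omega) rfl rfl,
      D.Z_sq E e _ rfl rfl, map_zero, LinearMap.zero_apply, map_zero]
    have := D.hε e.1
    rw [show D.ε' e.1 = 1 - D.ε e.1 by omega]
    exact odd_one.sub_even h1
  · rw [D.R_sq E e h1, map_zero, LinearMap.zero_apply]

/-- The square of the twist vanishes. -/
lemma double_sum {U : Opens X} (E : LocalFrame 𝒳 U) (s : Sec (P a i) U)
    (m : SSec ((M.cx j).X b) U) (h : a + b + 1 + 1 = p) (h' : i + j = q) :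
    ∑ e ∈ E.idx n, (D.ε e.1).negOnePow • D.tw E (p := p) (q := q) (by have := D.hε e.1; omega)
      (by have := D.hw; omega) (D.R E e rfl rfl s) (M.act rfl rfl U (D.Z E e) m) = 0 := by
  simp only [tw, Finset.smul_sum]
  rw [← Finset.sum_product']
  refine Finset.sum_involution (fun x _ => x.swap) ?_ ?_ ?_ (by simp)
  · rintro ⟨e, f⟩ -
    dsimp only [Prod.swap]
    rw [D.cell_swap E e f s m (by have := D.hε e.1; have := D.hε f.1; omega) (by have := D.hw; omega),
      smul_smul, ← Int.negOnePow_add, show D.ε f.1 + (1 + D.ε e.1 + D.ε f.1) =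
      D.ε e.1 + 1 + 2 * D.ε f.1 by ring, Int.negOnePow_add _ (2 * _), Int.negOnePow_even _ (even_two_mul _), mul_one,
      Int.negOnePow_succ, Units.neg_smul, add_neg_cancel]
  · rintro ⟨e, f⟩ - hne heq
    obtain rfl : f = e := by simpa using congrArg Prod.fst heq
    exact hne (by rw [cell_diag, smul_zero])
  · rintro ⟨e, f⟩ he
    simpa [and_comm] using he

variable (hF : HasFrames 𝒳)

lemma diff_cell {U : Opens X} (E : LocalFrame 𝒳 U) (e : Σ k, Fin (E.r k)) (s : Sec (P a i) U)
    (m : SSec ((M.cx j).X b) U) (h : a + b + 1 = p) (h₁ : p + 1 = p') (h' : i + j = q) :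
    sMap (D.diff hF h₁ q M) U (gtmulL P M (by have := D.hε e.1; omega) (by have := D.hw; omega) U
      (D.R E e rfl rfl s) (M.act rfl rfl U (D.Z E e) m)) =
    gtmulL P M (p := p') (q := q) (by have := D.hε e.1; omega) (by have := D.hw; omega) U
      (D.R E e rfl rfl (secMap (D.dP rfl i) U s)) (M.act rfl rfl U (D.Z E e) m) +
    a.negOnePow • (gtmulL P M (p := p') (q := q) (by have := D.hε e.1; omega) (by have := D.hw; omega) U
      (D.dR E e rfl rfl s) (M.act rfl rfl U (D.Z E e) m) +
      (D.ε e.1).negOnePow • gtmulL P M (p := p') (q := q) (by have := D.hε e.1; omega)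
        (by have := D.hw; omega) U (D.R E e rfl rfl s)
        (M.act rfl rfl U (secMap (𝒜.d (a := D.ε' e.1) rfl D.w') U (D.Z E e)) m)) -
    a.negOnePow • gtmulL P M (p := p') (q := q) (by have := D.hε e.1; omega) (by have := D.hw; omega) U
      (D.R E e rfl rfl s) (M.act rfl rfl U (D.Z E e) (sMap ((M.cx j).d b (b + 1)) U m)) +
    a.negOnePow • (D.ε e.1).negOnePow • D.tw E (by have := D.hε e.1; omega)
      (by have := D.hw; omega) (D.R E e rfl rfl s) (M.act rfl rfl U (D.Z E e) m) := by
  have hεe := D.hε e.1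
  have hw := D.hw
  rw [D.diff_gtmul hF _ _ _ E, D.d_R E e rfl rfl rfl (by omega) rfl rfl,
    M.leibniz (b := b) rfl rfl rfl rfl (by omega) (by omega) rfl]
  rw [map_add, map_add, LinearMap.add_apply, D.cell_eq E e, DGMod.map_unit_smul, smul_add,
    DGMod.map_unit_smul]
  have h2 : gtmulL P M (p := p') (q := q) (by omega) (by omega) U (D.R E e rfl rfl s)
      (M.act (b := b) (p := D.ε' e.1 + b + 1) (by omega) rfl U (secMap (𝒜.d (a := D.ε' e.1) rfl D.w') U (D.Z E e)) m) =
      gtmulL P M (p := p') (q := q) (by omega)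
        (by omega) U (D.R E e rfl rfl s)
        (M.act rfl rfl U (secMap (𝒜.d (a := D.ε' e.1) rfl D.w') U (D.Z E e)) m) := by
    have : ∀ {b' : ℤ} (h : D.ε' e.1 + 1 + b = b') (h1 : a + D.ε e.1 + b' = p'),
        gtmulL P M (p := p') (q := q) h1 (by omega) U (D.R E e rfl rfl s)
        (M.act (b := b) h rfl U (secMap (𝒜.d (a := D.ε' e.1) rfl D.w') U (D.Z E e)) m) =
        gtmulL P M (p := p') (q := q) (by omega) (by omega) U (D.R E e rfl rfl s)
        (M.act rfl rfl U (secMap (𝒜.d (a := D.ε' e.1) rfl D.w') U (D.Z E e)) m) := by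
      intro b' h h1; subst h; rfl
    exact this _ _
  rw [D.cell_eq E e (b := b + 1), h2]
  have h3 : (a + D.ε e.1).negOnePow * (D.ε' e.1).negOnePow = -a.negOnePow := by
    rw [← Int.negOnePow_add, add_assoc, hεe, Int.negOnePow_succ]
  rw [LinearMap.smul_apply, smul_smul (a + D.ε e.1).negOnePow, h3, Units.neg_smul,
    smul_add a.negOnePow, smul_smul a.negOnePow, smul_smul a.negOnePow, Int.negOnePow_add]
  abel

lemma diff_tw {U : Opens X} (E : LocalFrame 𝒳 U) (s : Sec (P a i) U)
    (m : SSec ((M.cx j).X b) U) (h : a + b + 1 = p) (h₁ : p + 1 = p') (h' : i + j = q) :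
    sMap (D.diff hF h₁ q M) U (D.tw E h h' s m) =
      D.tw E (by omega) h' (secMap (D.dP rfl i) U s) m -
      a.negOnePow • D.tw E (by omega) h' s (sMap ((M.cx j).d b (b + 1)) U m) := by
  rw [tw, map_sum, Finset.sum_congr rfl fun e _ => D.diff_cell hF E e s m h h₁ h',
    Finset.sum_add_distrib, Finset.sum_sub_distrib, Finset.sum_add_distrib, ← Finset.smul_sum,
    ← Finset.smul_sum, ← Finset.smul_sum, D.double_sum E s m (by omega) h', smul_zero, add_zero]
  have h3 := D.closed E s (G := SSec (gtensor P M p' q) U) (fun {p₁ c} h₁ =>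
    (gtmulL P M (b := c + b) (j := D.w' + j) (by omega) (by have := D.hw; omega) U).compl₂
      ((M.act rfl rfl U).flip m))
  simp only [LinearMap.compl₂_apply, LinearMap.flip_apply] at h3
  rw [h3, smul_zero, add_zero]
  rfl

lemma diff_diff {p'' : ℤ} (h : p + 1 = p') (h' : p' + 1 = p'') (M : DGMod 𝒜) :
    D.diff hF h q M ≫ D.diff hF h' q M = 0 := by
  refine hom_ext_frame hF fun {a b i j} h₁ h₂ V E s m => ?_
  rw [sMap_comp, sMap_zero, D.diff_gtmul hF _ _ _ E, map_add, map_add, D.diff_gtmul hF _ _ _ E,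
    DGMod.map_unit_smul, DGMod.map_unit_smul, D.diff_gtmul hF _ _ _ E, D.diff_tw hF,
    ← secMap_comp, D.dP_dP, secMap_zero, ← sMap_comp, HomologicalComplex.d_comp_d, sMap_zero,
    map_zero, LinearMap.zero_apply, map_zero, smul_zero, add_zero, zero_add, Int.negOnePow_succ]
  simp only [smul_add, smul_sub, smul_smul, Int.units_mul_self, one_smul, Units.neg_smul]
  abel

/-- The complexes of the dg-module `P ⊗ M`. -/
noncomputable def cx (M : DGMod 𝒜) (q : ℤ) : CochainComplex (Mod O) ℤ where
  X p := gtensor P M p q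
  d p p' := if h : p + 1 = p' then D.diff hF h q M else 0
  shape p p' h := dif_neg h
  d_comp_d' p p' p'' h h' := by
    exact (congrArg₂ (· ≫ ·) (dif_pos h) (dif_pos h')).trans (D.diff_diff hF h h' M)

lemma cx_d (M : DGMod 𝒜) (p q : ℤ) : (D.cx hF M q).d p (p + 1) = D.diff hF rfl q M := dif_pos rfl

section act
variable {c l q' : ℤ} {U : Opens X}

/-- Left multiplication by a local section of `ℬ` on elements of the form `s ⊗ m`. -/
noncomputable def actBil (h : a + b = p) (h' : i + j = q) (h₁ : c + p = p') (h₁' : l + q = q')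
    (M : DGMod 𝒜) (t : Sec (ℬ.obj c l) U) :
    LBil U (P a i) (toP.obj ((M.cx j).X b)) (toP.obj (gtensor P M p' q')) where
  app V hV := (gtmulL P M (a := c + a) (i := l + i) (by omega) (by omega) V).comp
    (D.lact rfl rfl V (res _ hV t))
  app_res {V W} hV hW s m := by
    rw [LinearMap.comp_apply, LinearMap.comp_apply, ← gtmulL_res, ← D.lact_res, res_res]

/-- Left multiplication by a local section of `ℬ` on `P ⊗ M`. -/
noncomputable def actHom (h₁ : c + p = p') (h₁' : l + q = q') (M : DGMod 𝒜) (t : Sec (ℬ.obj c l) U) :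
    LHom U (toP.obj (gtensor P M p q)) (toP.obj (gtensor P M p' q')) :=
  gtLift (P := P) (M := M) fun k => D.actBil k.hab k.hij h₁ h₁' M t

lemma actHom_gtmul (h : a + b = p) (h' : i + j = q) (h₁ : c + p = p') (h₁' : l + q = q')
    (t : Sec (ℬ.obj c l) U) (V : Opens X) (hV : V ≤ U) (s : Sec (P a i) V)
    (m : SSec ((M.cx j).X b) V) :
    (D.actHom h₁ h₁' M t).app V hV (gtmulL P M h h' V s m) =
      gtmulL P M (by omega) (by omega) V (D.lact rfl rfl V (res _ hV t) s) m :=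
  gtLift_gtmul (fun k => D.actBil k.hab k.hij h₁ h₁' M t) h h' V hV s m

lemma actHom_restr (h₁ : c + p = p') (h₁' : l + q = q') (M : DGMod 𝒜) (t : Sec (ℬ.obj c l) U)
    {V : Opens X} (hV : V ≤ U) :
    D.actHom h₁ h₁' M (res _ hV t) = (D.actHom h₁ h₁' M t).restr hV := by
  refine gt_ext fun h h' W hW s m => ?_
  rw [gtmul_eq, LHom.restr_app, actHom_gtmul, actHom_gtmul, res_res]

/-- The action of `ℬ` on `P ⊗ M`. -/
noncomputable def act (h₁ : c + p = p') (h₁' : l + q = q') (M : DGMod 𝒜) (U : Opens X) :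
    Sec (ℬ.obj c l) U →ₗ[Fn O U] SSec (gtensor P M p q) U →ₗ[Fn O U] SSec (gtensor P M p' q') U where
  toFun t := (D.actHom h₁ h₁' M t).app U le_rfl
  map_add' t t' := by
    have : D.actHom h₁ h₁' M (t + t') = D.actHom h₁ h₁' M t + D.actHom h₁ h₁' M t' := by
      refine gt_ext fun h h' W hW s m => ?_
      rw [gtmul_eq, LHom.add_app, actHom_gtmul, actHom_gtmul, actHom_gtmul]
      simp only [map_add, LinearMap.add_apply]
    rw [this]; rfl
  map_smul' r t := by
    have : D.actHom h₁ h₁' M (r • t) = r • D.actHom h₁ h₁' M t := by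
      refine gt_ext fun h h' W hW s m => ?_
      rw [gtmul_eq, LHom.fn_smul_app, actHom_gtmul, actHom_gtmul, LinearMap.map_smulₛₗ]
      simp only [map_smul, LinearMap.smul_apply]
    rw [this]
    ext x
    rw [LHom.fn_smul_app, resFn_refl]; rfl

lemma act_gtmul (h : a + b = p) (h' : i + j = q) (h₁ : c + p = p') (h₁' : l + q = q')
    (t : Sec (ℬ.obj c l) U) (s : Sec (P a i) U) (m : SSec ((M.cx j).X b) U) :
    D.act h₁ h₁' M U t (gtmulL P M h h' U s m) =
      gtmulL P M (by omega) (by omega) U (D.lact rfl rfl U t s) m := by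
  refine (D.actHom_gtmul h h' h₁ h₁' t U le_rfl s m).trans ?_
  rw [res_refl]

lemma lact_gtmul {a₁ i₁ : ℤ} (h₁ : c + a = a₁) (h₁' : l + i = i₁) (h : a₁ + b = p) (h' : i₁ + j = q)
    (t : Sec (ℬ.obj c l) U) (s : Sec (P a i) U) (m : SSec ((M.cx j).X b) U) :
    gtmulL P M h h' U (D.lact h₁ h₁' U t s) m =
      gtmulL P M (by omega) (by omega) U (D.lact rfl rfl U t s) m := by
  subst h₁ h₁'; rfl

lemma act_res (h₁ : c + p = p') (h₁' : l + q = q') {V : Opens X} (hV : V ≤ U)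
    (t : Sec (ℬ.obj c l) U) (z : SSec (gtensor P M p q) U) :
    D.act h₁ h₁' M V (res _ hV t) (res _ hV z) = res _ hV (D.act h₁ h₁' M U t z) := by
  change (D.actHom h₁ h₁' M (res _ hV t)).app V le_rfl _ = _
  rw [actHom_restr]
  exact (D.actHom h₁ h₁' M t).app_res le_rfl hV z
end act

/-- The dg-module `P ⊗ M` with the twisted differential. -/
noncomputable def obj (M : DGMod 𝒜) : DGMod ℬ where
  cx := D.cx hF M
  act h h' U := D.act h h' M U
  act_res h h' U V hV t z := D.act_res h h' hV t z
  one_act {b j} U z := by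
    have : D.actHom (zero_add b) (zero_add j) M (ℬ.one U) = LHom.ofHom U (𝟙 _) := by
      refine gt_ext fun h h' W hW s m => ?_
      rw [gtmul_eq, actHom_gtmul, ℬ.one_res, LHom.ofHom_app, secMap_id,
        ← D.lact_gtmul (zero_add _) (zero_add _) h h', D.one_lact]
    exact congrArg (fun φ => LHom.app φ U le_rfl z) this
  mul_act {a b c ab bc p i j k ij jk q} h₁ h₂ h₃ h₄ h₁' h₂' h₃' h₄' U x y z := by
    have : D.actHom h₂ h₂' M (ℬ.mul h₁ h₁' U x y) =
        (D.actHom h₄ h₄' M x).comp (D.actHom h₃ h₃' M y) := by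
      refine gt_ext fun {a' b' i' j'} h h' W hW s m => ?_
      rw [gtmul_eq, LHom.comp_app, actHom_gtmul, actHom_gtmul, actHom_gtmul, ← ℬ.mul_res,
        D.mul_lact h₁ rfl rfl (p := ab + a') (by omega) h₁' rfl rfl (by omega), lact_gtmul]
    exact congrArg (fun φ => LHom.app φ U le_rfl z) this
  leibniz {a b p a' b' p' i j q} h ha hb hp h₁ h₂ h' U x z := by
    subst ha hb hp
    rw [cx_d, cx_d]
    have : (LHom.ofHom U (toP.map (D.diff hF rfl q M))).comp (D.actHom h h' M x) =
        D.actHom h₁ h' M (secMap (ℬ.d rfl i) U x) + a.negOnePow •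
        (D.actHom h₂ h' M x).comp (LHom.ofHom U (toP.map (D.diff hF rfl j M))) := by
      refine gt_ext_frame hF fun {a₁ b₁ i₁ j₁} h₃ h₃' W hW E s m => ?_
      have key := fun e : Σ k, Fin (E.r k) => D.R_lact E e (c := a) (a := a₁) (l := i) (i := i₁)
        rfl rfl rfl (by omega) rfl rfl rfl (by omega) (res _ hW x) s
      rw [LHom.comp_app, LHom.add_app, LHom.smul_app, LHom.comp_app, LHom.ofHom_app, LHom.ofHom_app,
        actHom_gtmul, actHom_gtmul, D.diff_gtmul hF _ _ _ E, D.diff_gtmul hF _ _ _ E, map_add,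
        map_add, DGMod.map_unit_smul, DGMod.map_unit_smul, actHom_gtmul, actHom_gtmul, tw, tw, map_sum,
        Finset.sum_congr rfl fun e _ => (D.actHom_gtmul _ _ _ _ _ _ _ _ _),
        D.leibniz rfl rfl rfl rfl (by omega) (by omega) rfl, map_add, LinearMap.add_apply,
        lact_gtmul, ← secMap_res]
      have h6 : ∀ e ∈ E.idx n, gtmulL P M (p := p + 1) (q := q)
          (by have := D.hε e.1; omega) (by have := D.hw; omega) W
          (D.R E e rfl rfl (D.lact rfl rfl W (res _ hW x) s)) (M.act rfl rfl W (D.Z E e) m) =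
          gtmulL P M (by have := D.hε e.1; omega) (by have := D.hw; omega) W
          (D.lact rfl rfl W (res _ hW x) (D.R E e rfl rfl s)) (M.act rfl rfl W (D.Z E e) m) :=
        fun e _ => (congrArg (fun y => gtmulL P M _ _ W y _) (key e)).trans (D.lact_gtmul _ _ _ _ _ _ _)
      rw [Finset.sum_congr rfl h6, DGMod.map_unit_smul, LinearMap.smul_apply, lact_gtmul,
        Int.negOnePow_add]
      simp only [smul_add, smul_smul]
      simp only [add_assoc]
      congr 1
      congr 1
      congr 1
      exact D.lact_gtmul _ _ _ _ _ _ _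
    exact congrArg (fun φ => LHom.app φ U le_rfl z) this

section map
variable {N : DGMod 𝒜}

/-- The map `s ⊗ m ↦ s ⊗ f m` on elements. -/
noncomputable def mapBil (f : M ⟶ N) (h : a + b = p) (h' : i + j = q) :
    LBil ⊤ (P a i) (toP.obj ((M.cx j).X b)) (toP.obj (gtensor P N p q)) where
  app V _ := (gtmulL P N h h' V).compl₂ (sMap ((f.f j).f b) V)
  app_res h hW s m := by
    simp only [LinearMap.compl₂_apply, sMap_res, gtmulL_res]

variable (P) in
/-- The map `s ⊗ m ↦ s ⊗ f m`. -/
noncomputable def gmap (f : M ⟶ N) (p q : ℤ) : gtensor P M p q ⟶ gtensor P N p q :=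
  (gtLift (P := P) (M := M) fun k => mapBil (P := P) f k.hab k.hij).toHom

lemma gmap_gtmul (f : M ⟶ N) (h : a + b = p) (h' : i + j = q) (U : Opens X)
    (s : Sec (P a i) U) (m : SSec ((M.cx j).X b) U) :
    sMap (gmap P f p q) U (gtmulL P M h h' U s m) = gtmulL P N h h' U s (sMap ((f.f j).f b) U m) :=
  gtLift_gtmul (fun k => mapBil (P := P) f k.hab k.hij) h h' U le_top s m

lemma gmap_tw (f : M ⟶ N) {U : Opens X} (E : LocalFrame 𝒳 U) (h : a + b + 1 = p) (h' : i + j = q)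
    (s : Sec (P a i) U) (m : SSec ((M.cx j).X b) U) :
    sMap (gmap P f p q) U (D.tw E h h' s m) = D.tw E h h' s (sMap ((f.f j).f b) U m) := by
  rw [tw, tw, map_sum]
  refine Finset.sum_congr rfl fun e _ => ?_
  rw [gmap_gtmul, f.map_act]

lemma gmap_diff (f : M ⟶ N) (h : p + 1 = p') (q : ℤ) :
    gmap P f p q ≫ D.diff hF h q N = D.diff hF h q M ≫ gmap P f p' q := by
  refine hom_ext_frame hF fun {a b i j} h₁ h₂ V E s m => ?_
  rw [sMap_comp, sMap_comp, gmap_gtmul, D.diff_gtmul hF _ _ _ E, D.diff_gtmul hF _ _ _ E, map_add,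
    map_add, DGMod.map_unit_smul, DGMod.map_unit_smul, gmap_gtmul, gmap_gtmul, gmap_tw, ← sMap_comp,
    ← sMap_comp, (f.f j).comm]

/-- The functor `M ↦ P ⊗ M` with the twisted differential. -/
noncomputable def functor : DGMod 𝒜 ⥤ DGMod ℬ where
  obj M := D.obj hF M
  map {M N} f :=
    { f := fun q =>
        { f := fun p => gmap P f p q
          comm' := fun p p' h => by
            obtain rfl : p + 1 = p' := h
            change _ ≫ (D.cx hF N q).d _ _ = (D.cx hF M q).d _ _ ≫ _
            rw [cx_d, cx_d]
            exact D.gmap_diff hF f rfl q }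
      map_act := fun {c b p l j q} h h' U x z => by
        have : (LHom.ofHom U (toP.map (gmap P f p q))).comp (D.actHom h h' M x) =
            (D.actHom h h' N x).comp (LHom.ofHom U (toP.map (gmap P f b j))) := by
          refine gt_ext fun h₁ h₁' V hV s m => ?_
          rw [gtmul_eq, LHom.comp_app, LHom.comp_app, actHom_gtmul, LHom.ofHom_app, LHom.ofHom_app,
            gmap_gtmul, gmap_gtmul, actHom_gtmul]
        exact congrArg (fun φ => LHom.app φ U le_rfl z) this }
  map_id M := by
    refine DGMod.hom_ext fun q => HomologicalComplex.hom_ext _ _ fun p => ?_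
    refine gtensor_hom_ext fun h₁ h₁' V s m => ?_
    exact gmap_gtmul (𝟙 M) h₁ h₁' V s m
  map_comp {M N N'} f g := by
    refine DGMod.hom_ext fun q => HomologicalComplex.hom_ext _ _ fun p => ?_
    refine gtensor_hom_ext fun h₁ h₁' V s m => ?_
    refine (gmap_gtmul (f ≫ g) h₁ h₁' V s m).trans ?_
    change _ = sMap (gmap P g p q) V (sMap (gmap P f p q) V (gtmulL P M h₁ h₁' V s m))
    rw [gmap_gtmul, gmap_gtmul]
    rfl
end map

/-- A functor of the form `M ↦ P ⊗ M` whose action and differential are given by the twisting data. -/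
structure IsTwisted (Φ : TensorFunctor P 𝒜 ℬ) : Prop where
  act_tm (M : DGMod 𝒜) {c a b ca p p' l i j li q q' : ℤ} (h : a + b = p) (h' : i + j = q)
    (h₁ : c + p = p') (h₁' : l + q = q') (h₂ : c + a = ca) (h₂' : l + i = li) (h₃ : ca + b = p')
    (h₃' : li + j = q') (U : Opens X) (t : Sec (ℬ.obj c l) U)
    (s : Sec (P a i) U) (m : SSec ((M.cx j).X b) U) :
    (Φ.F.obj M).act h₁ h₁' U t (Φ.tm M h h' U s m) = Φ.tm M h₃ h₃' U (D.lact h₂ h₂' U t s) m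
  d_tm (M : DGMod 𝒜) {a b p i j q : ℤ} (h : a + b = p) (h' : i + j = q)
    (U : Opens X) (E : LocalFrame 𝒳 U) (s : Sec (P a i) U) (m : SSec ((M.cx j).X b) U) :
    sMap (((Φ.F.obj M).cx q).d p (p + 1)) U (Φ.tm M h h' U s m) =
      Φ.tm M (a := a + 1) (by omega) h' U (secMap (D.dP rfl i) U s) m +
      a.negOnePow • Φ.tm M (b := b + 1) (by omega) h' U s (sMap ((M.cx j).d b (b + 1)) U m) +
      a.negOnePow • ∑ e ∈ E.idx n,
        Φ.tm M (by have := D.hε e.1; omega) (by have := D.hw; omega) U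
          (D.R E e rfl rfl s) (M.act rfl rfl U (D.Z E e) m)

/-- The functor defined by twisting data. -/
noncomputable def tensorFunctor : TensorFunctor P 𝒜 ℬ where
  F := D.functor hF
  iso M p q := Iso.refl _
  map_iso := by
    intro M N f a b p i j q h h' U s m
    exact gmap_gtmul f h h' U s m

lemma isTwisted : D.IsTwisted (D.tensorFunctor hF) where
  act_tm M {c a b ca p p' l i j li q q'} h h' h₁ h₁' h₂ h₂' h₃ h₃' U t s m :=
    (D.act_gtmul h h' h₁ h₁' t s m).trans (D.lact_gtmul h₂ h₂' h₃ h₃' t s m).symm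
  d_tm M {a b p i j q} h h' U E s m := by
    refine Eq.trans ?_ (D.diff_gtmul hF h rfl h' E s m)
    change sMap ((D.cx hF M q).d p (p + 1)) U _ = _
    rw [cx_d]
    rfl

end Twist
end Twist

/-! ### The canonical element of a frame; graded commutativity -/

section Casimir
variable {X : TopCat.{u}} {O : Sheaf (Opens.grothendieckTopology X) CommRingCat.{u}}
  {𝒳 : CochainComplex (Mod O) ℤ} {U : Opens X}

lemma ev_ext {F : PMod O} {φ ψ : Sec (dual F) U}
    (h : ∀ (W : Opens X) (hW : W ≤ U) (t : Sec F W), ev φ hW t = ev ψ hW t) : φ = ψ :=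
  DualSec.ext (funext fun W => funext fun hW => LinearMap.ext (h W hW))

lemma ev_smul {F : PMod O} (r : Fn O U) (φ : Sec (dual F) U) {W : Opens X} (hW : W ≤ U) (t : Sec F W) :
    ev (r • φ) hW t = resFn O hW r * ev φ hW t := rfl

/-- Evaluation on a section as an additive map. -/
def evHom (F : PMod O) {W : Opens X} (hW : W ≤ U) (t : Sec F W) : Sec (dual F) U →+ Fn O W where
  toFun φ := ev φ hW t
  map_zero' := rfl
  map_add' _ _ := rfl

lemma ev_sum {F : PMod O} {ι : Type*} (s : Finset ι) (φ : ι → Sec (dual F) U) {W : Opens X}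
    (hW : W ≤ U) (t : Sec F W) : ev (∑ i ∈ s, φ i) hW t = ∑ i ∈ s, ev (φ i) hW t :=
  map_sum (evHom F hW t) _ _

lemma ev_unit_smul {F : PMod O} (k : ℤˣ) (φ : Sec (dual F) U) {W : Opens X} (hW : W ≤ U)
    (t : Sec F W) : ev (k • φ) hW t = k • ev φ hW t := by
  rw [Units.smul_def, Units.smul_def]
  exact map_zsmul (evHom F hW t) _ _

lemma ev_res {F : PMod O} (φ : Sec (dual F) U) {W W' : Opens X} (h : W ≤ U) (h' : W' ≤ W)
    (t : Sec F W) : ev φ (h'.trans h) (res F h' t) = resFn O h' (ev φ h t) :=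
  DualSec.app_res φ W W' h h' t

namespace LocalFrame
variable (E E' : LocalFrame 𝒳 U)

lemma sum_x (k : ℤ) (v : SSec (𝒳.X (1 - k)) U) :
    ∑ α, ev (F := toP.obj (𝒳.X (1 - k))) (E.y k α) le_rfl v • E.x k α = v := by
  refine Eq.trans ?_ (E.expand k U le_rfl v)
  refine Finset.sum_congr rfl fun α _ => ?_
  rw [res_refl]

lemma sum_y (k : ℤ) (φ : Sec ((dualComplex 𝒳).X k) U) :
    ∑ α, ev (F := toP.obj (𝒳.X (1 - k))) φ le_rfl (E.x k α) • E.y k α = φ := by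
  refine ev_ext (F := toP.obj (𝒳.X (1 - k))) fun W hW v => ?_
  refine (ev_sum (F := toP.obj (𝒳.X (1 - k))) _ _ hW v).trans ?_
  conv_rhs => rw [← E.expand k W hW v, map_sum]
  refine Finset.sum_congr rfl fun α _ => ?_
  rw [map_smul, smul_eq_mul]
  refine (mul_comm _ _).trans (congrArg _ ?_)
  exact (ev_res (F := toP.obj (𝒳.X (1 - k))) φ le_rfl hW (E.x k α)).symm

variable {G : Type u} [AddCommGroup G] [Module (Fn O U) G]

/-- The canonical element `∑ y_α ⊗ x_α` of a frame does not depend on the frame. -/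
lemma casimir_indep (k : ℤ)
    (β : Sec ((dualComplex 𝒳).X k) U →ₗ[Fn O U] SSec (𝒳.X (1 - k)) U →ₗ[Fn O U] G) :
    ∑ α, β (E.y k α) (E.x k α) = ∑ α, β (E'.y k α) (E'.x k α) := by
  have h1 : ∀ α, β (E.y k α) (E.x k α) = ∑ γ, β (E'.y k γ)
      (ev (F := toP.obj (𝒳.X (1 - k))) (E.y k α) le_rfl (E'.x k γ) • E.x k α) := by
    intro α
    conv_lhs => rw [← E'.sum_y k (E.y k α)]
    rw [map_sum, LinearMap.sum_apply]
    refine Finset.sum_congr rfl fun γ _ => ?_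
    rw [map_smul, map_smul]; rfl
  rw [Finset.sum_congr rfl fun α _ => h1 α, Finset.sum_comm]
  refine Finset.sum_congr rfl fun γ _ => ?_
  rw [← map_sum, E.sum_x]

/-- The image of the canonical element in degree `k` under the differential of the dual complex is, up to
sign, the image of the one in degree `k + 1` under the differential of the complex. The maps `β` and
`β'` are the same bilinear map, in degrees that are only propositionally equal. -/
lemma casimir_d (k i i' : ℤ) (hi : i = 1 - k) (hi' : i' = 1 - (k + 1))
    (β : Sec ((dualComplex 𝒳).X (k + 1)) U →ₗ[Fn O U] SSec (𝒳.X i) U →ₗ[Fn O U] G)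
    (β' : Sec ((dualComplex 𝒳).X (k + 1)) U →ₗ[Fn O U] SSec (𝒳.X (i' + 1)) U →ₗ[Fn O U] G)
    (hβ : ∀ (h : i = i' + 1) y x, β' y (h ▸ x) = β y x)
    (x : Fin (E.r k) → SSec (𝒳.X i) U) (x' : Fin (E.r (k + 1)) → SSec (𝒳.X i') U)
    (hx : ∀ α, hi ▸ x α = E.x k α) (hx' : ∀ α, hi' ▸ x' α = E.x (k + 1) α) :
    ∑ α, β (secMap ((dualComplex 𝒳).d k (k + 1)) U (E.y k α)) (x α) =
      k.negOnePow • ∑ α, β' (E.y (k + 1) α) (sMap (𝒳.d i' (i' + 1)) U (x' α)) := by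
  subst hi hi'
  obtain rfl : x = E.x k := funext hx
  obtain rfl : x' = E.x (k + 1) := funext hx'
  have h0 : 1 - (k + 1) + 1 = 1 - k := by ring
  have h3 : ∀ (y : Sec ((dualComplex 𝒳).X (k + 1)) U) (z : SSec (𝒳.X (1 - (k + 1))) U),
      β' y (sMap (𝒳.d (1 - (k + 1)) (1 - (k + 1) + 1)) U z) =
      β y (sMap (𝒳.d (1 - (k + 1)) (1 - k)) U z) := by
    intro y z
    rw [← hβ h0.symm]
    have : ∀ (i : ℤ) (h : i = 1 - (k + 1) + 1), (h ▸ sMap (𝒳.d (1 - (k + 1)) i) U z :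
      SSec (𝒳.X (1 - (k + 1) + 1)) U) = sMap (𝒳.d (1 - (k + 1)) (1 - (k + 1) + 1)) U z := by
      rintro i rfl; rfl
    rw [this]
  have h1 : ∀ α, β (secMap ((dualComplex 𝒳).d k (k + 1)) U (E.y k α)) (E.x k α) =
      ∑ γ, k.negOnePow • β (E.y (k + 1) γ) (ev (F := toP.obj (𝒳.X (1 - k))) (E.y k α) le_rfl
        (sMap (𝒳.d (1 - (k + 1)) (1 - k)) U (E.x (k + 1) γ)) • E.x k α) := by
    intro α
    conv_lhs => rw [← E.sum_y (k + 1) (secMap ((dualComplex 𝒳).d k (k + 1)) U (E.y k α))]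
    rw [map_sum, LinearMap.sum_apply]
    refine Finset.sum_congr rfl fun γ _ => ?_
    have h2 : ev (F := toP.obj (𝒳.X (1 - (k + 1)))) (secMap ((dualComplex 𝒳).d k (k + 1)) U (E.y k α))
        le_rfl (E.x (k + 1) γ) = k.negOnePow • ev (F := toP.obj (𝒳.X (1 - k))) (E.y k α) le_rfl
          (sMap (𝒳.d (1 - (k + 1)) (1 - k)) U (E.x (k + 1) γ)) := by
      exact (congrArg (fun ψ : Sec (LinearKoszul.dual (toP.obj (𝒳.X (1 - (k + 1))))) U =>
        ev ψ le_rfl (E.x (k + 1) γ)) (secMap_smul k.negOnePow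
          (dualMap (toP.map (𝒳.d (1 - (k + 1)) (1 - k)))) U
          (E.y k α : Sec (LinearKoszul.dual (toP.obj (𝒳.X (1 - k)))) U))).trans
        (ev_unit_smul (F := toP.obj (𝒳.X (1 - (k + 1)))) _ _ _ _)
    rw [h2, map_smul, map_smul, Units.smul_def, Units.smul_def, smul_assoc, LinearMap.smul_apply]; rfl
  rw [Finset.sum_congr rfl fun α _ => h1 α, Finset.sum_comm, Finset.smul_sum]
  refine Finset.sum_congr rfl fun γ _ => ?_
  rw [← Finset.smul_sum, ← map_sum, E.sum_x, h3]

lemma sum_telescope (f : ℤ → G) (n : ℕ) :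
    ∑ k ∈ Finset.Icc (1 : ℤ) (n + 1), (f k - f (k + 1)) = f 1 - f (n + 2) := by
  induction n with
  | zero => simp
  | succ n ih =>
    have : Finset.Icc (1 : ℤ) ((n + 1 : ℕ) + 1) = insert ((n : ℤ) + 2) (Finset.Icc (1 : ℤ) (n + 1)) := by
      ext k; simp; omega
    rw [this, Finset.sum_insert (by simp), ih]
    push_cast
    rw [show (n : ℤ) + 2 + 1 = n + 1 + 2 by ring]
    abel

variable {n : ℕ} (h𝒳 : IsFiniteLocallyFree n 𝒳)

include h𝒳 in
/-- The canonical element is closed. -/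
lemma casimir_closed
    (γ : ∀ {k i : ℤ} (_ : k + i = 2),
      Sec ((dualComplex 𝒳).X k) U →ₗ[Fn O U] SSec (𝒳.X i) U →ₗ[Fn O U] G) :
    ∑ k ∈ Finset.Icc (1 : ℤ) (n + 1), ∑ α,
      (γ (by omega) (secMap ((dualComplex 𝒳).d k (k + 1)) U (E.y k α)) (E.x k α) +
      k.negOnePow • γ (by omega) (E.y k α) (sMap (𝒳.d (1 - k) (1 - k + 1)) U (E.x k α))) = 0 := by
  -- by `casimir_d` the sum telescopes, and the boundary terms vanish as `𝒳` is concentrated in `[-n, 0]`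
  let B : ℤ → G := fun k => k.negOnePow •
    ∑ α, γ (by omega) (E.y k α) (sMap (𝒳.d (1 - k) (1 - k + 1)) U (E.x k α))
  have hA : ∀ k, ∑ α, γ (by omega) (secMap ((dualComplex 𝒳).d k (k + 1)) U (E.y k α)) (E.x k α) =
      - B (k + 1) := by
    intro k
    rw [E.casimir_d k (1 - k) (1 - (k + 1)) rfl rfl (γ (by omega)) (γ (by omega)) (by
      have : ∀ (i j : ℤ) (h : i = j) (hi hj) (y : Sec ((dualComplex 𝒳).X (k + 1)) U)
        (x : SSec (𝒳.X i) U), γ (i := j) hj y (h ▸ x) = γ (i := i) hi y x := by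
        rintro i _ rfl _ _ y x; rfl
      exact fun h y x => this _ _ h _ _ y x) (E.x k) (E.x (k + 1)) (fun _ => rfl) (fun _ => rfl)]
    simp only [B, Int.negOnePow_succ, Units.neg_smul, neg_neg]
  have h0 : ∀ k, 1 - k ∉ Set.Icc (-n : ℤ) 0 → B k = 0 := by
    intro k hk
    simp only [B]
    rw [Finset.sum_eq_zero, smul_zero]
    intro α _
    rw [subsingleton_of_isZero (h𝒳.isZero _ hk) U (E.x k α), map_zero, map_zero]
  have h1 : B 1 = 0 := by
    have := hA 0
    rw [Finset.sum_eq_zero] at this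
    · simpa using this.symm
    · intro α _
      rw [subsingleton_of_isZero (h𝒳.isZero _ (by simp)) U (E.x 0 α), map_zero]
  rw [Finset.sum_congr rfl fun k _ => (Finset.sum_add_distrib.trans
    (congrArg₂ (· + ·) (hA k) (Finset.smul_sum (r := k.negOnePow)).symm))]
  have h2 := sum_telescope B n
  rw [h1, h0 (n + 2) (by simp; omega), sub_zero] at h2
  rw [← h2]
  refine Finset.sum_congr rfl fun k _ => ?_
  exact (add_comm _ _).trans (sub_eq_add_neg _ _).symm
end LocalFrame
end Casimir

section SymAlg
variable {X : TopCat.{u}} {O : Sheaf (Opens.grothendieckTopology X) CommRingCat.{u}}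

namespace GSym
variable {R : Type u} [CommRing R] {V : ℤ → Type u} [∀ i, AddCommGroup (V i)] [∀ i, Module R (V i)]

/-- The graded-symmetric algebra is graded-commutative. -/
lemma mul_comm_of_mem {w a b i j : ℤ} {x y : GSym R V} (hx : x ∈ piece R V w a i)
    (hy : y ∈ piece R V w b j) : x * y = (a * b).negOnePow • (y * x) := by
  have h1 : ∀ (k : ℤ) (v : V k) (l : List (Σ i, V i)), gen R V k v * mon l =
      (k * (l.map Sigma.fst).sum).negOnePow • (mon l * gen R V k v) := by
    intro k v l
    induction l with
    | nil => simp [mon]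
    | cons v' l ih =>
      rw [mon_cons, ← mul_assoc, gen_mul_gen, smul_mul_assoc, mul_assoc, ih, mul_smul_comm,
        smul_smul, ← mul_assoc, List.map_cons, List.sum_cons, mul_add, Int.negOnePow_add]
  have h2 : ∀ (l l' : List (Σ i, V i)), (mon l * mon l' : GSym R V) =
      ((l.map Sigma.fst).sum * (l'.map Sigma.fst).sum).negOnePow • (mon l' * mon l) := by
    intro l l'
    induction l with
    | nil => simp [mon]
    | cons v l ih =>
      rw [mon_cons, mul_assoc, ih, mul_smul_comm, ← mul_assoc, h1, smul_mul_assoc, smul_smul,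
        mul_assoc, List.map_cons, List.sum_cons, add_mul, Int.negOnePow_add, mul_comm (Int.negOnePow _)]
  induction hx using Submodule.span_induction with
  | mem x hx =>
    obtain ⟨l, rfl, -, rfl⟩ := hx
    induction hy using Submodule.span_induction with
    | mem y hy => obtain ⟨l', rfl, -, rfl⟩ := hy; exact h2 l l'
    | zero => simp
    | add y z _ _ hy hz => rw [mul_add, hy, hz, add_mul, smul_add]
    | smul r y _ hy =>
      rw [mul_smul_comm, hy, smul_mul_assoc, Units.smul_def, Units.smul_def, smul_comm]
  | zero => simp
  | add x₁ x₂ _ _ h₁ h₂ => rw [add_mul, h₁, h₂, mul_add, smul_add]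
  | smul r x _ hx =>
    rw [mul_smul_comm, smul_mul_assoc, hx, Units.smul_def, Units.smul_def, smul_comm]
end GSym

variable (w : ℤ) (V : CochainComplex (PMod O) ℤ)

lemma symAlg_comm {a b p i j q : ℤ} (h : a + b = p) (h₁ : b + a = p) (h' : i + j = q) (h₁' : j + i = q)
    (U : Opens X) (x : Sec ((symAlg w V).obj a i) U) (y : Sec ((symAlg w V).obj b j) U) :
    (symAlg w V).mul h h' U x y = (a * b).negOnePow • (symAlg w V).mul h₁ h₁' U y x := by
  have h2 := GSym.mul_comm_of_mem (x := x.1) (y := y.1) x.2 y.2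
  rw [Units.smul_def] at h2 ⊢
  refine Subtype.ext (h2.trans ?_)
  exact (map_zsmul (SymPiece w V p q U).subtype _
    (show SymPiece w V p q U from (symAlg w V).mul h₁ h₁' U y x)).symm

lemma symGen_mul_self {i p q : ℤ} (hi : Odd i) (h : i + i = p) (h' : w + w = q) (U : Opens X)
    (x : Sec (V.X i) U) : (symAlg w V).mul h h' U (symGen w V i U x) (symGen w V i U x) = 0 :=
  Subtype.ext (GSym.gen_mul_self (R := Fn O U) (V := fun i => Sec (V.X i) U) i hi x)

lemma symGen_res {i : ℤ} {U W : Opens X} (hW : W ≤ U) (x : Sec (V.X i) U) :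
    symGen w V i W (res _ hW x) = res _ hW (symGen w V i U x) :=
  Subtype.ext (GSym.map_gen (R := Fn O U) (V := fun i => Sec (V.X i) U) (R' := Fn O W)
    (V' := fun i => Sec (V.X i) W) (resFn O hW) (fun i => res (V.X i) hW) i x).symm

lemma symGen_d {i : ℤ} (U : Opens X) (x : Sec (V.X i) U) :
    secMap ((symAlg w V).d rfl w) U (symGen w V i U x) =
      symGen w V (i + 1) U (secMap (V.d i (i + 1)) U x) :=
  Subtype.ext (GSym.d_gen (R := Fn O U) (V := fun i => Sec (V.X i) U) _ i x)

/-- The inclusion of the generators as a linear map. -/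
noncomputable def symGenL (i : ℤ) (U : Opens X) :
    Sec (V.X i) U →ₗ[Fn O U] Sec ((symAlg w V).obj i w) U where
  toFun := symGen w V i U
  map_add' x y := Subtype.ext (map_add (GSym.gen (Fn O U) (fun i => Sec (V.X i) U) i) x y)
  map_smul' r x := Subtype.ext (_root_.map_smul (GSym.gen (Fn O U) (fun i => Sec (V.X i) U) i) r x)

end SymAlg

/-! ### The twisting data of the two functors -/

section Instances
variable {X : TopCat.{u}} {O : Sheaf (Opens.grothendieckTopology X) CommRingCat.{u}}

lemma DGAlg.mul_eq {𝒜 : DGAlg O} {a b p i j q : ℤ} (h : a + b = p) (h' : i + j = q) (U : Opens X)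
    (x : Sec (𝒜.obj a i) U) (k : ℤˣ) (y : Sec (𝒜.obj b j) U) :
    𝒜.mul h h' U (k • x) y = k • 𝒜.mul h h' U x y := by
  rw [DGMod.map_unit_smul]; rfl

section
variable {n : ℕ} {𝒳 : CochainComplex (Mod O) ℤ}

/-- The complex `𝒳` as a complex of presheaves. -/
noncomputable abbrev xP (𝒳 : CochainComplex (Mod O) ℤ) : CochainComplex (PMod O) ℤ :=
  (toP.mapHomologicalComplex (ComplexShape.up ℤ)).obj 𝒳

lemma sum_idx {U : Opens X} (E : LocalFrame 𝒳 U) {G : Type*} [AddCommMonoid G] (n : ℕ)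
    (f : (Σ k, Fin (E.r k)) → G) :
    ∑ e ∈ E.idx n, f e = ∑ k ∈ Finset.Icc (1 : ℤ) (n + 1), ∑ α, f ⟨k, α⟩ := by
  rw [LocalFrame.idx, Finset.sum_sigma]

/-- The twisting data of the functor `M ↦ 𝒮 ⊗ M`: the operator `R e` is right multiplication by the
generator dual to `e`. -/
noncomputable def twA (h𝒳 : IsFiniteLocallyFree n 𝒳) :
    Twist n 𝒳 (algS 𝒳).obj (algT 𝒳) (algS 𝒳) where
  dP h i := (algS 𝒳).d h i
  dP_dP h h' i := (algS 𝒳).d_d h h' i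
  lact h h' U := (algS 𝒳).mul h h' U
  lact_res h h' U V hV x s := (algS 𝒳).mul_res h h' hV x s
  one_lact U s := (algS 𝒳).one_mul U s
  mul_lact h₁ h₂ h₃ h₄ h₁' h₂' h₃' h₄' U x y s :=
    (algS 𝒳).mul_assoc h₁ h₂ h₃ h₄ h₁' h₂' h₃' h₄' U x y s
  leibniz h ha hb hp h₁ h₂ h' U x s := (algS 𝒳).leibniz h ha hb hp h₁ h₂ h' U x s
  ε k := k
  ε' k := 1 - k
  hε k := by ring
  w := -2
  w' := 2
  hw := by norm_num
  Z E e := E.xT e.1 e.2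
  Z_res E hV e := symGen_res 2 (xP 𝒳) hV (E.x e.1 e.2)
  Z_comm E e f c l h h₁ h' := symAlg_comm _ _ h h₁ h' h' _ _ _
  Z_sq E e c l he h h' := symGen_mul_self _ _ he h h' _ _
  R E e a p i q h h' := ((algS 𝒳).mul h h' _).flip (E.yS e.1 e.2)
  dR E e a p i q h h' := ((algS 𝒳).mul (b := e.1 + 1) (by omega) h' _).flip
    (secMap ((algS 𝒳).d rfl (-2)) _ (E.yS e.1 e.2))
  R_res E hV e a p i q h h' s := by
    rw [LinearMap.flip_apply, LinearMap.flip_apply, ← (algS 𝒳).mul_res]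
    exact congrArg _ (symGen_res (-2) (dualComplex 𝒳) hV (E.y e.1 e.2))
  R_comm {U} E e f a p p₁ p₂ i q q₁ h₁ h₂ h₃ h₄ h₁' h₂' s := by
    simp only [LinearMap.flip_apply]
    have h := symAlg_comm (-2) (dualComplex 𝒳) (a := e.1) (b := f.1) rfl (add_comm _ _) rfl rfl U
      (E.yS e.1 e.2) (E.yS f.1 f.2)
    rw [(algS 𝒳).mul_assoc h₁ h₃ rfl (by omega) h₁' h₂' rfl (by omega),
      (algS 𝒳).mul_assoc h₂ h₄ (bc := e.1 + f.1) (add_comm _ _) (by omega) h₁' h₂' rfl (by omega)]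
    exact (congrArg _ h).trans (DGMod.map_unit_smul _ _ _)
  R_sq {U} E e he a p p₁ i q q₁ h₁ h₃ h₁' h₂' s := by
    simp only [LinearMap.flip_apply]
    rw [(algS 𝒳).mul_assoc h₁ h₃ rfl (by omega) h₁' h₂' rfl (by omega)]
    exact (congrArg _ (symGen_mul_self (-2) (dualComplex 𝒳) he rfl rfl U (E.y e.1 e.2))).trans (map_zero _)
  d_R {U} E e a a' p p' i q ha hp h h₁ h₂ h' s := by
    simp only [LinearMap.flip_apply]
    exact (algS 𝒳).leibniz h ha rfl hp h₁ (by omega) h' U s (E.yS e.1 e.2)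
  R_lact E e c a p p₁ p₂ l i q q₁ q₂ h₁ h₂ h₃ h₄ h₁' h₂' h₃' h₄' x s :=
    (algS 𝒳).mul_assoc h₁ h₂ h₃ h₄ h₁' h₂' h₃' h₄' _ x s _
  indep {U} E E' a i s G _ _ β := by
    rw [sum_idx, sum_idx]
    refine Finset.sum_congr rfl fun k _ => ?_
    exact E.casimir_indep E' k (((β (p := a + k) (c := 1 - k) (by omega)).comp
      (((algS 𝒳).mul rfl rfl U s).comp (symGenL (-2) (dualComplex 𝒳) k U))).compl₂
        (symGenL 2 (xP 𝒳) (1 - k) U))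
  closed {U} E a i s G _ _ β := by
    rw [sum_idx]
    have := E.casimir_closed h𝒳 (G := G) (fun {k i} h => ((β (p := a + k) (c := i) (by omega)).comp
      (((algS 𝒳).mul rfl rfl U s).comp (symGenL (-2) (dualComplex 𝒳) k U))).compl₂
        (symGenL 2 (xP 𝒳) i U))
    refine Eq.trans ?_ this
    refine Finset.sum_congr rfl fun k _ => Finset.sum_congr rfl fun α _ => ?_
    have h1 : ∀ (p : ℤ) (h : a + (k + 1) = p) (h' : p + (1 - k) = a + 2)
      (y : Sec ((algS 𝒳).obj (k + 1) (-2)) U) z,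
      β h' ((algS 𝒳).mul h rfl U s y) z = β (by omega) ((algS 𝒳).mul rfl rfl U s y) z := by
      rintro p rfl h' y z; rfl
    refine congrArg₂ (· + ·) ((h1 _ (by dsimp only; omega) _ _ _).trans ?_) ?_
    · exact congrArg (fun y => β (p := a + (k + 1)) (c := 1 - k) (by omega)
        ((algS 𝒳).mul rfl rfl U s y) (E.xT k α)) (symGen_d (-2) (dualComplex 𝒳) U (E.y k α))
    · exact congrArg (fun z => k.negOnePow • β (p := a + k) (c := 1 - k + 1) (by omega)
        ((algS 𝒳).mul rfl rfl U s (E.yS k α)) z) (symGen_d 2 (xP 𝒳) U (E.x k α))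

end

section dgDual
variable {𝒜 : DGAlg O}

/-- The evaluation of a section of `𝒜^∨` on sections of `𝒜`. -/
noncomputable def dev {a i : ℤ} {U : Opens X} (φ : Sec (dgDual 𝒜 a i) U) {W : Opens X} (hW : W ≤ U) :
    Sec (𝒜.obj (-a) (-i)) W →ₗ[Fn O W] Fn O W :=
  ev (F := 𝒜.obj (-a) (-i)) φ hW

lemma dev_ext {a i : ℤ} {U : Opens X} {φ ψ : Sec (dgDual 𝒜 a i) U}
    (h : ∀ (W : Opens X) (hW : W ≤ U) (t : Sec (𝒜.obj (-a) (-i)) W), dev φ hW t = dev ψ hW t) :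
    φ = ψ := ev_ext (F := 𝒜.obj (-a) (-i)) h

section
variable {a i : ℤ} {U : Opens X} (φ ψ : Sec (dgDual 𝒜 a i) U) {W : Opens X} (hW : W ≤ U)
  (t : Sec (𝒜.obj (-a) (-i)) W)
lemma dev_add : dev (φ + ψ) hW t = dev φ hW t + dev ψ hW t := rfl
lemma dev_zero : dev (0 : Sec (dgDual 𝒜 a i) U) hW t = 0 := rfl
lemma dev_smul (r : Fn O U) : dev (r • φ) hW t = resFn O hW r * dev φ hW t := rfl
lemma dev_unit_smul (k : ℤˣ) : dev (k • φ) hW t = k • dev φ hW t :=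
  ev_unit_smul (F := 𝒜.obj (-a) (-i)) k φ hW t
lemma dev_res {V : Opens X} (h : W ≤ V) (h' : V ≤ U) :
    dev (res _ h' φ) h t = dev φ (h.trans h') t := rfl
end

lemma dev_precomp {a c p i l q : ℤ} (h : a + c = p) (h' : i + l = q) {U : Opens X}
    (x : Sec (𝒜.obj c l) U) (φ : Sec (dgDual 𝒜 a i) U) {W : Opens X} (hW : W ≤ U)
    (t : Sec (𝒜.obj (-p) (-q)) W) :
    dev (precomp 𝒜 h h' U x φ) hW t =
      dev φ hW (𝒜.mul (by omega) (by omega) W (res _ hW x) t) := rfl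

lemma dev_dgDualD {a a' : ℤ} (h : a + 1 = a') {i : ℤ} {U : Opens X} (φ : Sec (dgDual 𝒜 a i) U)
    {W : Opens X} (hW : W ≤ U) (t : Sec (𝒜.obj (-a') (-i)) W) :
    dev (secMap (dgDualD 𝒜 h i) U φ) hW t = (a + 1).negOnePow •
      dev φ hW (secMap (𝒜.d (by omega) (-i)) W t) :=
  (congrArg (fun ψ : Sec (dual (𝒜.obj (-a') (-i))) U => ev ψ hW t)
    (secMap_smul _ (dualMap (𝒜.d (a := -a') (a' := -a) (by omega) (-i))) U
      (φ : Sec (dual (𝒜.obj (-a) (-i))) U))).trans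
    (ev_unit_smul (F := 𝒜.obj (-a') (-i)) _ _ _ _)

lemma dev_dualAct {a c p i l q : ℤ} (h : c + a = p) (h' : l + i = q) {U : Opens X}
    (x : Sec (𝒜.obj c l) U) (φ : Sec (dgDual 𝒜 a i) U) {W : Opens X} (hW : W ≤ U)
    (t : Sec (𝒜.obj (-p) (-q)) W) :
    dev (dualAct 𝒜 h h' U x φ) hW t = (c * a).negOnePow •
      dev φ hW (𝒜.mul (by omega) (by omega) W (res _ hW x) t) :=
  ev_unit_smul (F := 𝒜.obj (-p) (-q)) _ _ _ _

variable (𝒜) in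
/-- The section `φ(x · -)`, as a bilinear map. -/
noncomputable def precompL {a c p i l q : ℤ} (h : a + c = p) (h' : i + l = q) (U : Opens X) :
    Sec (𝒜.obj c l) U →ₗ[Fn O U] Sec (dgDual 𝒜 a i) U →ₗ[Fn O U] Sec (dgDual 𝒜 p q) U :=
  LinearMap.mk₂ (Fn O U) (precomp 𝒜 h h' U)
    (fun x x' φ => dev_ext fun W hW t => by
      rw [dev_add, dev_precomp, dev_precomp, dev_precomp, map_add, map_add, LinearMap.add_apply,
        map_add])
    (fun r x φ => dev_ext fun W hW t => by
      rw [dev_smul, dev_precomp, dev_precomp, LinearMap.map_smulₛₗ, map_smul, LinearMap.smul_apply,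
        map_smul, smul_eq_mul])
    (fun x φ ψ => rfl)
    (fun r x φ => rfl)

variable (𝒜) in
/-- The action of `𝒜` on `𝒜^∨`, as a bilinear map. -/
noncomputable def dualActL {c a p l i q : ℤ} (h : c + a = p) (h' : l + i = q) (U : Opens X) :
    Sec (𝒜.obj c l) U →ₗ[Fn O U] Sec (dgDual 𝒜 a i) U →ₗ[Fn O U] Sec (dgDual 𝒜 p q) U :=
  (c * a).negOnePow • precompL 𝒜 (by omega) (by omega) U

lemma dgDualD_dgDualD {a a' a'' : ℤ} (h : a + 1 = a') (h' : a' + 1 = a'') (i : ℤ) :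
    dgDualD 𝒜 h i ≫ dgDualD 𝒜 h' i = 0 := by
  refine PresheafOfModules.hom_ext fun U => ?_
  ext φ
  refine dev_ext fun W hW t => ?_
  refine (dev_dgDualD h' (secMap (dgDualD 𝒜 h i) U.unop φ) hW t).trans ?_
  rw [dev_dgDualD, ← secMap_comp, 𝒜.d_d, secMap_zero, map_zero, smul_zero, smul_zero]
  rfl

lemma dualAct_res {c a p l i q : ℤ} (h : c + a = p) (h' : l + i = q) {U V : Opens X} (hV : V ≤ U)
    (x : Sec (𝒜.obj c l) U) (φ : Sec (dgDual 𝒜 a i) U) :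
    dualAct 𝒜 h h' V (res _ hV x) (res _ hV φ) = res _ hV (dualAct 𝒜 h h' U x φ) := by
  refine dev_ext fun W hW t => ?_
  rw [dev_res, dev_dualAct, dev_dualAct, res_res]; rfl

lemma one_dualAct {b j : ℤ} (U : Opens X) (φ : Sec (dgDual 𝒜 b j) U) :
    dualAct 𝒜 (zero_add b) (zero_add j) U (𝒜.one U) φ = φ := by
  refine dev_ext fun W hW t => ?_
  rw [dev_dualAct, 𝒜.one_res, 𝒜.one_mul, zero_mul, Int.negOnePow_zero, one_smul]

lemma dualAct_leibniz {a b p a' b' p' i j q : ℤ} (h : a + b = p) (ha : a + 1 = a') (hb : b + 1 = b')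
    (hp : p + 1 = p') (h₁ : a' + b = p') (h₂ : a + b' = p') (h' : i + j = q) (U : Opens X)
    (x : Sec (𝒜.obj a i) U) (φ : Sec (dgDual 𝒜 b j) U) :
    secMap (dgDualD 𝒜 hp q) U (dualAct 𝒜 h h' U x φ) =
      dualAct 𝒜 h₁ h' U (secMap (𝒜.d ha i) U x) φ +
        a.negOnePow • dualAct 𝒜 h₂ h' U x (secMap (dgDualD 𝒜 hb j) U φ) := by
  refine dev_ext fun W hW t => ?_
  rw [dev_add, dev_unit_smul, dev_dgDualD, dev_dualAct, dev_dualAct, dev_dualAct, dev_dgDualD,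
    𝒜.leibniz (a := a) (b := -p') (p := -b') (a' := a') (b' := -p) (p' := -b)
      (by omega) ha (by omega) (by omega) (by omega) (by omega) (by omega),
    map_add, DGMod.map_unit_smul, secMap_res]
  subst ha hb hp h
  simp only [smul_add, smul_smul, ← Int.negOnePow_add]
  rw [add_left_comm]
  have e1 : a + (a * (b + 1) + (b + 1)) = (a + 1) * b + 1 + 2 * a := by ring
  have e2 : a + (a * (b + 1) + (b + 1 + a)) = a + b + 1 + a * b + 2 * a := by ring
  rw [e1, e2, Int.negOnePow_add _ (2 * a), Int.negOnePow_add _ (2 * a),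
    Int.negOnePow_even _ (even_two_mul a), mul_one, mul_one, Int.negOnePow_succ, Units.neg_smul]
  exact (neg_add_cancel_left _ _).symm

lemma precomp_dgDualD {c a a' p p' i l q : ℤ} (ha : a + 1 = a') (hp : p + 1 = p') (h : a + c = p)
    (h₁ : a' + c = p') (h₂ : a + (c + 1) = p') (h' : i + l = q) {U : Opens X}
    (x : Sec (𝒜.obj c l) U) (φ : Sec (dgDual 𝒜 a i) U) :
    secMap (dgDualD 𝒜 hp q) U (precomp 𝒜 h h' U x φ) =
      precomp 𝒜 h₁ h' U x (secMap (dgDualD 𝒜 ha i) U φ) +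
        a.negOnePow • precomp 𝒜 h₂ h' U (secMap (𝒜.d rfl l) U x) φ := by
  refine dev_ext fun W hW t => ?_
  rw [dev_add, dev_unit_smul, dev_dgDualD, dev_precomp, dev_precomp, dev_precomp, dev_dgDualD,
    𝒜.leibniz (a := c) (b := -p') (p := -a') (b' := -p) (p' := -a)
      (by omega) rfl (by omega) (by omega) (by omega) (by omega) (by omega),
    map_add, DGMod.map_unit_smul, secMap_res, smul_add, smul_smul, ← Int.negOnePow_add]
  subst ha hp h
  have e1 : (a + 1 + c).negOnePow = (a + c + 1).negOnePow := by rw [h₁]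
  rw [e1, Int.negOnePow_succ a, Units.neg_smul, neg_add_cancel_comm]

lemma precomp_res {a c p i l q : ℤ} (h : a + c = p) (h' : i + l = q) {U V : Opens X} (hV : V ≤ U)
    (x : Sec (𝒜.obj c l) U) (φ : Sec (dgDual 𝒜 a i) U) :
    precomp 𝒜 h h' V (res _ hV x) (res _ hV φ) = res _ hV (precomp 𝒜 h h' U x φ) := by
  refine dev_ext fun W hW t => ?_
  rw [dev_res, dev_precomp, dev_precomp, res_res]; rfl

section
/-- Graded commutativity. -/
def DGAlg.IsComm (𝒜 : DGAlg O) : Prop :=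
  ∀ ⦃a b p i j q : ℤ⦄ (h : a + b = p) (h₁ : b + a = p) (h' : i + j = q) (h₁' : j + i = q)
    (U : Opens X) (x : Sec (𝒜.obj a i) U) (y : Sec (𝒜.obj b j) U),
    𝒜.mul h h' U x y = (a * b).negOnePow • 𝒜.mul h₁ h₁' U y x
variable (hc : 𝒜.IsComm)
include hc

lemma dev_mul_swap {b a c p i j k q : ℤ} {U : Opens X}
    (φ : Sec (dgDual 𝒜 p q) U) {W : Opens X} (hW : W ≤ U) {bc ac jk ik : ℤ}
    (h₁ : b + c = bc) (h₂ : a + bc = -p) (h₃ : a + c = ac) (h₄ : b + ac = -p)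
    (h₁' : j + k = jk) (h₂' : i + jk = -q) (h₃' : i + k = ik) (h₄' : j + ik = -q)
    (x : Sec (𝒜.obj a i) W) (y : Sec (𝒜.obj b j) W) (z : Sec (𝒜.obj c k) W) :
    dev φ hW (𝒜.mul h₂ h₂' W x (𝒜.mul h₁ h₁' W y z)) = (a * b).negOnePow •
      dev φ hW (𝒜.mul h₄ h₄' W y (𝒜.mul h₃ h₃' W x z)) := by
  rw [← 𝒜.mul_assoc (ab := a + b) (ij := i + j) rfl (by omega) h₁ h₂ rfl (by omega) h₁' h₂',
    ← 𝒜.mul_assoc (ab := a + b) (ij := i + j) (by omega) (by omega) h₃ h₄ (by omega) (by omega) h₃' h₄',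
    hc rfl (add_comm _ _) rfl (add_comm _ _), DGAlg.mul_eq, DGMod.map_unit_smul]

lemma mul_dualAct {a b c ab bc p i j k ij jk q : ℤ} (h₁ : a + b = ab) (h₂ : ab + c = p)
    (h₃ : b + c = bc) (h₄ : a + bc = p) (h₁' : i + j = ij) (h₂' : ij + k = q)
    (h₃' : j + k = jk) (h₄' : i + jk = q) (U : Opens X)
    (x : Sec (𝒜.obj a i) U) (y : Sec (𝒜.obj b j) U) (φ : Sec (dgDual 𝒜 c k) U) :
    dualAct 𝒜 h₂ h₂' U (𝒜.mul h₁ h₁' U x y) φ =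
      dualAct 𝒜 h₄ h₄' U x (dualAct 𝒜 h₃ h₃' U y φ) := by
  refine dev_ext fun W hW t => ?_
  rw [dev_dualAct, dev_dualAct, dev_dualAct, ← 𝒜.mul_res,
    𝒜.mul_assoc (bc := b - p) (jk := j - q) h₁ (by omega) (by omega) (by omega) h₁' (by omega) (by omega) (by omega),
    dev_mul_swap hc (ac := -bc) (ik := -jk) φ hW (by omega) (by omega) (by omega) (by omega)
      (by omega) (by omega) (by omega) (by omega), smul_smul, smul_smul, ← Int.negOnePow_add, ← Int.negOnePow_add]
  congr 2
  subst h₁ h₃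
  ring

lemma precomp_comm {c b a p p₁ p₂ l j i q q₁ q₂ : ℤ}
    (h₁ : a + c = p₁) (h₂ : a + b = p₂) (h₃ : p₁ + b = p) (h₄ : p₂ + c = p)
    (h₁' : i + l = q₁) (h₂' : i + j = q₂) (h₃' : q₁ + j = q) (h₄' : q₂ + l = q) {U : Opens X}
    (x : Sec (𝒜.obj c l) U) (y : Sec (𝒜.obj b j) U) (φ : Sec (dgDual 𝒜 a i) U) :
    precomp 𝒜 h₃ h₃' U y (precomp 𝒜 h₁ h₁' U x φ) =
      (c * b).negOnePow • precomp 𝒜 h₄ h₄' U x (precomp 𝒜 h₂ h₂' U y φ) := by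
  refine dev_ext fun W hW t => ?_
  rw [dev_unit_smul, dev_precomp, dev_precomp, dev_precomp, dev_precomp,
    dev_mul_swap hc (ac := -p₂) (ik := -q₂) φ hW (by omega) (by omega) (by omega) (by omega)
      (by omega) (by omega) (by omega) (by omega)]

lemma precomp_dualAct {c b a p p₁ p₂ l j i q q₁ q₂ : ℤ}
    (h₁ : c + a = p₁) (h₂ : p₁ + b = p) (h₃ : a + b = p₂) (h₄ : c + p₂ = p)
    (h₁' : l + i = q₁) (h₂' : q₁ + j = q) (h₃' : i + j = q₂) (h₄' : l + q₂ = q) {U : Opens X}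
    (x : Sec (𝒜.obj c l) U) (y : Sec (𝒜.obj b j) U) (φ : Sec (dgDual 𝒜 a i) U) :
    precomp 𝒜 h₂ h₂' U y (dualAct 𝒜 h₁ h₁' U x φ) =
      dualAct 𝒜 h₄ h₄' U x (precomp 𝒜 h₃ h₃' U y φ) := by
  refine dev_ext fun W hW t => ?_
  rw [dev_precomp, dev_dualAct, dev_dualAct, dev_precomp,
    dev_mul_swap hc (ac := -p₂) (ik := -q₂) φ hW (by omega) (by omega) (by omega) (by omega)
      (by omega) (by omega) (by omega) (by omega), smul_smul, ← Int.negOnePow_add, ← mul_add]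
  congr 3

end

lemma precomp_sq {c a p p₁ l i q q₁ : ℤ} (h₁ : a + c = p₁) (h₃ : p₁ + c = p)
    (h₁' : i + l = q₁) (h₂' : q₁ + l = q) {U : Opens X}
    (x : Sec (𝒜.obj c l) U) (hx : 𝒜.mul rfl rfl U x x = 0) (φ : Sec (dgDual 𝒜 a i) U) :
    precomp 𝒜 h₃ h₂' U x (precomp 𝒜 h₁ h₁' U x φ) = 0 := by
  refine dev_ext fun W hW t => ?_
  rw [dev_precomp, dev_precomp, ← 𝒜.mul_assoc (ab := c + c) (ij := l + l) rfl (by omega) (by omega)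
    (by omega) rfl (by omega) (by omega) (by omega), 𝒜.mul_res, hx, map_zero, map_zero,
    LinearMap.zero_apply, map_zero, dev_zero]
end dgDual

section
variable {n : ℕ} {𝒳 : CochainComplex (Mod O) ℤ}

lemma algT_comm (𝒳 : CochainComplex (Mod O) ℤ) : (algT 𝒳).IsComm :=
  fun _ _ _ _ _ _ h h₁ h' h₁' U x y => symAlg_comm 2 (xP 𝒳) h h₁ h' h₁' U x y

lemma algS_comm (𝒳 : CochainComplex (Mod O) ℤ) : (algS 𝒳).IsComm :=
  fun _ _ _ _ _ _ h h₁ h' h₁' U x y => symAlg_comm (-2) (dualComplex 𝒳) h h₁ h' h₁' U x y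

/-- The twisting data of the functor `N ↦ 𝒯^∨ ⊗ N`: the operator `R e` is `φ ↦ φ(e · -)`. -/
noncomputable def twB (h𝒳 : IsFiniteLocallyFree n 𝒳) :
    Twist n 𝒳 (dgDual (algT 𝒳)) (algS 𝒳) (algT 𝒳) where
  dP h i := dgDualD (algT 𝒳) h i
  dP_dP h h' i := dgDualD_dgDualD h h' i
  lact h h' U := dualActL (algT 𝒳) h h' U
  lact_res h h' U V hV x φ := dualAct_res h h' hV x φ
  one_lact U φ := one_dualAct U φ
  mul_lact h₁ h₂ h₃ h₄ h₁' h₂' h₃' h₄' U x y φ :=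
    mul_dualAct (algT_comm 𝒳) h₁ h₂ h₃ h₄ h₁' h₂' h₃' h₄' U x y φ
  leibniz h ha hb hp h₁ h₂ h' U x φ := dualAct_leibniz h ha hb hp h₁ h₂ h' U x φ
  ε k := 1 - k
  ε' k := k
  hε k := by ring
  w := 2
  w' := -2
  hw := by norm_num
  Z E e := E.yS e.1 e.2
  Z_res E hV e := symGen_res (-2) (dualComplex 𝒳) hV (E.y e.1 e.2)
  Z_comm E e f c l h h₁ h' := algS_comm 𝒳 h h₁ h' h' _ _ _
  Z_sq E e c l he h h' := symGen_mul_self (-2) (dualComplex 𝒳) he h h' _ _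
  R E e a p i q h h' := precompL (algT 𝒳) h h' _ (E.xT e.1 e.2)
  dR E e a p i q h h' := precompL (algT 𝒳) (c := 1 - e.1 + 1) (by omega) h' _
    (secMap ((algT 𝒳).d rfl 2) _ (E.xT e.1 e.2))
  R_res E hV e a p i q h h' φ :=
    (congrArg (fun x => precomp (algT 𝒳) h h' _ x (res _ hV φ))
      (symGen_res 2 (xP 𝒳) hV (E.x e.1 e.2))).trans (precomp_res h h' hV (E.xT e.1 e.2) φ)
  R_comm E e f a p p₁ p₂ i q q₁ h₁ h₂ h₃ h₄ h₁' h₂' φ :=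
    precomp_comm (algT_comm 𝒳) h₁ h₂ h₃ h₄ h₁' h₁' h₂' h₂' (E.xT e.1 e.2) (E.xT f.1 f.2) φ
  R_sq {U} E e he a p p₁ i q q₁ h₁ h₃ h₁' h₂' φ :=
    precomp_sq h₁ h₃ h₁' h₂' (E.xT e.1 e.2) (symGen_mul_self 2 (xP 𝒳) he rfl rfl U (E.x e.1 e.2)) φ
  d_R E e a a' p p' i q ha hp h h₁ h₂ h' φ :=
    precomp_dgDualD ha hp h h₁ (by omega) h' (E.xT e.1 e.2) φ
  R_lact E e c a p p₁ p₂ l i q q₁ q₂ h₁ h₂ h₃ h₄ h₁' h₂' h₃' h₄' x φ :=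
    precomp_dualAct (algT_comm 𝒳) h₁ h₂ h₃ h₄ h₁' h₂' h₃' h₄' x (E.xT e.1 e.2) φ
  indep {U} E E' a i φ G _ _ β := by
    rw [sum_idx, sum_idx]
    refine Finset.sum_congr rfl fun k _ => ?_
    exact E.casimir_indep E' k ((((β (p := a + (1 - k)) (c := k) (by omega)).comp
      (((precompL (algT 𝒳) rfl rfl U).flip φ).comp (symGenL 2 (xP 𝒳) (1 - k) U))).compl₂
        (symGenL (-2) (dualComplex 𝒳) k U)).flip)
  closed {U} E a i φ G _ _ β := by
    rw [sum_idx]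
    have := E.casimir_closed h𝒳 (G := G) (fun {k i} h => k.negOnePow •
      (((β (p := a + i) (c := k) (by omega)).comp
      (((precompL (algT 𝒳) rfl rfl U).flip φ).comp (symGenL 2 (xP 𝒳) i U))).compl₂
        (symGenL (-2) (dualComplex 𝒳) k U)).flip)
    refine Eq.trans ?_ this
    refine Finset.sum_congr rfl fun k _ => Finset.sum_congr rfl fun α _ => ?_
    have h1 : ∀ (p : ℤ) (h : a + (1 - k + 1) = p) (h' : p + k = a + 2)
      (x : Sec ((algT 𝒳).obj (1 - k + 1) 2) U) z,
      β h' (precompL (algT 𝒳) h rfl U x φ) z = β (by omega) (precompL (algT 𝒳) rfl rfl U x φ) z := by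
      rintro p rfl h' y z; rfl
    refine (add_comm _ _).trans (congrArg₂ (· + ·) ?_ ((h1 _ (by dsimp only; omega) _ _ _).trans ?_))
    · refine congrArg (fun z => _ • β (p := a + (1 - k)) (c := k + 1) (by omega)
        (precompL (algT 𝒳) rfl rfl U (E.xT k α) φ) z) (symGen_d (-2) (dualComplex 𝒳) U (E.y k α)) |>.trans ?_
      refine congrArg (· • _) (?_ : (1 - k).negOnePow = (k + 1).negOnePow)
      rw [Int.negOnePow_sub, Int.negOnePow_add, mul_comm]
    · refine (congrArg (fun x => β (p := a + (1 - k + 1)) (c := k) (by omega)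
        (precompL (algT 𝒳) rfl rfl U x φ) (E.yS k α)) (symGen_d 2 (xP 𝒳) U (E.x k α))).trans ?_
      exact ((smul_smul _ _ _).trans ((congrArg (· • _) (Int.units_mul_self _)).trans
        (one_smul _ _))).symm

lemma nonempty_koszulA (h𝒳 : IsFiniteLocallyFree n 𝒳) (hF : HasFrames 𝒳) :
    Nonempty (KoszulA n 𝒳) :=
  ⟨{ toTensorFunctor := (twA h𝒳).tensorFunctor hF
     act_tm := ((twA h𝒳).isTwisted hF).act_tm
     d_tm := fun M {a b p i j q} h h' U E s m => by
      refine (((twA h𝒳).isTwisted hF).d_tm M h h' U E s m).trans ?_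
      rw [sum_idx]; rfl }⟩

lemma nonempty_koszulB (h𝒳 : IsFiniteLocallyFree n 𝒳) (hF : HasFrames 𝒳) :
    Nonempty (KoszulB n 𝒳) :=
  ⟨{ toTensorFunctor := (twB h𝒳).tensorFunctor hF
     act_tm := ((twB h𝒳).isTwisted hF).act_tm
     d_tm := fun M {a b p i j q} h h' U E s m => by
      refine (((twB h𝒳).isTwisted hF).d_tm M h h' U E s m).trans ?_
      rw [sum_idx]; rfl }⟩

lemma KoszulA.isTwisted (h𝒳 : IsFiniteLocallyFree n 𝒳) (A : KoszulA n 𝒳) :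
    (twA h𝒳).IsTwisted A.toTensorFunctor where
  act_tm := A.act_tm
  d_tm M {a b p i j q} h h' U E s m := by
    refine (A.d_tm M h h' U E s m).trans ?_
    rw [sum_idx]; rfl

lemma KoszulB.isTwisted (h𝒳 : IsFiniteLocallyFree n 𝒳) (B : KoszulB n 𝒳) :
    (twB h𝒳).IsTwisted B.toTensorFunctor where
  act_tm := B.act_tm
  d_tm M {a b p i j q} h h' U E s m := by
    refine (B.d_tm M h h' U E s m).trans ?_
    rw [sum_idx]; rfl
end
end Instances

universe v₁ u₁


/-! ### Existence of local frames -/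

section
variable {C : Type u₁} [Category.{v₁} C] {J : GrothendieckTopology C} {R : Sheaf J RingCat.{u}}
  [HasSheafify J AddCommGrpCat.{u}] [J.WEqualsLocallyBijective AddCommGrpCat.{u}]

open scoped Classical in
/-- A finite family of generating sections that is a basis has a dual basis. -/
lemma exists_dual_of_isIso {N : SheafOfModules.{u} R} (σ : N.GeneratingSections) [IsIso σ.π]
    [Fintype σ.I] : ∃ p : σ.I → (N ⟶ SheafOfModules.unit R),
      (∀ i j (T : Cᵒᵖ), ((p i).val.app T).hom ((σ.s j).val T) =
        if i = j then (1 : R.obj.obj T) else 0) ∧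
      ∑ i, p i ≫ N.unitHomEquiv.symm (σ.s i) = 𝟙 N := by
  have hι (j) : SheafOfModules.ιFree j ≫ σ.π = N.unitHomEquiv.symm (σ.s j) := by
    rw [← SheafOfModules.unitHomEquiv_symm_freeHomEquiv_apply, Equiv.apply_symm_apply]
  let pr (i : σ.I) : SheafOfModules.free (R := R) σ.I ⟶ SheafOfModules.unit R :=
    Cofan.IsColimit.desc (SheafOfModules.isColimitFreeCofan σ.I) fun j => if i = j then 𝟙 _ else 0
  have hpr (i j) : SheafOfModules.ιFree j ≫ pr i = if i = j then 𝟙 _ else 0 :=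
    Cofan.IsColimit.fac (SheafOfModules.isColimitFreeCofan σ.I) _ j
  refine ⟨fun i => inv σ.π ≫ pr i, fun i j T => ?_, ?_⟩
  · have h : N.unitHomEquiv.symm (σ.s j) ≫ inv σ.π ≫ pr i = if i = j then 𝟙 _ else 0 := by
      rw [← hι, Category.assoc, IsIso.hom_inv_id_assoc, hpr]
    have h2 := congrArg (fun f => ((SheafOfModules.unit R).unitHomEquiv f).val T) h
    have h3 := congrArg (fun s : (SheafOfModules.unit R).sections => s.val T)
      (SheafOfModules.unitHomEquiv_comp_apply (N.unitHomEquiv.symm (σ.s j)) (inv σ.π ≫ pr i))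
    rw [Equiv.apply_symm_apply] at h3
    refine (h3.symm.trans h2 : _).trans ?_
    by_cases h : i = j
    · rw [if_pos h, if_pos h]; rfl
    · rw [if_neg h, if_neg h]; rfl
  · have h : ∑ i, pr i ≫ SheafOfModules.ιFree i = 𝟙 (SheafOfModules.free (R := R) σ.I) := by
      refine Cofan.IsColimit.hom_ext (SheafOfModules.isColimitFreeCofan σ.I) _ _ fun j => ?_
      change SheafOfModules.ιFree j ≫ _ = SheafOfModules.ιFree j ≫ _
      rw [Preadditive.comp_sum, Category.comp_id, Finset.sum_eq_single j]
      · rw [← Category.assoc, hpr, if_pos rfl, Category.id_comp]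
      · intro i _ hij
        rw [← Category.assoc, hpr, if_neg hij, zero_comp]
      · simp
    have h2 : inv σ.π ≫ (∑ i, pr i ≫ SheafOfModules.ιFree i) ≫ σ.π = 𝟙 N := by
      rw [h, Category.id_comp, IsIso.inv_hom_id]
    rw [← h2, Preadditive.sum_comp, Preadditive.comp_sum]
    refine Finset.sum_congr rfl fun i _ => ?_
    rw [Category.assoc, Category.assoc, hι]
end

section
variable {X : TopCat.{u}} {O : Sheaf (Opens.grothendieckTopology X) CommRingCat.{u}}

/-- A finite basis of sections of `F` over `U` together with the dual basis. -/
structure LocalBasis (F : PMod O) (U : Opens X) where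
  r : ℕ
  x : Fin r → Sec F U
  y : Fin r → Sec (dual F) U
  expand (W : Opens X) (h : W ≤ U) (v : Sec F W) : ∑ α, ev (y α) h v • res _ h (x α) = v
  dual (α β : Fin r) : ev (y α) le_rfl (x β) = if α = β then 1 else 0

/-- The restriction of a local basis to a smaller open subset. -/
noncomputable def LocalBasis.restr {F : PMod O} {U V : Opens X} (b : LocalBasis F U) (hV : V ≤ U) :
    LocalBasis F V where
  r := b.r
  x α := res _ hV (b.x α)
  y α := res _ hV (b.y α)
  expand W h v := by
    refine Eq.trans ?_ (b.expand W (h.trans hV) v)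
    refine Finset.sum_congr rfl fun α _ => ?_
    rw [res_res]; rfl
  dual α β := by
    have h := DualSec.app_res (b.y α) U V le_rfl hV (b.x β)
    refine Eq.trans h ?_
    refine (congrArg (resFn O hV) (b.dual α β)).trans ?_
    split_ifs <;> simp

open scoped Classical in
/-- A local basis from a finite family of sections and linear forms that are compatible with restriction. -/
lemma nonempty_localBasis {F : PMod O} {U : Opens X} {I : Type u} [Fintype I]
    (lin : I → ∀ W : Opens X, W ≤ U → (Sec F W →ₗ[Fn O W] Fn O W))
    (x : I → ∀ W : Opens X, W ≤ U → Sec F W)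
    (lin_res : ∀ a (W W' : Opens X) (h : W ≤ U) (h' : W' ≤ W) v,
      lin a W' (h'.trans h) (res F h' v) = resFn O h' (lin a W h v))
    (x_res : ∀ a (W : Opens X) (h : W ≤ U), res F h (x a U le_rfl) = x a W h)
    (sum : ∀ (W : Opens X) (h : W ≤ U) v, ∑ a, lin a W h v • x a W h = v)
    (pair : ∀ a b, lin a U le_rfl (x b U le_rfl) = if a = b then 1 else 0) :
    Nonempty (LocalBasis F U) := by
  let e := Fintype.equivFin I
  refine ⟨⟨Fintype.card I, fun α => x (e.symm α) U le_rfl,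
    fun α => (⟨lin (e.symm α), lin_res _⟩ : DualSec F U), fun W h v => ?_, fun α β => ?_⟩⟩
  · refine (Equiv.sum_comp e.symm fun a => lin a W h v • res F h (x a U le_rfl)).trans ?_
    simp only [x_res, sum]
  · refine (pair _ _).trans ?_
    simp only [EmbeddingLike.apply_eq_iff_eq]

lemma exists_localBasis {M : Mod O} (q : SheafOfModules.LocalGeneratorsData.{u} M)
    (h₁ : q.IsLocallyFreeData) (h₂ : q.IsFiniteType) (p : X) :
    ∃ W : Opens X, p ∈ W ∧ Nonempty (LocalBasis (toP.obj M) W) := by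
  obtain ⟨V, f, ⟨i, ⟨g⟩⟩, hp⟩ := q.coversTop ⊤ p trivial
  refine ⟨q.X i, leOfHom g hp, ?_⟩
  have : (q.generators i).IsFiniteType := h₂.isFiniteType i
  have : Finite (q.generators i).I := this.finite
  have : Fintype (q.generators i).I := Fintype.ofFinite _
  have := h₁.isIso i
  obtain ⟨pr, hpr, hsum⟩ := exists_dual_of_isIso (q.generators i)
  let T (W : Opens X) (h : W ≤ q.X i) : (Over (q.X i))ᵒᵖ := op (Over.mk (homOfLE h))
  refine nonempty_localBasis (fun a W h => ((pr a).val.app (T W h)).hom)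
    (fun a W h => ((q.generators i).s a).val (T W h)) (fun a W W' h h' v => ?_) (fun a W h => ?_)
    (fun W h v => ?_) (fun a b => ?_)
  · exact PresheafOfModules.naturality_apply (pr a).val
      (Quiver.Hom.op (Over.homMk (homOfLE h') rfl : Over.mk (homOfLE (h'.trans h)) ⟶ Over.mk (homOfLE h))) v
  · exact ((q.generators i).s a).property
      (Quiver.Hom.op (Over.homMk (homOfLE h) rfl : Over.mk (homOfLE h) ⟶ Over.mk (𝟙 _)))
  · let φ : (M.over (q.X i) ⟶ M.over (q.X i)) →+ (M.over (q.X i)).val.obj (T W h) :=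
      { toFun f := (f.val.app (T W h)).hom v
        map_zero' := rfl
        map_add' _ _ := rfl }
    exact (map_sum φ _ _).symm.trans (congrArg φ hsum)
  · exact hpr a b _

/-- A bounded complex of locally free modules of finite rank has a frame around every point: only finitely
many components are nonzero. -/
lemma hasFrames {n : ℕ} {𝒳 : CochainComplex (Mod O) ℤ} (h𝒳 : IsFiniteLocallyFree n 𝒳) :
    HasFrames 𝒳 := by
  intro p
  have h1 : ∀ s : Finset ℤ, ∃ W : Opens X, p ∈ W ∧ ∀ k ∈ s,
      Nonempty (LocalBasis (toP.obj (𝒳.X (1 - k))) W) := by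
    intro s
    induction s using Finset.induction_on with
    | empty => exact ⟨⊤, trivial, by simp⟩
    | insert k s _ ih =>
      obtain ⟨W, hpW, hW⟩ := ih
      obtain ⟨q, hq, hq'⟩ := h𝒳.locallyFree (1 - k)
      obtain ⟨W', hpW', ⟨b⟩⟩ := exists_localBasis q hq hq' p
      refine ⟨W ⊓ W', ⟨hpW, hpW'⟩, fun l hl => ?_⟩
      rcases Finset.mem_insert.1 hl with rfl | hl
      · exact ⟨b.restr inf_le_right⟩
      · exact ⟨(hW l hl).some.restr inf_le_left⟩
  obtain ⟨W, hpW, hW⟩ := h1 (Finset.Icc 1 (n + 1))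
  have h2 (k : ℤ) : ∃ b : LocalBasis (toP.obj (𝒳.X (1 - k))) W,
      k ∉ Finset.Icc (1 : ℤ) (n + 1) → b.r = 0 := by
    by_cases hk : k ∈ Finset.Icc (1 : ℤ) (n + 1)
    · exact ⟨(hW k hk).some, fun h => absurd hk h⟩
    · refine ⟨⟨0, Fin.elim0, Fin.elim0, fun V h v => ?_, fun α => α.elim0⟩, fun _ => rfl⟩
      have : 1 - k ∉ Set.Icc (-n : ℤ) 0 := by
        simp only [Finset.mem_Icc, Set.mem_Icc] at hk ⊢; omega
      exact ((subsingleton_of_isZero (h𝒳.isZero _ this) V v).trans (by simp)).symm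
  choose b hb using h2
  exact ⟨W, hpW, ⟨⟨fun k => (b k).r, fun k => (b k).x, fun k => (b k).y,
    fun k => (b k).expand, fun k => (b k).dual⟩⟩⟩
end

/-! ### Monomial bases over open subsets -/

section Bases
variable {X : TopCat.{u}} {O : Sheaf (Opens.grothendieckTopology X) CommRingCat.{u}}
variable {J : Type} [Fintype J] [LinearOrder J]

/-- A basis over the open subset `W` of a bigraded presheaf of modules, indexed by exponents of
monomials: the basis section `e (da γ) (v * len γ) γ` has bidegree `(da γ, v * len γ)`, and `c` is the
dual basis. The values of `e` and `c` in other bidegrees, and for the exponents of monomials that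
vanish, are zero by convention. -/
structure MonBasis (P : ℤ → ℤ → PMod O) (W : Opens X) (deg : J → ℤ) where
  da : (J → ℕ) → ℤ
  v : ℤ
  hv : v ≠ 0
  e (a i : ℤ) (γ : J → ℕ) : Sec (P a i) W
  c (a i : ℤ) (γ : J → ℕ) : Sec (dual (P a i)) W
  e_zero {a i : ℤ} {γ : J → ℕ} : ¬ (Adm deg γ ∧ da γ = a ∧ v * len γ = i) → e a i γ = 0
  c_zero {a i : ℤ} {γ : J → ℕ} : ¬ (Adm deg γ ∧ da γ = a ∧ v * len γ = i) → c a i γ = 0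
  dual_self {a i : ℤ} {γ : J → ℕ} : Adm deg γ → da γ = a → v * len γ = i →
    ev (c a i γ) le_rfl (e a i γ) = 1
  dual_ne {a i : ℤ} {γ γ' : J → ℕ} : γ ≠ γ' → ev (c a i γ) le_rfl (e a i γ') = 0
  expand (a i : ℤ) (s : Finset (J → ℕ))
    (hs : ∀ γ, Adm deg γ → da γ = a → v * len γ = i → γ ∈ s) (V : Opens X) (h : V ≤ W)
    (x : Sec (P a i) V) : ∑ γ ∈ s, ev (c a i γ) h x • res _ h (e a i γ) = x

variable {deg : J → ℤ}

/-- A homogeneous basis over `W` of a complex of presheaves of modules. -/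
structure PBasis (V : CochainComplex (PMod O) ℤ) (W : Opens X) (deg : J → ℤ) where
  e (i : ℤ) : J → Sec (V.X i) W
  c (i : ℤ) : J → Sec (LinearKoszul.dual (V.X i)) W
  e_eq_zero {i : ℤ} {j : J} : deg j ≠ i → e i j = 0
  c_eq_zero {i : ℤ} {j : J} : deg j ≠ i → c i j = 0
  dual {i : ℤ} {j : J} (j' : J) : deg j = i → ev (c i j') le_rfl (e i j) = if j' = j then 1 else 0
  expand (i : ℤ) (U : Opens X) (h : U ≤ W) (v : Sec (V.X i) U) :
    ∑ j, ev (c i j) h v • res _ h (e i j) = v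

lemma ev_res_res {F : PMod O} {W U : Opens X} (φ : Sec (dual F) W) (h : U ≤ W) (x : Sec F W) :
    ev φ h (res F h x) = resFn O h (ev φ le_rfl x) :=
  DualSec.app_res φ W U le_rfl h x

namespace PBasis
variable {V : CochainComplex (PMod O) ℤ} {W : Opens X} (b : PBasis V W deg)

/-- The basis of sections over a smaller open subset. -/
noncomputable def hb {U : Opens X} (h : U ≤ W) : HBasis (Fn O U) (fun i => Sec (V.X i) U) deg where
  e i j := res _ h (b.e i j)
  c i j := ev (b.c i j) h
  e_eq_zero hj := by rw [b.e_eq_zero hj, map_zero]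
  c_eq_zero hj := by rw [b.c_eq_zero hj]; rfl
  dual {i j} j' hj := by
    rw [ev_res_res, b.dual j' hj]
    split_ifs <;> simp
  expand i v := b.expand i U h v

variable {w : ℤ}

lemma symRes_pbw {U U' : Opens X} (h : U ≤ W) (h' : U' ≤ U) (γ : J → ℕ) :
    symRes V h' ((b.hb h).pbw γ) = (b.hb (h'.trans h)).pbw γ := by
  have h1 (j : J) : symRes V h' ((b.hb h).var j) = (b.hb (h'.trans h)).var j := by
    rw [symRes, HBasis.var, GSym.map_gen]
    exact congrArg _ (res_res _ _ _ _)
  rw [HBasis.pbw, HBasis.pbw, HBasis.lmon, HBasis.lmon, map_list_prod, List.map_map]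
  congr 1
  refine List.map_congr_left fun j _ => ?_
  rw [Function.comp_apply, map_pow, h1]

end PBasis

lemma HBasis.mem_span {R : Type u} [CommRing R] {V : ℤ → Type u} [∀ i, AddCommGroup (V i)]
    [∀ i, Module R (V i)] (b : HBasis R V deg) {w p q : ℤ} {z : GSym R V}
    (hz : z ∈ GSym.piece R V w p q) : z ∈ Submodule.span R
      {z | ∃ γ, Adm deg γ ∧ tdeg deg γ = p ∧ w * len γ = q ∧ b.pbw γ = z} := by
  refine Submodule.span_le.2 ?_ hz
  rintro _ ⟨l, rfl, rfl, rfl⟩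
  refine Submodule.span_mono ?_ (b.mon_mem_span l)
  rintro _ ⟨γ, h1, h2, h3, rfl⟩
  exact ⟨γ, h1, h2, by rw [h3], rfl⟩

lemma HBasis.coef_eq_zero {R : Type u} [CommRing R] {V : ℤ → Type u} [∀ i, AddCommGroup (V i)]
    [∀ i, Module R (V i)] (b : HBasis R V deg) {w p q : ℤ} {z : GSym R V}
    (hz : z ∈ GSym.piece R V w p q) {γ : J → ℕ} (h : ¬ (Adm deg γ ∧ tdeg deg γ = p ∧ w * len γ = q)) :
    b.coef γ z = 0 := by
  classical
  replace hz := b.mem_span hz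
  induction hz using Submodule.span_induction with
  | mem z hz =>
    obtain ⟨γ', h1, h2, h3, rfl⟩ := hz
    rw [b.coef_pbw, if_neg]
    rintro ⟨rfl, -⟩
    exact h ⟨h1, h2, h3⟩
  | zero => exact map_zero _
  | add y z _ _ hy hz => rw [map_add, hy, hz, add_zero]
  | smul r y _ hy => rw [_root_.map_smul, hy, smul_zero]

lemma HBasis.sum_coef {R : Type u} [CommRing R] {V : ℤ → Type u} [∀ i, AddCommGroup (V i)]
    [∀ i, Module R (V i)] (b : HBasis R V deg) {w p q : ℤ} {z : GSym R V}
    (hz : z ∈ GSym.piece R V w p q) {s : Finset (J → ℕ)}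
    (hs : ∀ γ, Adm deg γ → tdeg deg γ = p → w * len γ = q → γ ∈ s) :
    ∑ γ ∈ s, b.coef γ z • b.pbw γ = z := by
  classical
  replace hz := b.mem_span hz
  induction hz using Submodule.span_induction with
  | mem z hz =>
    obtain ⟨γ', h1, h2, h3, rfl⟩ := hz
    rw [Finset.sum_eq_single γ']
    · rw [b.coef_pbw, if_pos ⟨rfl, h1⟩, one_smul]
    · intro γ _ hne
      rw [b.coef_pbw, if_neg fun h => hne h.1, zero_smul]
    · exact fun h => absurd (hs _ h1 h2 h3) h
  | zero => simp
  | add y z _ _ hy hz => simp only [map_add, add_smul, Finset.sum_add_distrib, hy, hz]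
  | smul r y _ hy => simp only [_root_.map_smul, smul_assoc, ← Finset.smul_sum, hy]

namespace PBasis
variable {V : CochainComplex (PMod O) ℤ} {W : Opens X} (b : PBasis V W deg) {w : ℤ}

lemma coef_symRes {U U' : Opens X} (h : U ≤ W) (h' : U' ≤ U) (γ : J → ℕ) {p q : ℤ} {z : SymSec V U}
    (hz : z ∈ SymPiece w V p q U) :
    (b.hb (h'.trans h)).coef γ (symRes V h' z) = resFn O h' ((b.hb h).coef γ z) := by
  classical
  replace hz := (b.hb h).mem_span hz
  induction hz using Submodule.span_induction with
  | mem z hz =>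
    obtain ⟨γ', h1, h2, h3, rfl⟩ := hz
    rw [b.symRes_pbw, HBasis.coef_pbw, HBasis.coef_pbw]
    split_ifs <;> simp
  | zero => simp
  | add y z _ _ hy hz => simp only [map_add, hy, hz]
  | smul r y _ hy =>
    rw [symRes, GSym.map_smul, _root_.map_smul, _root_.map_smul, smul_eq_mul, smul_eq_mul, map_mul,
      ← symRes, hy]

variable (w)

open scoped Classical in
/-- The monomial of exponent `γ`, as a section of the graded-symmetric algebra. -/
noncomputable def monSec (a i : ℤ) (γ : J → ℕ) {U : Opens X} (h : U ≤ W) :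
    Sec ((symAlg w V).obj a i) U :=
  (⟨if tdeg deg γ = a ∧ w * len γ = i then (b.hb h).pbw γ else 0, by
    split_ifs with h1
    · obtain ⟨rfl, rfl⟩ := h1; exact (b.hb h).pbw_mem w γ
    · exact zero_mem _⟩ : SymPiece w V a i U)

lemma monSec_res (a i : ℤ) (γ : J → ℕ) {U U' : Opens X} (h : U ≤ W) (h' : U' ≤ U) :
    res _ h' (b.monSec w a i γ h) = b.monSec w a i γ (h'.trans h) := by
  refine Subtype.ext ?_
  change symRes V h' (if _ then _ else _) = if _ then _ else _
  split_ifs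
  · exact b.symRes_pbw h h' γ
  · exact map_zero _

/-- The coefficient of the monomial of exponent `γ`, as a section of the dual. -/
noncomputable def coefSec (a i : ℤ) (γ : J → ℕ) : Sec (LinearKoszul.dual ((symAlg w V).obj a i)) W :=
  (⟨fun U h => ((b.hb h).coef γ).comp (SymPiece w V a i U).subtype, fun _ _ h h' z =>
    b.coef_symRes h h' γ (show z.1 ∈ SymPiece w V a i _ from z.2)⟩ : DualSec ((symAlg w V).obj a i) W)

/-- The basis of monomials of the graded-symmetric algebra. -/
noncomputable def monBasis (hw : w ≠ 0) : MonBasis (symAlg w V).obj W deg where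
  da := tdeg deg
  v := w
  hv := hw
  e a i γ := b.monSec w a i γ le_rfl
  c a i γ := b.coefSec w a i γ
  e_zero {a i γ} h := by
    refine Subtype.ext ?_
    change (if _ then _ else _) = _
    split_ifs with h1
    · exact (b.hb le_rfl).pbw_eq_zero fun h2 => h ⟨h2, h1⟩
    · rfl
  c_zero {a i γ} h := ev_ext fun U hU z => (b.hb hU).coef_eq_zero z.2 h
  dual_self {a i γ} h1 h2 h3 := by
    classical
    change (b.hb le_rfl).coef γ (if _ then _ else _) = 1
    rw [if_pos ⟨h2, h3⟩, HBasis.coef_pbw, if_pos ⟨rfl, h1⟩]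
  dual_ne {a i γ γ'} h := by
    classical
    by_cases h1 : tdeg deg γ' = a ∧ w * len γ' = i
    · refine (congrArg ((b.hb le_rfl).coef γ) (if_pos h1)).trans ?_
      rw [HBasis.coef_pbw, if_neg fun h' => h h'.1]
    · exact (congrArg ((b.hb le_rfl).coef γ) (if_neg h1)).trans (map_zero _)
  expand a i s hs U hU x := by
    refine Subtype.ext ?_
    refine (map_sum (SymPiece w V a i U).subtype _ _).trans
      (Eq.trans ?_ ((b.hb hU).sum_coef x.2 hs))
    refine Finset.sum_congr rfl fun γ _ => ?_
    rw [b.monSec_res]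
    let c := (b.hb hU).coef γ (show SymPiece w V a i U from x).1
    by_cases h1 : tdeg deg γ = a ∧ w * len γ = i
    · exact congrArg (fun y : SymSec V U => c • y) (if_pos h1)
    · have hc : c = 0 := (b.hb hU).coef_eq_zero (show SymPiece w V a i U from x).2 fun h => h1 h.2
      exact (congrArg (fun y : SymSec V U => c • y) (if_neg h1)).trans
        ((smul_zero c).trans ((congrArg (· • (b.hb hU).pbw γ) hc).trans (zero_smul _ _)).symm)

end PBasis

lemma dev_sum {𝒜 : DGAlg O} {a i : ℤ} {U : Opens X} {ι : Type*} (s : Finset ι)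
    (φ : ι → Sec (dgDual 𝒜 a i) U) {W : Opens X} (hW : W ≤ U) (t : Sec (𝒜.obj (-a) (-i)) W) :
    dev (∑ k ∈ s, φ k) hW t = ∑ k ∈ s, dev (φ k) hW t :=
  ev_sum (F := 𝒜.obj (-a) (-i)) s φ hW t

/-- The basis of `𝒜^∨` dual to a basis of monomials of `𝒜`. -/
noncomputable def MonBasis.dualBasis {𝒜 : DGAlg O} {W : Opens X} (b : MonBasis 𝒜.obj W deg) :
    MonBasis (dgDual 𝒜) W deg where
  da γ := -b.da γ
  v := -b.v
  hv := neg_ne_zero.2 b.hv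
  e a i γ := b.c (-a) (-i) γ
  c a i γ := (⟨fun U h =>
      { toFun φ := dev φ le_rfl (res _ h (b.e (-a) (-i) γ))
        map_add' _ _ := rfl
        map_smul' r φ := by
          refine (dev_smul φ le_rfl _ r).trans ?_
          rw [resFn_refl]; rfl },
      fun U U' h h' φ => by
        have := DualSec.app_res φ U U' le_rfl h' (res _ h (b.e (-a) (-i) γ))
        rw [res_res] at this
        exact this⟩ : DualSec (dgDual 𝒜 a i) W)
  e_zero {a i γ} h := b.c_zero fun h' => h ⟨h'.1, by omega, by linarith [h'.2.2]⟩
  c_zero {a i γ} h := ev_ext fun U hU φ => by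
    have : b.e (-a) (-i) γ = 0 := b.e_zero fun h' => h ⟨h'.1, by omega, by linarith [h'.2.2]⟩
    change dev φ le_rfl (res _ hU (b.e (-a) (-i) γ)) = 0
    rw [this, map_zero, map_zero]
  dual_self {a i γ} h1 h2 h3 := by
    change dev (b.c (-a) (-i) γ) le_rfl (res _ le_rfl (b.e (-a) (-i) γ)) = 1
    rw [res_refl]
    exact b.dual_self h1 (by omega) (by linarith)
  dual_ne {a i γ γ'} h := by
    change dev (b.c (-a) (-i) γ') le_rfl (res _ le_rfl (b.e (-a) (-i) γ)) = 0
    rw [res_refl]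
    exact b.dual_ne h.symm
  expand a i s hs U hU φ := by
    refine dev_ext fun U' hU' t => ?_
    refine (dev_sum s _ hU' t).trans ?_
    have h1 := b.expand (-a) (-i) s (fun γ h1 h2 h3 => hs γ h1 (by omega) (by linarith)) U'
      (hU'.trans hU) t
    conv_rhs => rw [← h1, map_sum]
    refine Finset.sum_congr rfl fun γ _ => ?_
    rw [_root_.map_smul, smul_eq_mul, mul_comm]
    have := DualSec.app_res φ U U' le_rfl hU' (res _ hU (b.e (-a) (-i) γ))
    rw [res_res] at this
    exact congrArg (· * ev (b.c (-a) (-i) γ) (hU'.trans hU) t) this.symm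
end Bases

/-! ### The bases given by a frame; elements of tensor products -/

section FrameBases
variable {X : TopCat.{u}} {O : Sheaf (Opens.grothendieckTopology X) CommRingCat.{u}}

/-- The evaluation at a section of `F`, as a section of the bidual. -/
noncomputable def evSec {F : PMod O} {W : Opens X} (x : Sec F W) : Sec (dual (dual F)) W :=
  (⟨fun U h =>
    { toFun φ := ev (F := F) φ le_rfl (res F h x)
      map_add' _ _ := rfl
      map_smul' r φ := by
        refine (ev_smul (F := F) r φ le_rfl _).trans ?_
        rw [resFn_refl]; rfl },
    fun U U' h h' φ => by
      have := DualSec.app_res φ U U' le_rfl h' (res F h x)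
      rw [res_res] at this
      exact this⟩ : DualSec (dual F) W)

lemma ev_evSec {F : PMod O} {W : Opens X} (x : Sec F W) {U : Opens X} (h : U ≤ W)
    (φ : Sec (dual F) U) : ev (F := dual F) (evSec x) h φ = ev φ le_rfl (res F h x) := rfl

section
variable {V : CochainComplex (PMod O) ℤ} {W : Opens X} {K : Finset ℤ} {d : ℤ → ℤ} {r : ℤ → ℕ}
  [LinearOrder (Σ k : K, Fin (r k))]

/-- A homogeneous basis of a complex of presheaves from bases of its components in the degrees `d k`
for `k ∈ K`. -/
noncomputable def PBasis.ofFamilies (hd : Function.Injective d)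
    (x : ∀ k, Fin (r k) → Sec (V.X (d k)) W) (y : ∀ k, Fin (r k) → Sec (LinearKoszul.dual (V.X (d k))) W)
    (expand : ∀ k (U : Opens X) (h : U ≤ W) (v : Sec (V.X (d k)) U),
      ∑ α, ev (y k α) h v • res _ h (x k α) = v)
    (dual : ∀ k α β, ev (y k α) le_rfl (x k β) = if α = β then 1 else 0)
    (zero : ∀ i, (∀ k ∈ K, d k ≠ i) → ∀ (U : Opens X), U ≤ W → ∀ v : Sec (V.X i) U, v = 0) :
    PBasis V W (fun j : Σ k : K, Fin (r k) => d j.1) where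
  e i j := if h : d j.1 = i then h ▸ x j.1 j.2 else 0
  c i j := if h : d j.1 = i then h ▸ y j.1 j.2 else 0
  e_eq_zero h := dif_neg h
  c_eq_zero h := dif_neg h
  dual {i j} j' h := by
    subst h
    dsimp only
    rw [dif_pos rfl]
    obtain ⟨k, α⟩ := j
    obtain ⟨k', β⟩ := j'
    by_cases hk : k' = k
    · subst hk
      rw [dif_pos rfl]
      refine (dual k' β α).trans ?_
      simp only [Sigma.mk.injEq, heq_eq_eq, true_and]
    · rw [dif_neg fun h => hk (Subtype.ext (hd h)), if_neg fun h => hk (congrArg Sigma.fst h)]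
      rfl
  expand i U h v := by
    by_cases hi : ∃ k ∈ K, d k = i
    · obtain ⟨k, hk, rfl⟩ := hi
      rw [Fintype.sum_sigma, Fintype.sum_eq_single ⟨k, hk⟩]
      · refine Eq.trans ?_ (expand k U h v)
        refine Finset.sum_congr rfl fun α _ => ?_
        rw [dif_pos rfl, dif_pos rfl]
      · intro k' hk'
        refine Finset.sum_eq_zero fun α _ => ?_
        rw [dif_neg fun h => hk' (Subtype.ext (hd h)), dif_neg fun h => hk' (Subtype.ext (hd h)),
          map_zero, smul_zero]
    · rw [zero i (by simpa using hi) U h v]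
      simp
end

variable {n : ℕ} {𝒳 : CochainComplex (Mod O) ℤ} {W : Opens X}

/-- The indices of the elements of a frame in the degrees in which the complex may be nonzero. -/
abbrev LocalFrame.J (n : ℕ) (E : LocalFrame 𝒳 W) : Type := Σ k : Finset.Icc (1 : ℤ) (n + 1), Fin (E.r k)

/-- An arbitrary linear order on the elements of a frame. -/
noncomputable instance (E : LocalFrame 𝒳 W) : LinearOrder (E.J n) :=
  LinearOrder.lift' (Fintype.equivFin (E.J n)) (Equiv.injective _)

/-- The degrees of the elements of a frame. -/
abbrev LocalFrame.degX (E : LocalFrame 𝒳 W) (j : E.J n) : ℤ := 1 - j.1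
/-- The degrees of the elements of the dual frame. -/
abbrev LocalFrame.degY (E : LocalFrame 𝒳 W) (j : E.J n) : ℤ := j.1

variable (h𝒳 : IsFiniteLocallyFree n 𝒳)
include h𝒳

/-- The basis of `𝒳` given by a frame. -/
noncomputable def LocalFrame.basisX (E : LocalFrame 𝒳 W) : PBasis (xP 𝒳) W (E.degX (n := n)) :=
  PBasis.ofFamilies (V := xP 𝒳) (d := fun k => 1 - k) (fun k l h => by simpa using h) E.x E.y E.expand E.dual
    (fun i hi U _ v => by
      refine subsingleton_of_isZero (h𝒳.isZero i fun h => ?_) U v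
      have := hi (1 - i)
      simp only [Finset.mem_Icc, Set.mem_Icc] at this h
      exact this (by omega) (by omega))

/-- The basis of `𝒳^∨[-1]` given by a frame. -/
noncomputable def LocalFrame.basisY (E : LocalFrame 𝒳 W) :
    PBasis (dualComplex 𝒳) W (E.degY (n := n)) :=
  PBasis.ofFamilies (V := dualComplex 𝒳) (d := fun k => k) (fun k l h => h) E.y
    (fun k α => evSec (E.x k α))
    (fun k U h φ => (E.restr h).sum_y k φ)
    (fun k α β => by
      refine (ev_evSec _ _ _).trans ?_
      rw [res_refl]
      refine (E.dual k β α).trans ?_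
      simp only [eq_comm])
    (fun i hi U _ v => by
      have : IsZero (𝒳.X (1 - i)) := h𝒳.isZero _ fun h => by
        have := hi i
        simp only [Finset.mem_Icc, Set.mem_Icc] at this h
        exact this (by omega) rfl
      refine ev_ext (F := toP.obj (𝒳.X (1 - i))) fun U' hU' t => ?_
      rw [subsingleton_of_isZero this U' t, map_zero, map_zero])

/-- The monomial basis of `𝒮` given by a frame. -/
noncomputable def LocalFrame.basisS (E : LocalFrame 𝒳 W) :
    MonBasis (algS 𝒳).obj W (E.degY (n := n)) := (E.basisY h𝒳).monBasis (-2) (by norm_num)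

/-- The monomial basis of `𝒯` given by a frame. -/
noncomputable def LocalFrame.basisT (E : LocalFrame 𝒳 W) :
    MonBasis (algT 𝒳).obj W (E.degX (n := n)) := (E.basisX h𝒳).monBasis 2 (by norm_num)

/-- The basis of `𝒯^∨` dual to the monomial basis of `𝒯` given by a frame. -/
noncomputable def LocalFrame.basisTd (E : LocalFrame 𝒳 W) :
    MonBasis (dgDual (algT 𝒳)) W (E.degX (n := n)) := (E.basisT h𝒳).dualBasis
end FrameBases

section Coordinates
variable {X : TopCat.{u}} {O : Sheaf (Opens.grothendieckTopology X) CommRingCat.{u}}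
variable {P : ℤ → ℤ → PMod O} {𝒜 ℬ : DGAlg O} (Φ : TensorFunctor P 𝒜 ℬ) (M : DGMod 𝒜)

namespace TensorFunctor
variable {a b p i j q : ℤ}

/-- The product `tm` as a bilinear map. -/
noncomputable def tmL (h : a + b = p) (h' : i + j = q) (U : Opens X) :
    Sec (P a i) U →ₗ[Fn O U] SSec ((M.cx j).X b) U →ₗ[Fn O U] SSec (((Φ.F.obj M).cx q).X p) U :=
  (gtmulL P M h h' U).compr₂ (sMap (Φ.iso M p q).hom U)

lemma tmL_apply (h : a + b = p) (h' : i + j = q) (U : Opens X) (s : Sec (P a i) U)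
    (m : SSec ((M.cx j).X b) U) : Φ.tmL M h h' U s m = Φ.tm M h h' U s m := rfl

variable {M}
lemma tm_res (h : a + b = p) (h' : i + j = q) {U V : Opens X} (hV : V ≤ U) (s : Sec (P a i) U)
    (m : SSec ((M.cx j).X b) U) :
    Φ.tm M h h' V (res _ hV s) (res _ hV m) = res _ hV (Φ.tm M h h' U s m) := by
  rw [tm, tm, gtmul_res, sMap_res]

lemma map_tm {N : DGMod 𝒜} (f : M ⟶ N) (h : a + b = p) (h' : i + j = q) (U : Opens X)
    (s : Sec (P a i) U) (m : SSec ((M.cx j).X b) U) :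
    sMap (((Φ.F.map f).f q).f p) U (Φ.tm M h h' U s m) =
      Φ.tm N h h' U s (sMap ((f.f j).f b) U m) := Φ.map_iso f h h' U s m

lemma tm_ext {U : Opens X} {G : Mod O} {f g : LHom U (toP.obj (((Φ.F.obj M).cx q).X p)) (toP.obj G)}
    (h : ∀ {a b i j : ℤ} (h : a + b = p) (h' : i + j = q) (V : Opens X) (hV : V ≤ U)
      (s : Sec (P a i) V) (m : SSec ((M.cx j).X b) V),
      f.app V hV (Φ.tm M h h' V s m) = g.app V hV (Φ.tm M h h' V s m)) : f = g := by
  have : f.comp (LHom.ofHom U (toP.map (Φ.iso M p q).hom)) =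
      g.comp (LHom.ofHom U (toP.map (Φ.iso M p q).hom)) := gt_ext fun h₁ h₂ V hV s m => h h₁ h₂ V hV s m
  ext V hV x
  have h1 := congrArg (fun f => f.app V hV (sMap (Φ.iso M p q).inv V x)) this
  change f.app V hV (sMap _ V _) = g.app V hV (sMap _ V _) at h1
  rwa [iso_hom_inv] at h1

/-- The local map defined on the sections `s ⊗ m` by a family of bilinear maps. -/
noncomputable def tmLift {U : Opens X} {G : Mod O}
    (β : ∀ k : BiIdx p q, LBil U (P k.a k.i) (toP.obj ((M.cx k.j).X k.b)) (toP.obj G)) :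
    LHom U (toP.obj (((Φ.F.obj M).cx q).X p)) (toP.obj G) :=
  (gtLift β).comp (LHom.ofHom U (toP.map (Φ.iso M p q).inv))

lemma tmLift_tm {U : Opens X} {G : Mod O}
    (β : ∀ k : BiIdx p q, LBil U (P k.a k.i) (toP.obj ((M.cx k.j).X k.b)) (toP.obj G))
    (h : a + b = p) (h' : i + j = q) (V : Opens X) (hV : V ≤ U)
    (s : Sec (P a i) V) (m : SSec ((M.cx j).X b) V) :
    (Φ.tmLift β).app V hV (Φ.tm M h h' V s m) = (β ⟨a, b, i, j, h, h'⟩).app V hV s m := by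
  change (gtLift β).app V hV (sMap (Φ.iso M p q).inv V (sMap (Φ.iso M p q).hom V _)) = _
  rw [iso_inv_hom, gtLift_gtmul]
end TensorFunctor
end Coordinates

/-! ### Coordinates on tensor products -/

section Coordinates
variable {X : TopCat.{u}} {O : Sheaf (Opens.grothendieckTopology X) CommRingCat.{u}}
variable {J : Type} [Fintype J] [LinearOrder J] {deg : J → ℤ} {W : Opens X}

/-- The dg-module vanishes in internal degrees larger than `N`. -/
def BoundedBy {𝒜 : DGAlg O} (M : DGMod 𝒜) (N : ℤ) : Prop :=
  ∀ j, N < j → ∀ i, IsZero ((M.cx j).X i)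

variable {P : ℤ → ℤ → PMod O} {𝒜 ℬ : DGAlg O} (B : MonBasis P W deg) (Φ : TensorFunctor P 𝒜 ℬ)
  (M : DGMod 𝒜)

namespace MonBasis
variable {a b p i j q : ℤ}

/-- The basis section of exponent `γ` over a smaller open subset. -/
noncomputable def bs (γ : J → ℕ) {V : Opens X} (hV : V ≤ W) : Sec (P (B.da γ) (B.v * len γ)) V :=
  res _ hV (B.e _ _ γ)

lemma bs_res (γ : J → ℕ) {V V' : Opens X} (hV : V ≤ W) (hV' : V' ≤ V) :
    res _ hV' (B.bs γ hV) = B.bs γ (hV'.trans hV) := res_res _ _ _ _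

open scoped Classical in
/-- The bilinear map `(s, m) ↦ c(s) m` with values in a given bidegree, for the dual basis section `c`
of exponent `γ`. -/
noncomputable def coordAux (γ : J → ℕ) (k : BiIdx p q) : LBil W (P k.a k.i)
    (toP.obj ((M.cx k.j).X k.b)) (toP.obj ((M.cx j).X b)) :=
  if h : 0 + k.b = b ∧ 0 + k.j = j then
    ⟨fun V hV => (M.act h.1 h.2 V).comp ((ev (B.c k.a k.i γ) hV).smulRight (𝒜.one V)),
      fun {V V'} hV hV' x y => by
        rw [LinearMap.comp_apply, LinearMap.comp_apply, LinearMap.smulRight_apply,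
          LinearMap.smulRight_apply, ← M.act_res, (res (𝒜.obj 0 0) hV').map_smulₛₗ, 𝒜.one_res,
          ev_res]⟩
  else ⟨fun _ _ => 0, fun _ _ _ _ => by simp⟩

variable {M}
/-- The coefficient of the basis section of exponent `γ` in a section of the image of `M`. -/
noncomputable def coord (γ : J → ℕ) (_ : B.da γ + b = p) (_ : B.v * len γ + j = q) :
    LHom W (toP.obj (((Φ.F.obj M).cx q).X p)) (toP.obj ((M.cx j).X b)) :=
  Φ.tmLift fun k => B.coordAux M γ k

lemma coord_tm (γ : J → ℕ) (h : B.da γ + b = p) (h' : B.v * len γ + j = q) (h₁ : a + b = p)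
    (h₁' : i + j = q) {V : Opens X} (hV : V ≤ W) (s : Sec (P a i) V) (m : SSec ((M.cx j).X b) V) :
    (B.coord Φ γ h h').app V hV (Φ.tm M h₁ h₁' V s m) = ev (B.c a i γ) hV s • m := by
  rw [coord, Φ.tmLift_tm, coordAux, dif_pos ⟨zero_add b, zero_add j⟩]
  change M.act (zero_add b) (zero_add j) V (ev (B.c a i γ) hV s • 𝒜.one V) m = _
  rw [map_smul, LinearMap.smul_apply, M.one_act]

lemma coord_tm_ne {b' j' : ℤ} (γ : J → ℕ) (h : B.da γ + b = p) (h' : B.v * len γ + j = q)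
    (h₁ : a + b' = p) (h₁' : i + j' = q) {V : Opens X} (hV : V ≤ W) (s : Sec (P a i) V)
    (m : SSec ((M.cx j').X b') V) (hne : ¬ (B.da γ = a ∧ B.v * len γ = i)) :
    (B.coord Φ γ h h').app V hV (Φ.tm M h₁ h₁' V s m) = 0 := by
  rw [coord, Φ.tmLift_tm, coordAux, dif_neg]
  · rfl
  · rintro ⟨h2, h3⟩
    exact hne ⟨by dsimp only at h2; omega, by dsimp only at h3; omega⟩

lemma ev_bs_self {γ : J → ℕ} (hγ : Adm deg γ) {V : Opens X} (hV : V ≤ W) :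
    ev (B.c _ _ γ) hV (B.bs γ hV) = 1 := by
  rw [bs, ev_res_res, B.dual_self hγ rfl rfl, map_one]

lemma coord_bs_self {γ : J → ℕ} (hγ : Adm deg γ) (h : B.da γ + b = p) (h' : B.v * len γ + j = q)
    {V : Opens X} (hV : V ≤ W) (m : SSec ((M.cx j).X b) V) :
    (B.coord Φ γ h h').app V hV (Φ.tm M h h' V (B.bs γ hV) m) = m := by
  rw [coord_tm, ev_bs_self B hγ, one_smul]

lemma coord_res_e_ne {γ γ' : J → ℕ} (hne : γ ≠ γ') {b' j' : ℤ} (h : B.da γ + b = p)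
    (h' : B.v * len γ + j = q) (h₁ : a + b' = p) (h₁' : i + j' = q)
    {V : Opens X} (hV : V ≤ W) (m : SSec ((M.cx j').X b') V) :
    (B.coord Φ γ h h').app V hV (Φ.tm M h₁ h₁' V (res _ hV (B.e a i γ')) m) = 0 := by
  by_cases hd : B.da γ = a ∧ B.v * len γ = i
  · obtain rfl : b' = b := by omega
    obtain rfl : j' = j := by omega
    rw [coord_tm, ev_res_res, B.dual_ne hne, map_zero, zero_smul]
  · rw [coord_tm_ne B Φ γ h h' h₁ h₁' hV _ _ hd]

lemma coord_bs_ne {γ γ' : J → ℕ} (hne : γ ≠ γ') {b' j' : ℤ} (h : B.da γ + b = p)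
    (h' : B.v * len γ + j = q) (h₁ : B.da γ' + b' = p) (h₁' : B.v * len γ' + j' = q)
    {V : Opens X} (hV : V ≤ W) (m : SSec ((M.cx j').X b') V) :
    (B.coord Φ γ h h').app V hV (Φ.tm M h₁ h₁' V (B.bs γ' hV) m) = 0 :=
  B.coord_res_e_ne Φ hne h h' h₁ h₁' hV m

lemma coord_of_not_adm {γ : J → ℕ} (hγ : ¬ Adm deg γ) (h : B.da γ + b = p)
    (h' : B.v * len γ + j = q) : B.coord (M := M) Φ γ h h' = 0 := by
  refine Φ.tm_ext fun {a b' i j'} h₁ h₁' V hV s m => ?_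
  by_cases hd : B.da γ = a ∧ B.v * len γ = i
  · obtain rfl : b' = b := by omega
    obtain rfl : j' = j := by omega
    rw [coord_tm, B.c_zero fun h => hγ h.1]
    exact zero_smul _ _
  · rw [coord_tm_ne B Φ γ h h' h₁ h₁' hV _ _ hd]; rfl

lemma coord_map {N : DGMod 𝒜} (f : M ⟶ N) (γ : J → ℕ) (h : B.da γ + b = p)
    (h' : B.v * len γ + j = q) {V : Opens X} (hV : V ≤ W) (z : SSec (((Φ.F.obj M).cx q).X p) V) :
    (B.coord Φ γ h h').app V hV (sMap (((Φ.F.map f).f q).f p) V z) =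
      sMap ((f.f j).f b) V ((B.coord Φ γ h h').app V hV z) := by
  have : (B.coord Φ γ h h').comp (LHom.ofHom W (toP.map (((Φ.F.map f).f q).f p))) =
      (LHom.ofHom W (toP.map ((f.f j).f b))).comp (B.coord Φ γ h h') := by
    refine Φ.tm_ext fun {a b' i j'} h₁ h₁' V hV s m => ?_
    change (B.coord Φ γ h h').app V hV (sMap _ V _) = sMap _ V ((B.coord Φ γ h h').app V hV _)
    rw [Φ.map_tm]
    by_cases hd : B.da γ = a ∧ B.v * len γ = i
    · obtain rfl : b' = b := by omega
      obtain rfl : j' = j := by omega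
      rw [coord_tm, coord_tm, map_smul]
    · rw [coord_tm_ne B Φ γ h h' h₁ h₁' hV _ _ hd, coord_tm_ne B Φ γ h h' h₁ h₁' hV _ _ hd, map_zero]
  exact congrArg (fun f => f.app V hV z) this

/-- The local map with values in the image of `M` defined by multiplication with the basis section of
exponent `γ`. -/
noncomputable def ins (γ : J → ℕ) (h : B.da γ + b = p) (h' : B.v * len γ + j = q) :
    LHom W (toP.obj ((M.cx j).X b)) (toP.obj (((Φ.F.obj M).cx q).X p)) :=
  ⟨fun V hV => Φ.tmL M h h' V (B.bs γ hV), fun {V V'} hV hV' m => by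
    rw [Φ.tmL_apply, Φ.tmL_apply, ← B.bs_res γ hV hV', Φ.tm_res]⟩

/-- Every section is the sum of its coefficients times the basis sections. -/
lemma sum_coord {N : ℤ} (hM : BoundedBy M N) (s : Finset (J → ℕ))
    (hs : ∀ γ, Adm deg γ → q - N ≤ B.v * len γ → γ ∈ s) {V : Opens X} (hV : V ≤ W)
    (z : SSec (((Φ.F.obj M).cx q).X p) V) :
    ∑ γ ∈ s, Φ.tm M (add_sub_cancel (B.da γ) p) (add_sub_cancel (B.v * len γ) q) V (B.bs γ hV)
      ((B.coord Φ γ (add_sub_cancel _ _) (add_sub_cancel _ _)).app V hV z) = z := by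
  classical
  let f (γ : J → ℕ) : LHom W (toP.obj (((Φ.F.obj M).cx q).X p)) (toP.obj (((Φ.F.obj M).cx q).X p)) :=
    (B.ins Φ γ (add_sub_cancel _ _) (add_sub_cancel _ _)).comp
      (B.coord Φ γ (add_sub_cancel _ _) (add_sub_cancel _ _))
  let F : LHom W (toP.obj (((Φ.F.obj M).cx q).X p)) (toP.obj (((Φ.F.obj M).cx q).X p)) :=
    ⟨fun V hV => ∑ γ ∈ s, (f γ).app V hV, fun h h' x => by
      rw [LinearMap.sum_apply, LinearMap.sum_apply, map_sum]
      exact Finset.sum_congr rfl fun γ _ => (f γ).app_res h h' x⟩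
  have hF : F = LHom.ofHom W (𝟙 _) := by
    refine Φ.tm_ext fun {a b i j} h₁ h₁' V hV x m => ?_
    change (∑ γ ∈ s, (f γ).app V hV) (Φ.tm M h₁ h₁' V x m) = Φ.tm M h₁ h₁' V x m
    rw [LinearMap.sum_apply]
    by_cases hj : N < j
    · rw [subsingleton_of_isZero (hM j hj b) V m, ← Φ.tmL_apply, map_zero]
      simp only [map_zero, Finset.sum_const_zero]
    · have h2 (γ) : (f γ).app V hV (Φ.tm M h₁ h₁' V x m) =
          Φ.tmL M h₁ h₁' V (ev (B.c a i γ) hV x • res _ hV (B.e a i γ)) m := by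
        change Φ.tmL M _ _ V (B.bs γ hV) ((B.coord Φ γ _ _).app V hV _) = _
        by_cases hd : B.da γ = a ∧ B.v * len γ = i
        · have key : ∀ (b' j' : ℤ) (e₁ : b' = b) (e₂ : j' = j) (g₁ : B.da γ + b' = p)
            (g₂ : B.v * len γ + j' = q),
            Φ.tmL M g₁ g₂ V (B.bs γ hV) ((B.coord Φ γ g₁ g₂).app V hV (Φ.tm M h₁ h₁' V x m)) =
            Φ.tmL M h₁ h₁' V (ev (B.c a i γ) hV x • res _ hV (B.e a i γ)) m := by
            rintro b' j' rfl rfl g₁ g₂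
            rw [coord_tm, map_smul, map_smul, LinearMap.smul_apply]
            obtain ⟨rfl, rfl⟩ := hd
            rfl
          exact key _ _ (by omega) (by omega) _ _
        · rw [coord_tm_ne B Φ γ _ _ h₁ h₁' hV _ _ hd, map_zero, B.c_zero fun h => hd h.2]
          have : ev (0 : Sec (dual (P a i)) W) hV x = 0 := rfl
          rw [this, zero_smul, map_zero]; rfl
      rw [Finset.sum_congr rfl fun γ _ => h2 γ, ← LinearMap.sum_apply, ← map_sum,
        B.expand a i s _ V hV x, Φ.tmL_apply]
      rintro γ hγ - h4
      exact hs γ hγ (by omega)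
  have := congrArg (fun f => f.app V hV z) hF
  change (∑ γ ∈ s, (f γ).app V hV) z = z at this
  rwa [LinearMap.sum_apply] at this

/-- The exponents of the monomials of length at most `N`. -/
noncomputable def _root_.LinearKoszul.shortExps (J : Type) [Fintype J] [LinearOrder J] (N : ℕ) : Finset (J → ℕ) :=
  (finite_len_le N).toFinset

lemma mem_shortExps (hv : B.v < 0) {N : ℤ} {γ : J → ℕ} (h : q - N ≤ B.v * len γ) :
    γ ∈ shortExps J (N - q).toNat := by
  simp only [shortExps, Set.Finite.mem_toFinset, Set.mem_ofPred_eq]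
  have h2 : B.v * len γ ≤ -1 * len γ := by
    refine mul_le_mul_of_nonneg_right (by omega) (by positivity)
  omega

lemma eq_zero_of_coord (hv : B.v < 0) {N : ℤ} (hM : BoundedBy M N) {V : Opens X} (hV : V ≤ W)
    {z : SSec (((Φ.F.obj M).cx q).X p) V} (h : ∀ γ, Adm deg γ → ∀ {b j : ℤ} (h : B.da γ + b = p)
      (h' : B.v * len γ + j = q), (B.coord Φ γ h h').app V hV z = 0) : z = 0 := by
  rw [← B.sum_coord Φ hM _ (fun γ _ hγ => B.mem_shortExps hv hγ) hV z]
  refine Finset.sum_eq_zero fun γ _ => ?_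
  by_cases hγ : Adm deg γ
  · rw [h γ hγ, ← Φ.tmL_apply, map_zero]
  · rw [coord_of_not_adm B Φ hγ]
    exact map_zero (Φ.tmL M _ _ V (B.bs γ hV))
end MonBasis

section differential
variable {n : ℕ} {𝒳 : CochainComplex (Mod O) ℤ} {D : Twist n 𝒳 P 𝒜 ℬ} {Φ M}

lemma Twist.IsTwisted.d_tm' (hΦ : D.IsTwisted Φ) {a a' b b' p p' i j q : ℤ} (h : a + b = p)
    (h' : i + j = q) (ha : a + 1 = a') (hb : b + 1 = b') (hp : p + 1 = p') (h₁ : a' + b = p')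
    (h₂ : a + b' = p') (U : Opens X) (E : LocalFrame 𝒳 U) (s : Sec (P a i) U)
    (m : SSec ((M.cx j).X b) U) :
    sMap (((Φ.F.obj M).cx q).d p p') U (Φ.tm M h h' U s m) =
      Φ.tm M h₁ h' U (secMap (D.dP ha i) U s) m +
      a.negOnePow • Φ.tm M h₂ h' U s (sMap ((M.cx j).d b b') U m) +
      a.negOnePow • ∑ e ∈ E.idx n,
        Φ.tm M (by have := D.hε e.1; omega) (by have := D.hw; omega) U
          (D.R E e rfl rfl s) (M.act rfl rfl U (D.Z E e) m) := by
  subst ha hb hp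
  exact hΦ.d_tm M h h' U E s m

/-- Apart from the differential of `P` and the twist, only the differential of `M` contributes to the
coefficients of the differential. -/
lemma Twist.IsTwisted.coord_d_tm (hΦ : D.IsTwisted Φ) {a b b' p p' i j b₁ j₁ q : ℤ} (h₁ : a + b = p)
    (h₁' : i + j = q) (hb : b + 1 = b') (hp : p + 1 = p')
    {V : Opens X} (hV : V ≤ W) (E : LocalFrame 𝒳 V) (s : Sec (P a i) V) (m : SSec ((M.cx j).X b) V)
    (γ : J → ℕ) (h : B.da γ + b₁ = p') (h' : B.v * len γ + j₁ = q)
    (hd : ¬ (B.da γ = a + 1 ∧ B.v * len γ = i)) (hR : B.v * len γ ≠ i + D.w) :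
    (B.coord Φ γ h h').app V hV (sMap (((Φ.F.obj M).cx q).d p p') V (Φ.tm M h₁ h₁' V s m)) =
      a.negOnePow • (B.coord Φ γ h h').app V hV (Φ.tm M (by omega) h₁' V s
        (sMap ((M.cx j).d b b') V m)) := by
  rw [hΦ.d_tm' h₁ h₁' rfl hb hp (by omega) (by omega) V E, map_add, map_add, DGMod.map_unit_smul,
    DGMod.map_unit_smul, map_sum, B.coord_tm_ne Φ γ h h' _ _ hV _ _ hd, zero_add,
    Finset.sum_eq_zero, smul_zero, add_zero]
  intro e _
  exact B.coord_tm_ne Φ γ h h' _ _ hV _ _ fun h => hR h.2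

/-- The order on the exponents with respect to which the differential is triangular. -/
def MonBasis.key (w : ℤ) (γ : J → ℕ) : ℤ ×ₗ ℤ := toLex (w * (B.v * len γ), B.da γ)

/-- The differential is triangular, with the differential of `M` on the diagonal: the differential of `P`
raises the degree of the basis section and preserves its internal degree, and the twist adds `w` to the
internal degree. -/
lemma Twist.IsTwisted.coord_d (hΦ : D.IsTwisted Φ) (hw : D.w ≠ 0) (hv : B.v < 0) {N : ℤ}
    (hM : BoundedBy M N) {p p' q b b' j : ℤ} (hp : p + 1 = p') (hb : b + 1 = b') {V : Opens X}
    (hV : V ≤ W) (E : LocalFrame 𝒳 V) (z : SSec (((Φ.F.obj M).cx q).X p) V) (γ : J → ℕ)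
    (h : B.da γ + b = p) (h₁ : B.da γ + b' = p') (h' : B.v * len γ + j = q)
    (hz : ∀ γ', B.key D.w γ' < B.key D.w γ → ∀ {b j : ℤ} (h : B.da γ' + b = p)
      (h' : B.v * len γ' + j = q), (B.coord Φ γ' h h').app V hV z = 0) :
    (B.coord Φ γ h₁ h').app V hV (sMap (((Φ.F.obj M).cx q).d p p') V z) =
      (B.da γ).negOnePow • sMap ((M.cx j).d b b') V ((B.coord Φ γ h h').app V hV z) := by
  classical
  by_cases hγ : Adm deg γ
  swap
  · rw [B.coord_of_not_adm Φ hγ, B.coord_of_not_adm Φ hγ]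
    exact ((congrArg _ (map_zero (sMap ((M.cx j).d b b') V))).trans (smul_zero _)).symm
  have hsum := B.sum_coord Φ hM (insert γ (shortExps J (N - q).toNat))
    (fun γ _ hγ => Finset.mem_insert_of_mem (B.mem_shortExps hv hγ)) hV z
  have hterm (γ' : J → ℕ) (hne : γ ≠ γ') : (B.coord Φ γ h₁ h').app V hV
      (sMap (((Φ.F.obj M).cx q).d p p') V (Φ.tm M (add_sub_cancel (B.da γ') p)
        (add_sub_cancel (B.v * len γ') q) V (B.bs γ' hV)
        ((B.coord Φ γ' (add_sub_cancel _ _) (add_sub_cancel _ _)).app V hV z))) = 0 := by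
    by_cases hlt : B.key D.w γ' < B.key D.w γ
    · rw [hz γ' hlt, ← Φ.tmL_apply, map_zero, map_zero, map_zero]
    · rw [hΦ.coord_d_tm B _ _ rfl hp hV E _ _ γ h₁ h', B.coord_bs_ne Φ hne, smul_zero]
      · rintro ⟨h3, h4⟩
        refine hlt (Prod.Lex.toLex_lt_toLex.2 (Or.inr ⟨?_, ?_⟩))
        · rw [h4]
        · change B.da γ' < B.da γ; omega
      · intro h3
        refine hlt (Prod.Lex.toLex_lt_toLex.2 (Or.inl ?_))
        change D.w * (B.v * len γ') < D.w * (B.v * len γ)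
        rw [h3, mul_add]
        have := mul_self_pos.2 hw
        omega
  conv_lhs => rw [← hsum]
  rw [map_sum, map_sum, Finset.sum_eq_single γ]
  · have key : ∀ (b₂ j₂ : ℤ) (e₁ : b₂ = b) (e₂ : j₂ = j) (g₁ : B.da γ + b₂ = p)
        (g₂ : B.v * len γ + j₂ = q), (B.coord Φ γ h₁ h').app V hV
      (sMap (((Φ.F.obj M).cx q).d p p') V (Φ.tm M g₁ g₂ V (B.bs γ hV)
        ((B.coord Φ γ g₁ g₂).app V hV z))) = (B.da γ).negOnePow • sMap ((M.cx j).d b b') V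
          ((B.coord Φ γ h h').app V hV z) := by
      rintro b₂ j₂ rfl rfl g₁ g₂
      rw [hΦ.coord_d_tm B _ _ hb hp hV E _ _ γ h₁ h', B.coord_bs_self Φ hγ]
      · omega
      · intro h3
        exact hw (by linarith)
    exact key _ _ (by omega) (by omega) _ _
  · intro γ' _ hne
    exact hterm γ' hne.symm
  · intro h
    exact absurd (Finset.mem_insert_self _ _) h
end differential
end Coordinates

/-! ### Boundedness, exactness and acyclicity -/

section Exactness
variable {X : TopCat.{u}} {O : Sheaf (Opens.grothendieckTopology X) CommRingCat.{u}}

lemma exists_common_nhd {ι : Type*} {V : Opens X} {x : X} (hx : x ∈ V) (Q : ι → Opens X → Prop)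
    (hQ : ∀ i W W', W' ≤ W → Q i W → Q i W') (s : Finset ι)
    (h : ∀ i ∈ s, ∃ W ≤ V, x ∈ W ∧ Q i W) : ∃ W ≤ V, x ∈ W ∧ ∀ i ∈ s, Q i W := by
  classical
  induction s using Finset.induction_on with
  | empty => exact ⟨V, le_rfl, hx, by simp⟩
  | insert a s ha ih =>
    obtain ⟨W, hW, hxW, h1⟩ := ih fun i hi => h i (Finset.mem_insert_of_mem hi)
    obtain ⟨W', hW', hxW', h2⟩ := h a (Finset.mem_insert_self _ _)
    refine ⟨W ⊓ W', inf_le_left.trans hW, ⟨hxW, hxW'⟩, fun i hi => ?_⟩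
    rcases Finset.mem_insert.1 hi with rfl | hi
    · exact hQ _ _ _ inf_le_right h2
    · exact hQ _ _ _ inf_le_left (h1 i hi)

/-- Every point has a neighbourhood over which `𝒳` has a frame and `P` has a monomial basis whose
variables have negative internal degree. -/
def HasMonBases (𝒳 : CochainComplex (Mod O) ℤ) (P : ℤ → ℤ → PMod O) : Prop :=
  ∀ x : X, ∃ W : Opens X, x ∈ W ∧ Nonempty (LocalFrame 𝒳 W) ∧
    ∃ (J : Type) (_ : Fintype J) (_ : LinearOrder J) (deg : J → ℤ) (B : MonBasis P W deg), B.v < 0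

variable {n : ℕ} {𝒳 : CochainComplex (Mod O) ℤ} {P : ℤ → ℤ → PMod O} {𝒜 ℬ : DGAlg O}

section local_basis
variable {J : Type} [Fintype J] [LinearOrder J] {deg : J → ℤ} {W : Opens X} (B : MonBasis P W deg)
  (Φ : TensorFunctor P 𝒜 ℬ) {M M' : DGMod 𝒜} {p q : ℤ}

/-- A section of `P ⊗ M` has a local preimage if its coefficients have. -/
lemma MonBasis.exists_preimage (hv : B.v < 0) {N : ℤ} (hM : BoundedBy M N) (f : M' ⟶ M)
    {V : Opens X} (hV : V ≤ W) (z : SSec (((Φ.F.obj M).cx q).X p) V) {x : X} (hx : x ∈ V)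
    (h : ∀ γ {b j : ℤ} (h : B.da γ + b = p) (h' : B.v * len γ + j = q),
      ∃ (V' : Opens X) (hV' : V' ≤ V), x ∈ V' ∧ ∃ y, sMap ((f.f j).f b) V' y =
        res _ hV' ((B.coord Φ γ h h').app V hV z)) :
    ∃ (V' : Opens X) (hV' : V' ≤ V), x ∈ V' ∧ ∃ y, sMap (((Φ.F.map f).f q).f p) V' y =
      res _ hV' z := by
  obtain ⟨V', hV', hxV', hy⟩ := exists_common_nhd hx (fun γ V' => ∃ (hV' : V' ≤ V), ∃ y,
    sMap ((f.f (q - B.v * len γ)).f (p - B.da γ)) V' y = res _ hV'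
      ((B.coord Φ γ (add_sub_cancel _ _) (add_sub_cancel _ _)).app V hV z))
    (by
      rintro γ V₁ V₂ h₁₂ ⟨hV₁, y, hy⟩
      exact ⟨h₁₂.trans hV₁, res _ h₁₂ y, by rw [sMap_res, hy, res_res]⟩)
    (shortExps J (N - q).toNat) (fun γ _ => by
      obtain ⟨V', hV', hxV', hy⟩ := h γ (add_sub_cancel _ _) (add_sub_cancel _ _)
      exact ⟨V', hV', hxV', hV', hy⟩)
  choose! _ y hy using hy
  refine ⟨V', hV', hxV', ∑ γ ∈ shortExps J (N - q).toNat, Φ.tm M' (add_sub_cancel (B.da γ) p)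
    (add_sub_cancel (B.v * len γ) q) V' (B.bs γ (hV'.trans hV)) (y γ), ?_⟩
  rw [map_sum, ← B.sum_coord Φ hM _ (fun γ _ hγ => B.mem_shortExps hv hγ) hV z, map_sum]
  refine Finset.sum_congr rfl fun γ hγ => ?_
  rw [Φ.map_tm, hy γ hγ, ← B.bs_res γ hV hV', Φ.tm_res]

variable {D : Twist n 𝒳 P 𝒜 ℬ} {Φ}

/-- If `M` is acyclic, a cocycle of `P ⊗ M` whose nonzero coefficients have their exponents in a finite set
`T` is locally a coboundary: the smallest coefficient is a cocycle of `M`, and its primitive can be used to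
remove its exponent from `T`. -/
lemma Twist.IsTwisted.exists_primitive (hΦ : D.IsTwisted Φ) (hw : D.w ≠ 0) (hv : B.v < 0) {N : ℤ}
    (hM : BoundedBy M N) (hac : ∀ j, (M.cx j).Acyclic) (E : LocalFrame 𝒳 W) {p'' p' : ℤ}
    (hp : p + 1 = p') (hp' : p'' + 1 = p) (T : Finset (J → ℕ))
    (hT : ∀ γ ∈ T, ∀ γ', q - N ≤ B.v * len γ' → B.key D.w γ < B.key D.w γ' → γ' ∈ T)
    {V : Opens X} (hV : V ≤ W) (z : SSec (((Φ.F.obj M).cx q).X p) V)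
    (hz : sMap (((Φ.F.obj M).cx q).d p p') V z = 0)
    (hzT : ∀ γ ∉ T, ∀ {b j : ℤ} (h : B.da γ + b = p) (h' : B.v * len γ + j = q),
      (B.coord Φ γ h h').app V hV z = 0) {x : X} (hx : x ∈ V) :
    ∃ (V' : Opens X) (hV' : V' ≤ V), x ∈ V' ∧ ∃ y, sMap (((Φ.F.obj M).cx q).d p'' p) V' y =
      res _ hV' z := by
  classical
  induction hn : T.card generalizing T V with
  | zero =>
    obtain rfl := Finset.card_eq_zero.1 hn
    refine ⟨V, le_rfl, hx, 0, ?_⟩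
    rw [map_zero, res_refl]
    exact (B.eq_zero_of_coord Φ hv hM hV fun γ _ {b j} h h' => hzT γ (by simp) h h').symm
  | succ k ih =>
    obtain ⟨γ, hγT, hmin⟩ := T.exists_min_image (B.key D.w) (Finset.card_pos.1 (by omega))
    have hT' : ∀ γ₁ ∈ T.erase γ, ∀ γ', q - N ≤ B.v * len γ' → B.key D.w γ₁ < B.key D.w γ' →
        γ' ∈ T.erase γ := by
      intro γ₁ h₁ γ' hq hlt
      refine Finset.mem_erase.2 ⟨?_, hT γ₁ (Finset.mem_of_mem_erase h₁) γ' hq hlt⟩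
      rintro rfl
      exact (hmin γ₁ (Finset.mem_of_mem_erase h₁)).not_gt hlt
    have hcard : (T.erase γ).card = k := by rw [Finset.card_erase_of_mem hγT]; omega
    by_cases hγ : Adm deg γ
    swap
    · refine ih (T.erase γ) hT' hV z hz (fun γ' h' {b j} h₁ h₂ => ?_) hx hcard
      by_cases he : γ' = γ
      · subst he
        rw [B.coord_of_not_adm Φ hγ]; rfl
      · exact hzT γ' (fun h => h' (Finset.mem_erase.2 ⟨he, h⟩)) h₁ h₂
    obtain ⟨b, hb⟩ : ∃ b, B.da γ + b + 1 = p := ⟨p'' - B.da γ, by omega⟩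
    obtain ⟨j, hj⟩ : ∃ j, B.v * len γ + j = q := ⟨q - B.v * len γ, by omega⟩
    have hd := hΦ.coord_d B hw hv hM hp (b := b + 1) rfl hV (E.restr hV) z γ (by omega) (by omega) hj
      fun γ' hlt {b j} h h' => hzT γ' (fun h => (hmin γ' h).not_gt hlt) h h'
    -- so the coefficient of `γ` is a cocycle of `M`
    rw [hz, map_zero, eq_comm, smul_eq_zero_iff_eq] at hd
    obtain ⟨V', hV', hxV', y, hy⟩ := (acyclic_iff_sections _).1 (hac j) b V _ hd x hx
    have hVW := hV'.trans hV
    let u : SSec (((Φ.F.obj M).cx q).X p'') V' :=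
      (B.da γ).negOnePow • Φ.tm M (by omega) hj V' (B.bs γ hVW) y
    have hu (γ' : J → ℕ) {b' j' : ℤ} (h : B.da γ' + b' = p) (h' : B.v * len γ' + j' = q)
        (hlt : ¬ B.key D.w γ < B.key D.w γ') : (B.coord Φ γ' h h').app V' hVW
          (sMap (((Φ.F.obj M).cx q).d p'' p) V' u) = (B.coord Φ γ' h h').app V' hVW
            (Φ.tm M (by omega) hj V' (B.bs γ hVW) (sMap ((M.cx j).d b (b + 1)) V' y)) := by
      rw [DGMod.map_unit_smul, DGMod.map_unit_smul, hΦ.coord_d_tm B _ hj rfl hp' hVW (E.restr hVW)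
        _ _ γ' h h', smul_smul, Int.units_mul_self, one_smul]
      · rintro ⟨h3, h4⟩
        refine hlt (Prod.Lex.toLex_lt_toLex.2 (Or.inr ⟨by rw [h4], ?_⟩))
        change B.da γ < B.da γ'; omega
      · intro h3
        refine hlt (Prod.Lex.toLex_lt_toLex.2 (Or.inl ?_))
        change D.w * (B.v * len γ) < D.w * (B.v * len γ')
        rw [h3, mul_add]
        have := mul_self_pos.2 hw
        omega
    obtain ⟨V'', hV'', hxV'', y', hy'⟩ := ih (T.erase γ) hT' hVW
      (res _ hV' z - sMap (((Φ.F.obj M).cx q).d p'' p) V' u) (by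
        rw [map_sub, sMap_res, hz, map_zero, ← sMap_comp, HomologicalComplex.d_comp_d, sMap_zero,
          sub_zero])
      (by
        intro γ' h' b' j' h₁ h₂
        rw [map_sub, LHom.app_res _ hV hV']
        by_cases he : γ' = γ
        · subst he
          obtain rfl : b' = b + 1 := by omega
          obtain rfl : j' = j := by omega
          rw [hu _ _ _ (lt_irrefl _), B.coord_bs_self Φ hγ, hy, sub_self]
        · have hγ' : γ' ∉ T := fun h => h' (Finset.mem_erase.2 ⟨he, h⟩)
          rw [hzT γ' hγ', map_zero, zero_sub, neg_eq_zero]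
          by_cases hq : q - N ≤ B.v * len γ'
          · rw [hu _ _ _ fun h => hγ' (hT γ hγT γ' hq h), B.coord_bs_ne Φ he]
          · exact subsingleton_of_isZero (hM _ (by omega) _) _ _) hxV' hcard
    refine ⟨V'', hV''.trans hV', hxV'', y' + res _ hV'' u, ?_⟩
    rw [map_add, hy', map_sub, sMap_res, res_res, sub_add_cancel]
end local_basis

variable {Φ : TensorFunctor P 𝒜 ℬ} {D : Twist n 𝒳 P 𝒜 ℬ} (hB : HasMonBases 𝒳 P)
include hB

lemma TensorFunctor.boundedBy {M : DGMod 𝒜} {N : ℤ} (hM : BoundedBy M N) :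
    BoundedBy (Φ.F.obj M) N := by
  intro q hq p
  refine isZero_of_sections fun U z => sec_ext _ fun x hx => ?_
  obtain ⟨W, hxW, -, J, _, _, deg, B, hv⟩ := hB x
  refine ⟨U ⊓ W, inf_le_left, ⟨hx, hxW⟩, ?_⟩
  rw [map_zero]
  refine B.eq_zero_of_coord Φ hv hM inf_le_right fun γ _ b j h h' => ?_
  refine subsingleton_of_isZero (hM j ?_ b) _ _
  have : B.v * len γ ≤ 0 := mul_nonpos_of_nonpos_of_nonneg hv.le (by positivity)
  omega

lemma TensorFunctor.injective {M M' : DGMod 𝒜} {N : ℤ} (hM : BoundedBy M N) (f : M ⟶ M')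
    (hf : ∀ j b U, Function.Injective (sMap ((f.f j).f b) U)) (q p : ℤ) (U : Opens X) :
    Function.Injective (sMap (((Φ.F.map f).f q).f p) U) := by
  refine (injective_iff_map_eq_zero _).2 fun z hz => sec_ext _ fun x hx => ?_
  obtain ⟨W, hxW, -, J, _, _, deg, B, hv⟩ := hB x
  refine ⟨U ⊓ W, inf_le_left, ⟨hx, hxW⟩, ?_⟩
  rw [map_zero]
  refine B.eq_zero_of_coord Φ hv hM inf_le_right fun γ _ b j h h' => hf j b _ ?_
  rw [← B.coord_map, sMap_res, hz, map_zero, map_zero, map_zero]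

lemma TensorFunctor.exact {L M N : DGMod 𝒜} {k : ℤ} (hM : BoundedBy M k) (f : L ⟶ M) (g : M ⟶ N)
    (h : ∀ (j b : ℤ) (U : Opens X) (z : SSec ((M.cx j).X b) U), sMap ((g.f j).f b) U z = 0 →
      ∀ x ∈ U, ∃ (W : Opens X) (hW : W ≤ U), x ∈ W ∧ ∃ y, sMap ((f.f j).f b) W y = res _ hW z)
    (q p : ℤ) (U : Opens X) (z : SSec (((Φ.F.obj M).cx q).X p) U)
    (hz : sMap (((Φ.F.map g).f q).f p) U z = 0) (x : X) (hx : x ∈ U) :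
    ∃ (W : Opens X) (hW : W ≤ U), x ∈ W ∧ ∃ y, sMap (((Φ.F.map f).f q).f p) W y = res _ hW z := by
  obtain ⟨W, hxW, -, J, _, _, deg, B, hv⟩ := hB x
  obtain ⟨V', hV', hx', y, hy⟩ := B.exists_preimage Φ hv hM f (V := U ⊓ W) inf_le_right
    (res _ inf_le_left z) ⟨hx, hxW⟩ fun γ {b j} h₁ h₂ => h j b _ _ (by
      rw [← B.coord_map, sMap_res, hz, map_zero, map_zero]) x ⟨hx, hxW⟩
  exact ⟨V', hV'.trans inf_le_left, hx', y, by rw [hy, res_res]⟩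

lemma TensorFunctor.locally_surjective {M N : DGMod 𝒜} {k : ℤ} (hN : BoundedBy N k) (f : M ⟶ N)
    (h : ∀ (j b : ℤ) (U : Opens X) (z : SSec ((N.cx j).X b) U),
      ∀ x ∈ U, ∃ (W : Opens X) (hW : W ≤ U), x ∈ W ∧ ∃ y, sMap ((f.f j).f b) W y = res _ hW z)
    (q p : ℤ) (U : Opens X) (z : SSec (((Φ.F.obj N).cx q).X p) U) (x : X) (hx : x ∈ U) :
    ∃ (W : Opens X) (hW : W ≤ U), x ∈ W ∧ ∃ y, sMap (((Φ.F.map f).f q).f p) W y = res _ hW z := by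
  obtain ⟨W, hxW, -, J, _, _, deg, B, hv⟩ := hB x
  obtain ⟨V', hV', hx', y, hy⟩ := B.exists_preimage Φ hv hN f (V := U ⊓ W) inf_le_right
    (res _ inf_le_left z) ⟨hx, hxW⟩ fun γ {b j} h₁ h₂ => h j b _ _ x ⟨hx, hxW⟩
  exact ⟨V', hV'.trans inf_le_left, hx', y, by rw [hy, res_res]⟩

lemma Twist.IsTwisted.acyclic (hΦ : D.IsTwisted Φ) (hw : D.w ≠ 0) {M : DGMod 𝒜} {N : ℤ}
    (hM : BoundedBy M N) (hac : ∀ j, (M.cx j).Acyclic) (q : ℤ) : ((Φ.F.obj M).cx q).Acyclic := by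
  refine (acyclic_iff_sections _).2 fun p U z hz x hx => ?_
  obtain ⟨W, hxW, ⟨E⟩, J, _, _, deg, B, hv⟩ := hB x
  obtain ⟨V', hV', hx', y, hy⟩ := hΦ.exists_primitive B hw hv hM hac E rfl rfl
    (shortExps J (N - q).toNat) (fun γ _ γ' hγ' _ => B.mem_shortExps hv hγ') (V := U ⊓ W)
    inf_le_right (res _ inf_le_left z) (by rw [sMap_res, hz, map_zero])
    (fun γ hγ b j h h' => subsingleton_of_isZero (hM j (by
      by_contra hj
      exact hγ (B.mem_shortExps (q := q) (N := N) hv (by omega))) b) _ _) ⟨hx, hxW⟩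
  exact ⟨V', hV'.trans inf_le_left, hx', y, by rw [hy, res_res]⟩

lemma TensorFunctor.preservesShortExact {Q : ObjectProperty (Mod O)}
    (h : ∀ M, minus 𝒜 Q M → minus ℬ Q (Φ.F.obj M)) :
    PreservesShortExact (restrictMinus Φ.F h) := by
  intro L M N f g hfg q p
  obtain ⟨k₁, hL⟩ := L.property.1
  obtain ⟨k₂, hM⟩ := M.property.1
  obtain ⟨k₃, hN⟩ := N.property.1
  have hinj (j b U) : Function.Injective (sMap ((f.hom.f j).f b) U) := by
    have := (hfg j b).choose_spec.mono_f
    exact sMap_injective_of_mono _ _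
  have w : ((Φ.F.map f.hom).f q).f p ≫ ((Φ.F.map g.hom).f q).f p = 0 := by
    refine hom_ext_sMap fun U z => ?_
    have hz : sMap (((Φ.F.map (f.hom ≫ g.hom)).f q).f p) U z = 0 := by
      refine sec_ext _ fun x hx => ?_
      obtain ⟨W, hxW, -, J, _, _, deg, B, hv⟩ := hB x
      refine ⟨U ⊓ W, inf_le_left, ⟨hx, hxW⟩, ?_⟩
      rw [map_zero, ← sMap_res]
      refine B.eq_zero_of_coord Φ hv hN inf_le_right fun γ _ b j h h' => ?_
      rw [B.coord_map]
      have := (hfg j b).choose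
      change sMap ((f.hom.f j).f b ≫ (g.hom.f j).f b) _ _ = 0
      rw [this, sMap_zero]
    rw [Φ.F.map_comp] at hz
    exact hz
  refine ⟨w, ?_⟩
  refine { exact := (exact_iff_sections _).2 fun U z hz x hx => ?_, mono_f := ?_, epi_g := ?_ }
  · refine TensorFunctor.exact hB hM f.hom g.hom (fun j b U z hz x hx => ?_) q p U z hz x hx
    exact (exact_iff_sections _).1 (hfg j b).choose_spec.exact U z hz x hx
  · exact mono_of_injective _ (TensorFunctor.injective hB hL f.hom hinj q p)
  · refine epi_of_locally_surjective _ fun U z x hx =>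
      TensorFunctor.locally_surjective hB hN g.hom (fun j b U z x hx => ?_) q p U z x hx
    have := (hfg j b).choose_spec.epi_g
    exact locally_surjective_of_epi _ U z x hx
end Exactness

section
variable {X : TopCat.{u}} {O : Sheaf (Opens.grothendieckTopology X) CommRingCat.{u}}
variable {n : ℕ} {𝒳 : CochainComplex (Mod O) ℤ} (h𝒳 : IsFiniteLocallyFree n 𝒳)
include h𝒳

lemma hasMonBases_algS : HasMonBases 𝒳 (algS 𝒳).obj := fun x => by
  obtain ⟨W, hx, ⟨E⟩⟩ := hasFrames h𝒳 x
  exact ⟨W, hx, ⟨E⟩, E.J n, inferInstance, inferInstance, _, E.basisS h𝒳, by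
    change (-2 : ℤ) < 0; norm_num⟩

lemma hasMonBases_dgDual : HasMonBases 𝒳 (dgDual (algT 𝒳)) := fun x => by
  obtain ⟨W, hx, ⟨E⟩⟩ := hasFrames h𝒳 x
  exact ⟨W, hx, ⟨E⟩, E.J n, inferInstance, inferInstance, _, E.basisTd h𝒳, by
    change -(2 : ℤ) < 0; norm_num⟩
end

/-! ### Shifts and cones -/

section ShiftCone
variable {X : TopCat.{u}} {O : Sheaf (Opens.grothendieckTopology X) CommRingCat.{u}}

namespace DGMod
variable {𝒜 : DGAlg O}

/-- The action of a section, as a local map. -/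
noncomputable def actL (M : DGMod 𝒜) {a b p i j q : ℤ} (h : a + b = p) (h' : i + j = q)
    {U : Opens X} (x : Sec (𝒜.obj a i) U) :
    LHom U (toP.obj ((M.cx j).X b)) (toP.obj ((M.cx q).X p)) :=
  ⟨fun V hV => M.act h h' V (res _ hV x), fun {V V'} hV hV' m => by
    rw [← res_res _ hV hV', M.act_res]⟩

/-- A morphism of dg-modules which is bijective on sections is an isomorphism. -/
lemma isIso_of_bijective {M N : DGMod 𝒜} (f : M ⟶ N)
    (h : ∀ j b U, Function.Bijective (sMap ((f.f j).f b) U)) : IsIso f := by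
  have h1 (j b) : IsIso ((f.f j).f b) := LinearKoszul.isIso_of_bijective _ (h j b)
  have h2 (j) : IsIso (f.f j) := HomologicalComplex.Hom.isIso_of_components _
  have h3 (j b U) (y : SSec ((N.cx j).X b) U) :
      sMap ((f.f j).f b) U (sMap ((inv (f.f j)).f b) U y) = y := by
    rw [← sMap_comp, ← HomologicalComplex.comp_f, IsIso.inv_hom_id]; rfl
  refine ⟨⟨fun j => inv (f.f j), ?_⟩, ?_, ?_⟩
  · intro a b p i j q h₁ h₁' U x m
    apply (h q p U).1
    rw [h3, f.map_act, h3]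
  · ext j : 1
    exact IsIso.hom_inv_id _
  · ext j : 1
    exact IsIso.inv_hom_id _
end DGMod

variable {n : ℕ} {𝒳 : CochainComplex (Mod O) ℤ} {P : ℤ → ℤ → PMod O} {𝒜 ℬ : DGAlg O}

namespace TensorFunctor
variable (Φ : TensorFunctor P 𝒜 ℬ) {M M' M'' : DGMod 𝒜} {p p' q : ℤ}

lemma tm_ext_frame (hF : HasFrames 𝒳) {U : Opens X} {G : Mod O}
    {f g : LHom U (toP.obj (((Φ.F.obj M).cx q).X p)) (toP.obj G)}
    (h : ∀ {a b i j : ℤ} (h : a + b = p) (h' : i + j = q) (V : Opens X) (hV : V ≤ U)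
      (_ : LocalFrame 𝒳 V) (s : Sec (P a i) V) (m : SSec ((M.cx j).X b) V),
      f.app V hV (Φ.tm M h h' V s m) = g.app V hV (Φ.tm M h h' V s m)) : f = g := by
  refine Φ.tm_ext fun h₁ h₁' V hV s m => frame_ext hF fun W hW E => ?_
  rw [← f.app_res hV hW, ← g.app_res hV hW, ← Φ.tm_res, h h₁ h₁' W _ E]

lemma hom_ext_tm {G : Mod O} {f g : ((Φ.F.obj M).cx q).X p ⟶ G}
    (h : ∀ {a b i j : ℤ} (h : a + b = p) (h' : i + j = q) (V : Opens X)
      (s : Sec (P a i) V) (m : SSec ((M.cx j).X b) V),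
      sMap f V (Φ.tm M h h' V s m) = sMap g V (Φ.tm M h h' V s m)) : f = g := by
  have : LHom.ofHom ⊤ (toP.map f) = LHom.ofHom ⊤ (toP.map g) :=
    Φ.tm_ext fun h₁ h₁' V _ s m => h h₁ h₁' V s m
  exact hom_ext_sMap fun U x => congrArg (fun f => f.app U le_top x) this

lemma hom_ext_tm_frame (hF : HasFrames 𝒳) {G : Mod O} {f g : ((Φ.F.obj M).cx q).X p ⟶ G}
    (h : ∀ {a b i j : ℤ} (h : a + b = p) (h' : i + j = q) (V : Opens X)
      (_ : LocalFrame 𝒳 V) (s : Sec (P a i) V) (m : SSec ((M.cx j).X b) V),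
      sMap f V (Φ.tm M h h' V s m) = sMap g V (Φ.tm M h h' V s m)) : f = g := by
  have : LHom.ofHom ⊤ (toP.map f) = LHom.ofHom ⊤ (toP.map g) :=
    Φ.tm_ext_frame hF fun h₁ h₁' V _ E s m => h h₁ h₁' V E s m
  exact hom_ext_sMap fun U x => congrArg (fun f => f.app U le_top x) this

/-- The map `s ⊗ m ↦ (-1)^(e |s|) s ⊗ g(m)` defined by a family `g` of maps of degree `e`. -/
noncomputable def grMap {e : ℤ}
    (g : ∀ (j : ℤ) {b b' : ℤ} (_ : b + e = b'), (M.cx j).X b ⟶ (M'.cx j).X b')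
    (h : p + e = p') (q : ℤ) : ((Φ.F.obj M).cx q).X p ⟶ ((Φ.F.obj M').cx q).X p' :=
  (Φ.tmLift (U := ⊤) fun k => ⟨fun V _ => (e * k.a).negOnePow •
      (Φ.tmL M' (by have := k.hab; omega) k.hij V).compl₂ (sMap (g k.j rfl) V),
    fun {V V'} hV hV' s m => by
      change (e * k.a).negOnePow • Φ.tm M' _ _ _ _ (sMap _ _ _) =
        res _ _ ((e * k.a).negOnePow • Φ.tm M' _ _ _ _ (sMap _ _ _))
      rw [sMap_res, Φ.tm_res, DGMod.map_unit_smul]⟩).toHom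

lemma grMap_tm {e : ℤ}
    (g : ∀ (j : ℤ) {b b' : ℤ} (_ : b + e = b'), (M.cx j).X b ⟶ (M'.cx j).X b')
    (h : p + e = p') {a b b' i j : ℤ} (h₁ : a + b = p) (h₂ : b + e = b') (h₃ : a + b' = p')
    (h' : i + j = q) (V : Opens X) (s : Sec (P a i) V) (m : SSec ((M.cx j).X b) V) :
    sMap (Φ.grMap g h q) V (Φ.tm M h₁ h' V s m) =
      (e * a).negOnePow • Φ.tm M' h₃ h' V s (sMap (g j h₂) V m) := by
  subst h₂
  exact Φ.tmLift_tm _ h₁ h' V le_top s m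

/-- The maps `grMap` commute with the action up to a sign. -/
lemma grMap_act {D : Twist n 𝒳 P 𝒜 ℬ} (hΦ : D.IsTwisted Φ) {e : ℤ}
    (g : ∀ (j : ℤ) {b b' : ℤ} (_ : b + e = b'), (M.cx j).X b ⟶ (M'.cx j).X b')
    {c p₁ p₁' l q₁ : ℤ} (h : p + e = p') (h₁ : p₁ + e = p₁') (hc : c + p = p₁) (hc' : c + p' = p₁')
    (hl : l + q = q₁) (U : Opens X) (t : Sec (ℬ.obj c l) U) (z : SSec (((Φ.F.obj M).cx q).X p) U) :
    sMap (Φ.grMap g h₁ q₁) U ((Φ.F.obj M).act hc hl U t z) =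
      (e * c).negOnePow • (Φ.F.obj M').act hc' hl U t (sMap (Φ.grMap g h q) U z) := by
  have : (LHom.ofHom U (toP.map (Φ.grMap g h₁ q₁))).comp ((Φ.F.obj M).actL hc hl t) =
      (e * c).negOnePow • ((Φ.F.obj M').actL hc' hl t).comp (LHom.ofHom U (toP.map (Φ.grMap g h q))) := by
    refine Φ.tm_ext fun {a b i j} h₂ h₂' V hV s m => ?_
    change sMap (Φ.grMap g h₁ q₁) V ((Φ.F.obj M).act hc hl V (res _ hV t) _) =
      (e * c).negOnePow • (Φ.F.obj M').act hc' hl V (res _ hV t) (sMap (Φ.grMap g h q) V _)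
    rw [Φ.grMap_tm g h h₂ rfl (by omega), DGMod.map_unit_smul, smul_smul, hΦ.act_tm M h₂ h₂' hc hl
      rfl rfl (by omega) (by omega), hΦ.act_tm M' _ h₂' hc' hl rfl rfl (by omega) (by omega),
      Φ.grMap_tm g h₁ _ rfl (by omega), ← Int.negOnePow_add, mul_add]
  have h2 := congrArg (fun f => f.app U le_rfl z) this
  change sMap (Φ.grMap g h₁ q₁) U ((Φ.F.obj M).act hc hl U (res _ le_rfl t) z) =
      (e * c).negOnePow • (Φ.F.obj M').act hc' hl U (res _ le_rfl t) (sMap (Φ.grMap g h q) U z) at h2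
  rwa [res_refl] at h2

/-- The maps `grMap` commute with the differential up to a sign, and up to the map defined by the
failure of `g` to commute with the differential. -/
lemma grMap_d {D : Twist n 𝒳 P 𝒜 ℬ} (hΦ : D.IsTwisted Φ) (hF : HasFrames 𝒳) {e : ℤ}
    (g : ∀ (j : ℤ) {b b' : ℤ} (_ : b + e = b'), (M.cx j).X b ⟶ (M'.cx j).X b')
    (g' : ∀ (j : ℤ) {b b' : ℤ} (_ : b + (e + 1) = b'), (M.cx j).X b ⟶ (M'.cx j).X b')
    (hact : ∀ {c b b₁ b' b₁' l j j₁ : ℤ} (h : b + e = b') (h₁ : b₁ + e = b₁') (hc : c + b = b₁)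
      (hc' : c + b' = b₁') (hl : l + j = j₁) (U : Opens X) (t : Sec (𝒜.obj c l) U)
      (m : SSec ((M.cx j).X b) U),
      sMap (g j₁ h₁) U (M.act hc hl U t m) = (e * c).negOnePow • M'.act hc' hl U t (sMap (g j h) U m))
    (hd : ∀ {b b₁ b' b₁' j : ℤ} (h : b + e = b') (h₁ : b₁ + e = b₁') (_ : b + 1 = b₁)
      (h₃ : b + (e + 1) = b₁') (U : Opens X) (m : SSec ((M.cx j).X b) U),
      sMap (g j h₁) U (sMap ((M.cx j).d b b₁) U m) =
        e.negOnePow • sMap ((M'.cx j).d b' b₁') U (sMap (g j h) U m) + sMap (g' j h₃) U m)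
    {p₁ p₁' : ℤ} (hp : p + 1 = p₁) (h : p + e = p') (h₁ : p₁ + e = p₁') (h₂ : p + (e + 1) = p₁')
    (U : Opens X) (z : SSec (((Φ.F.obj M).cx q).X p) U) :
    sMap (Φ.grMap g h₁ q) U (sMap (((Φ.F.obj M).cx q).d p p₁) U z) =
      e.negOnePow • sMap (((Φ.F.obj M').cx q).d p' p₁') U (sMap (Φ.grMap g h q) U z) +
        sMap (Φ.grMap g' h₂ q) U z := by
  have : (LHom.ofHom U (toP.map (Φ.grMap g h₁ q))).comp
      (LHom.ofHom U (toP.map (((Φ.F.obj M).cx q).d p p₁))) =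
      e.negOnePow • (LHom.ofHom U (toP.map (((Φ.F.obj M').cx q).d p' p₁'))).comp
        (LHom.ofHom U (toP.map (Φ.grMap g h q))) + LHom.ofHom U (toP.map (Φ.grMap g' h₂ q)) := by
    refine Φ.tm_ext_frame hF fun {a b i j} h₃ h₃' V hV E s m => ?_
    change sMap (Φ.grMap g h₁ q) V (sMap (((Φ.F.obj M).cx q).d p p₁) V _) =
      e.negOnePow • sMap (((Φ.F.obj M').cx q).d p' p₁') V (sMap (Φ.grMap g h q) V _) +
        sMap (Φ.grMap g' h₂ q) V _
    rw [Φ.grMap_tm g h h₃ rfl (by omega), Φ.grMap_tm g' h₂ h₃ rfl (by omega), DGMod.map_unit_smul,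
      hΦ.d_tm' h₃ h₃' rfl rfl hp (by omega) (by omega) V E,
      hΦ.d_tm' (p' := p₁') (b' := b + (e + 1)) _ h₃' rfl (by omega) (by omega) (by omega) (by omega) V E,
      map_add, map_add, DGMod.map_unit_smul, DGMod.map_unit_smul, map_sum,
      Φ.grMap_tm g h₁ (a := a + 1) _ rfl (by omega),
      Φ.grMap_tm g h₁ (b := b + 1) (b' := b + (e + 1)) _ (by omega) (by omega),
      hd (b₁' := b + (e + 1)) rfl (by omega) rfl rfl, ← Φ.tmL_apply (s := s), map_add,
      DGMod.map_unit_smul, Φ.tmL_apply, Φ.tmL_apply, smul_add, smul_add, smul_add, smul_add,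
      smul_add, smul_smul, smul_smul, smul_smul, smul_smul, smul_smul, smul_smul]
    have hsum : ∑ x ∈ E.idx n, sMap (Φ.grMap g h₁ q) V (Φ.tm M
          (by have := D.hε x.1; omega : a + D.ε x.1 + (D.ε' x.1 + b) = p₁)
          (by have := D.hw; omega : i + D.w + (D.w' + j) = q) V
          (D.R E x rfl rfl s) (M.act rfl rfl V (D.Z E x) m)) =
        (e * (a + 1)).negOnePow • ∑ x ∈ E.idx n, Φ.tm M' (by have := D.hε x.1; omega : a + D.ε x.1 + (D.ε' x.1 + (b + e)) = p₁')
          (by have := D.hw; omega : i + D.w + (D.w' + j) = q) V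
          (D.R E x rfl rfl s) (M'.act rfl rfl V (D.Z E x) (sMap (g j rfl) V m)) := by
      rw [Finset.smul_sum]
      refine Finset.sum_congr rfl fun x _ => ?_
      have h4 := D.hε x.1
      rw [Φ.grMap_tm g h₁ (b' := D.ε' x.1 + (b + e)) _ (by omega) (by omega),
        hact (b' := b + e) rfl (by omega) rfl rfl rfl, ← Φ.tmL_apply, DGMod.map_unit_smul,
        smul_smul, ← Int.negOnePow_add, Φ.tmL_apply, ← mul_add, add_assoc,
        show e * (a + (D.ε x.1 + D.ε' x.1)) = e * (a + 1) by rw [h4]]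
    rw [hsum]
    simp only [smul_add, smul_smul, mul_add, mul_one, Int.negOnePow_add, mul_comm, mul_left_comm]
    abel
  exact congrArg (fun f => f.app U le_rfl z) this

lemma grMap_grMap {e e' : ℤ}
    (g : ∀ (j : ℤ) {b b' : ℤ} (_ : b + e = b'), (M.cx j).X b ⟶ (M'.cx j).X b')
    (g' : ∀ (j : ℤ) {b b' : ℤ} (_ : b + e' = b'), (M'.cx j).X b ⟶ (M''.cx j).X b')
    {p'' : ℤ} (h : p + e = p') (h₁ : p' + e' = p'') {a b b' b'' i j : ℤ} (h₂ : a + b = p)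
    (h₃ : b + e = b') (h₄ : b' + e' = b'') (h₅ : a + b'' = p'')
    (h' : i + j = q) (V : Opens X) (s : Sec (P a i) V) (m : SSec ((M.cx j).X b) V) :
    sMap (Φ.grMap g' h₁ q) V (sMap (Φ.grMap g h q) V (Φ.tm M h₂ h' V s m)) =
      ((e + e') * a).negOnePow • Φ.tm M'' h₅ h' V s (sMap (g' j h₄) V (sMap (g j h₃) V m)) := by
  rw [Φ.grMap_tm g h h₂ h₃ (by omega), DGMod.map_unit_smul, Φ.grMap_tm g' h₁ _ h₄ h₅, smul_smul,
    ← Int.negOnePow_add, add_mul]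
end TensorFunctor

open CochainComplex CochainComplex.HomComplex DGMod
section
variable {Φ : TensorFunctor P 𝒜 ℬ} {D : Twist n 𝒳 P 𝒜 ℬ} (hΦ : D.IsTwisted Φ) (hF : HasFrames 𝒳)

lemma shiftObj_d (M : DGMod 𝒜) {b b' j : ℤ} {U : Opens X} (m : SSec ((M.shiftObj.cx j).X b) U) :
    sMap ((M.shiftObj.cx j).d b b') U m =
      -sMap ((M.cx j).d (b + 1) (b' + 1)) U (m : SSec ((M.cx j).X (b + 1)) U) := by
  have : (M.shiftObj.cx j).d b b' = -(M.cx j).d (b + 1) (b' + 1) := by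
    change (1 : ℤ).negOnePow • (M.cx j).d (b + 1) (b' + 1) = _
    rw [Int.negOnePow_one, Units.neg_smul, one_smul]
  rw [this]; rfl

/-- The identification of the components of `M[1]` with those of `M`. -/
noncomputable def unshift (M : DGMod 𝒜) (j : ℤ) {b b' : ℤ} (h : b + 1 = b') :
    (M.shiftObj.cx j).X b ⟶ (M.cx j).X b' := eqToHom (by subst h; rfl)

include hΦ hF in
lemma shift_d (M : DGMod 𝒜) {p p' q : ℤ} (h : p + 1 = p') (U : Opens X)
    (z : SSec (((Φ.F.obj M.shiftObj).cx q).X p) U) :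
    sMap (Φ.grMap (unshift M) (rfl : p' + 1 = p' + 1) q) U
      (sMap (((Φ.F.obj M.shiftObj).cx q).d p p') U z) =
      -sMap (((Φ.F.obj M).cx q).d (p + 1) (p' + 1)) U
        (sMap (Φ.grMap (unshift M) (rfl : p + 1 = p + 1) q) U z) := by
  rw [Φ.grMap_d hΦ hF (unshift M) (fun j {b b'} _ => 0) ?_ ?_ h rfl rfl (by omega) U z]
  · have : Φ.grMap (M := M.shiftObj) (M' := M) (p := p) (p' := p' + 1) (e := 1 + 1) (fun j {b b'} _ => 0)
        (by omega) q = 0 := by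
      refine Φ.hom_ext_tm fun h₁ h₁' V s m => ?_
      rw [Φ.grMap_tm _ _ h₁ rfl (by omega), sMap_zero, sMap_zero, ← Φ.tmL_apply, map_zero, smul_zero]
    rw [this, sMap_zero, add_zero, Int.negOnePow_one, Units.neg_smul, one_smul]
  · intro c b b₁ b' b₁' l j j₁ h h₁ hc hc' hl U t m
    subst h h₁
    rw [one_mul]
    exact M.shiftAct_apply hc hl U t m
  · intro b b₁ b' b₁' j h h₁ h₂ h₃ U m
    subst h h₁
    rw [sMap_zero, add_zero, Int.negOnePow_one, Units.neg_smul, one_smul]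
    exact shiftObj_d M m

/-- The comparison `s ⊗ m ↦ (-1)^|s| s ⊗ m` between the image of `M[1]` and the shift of the image
of `M`. -/
noncomputable def shiftHom (M : DGMod 𝒜) : Φ.F.obj M.shiftObj ⟶ (Φ.F.obj M).shiftObj where
  f q :=
    { f p := Φ.grMap (unshift M) (rfl : p + 1 = p + 1) q
      comm' p p' h := hom_ext_sMap fun U z => by
        refine (shiftObj_d _ _).trans ?_
        exact (shift_d hΦ hF M h U z).symm }
  map_act {a b p i j q} h h' U x m := by
    refine (Φ.grMap_act hΦ (unshift M) rfl rfl h (by omega) h' U x m).trans ?_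
    rw [one_mul]
    exact ((Φ.F.obj M).shiftAct_apply h h' U x _).symm

lemma shiftHom_tm (M : DGMod 𝒜) {a b p i j q : ℤ} (h : a + b = p) (h' : i + j = q) (U : Opens X)
    (s : Sec (P a i) U) (m : SSec ((M.cx j).X (b + 1)) U) :
    sMap (((shiftHom hΦ hF M).f q).f p) U (Φ.tm M.shiftObj h h' U s m) =
      a.negOnePow • Φ.tm M (by omega : a + (b + 1) = p + 1) h' U s m := by
  refine (Φ.grMap_tm (unshift M) rfl h rfl (by omega) h' U s m).trans ?_
  rw [one_mul]; rfl

lemma shiftHom_naturality {M N : DGMod 𝒜} (f : M ⟶ N) :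
    Φ.F.map ((DGMod.shiftFunctor 𝒜).map f) ≫ shiftHom hΦ hF N =
      shiftHom hΦ hF M ≫ (DGMod.shiftFunctor ℬ).map (Φ.F.map f) := by
  refine DGMod.hom_ext fun q => HomologicalComplex.hom_ext _ _ fun p => ?_
  refine Φ.hom_ext_tm fun {a b i j} h h' V s m => ?_
  refine (congrArg (sMap (((shiftHom hΦ hF N).f q).f p) V)
    (Φ.map_tm ((DGMod.shiftFunctor 𝒜).map f) h h' V s m)).trans ?_
  refine (shiftHom_tm hΦ hF N h h' V s _).trans ?_
  refine Eq.trans ?_ (congrArg (sMap (((Φ.F.map f).f q).f (p + 1)) V)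
    (shiftHom_tm hΦ hF M h h' V s m)).symm
  refine Eq.trans ?_ (map_unit_smul (sMap (((Φ.F.map f).f q).f (p + 1)) V) _ _).symm
  exact congrArg (a.negOnePow • ·) (Φ.map_tm f _ h' V s _).symm

/-- The inverse of `unshift`. -/
noncomputable def reshift (M : DGMod 𝒜) (j : ℤ) {b b' : ℤ} (h : b + -1 = b') :
    (M.cx j).X b ⟶ (M.shiftObj.cx j).X b' :=
  eqToHom (congrArg (M.cx j).X (by omega : b = b' + 1))

lemma isIso_shiftHom (M : DGMod 𝒜) : IsIso (shiftHom hΦ hF M) := by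
  refine DGMod.isIso_of_bijective _ fun q p U => Function.bijective_iff_has_inverse.2
    ⟨sMap (Φ.grMap (reshift M) (by omega : p + 1 + -1 = p) q) U, fun z => ?_, fun z => ?_⟩
  · have : Φ.grMap (unshift M) (rfl : p + 1 = p + 1) q ≫ Φ.grMap (reshift M) (by omega) q = 𝟙 _ := by
      refine Φ.hom_ext_tm fun {a b i j} h h' V s m => ?_
      refine (Φ.grMap_grMap _ _ rfl (by omega) h rfl (by omega : b + 1 + -1 = b) h h' V s m).trans ?_
      rw [add_neg_cancel, zero_mul, Int.negOnePow_zero, one_smul, sMap_id]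
      rfl
    exact congrArg (fun f => sMap f U z) this
  · have : Φ.grMap (reshift M) (by omega : p + 1 + -1 = p) q ≫
        Φ.grMap (unshift M) (rfl : p + 1 = p + 1) q = 𝟙 _ := by
      refine Φ.hom_ext_tm fun {a b i j} h h' V s m => ?_
      obtain ⟨b, rfl⟩ : ∃ c, b = c + 1 := ⟨b - 1, by omega⟩
      refine (Φ.grMap_grMap _ _ (by omega) rfl h (by omega : b + 1 + -1 = b) rfl h h' V s m).trans ?_
      rw [neg_add_cancel, zero_mul, Int.negOnePow_zero, one_smul, sMap_id]
      rfl
    exact congrArg (fun f => sMap f U z) this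

section cone
variable {M N : DGMod 𝒜} (φ : M ⟶ N)

/-- The first projection of the cone, in all degrees. -/
noncomputable def coneFst (j : ℤ) {b b' : ℤ} (h : b + 1 = b') :
    ((cone φ).cx j).X b ⟶ (M.cx j).X b' := (mappingCone.fst (φ.f j)).1.v b b' h
/-- The second projection of the cone, in all degrees. -/
noncomputable def coneSnd (j : ℤ) {b b' : ℤ} (h : b + 0 = b') :
    ((cone φ).cx j).X b ⟶ (N.cx j).X b' := (mappingCone.snd (φ.f j)).v b b' h
/-- The first inclusion of the cone, in all degrees. -/
noncomputable def coneInl (j : ℤ) {b b' : ℤ} (h : b + -1 = b') :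
    (M.cx j).X b ⟶ ((cone φ).cx j).X b' := (mappingCone.inl (φ.f j)).v b b' h

section
variable {j b : ℤ} {U : Opens X}
lemma coneSnd_coneInl (h : b + 1 + -1 = b) (m : SSec ((M.cx j).X (b + 1)) U) :
    sMap (coneSnd φ j (add_zero b)) U (sMap (coneInl φ j h) U m) = 0 := cSnd_cInl (φ.f j) b m
lemma coneFst_coneInl (h : b + 1 + -1 = b) (m : SSec ((M.cx j).X (b + 1)) U) :
    sMap (coneFst φ j rfl) U (sMap (coneInl φ j h) U m) = m := cFst_cInl (φ.f j) b m
lemma coneFst_coneInr (m : SSec ((N.cx j).X b) U) :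
    sMap (coneFst φ j rfl) U (sMap (((coneInr φ).f j).f b) U m) = 0 := cFst_cInr (φ.f j) b m
lemma coneSnd_coneInr (m : SSec ((N.cx j).X b) U) :
    sMap (coneSnd φ j (add_zero b)) U (sMap (((coneInr φ).f j).f b) U m) = m := cSnd_cInr (φ.f j) b m
lemma c_id {K L : CochainComplex (Mod O) ℤ} (f : K ⟶ L) (m : SSec ((mappingCone f).X b) U) :
    sMap (cInl f b) U (sMap (cFst f b) U m) + sMap (cInr f b) U (sMap (cSnd f b) U m) = m := by
  apply c_ext f
  · rw [map_add, cFst_cInl, cFst_cInr, add_zero]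
  · rw [map_add, cSnd_cInl, cSnd_cInr, zero_add]
lemma cone_id (h : b + 1 + -1 = b) (m : SSec (((cone φ).cx j).X b) U) :
    sMap (coneInl φ j h) U (sMap (coneFst φ j rfl) U m) +
      sMap (((coneInr φ).f j).f b) U (sMap (coneSnd φ j (add_zero b)) U m) = m :=
  c_id (φ.f j) m
lemma cProj_apply {K L : CochainComplex (Mod O) ℤ} (f : K ⟶ L) (m : SSec ((mappingCone f).X b) U) :
    sMap (cProj f b) U m = -sMap (cFst f b) U m := by rw [cProj_eq, sMap_neg]
lemma coneProj_apply (m : SSec (((cone φ).cx j).X b) U) :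
    sMap (((coneProj φ).f j).f b) U m = -sMap (coneFst φ j (rfl : b + 1 = b + 1)) U m :=
  cProj_apply (φ.f j) m

variable {p q : ℤ} {Φ : TensorFunctor P 𝒜 ℬ}
lemma coneInr_grMap_coneFst : ((Φ.F.map (coneInr φ)).f q).f p ≫
    Φ.grMap (coneFst φ) (rfl : p + 1 = p + 1) q = 0 := by
  refine Φ.hom_ext_tm fun {a b i j} h h' V s m => ?_
  rw [sMap_comp, Φ.map_tm, Φ.grMap_tm _ _ h rfl (by omega), sMap_zero, coneFst_coneInr,
    ← Φ.tmL_apply, map_zero, smul_zero]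
lemma coneInr_grMap_coneSnd : ((Φ.F.map (coneInr φ)).f q).f p ≫
    Φ.grMap (coneSnd φ) (add_zero p) q = 𝟙 _ := by
  refine Φ.hom_ext_tm fun {a b i j} h h' V s m => ?_
  rw [sMap_comp, Φ.map_tm, Φ.grMap_tm _ _ h (add_zero b) h, zero_mul, Int.negOnePow_zero, one_smul,
    sMap_id, coneSnd_coneInr]
end

include hΦ hF in
lemma grMap_coneFst_d {p p' q : ℤ} (h : p + 1 = p') (U : Opens X)
    (z : SSec (((Φ.F.obj (cone φ)).cx q).X p) U) :
    sMap (Φ.grMap (coneFst φ) (rfl : p' + 1 = p' + 1) q) U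
      (sMap (((Φ.F.obj (cone φ)).cx q).d p p') U z) =
      -sMap (((Φ.F.obj M).cx q).d (p + 1) (p' + 1)) U
        (sMap (Φ.grMap (coneFst φ) (rfl : p + 1 = p + 1) q) U z) := by
  rw [Φ.grMap_d hΦ hF (coneFst φ) (fun j {b b'} _ => 0) ?_ ?_ h rfl rfl (by omega) U z]
  · have : Φ.grMap (M := cone φ) (M' := M) (p := p) (p' := p' + 1) (e := 1 + 1) (fun j {b b'} _ => 0)
        (by omega) q = 0 := by
      refine Φ.hom_ext_tm fun h₁ h₁' V s m => ?_
      rw [Φ.grMap_tm _ _ h₁ rfl (by omega), sMap_zero, sMap_zero, ← Φ.tmL_apply, map_zero, smul_zero]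
    rw [this, sMap_zero, add_zero, Int.negOnePow_one, Units.neg_smul, one_smul]
  · intro c b b₁ b' b₁' l j j₁ h h₁ hc hc' hl U t m
    subst h h₁
    rw [one_mul]
    exact (cFst_act φ hc hl U t m).trans (M.shiftAct_apply hc hl U t _)
  · intro b b₁ b' b₁' j h h₁ h₂ h₃ U m
    subst h h₁ h₂
    rw [sMap_zero, add_zero, Int.negOnePow_one, Units.neg_smul, one_smul]
    exact cFst_d (φ.f j) m

include hΦ hF in
lemma grMap_coneSnd_d {p p' q : ℤ} (h : p + 1 = p') (U : Opens X)
    (z : SSec (((Φ.F.obj (cone φ)).cx q).X p) U) :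
    sMap (Φ.grMap (coneSnd φ) (add_zero p') q) U
      (sMap (((Φ.F.obj (cone φ)).cx q).d p p') U z) =
      sMap (((Φ.F.map φ).f q).f p') U (sMap (Φ.grMap (coneFst φ) h q) U z) +
      sMap (((Φ.F.obj N).cx q).d p p') U
        (sMap (Φ.grMap (coneSnd φ) (add_zero p) q) U z) := by
  rw [Φ.grMap_d hΦ hF (coneSnd φ) (fun j {b b'} h => coneFst φ j (by omega) ≫ (φ.f j).f b') ?_ ?_ h
    (add_zero p) (add_zero p') (by omega) U z]
  · have : Φ.grMap (M := cone φ) (M' := N) (p := p) (p' := p') (e := 0 + 1)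
        (fun j {b b'} h => coneFst φ j (by omega) ≫ (φ.f j).f b')
        (by omega) q = Φ.grMap (coneFst φ) h q ≫ ((Φ.F.map φ).f q).f p' := by
      refine Φ.hom_ext_tm fun {a b i j} h₁ h₁' V s m => ?_
      rw [Φ.grMap_tm _ _ h₁ (b' := b + 1) (by omega) (by omega), sMap_comp, sMap_comp,
        Φ.grMap_tm _ _ h₁ rfl (by omega), map_unit_smul, Φ.map_tm,
        show ((0 : ℤ) + 1) * a = 1 * a by ring]
    rw [this, Int.negOnePow_zero, one_smul, sMap_comp, add_comm]
  · intro c b b₁ b' b₁' l j j₁ h h₁ hc hc' hl U t m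
    obtain rfl : b = b' := by omega
    obtain rfl : b₁ = b₁' := by omega
    rw [zero_mul, Int.negOnePow_zero, one_smul]
    exact cSnd_act φ hc hl U t m
  · intro b b₁ b' b₁' j h h₁ h₂ h₃ U m
    obtain rfl : b = b' := by omega
    obtain rfl : b₁ = b₁' := by omega
    subst h₂
    rw [Int.negOnePow_zero, one_smul]
    exact (cSnd_d (φ.f j) m).trans (add_comm _ _)

/-- The components of the comparison between the image of a cone and the cone of the image. -/
noncomputable def coneHomX (p q : ℤ) :
    ((Φ.F.obj (cone φ)).cx q).X p ⟶ (mappingCone ((Φ.F.map φ).f q)).X p :=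
  Φ.grMap (coneFst φ) (rfl : p + 1 = p + 1) q ≫ cInl ((Φ.F.map φ).f q) p +
    Φ.grMap (coneSnd φ) (add_zero p) q ≫ cInr ((Φ.F.map φ).f q) p

lemma cFst_coneHomX (p q : ℤ) (U : Opens X) (z : SSec (((Φ.F.obj (cone φ)).cx q).X p) U) :
    sMap (cFst ((Φ.F.map φ).f q) p) U (sMap (coneHomX φ p q) U z) =
      sMap (Φ.grMap (coneFst φ) (rfl : p + 1 = p + 1) q) U z := by
  rw [coneHomX, sMap_add, sMap_comp, sMap_comp, map_add, cFst_cInl, cFst_cInr, add_zero]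

lemma cSnd_coneHomX (p q : ℤ) (U : Opens X) (z : SSec (((Φ.F.obj (cone φ)).cx q).X p) U) :
    sMap (cSnd ((Φ.F.map φ).f q) p) U (sMap (coneHomX φ p q) U z) =
      sMap (Φ.grMap (coneSnd φ) (add_zero p) q) U z := by
  rw [coneHomX, sMap_add, sMap_comp, sMap_comp, map_add, cSnd_cInl, cSnd_cInr, zero_add]

include hΦ hF in
lemma coneHomX_d (p q : ℤ) (U : Opens X) (z : SSec (((Φ.F.obj (cone φ)).cx q).X p) U) :
    sMap ((mappingCone ((Φ.F.map φ).f q)).d p (p + 1)) U (sMap (coneHomX φ p q) U z) =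
      sMap (coneHomX φ (p + 1) q) U (sMap (((Φ.F.obj (cone φ)).cx q).d p (p + 1)) U z) := by
  apply c_ext ((Φ.F.map φ).f q)
  · rw [cFst_d, cFst_coneHomX, cFst_coneHomX, grMap_coneFst_d hΦ hF φ rfl]
  · rw [cSnd_d, cFst_coneHomX, cSnd_coneHomX, cSnd_coneHomX, grMap_coneSnd_d hΦ hF φ rfl]

/-- The comparison between the image of a cone and the cone of the image. -/
noncomputable def coneHom : Φ.F.obj (cone φ) ⟶ cone (Φ.F.map φ) where
  f q :=
    { f p := coneHomX φ p q
      comm' p p' h := hom_ext_sMap fun U z => by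
        obtain rfl : p + 1 = p' := h
        exact coneHomX_d hΦ hF φ p q U z }
  map_act {a b p i j q} h h' U x m := by
    apply c_ext ((Φ.F.map φ).f q)
    · refine (cFst_coneHomX φ _ q U _).trans ?_
      refine Eq.trans ?_ (cFst_act (Φ.F.map φ) h h' U x _).symm
      refine Eq.trans ?_ (congrArg ((Φ.F.obj M).shiftAct h h' U x) (cFst_coneHomX φ _ j U _)).symm
      refine (Φ.grMap_act hΦ (coneFst φ) rfl rfl h (by omega) h' U x m).trans ?_
      rw [one_mul]
      exact ((Φ.F.obj M).shiftAct_apply h h' U x _).symm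
    · refine (cSnd_coneHomX φ _ q U _).trans ?_
      refine Eq.trans ?_ (cSnd_act (Φ.F.map φ) h h' U x _).symm
      refine Eq.trans ?_ (congrArg ((Φ.F.obj N).act h h' U x) (cSnd_coneHomX φ _ j U _)).symm
      refine (Φ.grMap_act hΦ (coneSnd φ) (add_zero _) (add_zero _) h h h' U x m).trans ?_
      rw [zero_mul, Int.negOnePow_zero, one_smul]

/-- The components of the inverse are built from the two inclusions of the cone. -/
lemma isIso_coneHom : IsIso (coneHom hΦ hF φ) := by
  refine DGMod.isIso_of_bijective _ fun q p U => Function.bijective_iff_has_inverse.2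
    ⟨fun v => sMap (Φ.grMap (coneInl φ) (by omega : p + 1 + -1 = p) q) U
      (sMap (cFst ((Φ.F.map φ).f q) p) U v) + sMap (((Φ.F.map (coneInr φ)).f q).f p) U
        (sMap (cSnd ((Φ.F.map φ).f q) p) U v), fun z => ?_, fun v => ?_⟩
  · have : Φ.grMap (coneFst φ) (rfl : p + 1 = p + 1) q ≫ Φ.grMap (coneInl φ) (by omega) q +
        Φ.grMap (coneSnd φ) (add_zero p) q ≫ ((Φ.F.map (coneInr φ)).f q).f p = 𝟙 _ := by
      refine Φ.hom_ext_tm fun {a b i j} h h' V s m => ?_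
      rw [sMap_add, sMap_comp, sMap_comp, Φ.grMap_grMap _ _ rfl (by omega) h rfl
        (by omega : b + 1 + -1 = b) h h' V s m, Φ.grMap_tm _ _ h (add_zero b) h, map_unit_smul,
        Φ.map_tm, add_neg_cancel, zero_mul, Int.negOnePow_zero, one_smul, one_smul, sMap_id,
        ← Φ.tmL_apply, ← Φ.tmL_apply, ← map_add, Φ.tmL_apply, cone_id]
    refine Eq.trans ?_ (congrArg (fun f => sMap f U z) this)
    exact congrArg₂ (fun x y => sMap (Φ.grMap (coneInl φ) (by omega : p + 1 + -1 = p) q) U x +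
      sMap (((Φ.F.map (coneInr φ)).f q).f p) U y) (cFst_coneHomX φ p q U z) (cSnd_coneHomX φ p q U z)
  · have h1 : Φ.grMap (coneInl φ) (by omega : p + 1 + -1 = p) q ≫
        Φ.grMap (coneFst φ) (rfl : p + 1 = p + 1) q = 𝟙 _ := by
      refine Φ.hom_ext_tm fun {a b i j} h h' V s m => ?_
      obtain ⟨b, rfl⟩ : ∃ c, b = c + 1 := ⟨b - 1, by omega⟩
      rw [sMap_comp, Φ.grMap_grMap _ _ (by omega) rfl h (by omega : b + 1 + -1 = b) rfl h h' V s m,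
        neg_add_cancel, zero_mul, Int.negOnePow_zero, one_smul, sMap_id, coneFst_coneInl]
    have h2 : Φ.grMap (coneInl φ) (by omega : p + 1 + -1 = p) q ≫
        Φ.grMap (coneSnd φ) (add_zero p) q = 0 := by
      refine Φ.hom_ext_tm fun {a b i j} h h' V s m => ?_
      obtain ⟨b, rfl⟩ : ∃ c, b = c + 1 := ⟨b - 1, by omega⟩
      rw [sMap_comp, Φ.grMap_grMap _ _ (by omega) (add_zero p) h (by omega : b + 1 + -1 = b)
        (add_zero b) (by omega) h' V s m, sMap_zero, coneSnd_coneInl, ← Φ.tmL_apply, map_zero, smul_zero]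
    apply c_ext ((Φ.F.map φ).f q)
    · refine (cFst_coneHomX φ p q U _).trans ?_
      rw [map_add, ← sMap_comp, ← sMap_comp, h1, coneInr_grMap_coneFst, sMap_id, sMap_zero, add_zero]
    · refine (cSnd_coneHomX φ p q U _).trans ?_
      rw [map_add, ← sMap_comp, ← sMap_comp, h2, coneInr_grMap_coneSnd, sMap_id, sMap_zero, zero_add]

lemma coneInr_coneHom : Φ.F.map (coneInr φ) ≫ coneHom hΦ hF φ = coneInr (Φ.F.map φ) := by
  refine DGMod.hom_ext fun q => HomologicalComplex.hom_ext _ _ fun p => hom_ext_sMap fun V z => ?_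
  apply c_ext ((Φ.F.map φ).f q)
  · refine (cFst_coneHomX φ p q V _).trans ?_
    refine Eq.trans ?_ (cFst_cInr ((Φ.F.map φ).f q) p _).symm
    exact congrArg (fun f => sMap f V z) (coneInr_grMap_coneFst φ)
  · refine (cSnd_coneHomX φ p q V _).trans ?_
    refine Eq.trans ?_ (cSnd_cInr ((Φ.F.map φ).f q) p _).symm
    exact congrArg (fun f => sMap f V z) (coneInr_grMap_coneSnd φ)

lemma coneHom_coneProj : coneHom hΦ hF φ ≫ coneProj (Φ.F.map φ) =
    Φ.F.map (coneProj φ) ≫ shiftHom hΦ hF M := by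
  refine DGMod.hom_ext fun q => HomologicalComplex.hom_ext _ _ fun p => ?_
  refine Φ.hom_ext_tm fun {a b i j} h h' V s m => ?_
  change @Eq (SSec (((Φ.F.obj M).cx q).X (p + 1)) V) _ _
  refine (cProj_apply ((Φ.F.map φ).f q) (sMap (coneHomX φ p q) V (Φ.tm _ h h' V s m))).trans ?_
  refine (congrArg Neg.neg (cFst_coneHomX φ p q V _)).trans ?_
  refine Eq.trans ?_ (congrArg (sMap (((shiftHom hΦ hF M).f q).f p) V)
    (Φ.map_tm (coneProj φ) h h' V s m)).symm
  refine Eq.trans ?_ (shiftHom_tm hΦ hF M h h' V s _).symm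
  refine Eq.trans ?_ (congrArg (fun x => a.negOnePow • Φ.tmL M (by omega : a + (b + 1) = p + 1) h' V s x)
    (coneProj_apply φ m)).symm
  rw [map_neg, smul_neg, Φ.tmL_apply, Φ.grMap_tm _ _ h rfl (by omega), one_mul]
end cone
end
end ShiftCone

/-! ### Derived functors -/

section TriangulatedFunctors
variable {X : TopCat.{u}} {O : Sheaf (Opens.grothendieckTopology X) CommRingCat.{u}}
variable {n : ℕ} {𝒳 : CochainComplex (Mod O) ℤ} {P : ℤ → ℤ → PMod O} {𝒜 ℬ : DGAlg O}
variable {Q : ObjectProperty (Mod O)}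
open DGMod

lemma boundedBy_cone {M N : DGMod 𝒜} (φ : M ⟶ N) {k : ℤ} (hM : BoundedBy M k)
    (hN : BoundedBy N k) : BoundedBy (cone φ) k := fun j hj i => isZero_of_sections fun U m => by
  rw [← cone_id φ (by omega) m, subsingleton_of_isZero (hM j hj _) U (sMap (coneFst φ j rfl) U m),
    subsingleton_of_isZero (hN j hj _) U (sMap (coneSnd φ j (add_zero i)) U m), map_zero, map_zero,
    add_zero]

lemma BoundedBy.mono {M : DGMod 𝒜} {k l : ℤ} (h : BoundedBy M k) (hkl : k ≤ l) : BoundedBy M l :=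
  fun j hj => h j (hkl.trans_lt hj)

/-- The functor preserves quasi-isomorphisms, as it commutes with cones and preserves acyclicity. -/
lemma Twist.IsTwisted.preservesQis {Φ : TensorFunctor P 𝒜 ℬ} {D : Twist n 𝒳 P 𝒜 ℬ}
    (hΦ : D.IsTwisted Φ) (hF : HasFrames 𝒳) (hB : HasMonBases 𝒳 P) (hw : D.w ≠ 0)
    (h : ∀ M, minus 𝒜 Q M → minus ℬ Q (Φ.F.obj M)) : PreservesQis (restrictMinus Φ.F h) := by
  intro M N f hf q
  obtain ⟨k₁, hM⟩ := M.property.1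
  obtain ⟨k₂, hN⟩ := N.property.1
  refine (quasiIso_iff_acyclic_mappingCone _).2 ?_
  have hM' : BoundedBy M.obj (max k₁ k₂) := BoundedBy.mono hM (le_max_left _ _)
  have hN' : BoundedBy N.obj (max k₁ k₂) := BoundedBy.mono hN (le_max_right _ _)
  have := hΦ.acyclic hB hw (boundedBy_cone f.hom hM' hN')
    (fun j => (quasiIso_iff_acyclic_mappingCone _).1 (hf j)) q
  have hiso := isIso_coneHom hΦ hF f.hom
  let F : DGMod ℬ ⥤ CochainComplex (Mod O) ℤ := { obj M := M.cx q, map f := f.f q }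
  exact acyclic_of_iso (F.mapIso (asIso (coneHom hΦ hF f.hom))) this

section
variable (F : CMinus 𝒜 Q ⥤ CMinus ℬ Q) (hF : PreservesQis F)

lemma toD_derived : toD ⋙ derived F hF = F ⋙ toD := Localization.Construction.fac _ _

lemma derived_map {M N : CMinus 𝒜 Q} (f : M ⟶ N) :
    (derived F hF).map (toD.map f) = toD.map (F.map f) := by
  refine (Functor.congr_hom (toD_derived F hF) f).trans ?_
  exact (Category.id_comp _).trans (Category.comp_id _)

end

section
variable (F : CMinus 𝒜 Q ⥤ CMinus ℬ Q) (hF : PreservesQis F)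
variable {𝒞 : DGAlg O} (G : CMinus ℬ Q ⥤ CMinus 𝒞 Q) (hG : PreservesQis G)

lemma toD_derived_derived : toD ⋙ derived F hF ⋙ derived G hG = F ⋙ G ⋙ toD := by
  rw [← toD_derived G hG, ← Functor.assoc, toD_derived, Functor.assoc]

variable (F' : CMinus 𝒜 Q ⥤ CMinus ℬ Q) (hF' : PreservesQis F')

/-- Composites of derived functors are isomorphic if the composites of the functors are. -/
noncomputable def derivedCompIso {ℬ' : DGAlg O} (F' : CMinus 𝒜 Q ⥤ CMinus ℬ' Q)
    (hF' : PreservesQis F') (G' : CMinus ℬ' Q ⥤ CMinus 𝒞 Q) (hG' : PreservesQis G')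
    (e : F ⋙ G ≅ F' ⋙ G') : derived F hF ⋙ derived G hG ≅ derived F' hF' ⋙ derived G' hG' :=
  letI : Localization.Lifting (qis 𝒜 Q).Q (qis 𝒜 Q) (F ⋙ G ⋙ toD) (derived F hF ⋙ derived G hG) :=
    ⟨eqToIso (toD_derived_derived F hF G hG)⟩
  letI : Localization.Lifting (qis 𝒜 Q).Q (qis 𝒜 Q) (F' ⋙ G' ⋙ toD)
      (derived F' hF' ⋙ derived G' hG') := ⟨eqToIso (toD_derived_derived F' hF' G' hG')⟩
  Localization.liftNatIso (qis 𝒜 Q).Q (qis 𝒜 Q) (F ⋙ G ⋙ toD) (F' ⋙ G' ⋙ toD) _ _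
    (Functor.isoWhiskerRight e toD)

lemma derivedCompIso_hom_app {ℬ' : DGAlg O} (F' : CMinus 𝒜 Q ⥤ CMinus ℬ' Q)
    (hF' : PreservesQis F') (G' : CMinus ℬ' Q ⥤ CMinus 𝒞 Q) (hG' : PreservesQis G')
    (e : F ⋙ G ≅ F' ⋙ G') (M : CMinus 𝒜 Q) :
    (derivedCompIso F hF G hG F' hF' G' hG' e).hom.app (toD.obj M) = toD.map (e.hom.app M) := by
  let _ : Localization.Lifting (qis 𝒜 Q).Q (qis 𝒜 Q) (F ⋙ G ⋙ toD) (derived F hF ⋙ derived G hG) :=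
    ⟨eqToIso (toD_derived_derived F hF G hG)⟩
  let _ : Localization.Lifting (qis 𝒜 Q).Q (qis 𝒜 Q) (F' ⋙ G' ⋙ toD)
      (derived F' hF' ⋙ derived G' hG') := ⟨eqToIso (toD_derived_derived F' hF' G' hG')⟩
  refine (Localization.liftNatTrans_app _ (qis 𝒜 Q) (F ⋙ G ⋙ toD) (F' ⋙ G' ⋙ toD) _ _ _ M).trans ?_
  change (eqToHom (toD_derived_derived F hF G hG)).app M ≫ toD.map (e.hom.app M) ≫
    (eqToHom (toD_derived_derived F' hF' G' hG').symm).app M = _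
  rw [eqToHom_app, eqToHom_app]
  exact (Category.id_comp _).trans (Category.comp_id _)

/-- If the composite of two functors that preserve quasi-isomorphisms is connected to the identity
by a natural transformation consisting of quasi-isomorphisms, then the composite of the derived
functors is isomorphic to the identity. -/
lemma nonempty_derived_comp_iso (G : CMinus ℬ Q ⥤ CMinus 𝒜 Q) (hG : PreservesQis G)
    (e : F ⋙ G ⟶ 𝟭 _) (he : ∀ M, qis 𝒜 Q (e.app M)) :
    Nonempty (derived F hF ⋙ derived G hG ≅ 𝟭 (DMinus 𝒜 Q)) := by
  have hiso (M : CMinus 𝒜 Q) : IsIso ((Functor.whiskerRight e (toD (P := Q))).app M) :=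
    Localization.inverts (qis 𝒜 Q).Q (qis 𝒜 Q) _ (he M)
  have : IsIso (Functor.whiskerRight e (toD (P := Q))) := NatIso.isIso_of_isIso_app _
  let _ : Localization.Lifting (qis 𝒜 Q).Q (qis 𝒜 Q) (F ⋙ G ⋙ toD) (derived F hF ⋙ derived G hG) :=
    ⟨eqToIso (toD_derived_derived F hF G hG)⟩
  let _ : Localization.Lifting (qis 𝒜 Q).Q (qis 𝒜 Q) toD (𝟭 (DMinus 𝒜 Q)) := ⟨Functor.rightUnitor _⟩
  exact ⟨Localization.liftNatIso (qis 𝒜 Q).Q (qis 𝒜 Q) (F ⋙ G ⋙ toD) toD _ _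
    (asIso (Functor.whiskerRight e (toD (P := Q))) ≪≫ Functor.leftUnitor _)⟩

lemma nonempty_derived_comp_iso' (G : CMinus ℬ Q ⥤ CMinus 𝒜 Q) (hG : PreservesQis G)
    (e : 𝟭 _ ⟶ F ⋙ G) (he : ∀ M, qis 𝒜 Q (e.app M)) :
    Nonempty (derived F hF ⋙ derived G hG ≅ 𝟭 (DMinus 𝒜 Q)) := by
  have hiso (M : CMinus 𝒜 Q) : IsIso ((Functor.whiskerRight e (toD (P := Q))).app M) :=
    Localization.inverts (qis 𝒜 Q).Q (qis 𝒜 Q) _ (he M)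
  have : IsIso (Functor.whiskerRight e (toD (P := Q))) := NatIso.isIso_of_isIso_app _
  let _ : Localization.Lifting (qis 𝒜 Q).Q (qis 𝒜 Q) (F ⋙ G ⋙ toD) (derived F hF ⋙ derived G hG) :=
    ⟨eqToIso (toD_derived_derived F hF G hG)⟩
  let _ : Localization.Lifting (qis 𝒜 Q).Q (qis 𝒜 Q) toD (𝟭 (DMinus 𝒜 Q)) := ⟨Functor.rightUnitor _⟩
  exact ⟨Localization.liftNatIso (qis 𝒜 Q).Q (qis 𝒜 Q) (F ⋙ G ⋙ toD) toD _ _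
    ((Functor.leftUnitor _).symm ≪≫ asIso (Functor.whiskerRight e (toD (P := Q)))).symm⟩
end

/-- The derived functor is triangulated, as the functor commutes with shifts and cones. -/
lemma Twist.IsTwisted.isTriangulated {Φ : TensorFunctor P 𝒜 ℬ} {D : Twist n 𝒳 P 𝒜 ℬ}
    (hΦ : D.IsTwisted Φ) (hF : HasFrames 𝒳)
    (h : ∀ M, minus 𝒜 Q M → minus ℬ Q (Φ.F.obj M)) (hq : PreservesQis (restrictMinus Φ.F h)) :
    IsTriangulated (derived (restrictMinus Φ.F h) hq) := by
  have hs (M : DGMod 𝒜) : IsIso (shiftHom hΦ hF M) := isIso_shiftHom hΦ hF M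
  let es (M : DGMod 𝒜) : Φ.F.obj M.shiftObj ≅ (Φ.F.obj M).shiftObj := asIso (shiftHom hΦ hF M)
  let F := restrictMinus Φ.F h
  let e : shiftMinus 𝒜 Q ⋙ F ≅ F ⋙ shiftMinus ℬ Q :=
    NatIso.ofComponents (fun M => ObjectProperty.isoMk _ (es M.obj))
      (fun {M N} f => by
        apply ObjectProperty.hom_ext
        exact shiftHom_naturality hΦ hF f.hom)
  refine ⟨derivedCompIso _ _ _ _ _ _ _ _ e, fun A B C f g k => ?_⟩
  rintro ⟨M, N, K, φ, i, a, b, c, h₁, h₂, h₃⟩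
  have hc : IsIso (coneHom hΦ hF φ.hom) := isIso_coneHom hΦ hF φ.hom
  let ec : Φ.F.obj (DGMod.cone φ.hom) ≅ DGMod.cone (Φ.F.map φ.hom) := asIso (coneHom hΦ hF φ.hom)
  refine ⟨F.obj M, F.obj N, F.obj K, F.map φ, Φ.F.mapIso i ≪≫ ec,
    (derived F hq).mapIso a, (derived F hq).mapIso b, (derived F hq).mapIso c, ?_, ?_, ?_⟩
  · rw [← derived_map F hq φ]
    exact ((derived F hq).map_comp _ _).symm.trans
      ((congrArg (derived F hq).map h₁).trans ((derived F hq).map_comp _ _))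
  · have : ObjectProperty.homMk (P := minus ℬ Q) (X := F.obj N) (Y := F.obj K) (DGMod.coneInr (Φ.F.map φ.hom) ≫
        (Φ.F.mapIso i ≪≫ ec).inv) =
        F.map (ObjectProperty.homMk (DGMod.coneInr φ.hom ≫ i.inv)) := by
      apply ObjectProperty.hom_ext
      change DGMod.coneInr (Φ.F.map φ.hom) ≫ inv (coneHom hΦ hF φ.hom) ≫ Φ.F.map i.inv =
        Φ.F.map (DGMod.coneInr φ.hom ≫ i.inv)
      rw [← coneInr_coneHom hΦ hF, Functor.map_comp, Category.assoc, IsIso.hom_inv_id_assoc]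
    refine Eq.trans ?_ (congrArg ((derived F hq).map b.hom ≫ ·) ((derived_map F hq _).trans
      (congrArg (toD (P := Q)).map this.symm)))
    exact ((derived F hq).map_comp _ _).symm.trans
      ((congrArg (derived F hq).map h₂).trans ((derived F hq).map_comp _ _))
  · have h4 := (derivedCompIso (shiftMinus 𝒜 Q) (fun _ _ f hf j => quasiIso_shift (f.hom.f j) (hf j)) F hq F
      hq (shiftMinus ℬ Q) (fun _ _ f hf j => quasiIso_shift (f.hom.f j) (hf j)) e).hom.naturality a.hom
    have h5 := derivedCompIso_hom_app (shiftMinus 𝒜 Q)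
      (fun _ _ f hf j => quasiIso_shift (f.hom.f j) (hf j)) F hq F
      hq (shiftMinus ℬ Q) (fun _ _ f hf j => quasiIso_shift (f.hom.f j) (hf j)) e M
    have h6 := derived_map F hq (N := (shiftMinus 𝒜 Q).obj M)
      (ObjectProperty.homMk (i.hom ≫ DGMod.coneProj φ.hom))
    have h7 : F.map (Y := (shiftMinus 𝒜 Q).obj M)
        (ObjectProperty.homMk (i.hom ≫ DGMod.coneProj φ.hom)) ≫ e.hom.app M =
        ObjectProperty.homMk ((Φ.F.mapIso i ≪≫ ec).hom ≫
          DGMod.coneProj (Φ.F.map φ.hom)) := by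
      apply ObjectProperty.hom_ext
      change Φ.F.map (i.hom ≫ DGMod.coneProj φ.hom) ≫ shiftHom hΦ hF M.obj =
        (Φ.F.map i.hom ≫ coneHom hΦ hF φ.hom) ≫ DGMod.coneProj (Φ.F.map φ.hom)
      rw [Functor.map_comp, Category.assoc, Category.assoc, coneHom_coneProj]
    rw [Category.assoc]
    refine (congrArg ((derived F hq).map k ≫ ·) h4.symm).trans ?_
    refine (Category.assoc _ _ _).symm.trans ?_
    refine (congrArg (· ≫ _) (((derived F hq).map_comp _ _).symm.trans
      ((congrArg (derived F hq).map h₃).trans ((derived F hq).map_comp _ _)))).trans ?_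
    refine (Category.assoc _ _ _).trans (congrArg ((derived F hq).map c.hom ≫ ·) ?_)
    refine (congrArg₂ (· ≫ ·) h6 h5).trans ?_
    exact ((toD (P := Q)).map_comp _ _).symm.trans (congrArg (toD (P := Q)).map h7)
end TriangulatedFunctors

/-! ### Elimination of matched cells -/

section Elimination

/-- A decomposition of a complex `K` of abelian groups into cells, for which the differential is
triangular: apart from the diagonal, the component of the differential from `c` to `c'` vanishes
unless `lead c c'`, in which case it is bijective, or `key c < key c'`. -/
structure CellComplex {ι Λ : Type*} [LinearOrder Λ] (key : ι → Λ) (lead : ι → ι → Prop) (K : ℤ → Type*)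
    [∀ p, AddCommGroup (K p)] (d : ∀ p, K p →+ K (p + 1)) (s : Finset ι) where
  G : ι → ℤ → Type*
  [grp : ∀ c p, AddCommGroup (G c p)]
  co (c : ι) (p : ℤ) : K p →+ G c p
  ins (c : ι) (p : ℤ) : G c p →+ K p
  sum_ins (p : ℤ) (z : K p) : ∑ c ∈ s, ins c p (co c p z) = z
  co_of_notMem (c : ι) (p : ℤ) (z : K p) : c ∉ s → co c p z = 0
  co_d_ins (c c' : ι) (p : ℤ) (m : G c p) : c ≠ c' → ¬ lead c c' → ¬ key c < key c' →
    co c' (p + 1) (d p (ins c p m)) = 0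
  bij (c c' : ι) (p : ℤ) : lead c c' →
    Function.Bijective fun m => co c' (p + 1) (d p (ins c p m))
  d_d (p : ℤ) (z : K p) : d (p + 1) (d p z) = 0
  key_eq (c c' : ι) : lead c c' → key c = key c'
  lead_fun (c c' c'' : ι) : lead c c' → lead c c'' → c' = c''
  lead_inj (c c' c'' : ι) : lead c c'' → lead c' c'' → c = c'
  lead_lead (c c' c'' : ι) : lead c c' → ¬ lead c' c''

attribute [instance] CellComplex.grp

variable {ι Λ : Type*} [LinearOrder Λ] {key : ι → Λ} {lead : ι → ι → Prop} {K : ℤ → Type*}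
    [∀ p, AddCommGroup (K p)] {d : ∀ p, K p →+ K (p + 1)} {s : Finset ι}

/-- A cocycle can be changed by a coboundary so that its components in a finite set of cells which are
paired with each other vanish. The cells of `s` not in `t` are either `c₀`, or carry no component of
the cocycle. -/
lemma CellComplex.exists_eq (C : CellComplex key lead K d s) (c₀ : ι)
    (t : Finset ι) (ht₀ : c₀ ∉ t) (ht : ∀ c ∈ t, ∃ c' ∈ t, lead c c' ∨ lead c' c)
    (hup : ∀ c ∈ t, ∀ c' ∈ s, key c < key c' → c' ∈ t ∨ c' = c₀)
    (p : ℤ) (z : K (p + 1)) (hz : d (p + 1) z = 0) (hzt : ∀ c ∉ t, c ≠ c₀ → C.co c (p + 1) z = 0)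
    (h₀ : (∀ c ∈ t, ¬ key c₀ < key c) ∨ (C.co c₀ (p + 1) z = 0 ∧ ∀ c ∈ t, ¬ key c < key c₀)) :
    ∃ w : K p, (∀ c, c ≠ c₀ → C.co c (p + 1) (z - d p w) = 0) ∧
      (C.co c₀ (p + 1) z = 0 → (∀ c ∈ t, ¬ key c < key c₀) → C.co c₀ (p + 1) (z - d p w) = 0) := by
  classical
  obtain ⟨k, hk⟩ : ∃ k, t.card = k := ⟨_, rfl⟩
  induction k using Nat.strong_induction_on generalizing t z with
  | _ k ih =>
  by_cases hne : t.Nonempty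
  swap
  · rw [Finset.not_nonempty_iff_eq_empty] at hne
    subst hne
    exact ⟨0, fun c hc => by rw [map_zero, sub_zero]; exact hzt c (by simp) hc,
      fun h _ => by rw [map_zero, sub_zero]; exact h⟩
  obtain ⟨c, hc, hmin⟩ := t.exists_min_image key hne
  obtain ⟨a, ha, b, hb, hab, hmin⟩ : ∃ a ∈ t, ∃ b ∈ t, lead a b ∧ ∀ x ∈ t, key a ≤ key x := by
    obtain ⟨c', hc', h | h⟩ := ht c hc
    · exact ⟨c, hc, c', hc', h, hmin⟩
    · exact ⟨c', hc', c, hc, h, fun x hx => (C.key_eq _ _ h).le.trans (hmin x hx)⟩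
  have hkey := C.key_eq a b hab
  have hne_ab : a ≠ b := fun h => C.lead_lead a b b hab (h ▸ hab)
  -- subtracting the boundary of `m` in the cell `a` removes the component of the cocycle in the cell `b`
  obtain ⟨m, hm⟩ := (C.bij a b p hab).2 (C.co b (p + 1) z)
  dsimp only at hm
  have hchange (x : ι) (hx : x ≠ a) (hxb : x ≠ b) (hlt : ¬ key a < key x) :
      C.co x (p + 1) (z - d p (C.ins a p m)) = C.co x (p + 1) z := by
    rw [map_sub, C.co_d_ins a x p m hx.symm (fun h => hxb (C.lead_fun a x b h hab)) hlt, sub_zero]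
  -- the new components outside the smaller set
  have hz' : d (p + 1) (z - d p (C.ins a p m)) = 0 := by rw [map_sub, hz, C.d_d, sub_zero]
  have hb0 : C.co b (p + 1) (z - d p (C.ins a p m)) = 0 := by rw [map_sub, hm, sub_self]
  have hout (x : ι) (hx : x ∉ t) (hx₀ : x ≠ c₀) : C.co x (p + 1) (z - d p (C.ins a p m)) = 0 := by
    by_cases hlt : key a < key x
    · refine C.co_of_notMem _ _ _ fun hxs => ?_
      rcases hup a ha x hxs hlt with h | h
      · exact hx h
      · exact hx₀ h
    · rw [hchange x (fun h => hx (h ▸ ha)) (fun h => hx (h ▸ hb)) hlt, hzt x hx hx₀]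
  have hc₀ : C.co c₀ (p + 1) z = 0 → (∀ c ∈ t, ¬ key c < key c₀) →
      C.co c₀ (p + 1) (z - d p (C.ins a p m)) = 0 := fun h h' => by
    rw [hchange c₀ (fun h => ht₀ (h ▸ ha)) (fun h => ht₀ (h ▸ hb)) (h' a ha), h]
  -- the component in the cell `a` is then the only one that contributes to the component in the cell `b`
  -- of the boundary, so it vanishes as well
  have ha0 : C.co a (p + 1) (z - d p (C.ins a p m)) = 0 := by
    have h1 : C.co b (p + 1 + 1) (d (p + 1) (z - d p (C.ins a p m))) = 0 := by rw [hz', map_zero]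
    rw [← C.sum_ins (p + 1) (z - d p (C.ins a p m)), map_sum, map_sum] at h1
    have h2 : ∀ x ∈ s, x ≠ a → C.co b (p + 1 + 1) (d (p + 1) (C.ins x (p + 1)
        (C.co x (p + 1) (z - d p (C.ins a p m))))) = 0 := by
      intro x _ hxa
      by_cases hxb : x = b
      · subst hxb; rw [hb0, map_zero, map_zero, map_zero]
      by_cases hlt : key x < key b
      · have hxt : x ∉ t := fun h => (hmin x h).not_gt (hkey ▸ hlt)
        have : C.co x (p + 1) (z - d p (C.ins a p m)) = 0 := by
          by_cases hx₀ : x = c₀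
          · subst hx₀
            rcases h₀ with h | h
            · exact absurd hlt (h b hb)
            · exact hc₀ h.1 h.2
          · exact hout x hxt hx₀
        rw [this, map_zero, map_zero, map_zero]
      · exact C.co_d_ins x b _ _ hxb (fun h => hxa (C.lead_inj _ _ _ h hab)) hlt
    by_cases has : a ∈ s
    · rw [Finset.sum_eq_single a h2 fun h => absurd has h] at h1
      refine (C.bij a b (p + 1) hab).1 (h1.trans ?_)
      dsimp only
      rw [map_zero, map_zero, map_zero]
    · exact C.co_of_notMem _ _ _ has
  have hsub : ((t.erase a).erase b) ⊆ t := (Finset.erase_subset _ _).trans (Finset.erase_subset _ _)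
  have hmem {x : ι} : x ∈ (t.erase a).erase b ↔ x ≠ b ∧ x ≠ a ∧ x ∈ t := by
    rw [Finset.mem_erase, Finset.mem_erase]
  have hlt : ((t.erase a).erase b).card < k := by
    rw [← hk]
    exact Finset.card_lt_card ⟨hsub, fun h => (hmem.1 (h ha)).2.1 rfl⟩
  obtain ⟨w, hw, hw₀⟩ := ih _ hlt ((t.erase a).erase b) (fun h => ht₀ (hsub h)) (fun x hx => by
      obtain ⟨hxb, hxa, hx⟩ := hmem.1 hx
      obtain ⟨y, hy, h⟩ := ht x hx
      refine ⟨y, hmem.2 ⟨?_, ?_, hy⟩, h⟩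
      · rintro rfl
        rcases h with h | h
        · exact hxa (C.lead_inj _ _ _ h hab)
        · exact C.lead_lead _ _ _ hab h
      · rintro rfl
        rcases h with h | h
        · exact C.lead_lead _ _ _ h hab
        · exact hxb (C.lead_fun _ _ _ h hab))
    (fun x hx y hy hxy => by
      rcases hup x (hsub hx) y hy hxy with h | h
      · have := (hmin x (hsub hx)).trans_lt hxy
        exact Or.inl (hmem.2 ⟨fun h => this.ne (h ▸ hkey), fun h => this.ne (h ▸ rfl), h⟩)
      · exact Or.inr h)
    (z - d p (C.ins a p m)) hz' (fun x hx hx₀ => by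
      by_cases hxt : x ∈ t
      · by_cases hxa : x = a
        · rw [hxa, ha0]
        by_cases hxb : x = b
        · rw [hxb, hb0]
        exact absurd (hmem.2 ⟨hxb, hxa, hxt⟩) hx
      · exact hout x hxt hx₀)
    (h₀.imp (fun h x hx => h x (hsub hx)) fun h => ⟨hc₀ h.1 h.2, fun x hx => h.2 x (hsub hx)⟩) rfl
  refine ⟨C.ins a p m + w, fun x hx => ?_, fun h h' => ?_⟩
  · rw [map_add, ← sub_sub]; exact hw x hx
  · rw [map_add, ← sub_sub]; exact hw₀ (hc₀ h h') fun c hc => h' c (hsub hc)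
end Elimination

section Cells
variable {J : Type} [Fintype J] [LinearOrder J] {deg deg' : J → ℤ}

/-- The leading part of the differential on pairs of exponents: the last variable that occurs in the
pair is moved from the second exponent to the first. -/
def Lead (deg deg' : J → ℤ) (c c' : (J → ℕ) × (J → ℕ)) : Prop :=
  ∃ r, c'.1 = c.1 + ex r ∧ c.2 = c'.2 + ex r ∧ (∀ j, r < j → c.1 j = 0 ∧ c.2 j = 0) ∧
    Adm deg c'.1 ∧ Adm deg' c.2

open scoped Classical in
/-- The part of the degree of the first exponent that comes from variables which are not the last one
that occurs. -/
noncomputable def lowDegree (c : (J → ℕ) × (J → ℕ)) : ℕ :=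
  ∑ j, if ∃ j', j < j' ∧ c.1 j' + c.2 j' ≠ 0 then c.1 j else 0

@[simp] lemma ex_self (r : J) : ex r r = 1 := by simp [ex]
lemma ex_of_ne {r j : J} (h : j ≠ r) : ex r j = 0 := by simp [ex, h]

lemma Lead.unique_var {c c' d d' : (J → ℕ) × (J → ℕ)} {r r' : J} (hs : ∀ j, c.1 j + c.2 j = d.1 j + d.2 j)
    (h1 : c.2 = c'.2 + ex r) (h2 : ∀ j, r < j → c.1 j = 0 ∧ c.2 j = 0)
    (h3 : d.2 = d'.2 + ex r') (h4 : ∀ j, r' < j → d.1 j = 0 ∧ d.2 j = 0) : r = r' := by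
  have e1 := congrFun h1 r
  have e3 := congrFun h3 r'
  simp only [Pi.add_apply, ex_self] at e1 e3
  rcases lt_trichotomy r r' with h | h | h
  · have := hs r'; have := h2 r' h; omega
  · exact h
  · have := hs r; have := h4 r h; omega

lemma Lead.sum_eq {c c' : (J → ℕ) × (J → ℕ)} (h : Lead deg deg' c c') (j : J) :
    c.1 j + c.2 j = c'.1 j + c'.2 j := by
  obtain ⟨r, h1, h2, -⟩ := h
  rw [h1, h2, Pi.add_apply, Pi.add_apply]; omega

lemma Lead.fun {c c' c'' : (J → ℕ) × (J → ℕ)} (h : Lead deg deg' c c') (h' : Lead deg deg' c c'') :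
    c' = c'' := by
  obtain ⟨r, h1, h2, h3, -⟩ := h
  obtain ⟨r', h1', h2', h3', -⟩ := h'
  obtain rfl := Lead.unique_var (fun _ => rfl) h2 h3 h2' h3'
  exact Prod.ext (h1.trans h1'.symm) (add_right_cancel (h2.symm.trans h2'))

lemma Lead.inj {c c' c'' : (J → ℕ) × (J → ℕ)} (h : Lead deg deg' c c'') (h' : Lead deg deg' c' c'') :
    c = c' := by
  have hs := fun j => (h.sum_eq j).trans (h'.sum_eq j).symm
  obtain ⟨r, h1, h2, h3, -⟩ := h
  obtain ⟨r', h1', h2', h3', -⟩ := h'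
  obtain rfl := Lead.unique_var hs h2 h3 h2' h3'
  exact Prod.ext (add_right_cancel (h1.symm.trans h1')) (h2.trans h2'.symm)

variable (hdeg : ∀ j, deg j + deg' j = 1)
include hdeg

/-- No pair of exponents is both the source and the target of leading terms, since each variable is odd in
exactly one of the two algebras. -/
lemma Lead.not_lead {c c' c'' : (J → ℕ) × (J → ℕ)} (h : Lead deg deg' c c') : ¬ Lead deg deg' c' c'' := by
  intro h'
  have hs := h.sum_eq
  obtain ⟨r, h1, h2, h3, -, h4⟩ := h
  obtain ⟨r', h1', h2', h3', h4', -⟩ := h'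
  obtain rfl := Lead.unique_var hs h2 h3 h2' h3'
  have e1 := congrFun h1 r
  have e2 := congrFun h2 r
  have e1' := congrFun h1' r
  have e2' := congrFun h2' r
  simp only [Pi.add_apply, ex_self] at e1 e2 e1' e2'
  rcases Int.even_or_odd (deg r) with h | h
  · have := h4 r (by have := hdeg r; rw [show deg' r = 1 - deg r by omega]; exact odd_one.sub_even h)
    omega
  · have := h4' r h
    omega

/-- Every nontrivial pair of exponents is matched with another one: the last variable that occurs is moved
to the first exponent if possible, and otherwise to the second. -/
lemma exists_lead {c : (J → ℕ) × (J → ℕ)} (h1 : Adm deg c.1) (h2 : Adm deg' c.2) (h : c ≠ 0) :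
    ∃ c' : (J → ℕ) × (J → ℕ), Adm deg c'.1 ∧ Adm deg' c'.2 ∧ (∀ j, c.1 j + c.2 j = c'.1 j + c'.2 j) ∧
      (Lead deg deg' c c' ∨ Lead deg deg' c' c) := by
  classical
  have hne : (Finset.univ.filter fun j => c.1 j + c.2 j ≠ 0).Nonempty := by
    by_contra hne
    rw [Finset.not_nonempty_iff_eq_empty, Finset.filter_eq_empty_iff] at hne
    refine h (Prod.ext (funext fun j => ?_) (funext fun j => ?_)) <;>
    · have := hne (Finset.mem_univ j)
      change _ = 0
      omega
  obtain ⟨r, hr, hmax⟩ := (Finset.univ.filter fun j => c.1 j + c.2 j ≠ 0).exists_max_image id hne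
  have hr : c.1 r + c.2 r ≠ 0 := (Finset.mem_filter.1 hr).2
  have hmax (j : J) (hj : r < j) : c.1 j = 0 ∧ c.2 j = 0 := by
    by_contra hj'
    exact (hmax j (Finset.mem_filter.2 ⟨Finset.mem_univ _, by omega⟩)).not_gt hj
  have hsub {γ : J → ℕ} (hγ : γ r ≠ 0) : γ = (γ - ex r) + ex r := by
    ext j
    by_cases hj : j = r
    · subst hj; simp only [Pi.add_apply, Pi.sub_apply, ex_self]; omega
    · simp [ex_of_ne hj]
  have hadd {dg : J → ℤ} {γ : J → ℕ} (hγ : Adm dg γ) (h : Odd (dg r) → γ r = 0) : Adm dg (γ + ex r) := by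
    intro j hj
    by_cases hjr : j = r
    · subst hjr; simp [h hj]
    · simpa [ex_of_ne hjr] using hγ j hj
  have hle (γ : J → ℕ) : γ - ex r ≤ γ := fun j => Nat.sub_le _ _
  have hpar : ¬ (Odd (deg r) ∧ Odd (deg' r)) := fun h => by
    have := h.1.add_odd h.2
    rw [hdeg r] at this
    exact absurd this (by decide)
  by_cases hA : c.2 r ≠ 0 ∧ (Odd (deg r) → c.1 r = 0)
  · have e := hsub hA.1
    refine ⟨(c.1 + ex r, c.2 - ex r), hadd h1 hA.2, h2.of_le (hle _), fun j => ?_,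
      Or.inl ⟨r, rfl, e, hmax, hadd h1 hA.2, h2⟩⟩
    have := congrFun e j
    simp only [Pi.add_apply, Pi.sub_apply] at this ⊢
    omega
  · have hB : c.1 r ≠ 0 ∧ (Odd (deg' r) → c.2 r = 0) := by
      by_cases h0 : c.2 r = 0
      · exact ⟨by omega, fun _ => h0⟩
      · have : Odd (deg r) ∧ c.1 r ≠ 0 := by
          by_contra h3
          exact hA ⟨h0, fun h4 => by by_contra h5; exact h3 ⟨h4, h5⟩⟩
        exact ⟨this.2, fun h => absurd ⟨this.1, h⟩ hpar⟩
    have e := hsub hB.1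
    refine ⟨(c.1 - ex r, c.2 + ex r), h1.of_le (hle _), hadd h2 hB.2, fun j => ?_,
      Or.inr ⟨r, e, rfl, fun j hj => ?_, h1, hadd h2 hB.2⟩⟩
    · have := congrFun e j
      simp only [Pi.add_apply, Pi.sub_apply] at this ⊢
      omega
    · have := hmax j hj
      simp only [Pi.add_apply, Pi.sub_apply, ex_of_ne hj.ne']
      omega
omit hdeg

/-- Moving the variable `r` to the first exponent does not decrease the low degree, and increases it unless
`r` is the last variable that occurs. -/
lemma lowDegree_step {c c' : (J → ℕ) × (J → ℕ)} {r : J} (h1 : c'.1 = c.1 + ex r)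
    (h2 : c.2 = c'.2 + ex r) : lowDegree c ≤ lowDegree c' ∧
      (lowDegree c = lowDegree c' → ∀ j, r < j → c.1 j = 0 ∧ c.2 j = 0) := by
  classical
  have hs (j : J) : c'.1 j + c'.2 j = c.1 j + c.2 j := by
    rw [h1, h2, Pi.add_apply, Pi.add_apply]; omega
  have hle : ∀ j ∈ Finset.univ, (if ∃ j', j < j' ∧ c.1 j' + c.2 j' ≠ 0 then c.1 j else 0) ≤
      if ∃ j', j < j' ∧ c'.1 j' + c'.2 j' ≠ 0 then c'.1 j else 0 := by
    intro j _
    simp only [hs]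
    split_ifs
    · rw [h1, Pi.add_apply]; omega
    · rfl
  refine ⟨Finset.sum_le_sum hle, fun heq j hj => ?_⟩
  have := (Finset.sum_eq_sum_iff_of_le hle).1 heq r (Finset.mem_univ r)
  simp only [hs] at this
  rw [h1, Pi.add_apply, ex_self] at this
  split_ifs at this with h
  · omega
  · have h' : ¬ (c.1 j + c.2 j ≠ 0) := fun h' => h ⟨j, hj, h'⟩
    omega

lemma lowDegree_eq {c c' : (J → ℕ) × (J → ℕ)} {r : J} (h1 : c'.1 = c.1 + ex r)
    (h2 : c.2 = c'.2 + ex r) (h3 : ∀ j, r < j → c.1 j = 0 ∧ c.2 j = 0) :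
    lowDegree c = lowDegree c' := by
  classical
  have hs (j : J) : c'.1 j + c'.2 j = c.1 j + c.2 j := by
    rw [h1, h2, Pi.add_apply, Pi.add_apply]; omega
  refine Finset.sum_congr rfl fun j _ => ?_
  simp only [hs]
  split_ifs with h
  · have : j ≠ r := by
      rintro rfl
      obtain ⟨j', hj', hne⟩ := h
      have := h3 j' hj'
      omega
    rw [h1, Pi.add_apply, ex_of_ne this, add_zero]
  · rfl
end Cells

/-! ### Coordinates on composites -/

section Composite
variable {X : TopCat.{u}} {O : Sheaf (Opens.grothendieckTopology X) CommRingCat.{u}}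
variable {J : Type} [Fintype J] [LinearOrder J] {deg₁ deg₂ deg deg' : J → ℤ} {W V : Opens X}
variable {P₁ P₂ : ℤ → ℤ → PMod O} {𝒜 ℬ 𝒞 : DGAlg O}
  (B₁ : MonBasis P₁ W deg₁) (B₂ : MonBasis P₂ W deg₂)
  (Φ₁ : TensorFunctor P₁ 𝒜 ℬ) (Φ₂ : TensorFunctor P₂ ℬ 𝒞) {M : DGMod 𝒜}
  {a a' b b₁ p i i' j j₁ q : ℤ}

/-- The coefficient of the product of basis sections of exponents `γ`, `δ` in a section of the image of
`M` under the composite of two functors. -/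
noncomputable def coord₂ (γ δ : J → ℕ) (h : B₂.da γ + b₁ = p) (h' : B₂.v * len γ + j₁ = q)
    (g : B₁.da δ + b = b₁) (g' : B₁.v * len δ + j = j₁) :
    LHom W (toP.obj (((Φ₂.F.obj (Φ₁.F.obj M)).cx q).X p)) (toP.obj ((M.cx j).X b)) :=
  (B₁.coord Φ₁ δ g g').comp (B₂.coord Φ₂ γ h h')

/-- The local map defined by multiplication with the product of basis sections of exponents `γ`, `δ`. -/
noncomputable def ins₂ (γ δ : J → ℕ) (h : B₂.da γ + b₁ = p) (h' : B₂.v * len γ + j₁ = q)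
    (g : B₁.da δ + b = b₁) (g' : B₁.v * len δ + j = j₁) :
    LHom W (toP.obj ((M.cx j).X b)) (toP.obj (((Φ₂.F.obj (Φ₁.F.obj M)).cx q).X p)) :=
  (B₂.ins Φ₂ γ h h').comp (B₁.ins Φ₁ δ g g')

variable (γ δ γ' δ' : J → ℕ) (hV : V ≤ W)

lemma coord₂_tm (h : B₂.da γ + b₁ = p) (h' : B₂.v * len γ + j₁ = q)
    (g : B₁.da δ + b = b₁) (g' : B₁.v * len δ + j = j₁) {b₁' j₁' : ℤ} (h₁ : a + b₁' = p)
    (h₁' : i + j₁' = q) (h₂ : a' + b = b₁') (h₂' : i' + j = j₁') (s : Sec (P₂ a i) V)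
    (φ : Sec (P₁ a' i') V) (m : SSec ((M.cx j).X b) V) :
    (coord₂ B₁ B₂ Φ₁ Φ₂ γ δ h h' g g').app V hV
      (Φ₂.tm (Φ₁.F.obj M) h₁ h₁' V s (Φ₁.tm M h₂ h₂' V φ m)) =
      ev (B₂.c a i γ) hV s • ev (B₁.c a' i' δ) hV φ • m := by
  change (B₁.coord Φ₁ δ g g').app V hV ((B₂.coord Φ₂ γ h h').app V hV _) = _
  by_cases hd : B₂.da γ = a ∧ B₂.v * len γ = i
  · obtain rfl : b₁ = b₁' := by omega
    obtain rfl : j₁ = j₁' := by omega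
    rw [B₂.coord_tm, map_smul, B₁.coord_tm]
  · rw [B₂.coord_tm_ne Φ₂ γ h h' h₁ h₁' hV _ _ hd, map_zero, B₂.c_zero fun h => hd h.2]
    exact (zero_smul _ _).symm

lemma coord₂_tm_ne (h : B₂.da γ + b₁ = p) (h' : B₂.v * len γ + j₁ = q)
    (g : B₁.da δ + b = b₁) (g' : B₁.v * len δ + j = j₁) {b₁' j₁' b' j' : ℤ} (h₁ : a + b₁' = p)
    (h₁' : i + j₁' = q) (h₂ : a' + b' = b₁') (h₂' : i' + j' = j₁') (s : Sec (P₂ a i) V)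
    (φ : Sec (P₁ a' i') V) (m : SSec ((M.cx j').X b') V) (hne : ¬ (b = b' ∧ j = j')) :
    (coord₂ B₁ B₂ Φ₁ Φ₂ γ δ h h' g g').app V hV
      (Φ₂.tm (Φ₁.F.obj M) h₁ h₁' V s (Φ₁.tm M h₂ h₂' V φ m)) = 0 := by
  change (B₁.coord Φ₁ δ g g').app V hV ((B₂.coord Φ₂ γ h h').app V hV _) = _
  by_cases hd : B₂.da γ = a ∧ B₂.v * len γ = i
  · obtain rfl : b₁ = b₁' := by omega
    obtain rfl : j₁ = j₁' := by omega
    rw [B₂.coord_tm, map_smul, B₁.coord_tm_ne Φ₁ δ g g' h₂ h₂', smul_zero]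
    omega
  · rw [B₂.coord_tm_ne Φ₂ γ h h' h₁ h₁' hV _ _ hd, map_zero]

variable {n : ℕ} {𝒳 : CochainComplex (Mod O) ℤ} {D₁ : Twist n 𝒳 P₁ 𝒜 ℬ} {D₂ : Twist n 𝒳 P₂ ℬ 𝒞}
  {Φ₁ Φ₂}

/-- Under the hypotheses on the exponents, which exclude the differentials of `P₁` and `P₂` and the twist of
`Φ₁`, only the twist of `Φ₂` contributes to the coefficients of the differential of the composite. -/
lemma coord₂_d_ins₂ (hΦ₁ : D₁.IsTwisted Φ₁) (hΦ₂ : D₂.IsTwisted Φ₂) (E : LocalFrame 𝒳 V) {p' b' b₁' j' j₁' : ℤ}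
    (hp : p + 1 = p') (h : B₂.da γ + b₁ = p) (h' : B₂.v * len γ + j₁ = q)
    (g : B₁.da δ + b = b₁) (g' : B₁.v * len δ + j = j₁) (k : B₂.da γ' + b₁' = p')
    (k' : B₂.v * len γ' + j₁' = q) (l : B₁.da δ' + b' = b₁') (l' : B₁.v * len δ' + j' = j₁')
    (hne : ¬ (γ = γ' ∧ δ = δ')) (H₁ : ¬ (δ' = δ ∧ B₂.da γ' = B₂.da γ + 1 ∧ B₂.v * len γ' = B₂.v * len γ))
    (H₂ : ¬ (γ' = γ ∧ B₁.da δ' = B₁.da δ + 1 ∧ B₁.v * len δ' = B₁.v * len δ))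
    (H₃ : ¬ (γ' = γ ∧ B₁.v * len δ' = B₁.v * len δ + D₁.w))
    (hγ : Adm deg₂ γ) (m : SSec ((M.cx j).X b) V) :
    (coord₂ B₁ B₂ Φ₁ Φ₂ γ' δ' k k' l l').app V hV
      (sMap (((Φ₂.F.obj (Φ₁.F.obj M)).cx q).d p p') V
        ((ins₂ B₁ B₂ Φ₁ Φ₂ γ δ h h' g g').app V hV m)) =
    (B₂.da γ).negOnePow • ∑ e ∈ E.idx n, (coord₂ B₁ B₂ Φ₁ Φ₂ γ' δ' k k' l l').app V hV
      (Φ₂.tm (Φ₁.F.obj M) (b := D₂.ε' e.1 + b₁) (j := D₂.w' + j₁)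
        (by have := D₂.hε e.1; omega) (by have := D₂.hw; omega) V
        (D₂.R E e rfl rfl (B₂.bs γ hV))
        (Φ₁.tm M (b := b) (j := j) (by omega) (by omega) V
          (D₁.lact rfl rfl V (D₂.Z E e) (B₁.bs δ hV)) m)) := by
  change (coord₂ B₁ B₂ Φ₁ Φ₂ γ' δ' k k' l l').app V hV (sMap _ V (Φ₂.tm _ h h' V (B₂.bs γ hV)
    (Φ₁.tm M g g' V (B₁.bs δ hV) m))) = _
  rw [hΦ₂.d_tm' h h' rfl rfl hp (by omega) (by omega) V E, map_add, map_add, DGMod.map_unit_smul,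
    DGMod.map_unit_smul, map_sum]
  have t1 : (coord₂ B₁ B₂ Φ₁ Φ₂ γ' δ' k k' l l').app V hV (Φ₂.tm (Φ₁.F.obj M) (a := B₂.da γ + 1)
      (by omega) h' V (secMap (D₂.dP rfl (B₂.v * len γ)) V (B₂.bs γ hV))
      (Φ₁.tm M g g' V (B₁.bs δ hV) m)) = 0 := by
    change (B₁.coord Φ₁ δ' l l').app V hV ((B₂.coord Φ₂ γ' k k').app V hV _) = 0
    by_cases hd : B₂.da γ' = B₂.da γ + 1 ∧ B₂.v * len γ' = B₂.v * len γ
    · obtain rfl : b₁' = b₁ := by omega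
      obtain rfl : j₁' = j₁ := by omega
      rw [B₂.coord_tm, map_smul, B₁.coord_bs_ne Φ₁ fun h => H₁ ⟨h, hd⟩, smul_zero]
    · rw [B₂.coord_tm_ne Φ₂ γ' k k' _ _ hV _ _ hd, map_zero]
  have t2 : (coord₂ B₁ B₂ Φ₁ Φ₂ γ' δ' k k' l l').app V hV (Φ₂.tm (Φ₁.F.obj M) (b := b₁ + 1)
      (by omega) h' V (B₂.bs γ hV) (sMap (((Φ₁.F.obj M).cx j₁).d b₁ (b₁ + 1)) V
      (Φ₁.tm M g g' V (B₁.bs δ hV) m))) = 0 := by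
    change (B₁.coord Φ₁ δ' l l').app V hV ((B₂.coord Φ₂ γ' k k').app V hV _) = 0
    by_cases hd : γ' = γ
    · subst hd
      obtain rfl : b₁' = b₁ + 1 := by omega
      obtain rfl : j₁' = j₁ := by omega
      rw [B₂.coord_bs_self Φ₂ hγ, hΦ₁.coord_d_tm B₁ g g' rfl rfl hV E _ _ δ' l l'
        (fun h => H₂ ⟨rfl, h⟩) (fun h => H₃ ⟨rfl, h⟩), B₁.coord_bs_ne Φ₁ fun h => hne ⟨rfl, h.symm⟩,
        smul_zero]
    · rw [B₂.coord_bs_ne Φ₂ hd, map_zero]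
  rw [t1, t2, smul_zero, zero_add, zero_add]
  congr 1
  refine Finset.sum_congr rfl fun e _ => ?_
  rw [hΦ₁.act_tm M g g' rfl rfl rfl rfl (by omega) (by omega)]

/-- The operators `T` map the basis section of exponent `γ` to plus or minus the basis section of the
exponent `γ'` for which `r γ γ'`. -/
structure MonBasis.IsStep {P : ℤ → ℤ → PMod O} (B : MonBasis P W deg) {V : Opens X} (hV : V ≤ W)
    (k w : ℤ)
    (T : ∀ {a p i q : ℤ}, a + k = p → i + w = q → Sec (P a i) V →ₗ[Fn O V] Sec (P p q) V)
    (r : (J → ℕ) → (J → ℕ) → Prop) : Prop where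
  da {γ γ' : J → ℕ} : r γ γ' → B.da γ' = B.da γ + k
  di {γ γ' : J → ℕ} : r γ γ' → B.v * len γ' = B.v * len γ + w
  zero {γ γ' : J → ℕ} {p q : ℤ} (h : B.da γ + k = p) (h' : B.v * len γ + w = q) :
    ¬ r γ γ' → ev (B.c p q γ') hV (T h h' (B.bs γ hV)) = 0
  unit {γ γ' : J → ℕ} {p q : ℤ} (h : B.da γ + k = p) (h' : B.v * len γ + w = q) :
    r γ γ' → Adm deg γ → Adm deg γ' →
      ∃ u : ℤˣ, ev (B.c p q γ') hV (T h h' (B.bs γ hV)) = u • (1 : Fn O V)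

/-- The exponent `γ'` is obtained from `γ` by adding the variable `r`. -/
def Up (r : J) (γ γ' : J → ℕ) : Prop := γ' = γ + ex r
/-- The exponent `γ'` is obtained from `γ` by removing the variable `r`. -/
def Down (r : J) (γ γ' : J → ℕ) : Prop := γ = γ' + ex r

/-- The two ways to view a pair of exponents, of a monomial of `𝒮` and of an element of the dual basis of
`𝒯^∨`, as an exponent for the outer and one for the inner of two functors. -/
inductive Arrangement (deg deg' : J → ℤ) : (g h : (J → ℕ) × (J → ℕ) → (J → ℕ)) →
    (r₂ r₁ : J → (J → ℕ) → (J → ℕ) → Prop) → (deg₂ deg₁ : J → ℤ) → Prop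
  | id : Arrangement deg deg' Prod.fst Prod.snd Up Down deg deg'
  | swap : Arrangement deg deg' Prod.snd Prod.fst Down Up deg' deg

variable {g h : (J → ℕ) × (J → ℕ) → (J → ℕ)} {r₂ r₁ : J → (J → ℕ) → (J → ℕ) → Prop}

namespace Arrangement
variable (hA : Arrangement deg deg' g h r₂ r₁ deg₂ deg₁)
include hA
variable {c c' : (J → ℕ) × (J → ℕ)}

lemma ext (h₁ : g c = g c') (h₂ : h c = h c') : c = c' := by
  cases hA
  · exact Prod.ext h₁ h₂
  · exact Prod.ext h₂ h₁

lemma len_snd (h₁ : len (g c') = len (g c)) (h₂ : len (h c') = len (h c)) : len c'.2 = len c.2 := by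
  cases hA
  · exact h₂
  · exact h₁

lemma len_add : len (g c) + len (h c) = len c.1 + len c.2 := by
  cases hA
  · rfl
  · exact Nat.add_comm _ _

lemma adm_iff : Adm deg₂ (g c) ∧ Adm deg₁ (h c) ↔ Adm deg c.1 ∧ Adm deg' c.2 := by
  cases hA
  · rfl
  · exact and_comm

lemma step_iff (r : J) : r₂ r (g c) (g c') ∧ r₁ r (h c) (h c') ↔
    c'.1 = c.1 + ex r ∧ c.2 = c'.2 + ex r := by
  cases hA
  · rfl
  · exact and_comm

lemma ne_of_step {r : J} (h₁ : c'.1 = c.1 + ex r) (h₂ : c.2 = c'.2 + ex r) :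
    g c ≠ g c' ∧ h c ≠ h c' := by
  have key (γ : J → ℕ) : γ ≠ γ + ex r := fun h => by simpa using congrFun h r
  cases hA
  · exact ⟨fun h => key _ (h.trans h₁), fun h => key _ (h.symm.trans h₂)⟩
  · exact ⟨fun h => key _ (h.symm.trans h₂), fun h => key _ (h.trans h₁)⟩

lemma apply_zero : g 0 = 0 ∧ h 0 = 0 := by
  cases hA <;> exact ⟨rfl, rfl⟩

lemma sum_product {G : Type*} [AddCommMonoid G] (s : Finset (J → ℕ)) (f : (J → ℕ) → (J → ℕ) → G) :
    ∑ c ∈ s ×ˢ s, f (g c) (h c) = ∑ γ ∈ s, ∑ δ ∈ s, f γ δ := by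
  cases hA
  · exact Finset.sum_product _ _ _
  · exact Finset.sum_product_right _ _ _
end Arrangement
end Composite

/-! ### The contraction of the composites -/

section Contraction
variable {X : TopCat.{u}} {O : Sheaf (Opens.grothendieckTopology X) CommRingCat.{u}}
variable {W : Opens X} {n : ℕ} {𝒳 : CochainComplex (Mod O) ℤ} {P₁ P₂ : ℤ → ℤ → PMod O} {𝒜 ℬ 𝒞 : DGAlg O}

/-- The element of index `j` of a frame. -/
def LocalFrame.emb {E : LocalFrame 𝒳 W} (j : E.J n) : Σ k, Fin (E.r k) := ⟨j.1, j.2⟩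

lemma LocalFrame.sum_idx_emb (E : LocalFrame 𝒳 W) {G : Type*} [AddCommMonoid G]
    (f : (Σ k, Fin (E.r k)) → G) : ∑ e ∈ E.idx n, f e = ∑ j : E.J n, f (emb j) := by
  rw [sum_idx, Fintype.sum_sigma]
  exact (Finset.sum_coe_sort (Finset.Icc (1 : ℤ) (n + 1)) fun k => ∑ α, f ⟨k, α⟩).symm

/-- The composite of two of the functors of linear Koszul duality, with bases of monomials of the
algebra and of the coalgebra by which they tensor. -/
structure CompositeBasis (n : ℕ) (E : LocalFrame 𝒳 W) (Φ₁ : TensorFunctor P₁ 𝒜 ℬ)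
    (Φ₂ : TensorFunctor P₂ ℬ 𝒞) where
  D₁ : Twist n 𝒳 P₁ 𝒜 ℬ
  D₂ : Twist n 𝒳 P₂ ℬ 𝒞
  hΦ₁ : D₁.IsTwisted Φ₁
  hΦ₂ : D₂.IsTwisted Φ₂
  hw : D₁.w ≠ 0
  deg₁ : E.J n → ℤ
  deg₂ : E.J n → ℤ
  B₁ : MonBasis P₁ W deg₁
  B₂ : MonBasis P₂ W deg₂
  hv₁ : B₁.v = -2
  hv₂ : B₂.v = -2
  g : (E.J n → ℕ) × (E.J n → ℕ) → (E.J n → ℕ)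
  h : (E.J n → ℕ) × (E.J n → ℕ) → (E.J n → ℕ)
  r₁ : E.J n → (E.J n → ℕ) → (E.J n → ℕ) → Prop
  r₂ : E.J n → (E.J n → ℕ) → (E.J n → ℕ) → Prop
  arr : Arrangement E.degY E.degX g h r₂ r₁ deg₂ deg₁
  step₂ {V : Opens X} (hV : V ≤ W) (j : E.J n) : B₂.IsStep hV (D₂.ε j.1) D₂.w
    (fun {_ _ _ _} h h' => D₂.R (E.restr hV) (LocalFrame.emb j) h h') (r₂ j)
  step₁ {V : Opens X} (hV : V ≤ W) (j : E.J n) : B₁.IsStep hV (D₂.ε' j.1) D₂.w'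
    (fun {_ _ _ _} h h' => D₁.lact ((add_comm _ _).trans h) ((add_comm _ _).trans h') V
      (D₂.Z (E.restr hV) (LocalFrame.emb j))) (r₁ j)

namespace CompositeBasis
variable {E : LocalFrame 𝒳 W} {Φ₁ : TensorFunctor P₁ 𝒜 ℬ} {Φ₂ : TensorFunctor P₂ ℬ 𝒞}
  (C : CompositeBasis n E Φ₁ Φ₂) {M : DGMod 𝒜} {V : Opens X} (hV : V ≤ W)

/-- The order on the pairs of exponents with respect to which the differential is triangular: the first
entry is raised by the twist of the inner functor, the second one by the differentials of `P₁` and `P₂`, and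
the third one by the terms of the twist of the outer functor other than the leading one. The earlier entries
are preserved in each case. -/
noncomputable def key (c : (E.J n → ℕ) × (E.J n → ℕ)) : ℤ ×ₗ ℤ ×ₗ ℕ :=
  toLex (C.D₁.w * (C.B₂.v * len (C.g c) + C.B₁.v * len (C.h c)),
    toLex (C.B₂.da (C.g c) + C.B₁.da (C.h c) + len c.2, lowDegree c))

section
variable {c c' : (E.J n → ℕ) × (E.J n → ℕ)} {p p' q b b₁ b' b₁' j j₁ j' j₁' : ℤ}
  (h : C.B₂.da (C.g c) + b₁ = p) (h' : C.B₂.v * len (C.g c) + j₁ = q)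
  (g : C.B₁.da (C.h c) + b = b₁) (g' : C.B₁.v * len (C.h c) + j = j₁)
  (k : C.B₂.da (C.g c') + b₁' = p') (k' : C.B₂.v * len (C.g c') + j₁' = q)
  (l : C.B₁.da (C.h c') + b' = b₁') (l' : C.B₁.v * len (C.h c') + j' = j₁')

/-- The differential is triangular apart from the leading terms. -/
lemma coord₂_d_ins₂_of_not_lead (hp : p + 1 = p') (hne : c ≠ c') (hlead : ¬ Lead E.degY E.degX c c')
    (hkey : ¬ C.key c < C.key c') (m : SSec ((M.cx j).X b) V) :
    (coord₂ C.B₁ C.B₂ Φ₁ Φ₂ (C.g c') (C.h c') k k' l l').app V hV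
      (sMap (((Φ₂.F.obj (Φ₁.F.obj M)).cx q).d p p') V
        ((ins₂ C.B₁ C.B₂ Φ₁ Φ₂ (C.g c) (C.h c) h h' g g').app V hV m)) = 0 := by
  have hw₁ := mul_self_pos.2 C.hw
  by_cases hadm : Adm C.deg₂ (C.g c) ∧ Adm C.deg₁ (C.h c)
  swap
  · have : (ins₂ C.B₁ C.B₂ Φ₁ Φ₂ (C.g c) (C.h c) h h' g g').app V hV m = 0 := by
      change Φ₂.tmL _ h h' V (C.B₂.bs _ hV) (Φ₁.tmL M g g' V (C.B₁.bs _ hV) m) = 0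
      by_cases hd : Adm C.deg₂ (C.g c)
      · have : C.B₁.bs (C.h c) hV = 0 := by
          rw [MonBasis.bs, C.B₁.e_zero fun h => hadm ⟨hd, h.1⟩, map_zero]
        rw [this, map_zero, LinearMap.zero_apply, map_zero]
      · have : C.B₂.bs (C.g c) hV = 0 := by
          rw [MonBasis.bs, C.B₂.e_zero fun h => hd h.1, map_zero]
        rw [this, map_zero, LinearMap.zero_apply]
    rw [this, map_zero, map_zero]
  by_cases hadm' : Adm C.deg₂ (C.g c') ∧ Adm C.deg₁ (C.h c')
  swap
  · change (C.B₁.coord Φ₁ _ l l').app V hV ((C.B₂.coord Φ₂ _ k k').app V hV _) = 0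
    by_cases hd : Adm C.deg₂ (C.g c')
    · rw [C.B₁.coord_of_not_adm Φ₁ fun h => hadm' ⟨hd, h⟩]; rfl
    · rw [C.B₂.coord_of_not_adm Φ₂ hd]; exact map_zero _
  have hlen {x y : ℕ} {v : ℤ} (hv : v = -2) (h : v * x = v * y) : x = y := by subst hv; omega
  rw [coord₂_d_ins₂ C.B₁ C.B₂ _ _ _ _ hV C.hΦ₁ C.hΦ₂ (E.restr hV) hp h h' g g' k k' l l'
    (fun h => hne (C.arr.ext h.1 h.2)) ?_ ?_ ?_ hadm.1, Finset.sum_eq_zero, smul_zero]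
  · intro e he
    by_cases hbj : b' = b ∧ j' = j
    swap
    · exact coord₂_tm_ne C.B₁ C.B₂ _ _ _ _ hV k k' l l' _ _ _ _ _ _ _ hbj
    obtain ⟨rfl, rfl⟩ := hbj
    rw [coord₂_tm]
    obtain ⟨r, rfl⟩ : ∃ r : E.J n, e = LocalFrame.emb r := by
      simp only [LocalFrame.idx, Finset.mem_sigma, Finset.mem_univ, and_true] at he
      exact ⟨⟨⟨e.1, he⟩, e.2⟩, rfl⟩
    by_cases hr₂ : C.r₂ r (C.g c) (C.g c')
    swap
    · exact (congrArg (· • _) ((C.step₂ hV r).zero rfl rfl hr₂)).trans (zero_smul _ _)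
    by_cases hr₁ : C.r₁ r (C.h c) (C.h c')
    swap
    · refine (congrArg (_ • ·) ((congrArg (· • m) ((C.step₁ hV r).zero (add_comm _ _) (add_comm _ _)
        hr₁)).trans (zero_smul _ _))).trans (smul_zero _)
    -- the term of a variable that is not the last one increases the low degree
    exfalso
    obtain ⟨s₁, s₂⟩ := (C.arr.step_iff r).1 ⟨hr₂, hr₁⟩
    have hlow := lowDegree_step s₁ s₂
    have hl2 : len c.2 = len c'.2 + 1 := by rw [s₂, len_add, len_ex]
    have hfst : C.B₂.v * (len (C.g c) : ℤ) + C.B₁.v * (len (C.h c) : ℤ) =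
      C.B₂.v * (len (C.g c') : ℤ) + C.B₁.v * (len (C.h c') : ℤ) := by omega
    refine hkey (Prod.Lex.toLex_lt_toLex.2 (Or.inr ⟨by rw [hfst],
      Prod.Lex.toLex_lt_toLex.2 (Or.inr ⟨by dsimp only; omega, ?_⟩)⟩))
    refine lt_of_le_of_ne hlow.1 fun heq => hlead ⟨r, s₁, s₂, hlow.2 heq, ?_, ?_⟩
    · exact (C.arr.adm_iff.1 hadm').1
    · exact (C.arr.adm_iff.1 hadm).2
  · rintro ⟨h1, h2, h3⟩
    refine hkey (Prod.Lex.toLex_lt_toLex.2 (Or.inr ⟨by rw [h1, h3],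
      Prod.Lex.toLex_lt_toLex.2 (Or.inl ?_)⟩))
    have := C.arr.len_snd (hlen C.hv₂ h3) (congrArg len h1)
    dsimp only
    rw [h1]; omega
  · rintro ⟨h1, h2, h3⟩
    refine hkey (Prod.Lex.toLex_lt_toLex.2 (Or.inr ⟨by rw [h1, h3],
      Prod.Lex.toLex_lt_toLex.2 (Or.inl ?_)⟩))
    have := C.arr.len_snd (congrArg len h1) (hlen C.hv₁ h3)
    dsimp only
    rw [h1]; omega
  · rintro ⟨h1, h3⟩
    refine hkey (Prod.Lex.toLex_lt_toLex.2 (Or.inl ?_))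
    dsimp only
    rw [h1, h3, ← add_assoc, mul_add _ _ C.D₁.w]
    omega

/-- The leading terms of the differential are plus or minus the identity. -/
lemma exists_coord₂_d_ins₂_of_lead (hp : p + 1 = p') (hlead : Lead E.degY E.degX c c')
    (k : C.B₂.da (C.g c') + b₁' = p') (k' : C.B₂.v * len (C.g c') + j₁' = q)
    (l : C.B₁.da (C.h c') + b = b₁') (l' : C.B₁.v * len (C.h c') + j = j₁') : ∃ u : ℤˣ,
    ∀ m : SSec ((M.cx j).X b) V, (coord₂ C.B₁ C.B₂ Φ₁ Φ₂ (C.g c') (C.h c') k k' l l').app V hV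
      (sMap (((Φ₂.F.obj (Φ₁.F.obj M)).cx q).d p p') V
        ((ins₂ C.B₁ C.B₂ Φ₁ Φ₂ (C.g c) (C.h c) h h' g g').app V hV m)) = u • m := by
  classical
  obtain ⟨r, s₁, s₂, -, ha₁, ha₂⟩ := hlead
  have hadm := C.arr.adm_iff.2 ⟨ha₁.of_le (fun x => by rw [s₁]; exact Nat.le_add_right _ _), ha₂⟩
  have hadm' := C.arr.adm_iff.2 ⟨ha₁, ha₂.of_le (fun x => by rw [s₂]; exact Nat.le_add_right _ _)⟩
  have hne := C.arr.ne_of_step s₁ s₂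
  obtain ⟨hr₂, hr₁⟩ := (C.arr.step_iff r).2 ⟨s₁, s₂⟩
  obtain ⟨u₂, hu₂⟩ := (C.step₂ hV r).unit rfl rfl hr₂ hadm.1 hadm'.1
  obtain ⟨u₁, hu₁⟩ := (C.step₁ hV r).unit (add_comm _ _) (add_comm _ _) hr₁ hadm.2 hadm'.2
  refine ⟨(C.B₂.da (C.g c)).negOnePow * u₂ * u₁, fun m => ?_⟩
  rw [coord₂_d_ins₂ C.B₁ C.B₂ _ _ _ _ hV C.hΦ₁ C.hΦ₂ (E.restr hV) hp h h' g g' k k' l l'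
    (fun h => hne.1 h.1) (fun h => hne.2 h.1.symm) (fun h => hne.1 h.1.symm) (fun h => hne.1 h.1.symm)
    hadm.1, mul_assoc, mul_smul]
  congr 1
  refine ((E.restr hV).sum_idx_emb (n := n) _).trans ?_
  rw [Fintype.sum_eq_single r]
  · rw [coord₂_tm]
    refine (congrArg₂ (fun (x y : Fn O V) => x • y • m) hu₂ hu₁).trans ?_
    rw [mul_smul]
    simp only [Units.smul_def, smul_assoc, one_smul]
  · intro e he
    rw [coord₂_tm]
    have hst : ¬ (C.r₂ e (C.g c) (C.g c') ∧ C.r₁ e (C.h c) (C.h c')) := fun h => he (by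
      have h1 := congrFun (add_left_cancel ((((C.arr.step_iff e).1 h).1.symm).trans s₁)) e
      by_contra hne
      rw [ex_self, ex_of_ne hne] at h1
      exact one_ne_zero h1)
    by_cases hr₂ : C.r₂ e (C.g c) (C.g c')
    · refine (congrArg (_ • ·) ((congrArg (· • m) ((C.step₁ hV e).zero (add_comm _ _) (add_comm _ _)
        fun h => hst ⟨hr₂, h⟩)).trans (zero_smul _ _))).trans (smul_zero _)
    · exact (congrArg (· • _) ((C.step₂ hV e).zero rfl rfl hr₂)).trans (zero_smul _ _)

end

variable {p q : ℤ}

lemma key_zero_iff {c : (E.J n → ℕ) × (E.J n → ℕ)} (hc : c ≠ 0) : (0 < C.D₁.w → C.key c < C.key 0) ∧ (C.D₁.w < 0 → C.key 0 < C.key c) := by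
  have hl : 0 < len (C.g c) + len (C.h c) := by
    rw [C.arr.len_add, Nat.pos_iff_ne_zero]
    intro h0
    refine hc (Prod.ext (funext fun x => ?_) (funext fun x => ?_))
    · have : c.1 x ≤ len c.1 := Finset.single_le_sum (f := c.1) (fun _ _ => Nat.zero_le _) (Finset.mem_univ x)
      change _ = 0; omega
    · have : c.2 x ≤ len c.2 := Finset.single_le_sum (f := c.2) (fun _ _ => Nat.zero_le _) (Finset.mem_univ x)
      change _ = 0; omega
  have h1 : C.B₂.v * (len (C.g c) : ℤ) + C.B₁.v * (len (C.h c) : ℤ) < 0 := by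
    rw [C.hv₁, C.hv₂]; omega
  have h2 : C.D₁.w * (C.B₂.v * (len (C.g 0) : ℤ) + C.B₁.v * (len (C.h 0) : ℤ)) = 0 := by
    rw [C.arr.apply_zero.1, C.arr.apply_zero.2, len_zero]; simp
  refine ⟨fun hw => Prod.Lex.toLex_lt_toLex.2 (Or.inl ?_), fun hw => Prod.Lex.toLex_lt_toLex.2 (Or.inl ?_)⟩ <;>
  dsimp only <;> rw [h2]
  · exact mul_neg_of_pos_of_neg hw h1
  · exact mul_pos_of_neg_of_neg hw h1

variable (M V)
/-- The component of the pair `c` of exponents, in the total bidegree `(p, q)`. -/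
abbrev Component (q : ℤ) (c : (E.J n → ℕ) × (E.J n → ℕ)) (p : ℤ) : Type u :=
  SSec ((M.cx (q - C.B₂.v * len (C.g c) - C.B₁.v * len (C.h c))).X
    (p - C.B₂.da (C.g c) - C.B₁.da (C.h c))) V

/-- The coefficient of the pair `c` of exponents. -/
noncomputable def co (q : ℤ) (c : (E.J n → ℕ) × (E.J n → ℕ)) (p : ℤ) :
    SSec (((Φ₂.F.obj (Φ₁.F.obj M)).cx q).X p) V →ₗ[Fn O V] C.Component M V q c p :=
  (coord₂ C.B₁ C.B₂ Φ₁ Φ₂ (C.g c) (C.h c) (add_sub_cancel _ _) (add_sub_cancel _ _) (add_sub_cancel _ _)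
    (add_sub_cancel _ _)).app V hV

/-- Multiplication by the basis sections of the pair `c` of exponents. -/
noncomputable def inc (q : ℤ) (c : (E.J n → ℕ) × (E.J n → ℕ)) (p : ℤ) :
    C.Component M V q c p →ₗ[Fn O V] SSec (((Φ₂.F.obj (Φ₁.F.obj M)).cx q).X p) V :=
  (ins₂ C.B₁ C.B₂ Φ₁ Φ₂ (C.g c) (C.h c) (add_sub_cancel _ _) (add_sub_cancel _ _) (add_sub_cancel _ _)
    (add_sub_cancel _ _)).app V hV

open scoped Classical in
/-- The pairs of exponents of total length at most `N` whose monomials do not vanish. -/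
noncomputable def _root_.LinearKoszul.shortPairs (n : ℕ) (E : LocalFrame 𝒳 W) (N : ℕ) :
    Finset ((E.J n → ℕ) × (E.J n → ℕ)) :=
  (shortExps (E.J n) N ×ˢ shortExps (E.J n) N).filter fun c =>
    len c.1 + len c.2 ≤ N ∧ Adm E.degY c.1 ∧ Adm E.degX c.2

lemma _root_.LinearKoszul.mem_shortPairs {E : LocalFrame 𝒳 W} {N : ℕ} {c : (E.J n → ℕ) × (E.J n → ℕ)} :
    c ∈ shortPairs n E N ↔ len c.1 + len c.2 ≤ N ∧ Adm E.degY c.1 ∧ Adm E.degX c.2 := by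
  simp only [shortPairs, Finset.mem_filter, Finset.mem_product, shortExps, Set.Finite.mem_toFinset,
    Set.mem_ofPred_eq]
  exact ⟨fun h => h.2, fun h => ⟨⟨by omega, by omega⟩, h⟩⟩

variable {M V} {N : ℤ} (hM : BoundedBy M N)
include hM

lemma co_of_notMem {c : (E.J n → ℕ) × (E.J n → ℕ)} (hc : c ∉ shortPairs n E (N - q).toNat)
    (z : SSec (((Φ₂.F.obj (Φ₁.F.obj M)).cx q).X p) V) : C.co M V hV q c p z = 0 := by
  by_cases hd : Adm C.deg₂ (C.g c) ∧ Adm C.deg₁ (C.h c)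
  · refine subsingleton_of_isZero (hM _ ?_ _) _ _
    rw [mem_shortPairs, ← C.arr.len_add, ← C.arr.adm_iff] at hc
    have : ¬ (len (C.g c) + len (C.h c) ≤ (N - q).toNat) := fun h => hc ⟨h, hd⟩
    rw [C.hv₁, C.hv₂]
    omega
  · change (C.B₁.coord Φ₁ _ (add_sub_cancel _ _) (add_sub_cancel _ _)).app V hV
      ((C.B₂.coord Φ₂ _ (add_sub_cancel _ _) (add_sub_cancel _ _)).app V hV _) = 0
    by_cases hd' : Adm C.deg₂ (C.g c)
    · rw [C.B₁.coord_of_not_adm Φ₁ fun h => hd ⟨hd', h⟩]; rfl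
    · rw [C.B₂.coord_of_not_adm Φ₂ hd']; exact map_zero _

variable (hB : HasMonBases 𝒳 P₁)
include hB

lemma sum_inc (z : SSec (((Φ₂.F.obj (Φ₁.F.obj M)).cx q).X p) V) :
    ∑ c ∈ shortPairs n E (N - q).toNat, C.inc M V hV q c p (C.co M V hV q c p z) = z := by
  classical
  rw [shortPairs, Finset.sum_filter_of_ne]
  swap
  · intro c _ hc
    by_contra h
    rw [← mem_shortPairs (E := E) (n := n)] at h
    rw [C.co_of_notMem hV hM h, map_zero] at hc
    exact hc rfl
  refine Eq.trans ?_ (C.B₂.sum_coord Φ₂ (TensorFunctor.boundedBy hB hM)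
    (shortExps (E.J n) (N - q).toNat)
    (fun γ _ hγ => C.B₂.mem_shortExps (by rw [C.hv₂]; norm_num) hγ) hV z)
  refine (C.arr.sum_product (shortExps (E.J n) (N - q).toNat) fun γ δ =>
    (ins₂ C.B₁ C.B₂ Φ₁ Φ₂ γ δ (add_sub_cancel _ _) (add_sub_cancel _ _) (add_sub_cancel _ _)
      (add_sub_cancel _ _)).app V hV ((coord₂ C.B₁ C.B₂ Φ₁ Φ₂ γ δ (add_sub_cancel _ _)
      (add_sub_cancel _ _) (add_sub_cancel _ _) (add_sub_cancel _ _)).app V hV z)).trans ?_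
  refine Finset.sum_congr rfl fun γ _ => ?_
  conv_rhs => rw [← C.B₁.sum_coord Φ₁ hM (shortExps (E.J n) (N - q).toNat) (fun δ _ hδ =>
    C.B₁.mem_shortExps (q := q) (by rw [C.hv₁]; norm_num) (by rw [C.hv₂] at hδ; omega)) hV
    ((C.B₂.coord Φ₂ γ (add_sub_cancel _ _) (add_sub_cancel _ _)).app V hV z)]
  exact (map_sum (Φ₂.tmL _ _ _ V (C.B₂.bs γ hV)) _ _).symm

/-- The decomposition of the composite of two functors of linear Koszul duality by pairs of
exponents. -/
noncomputable def cellComplex (q : ℤ) : CellComplex C.key (Lead E.degY E.degX)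
    (fun p => SSec (((Φ₂.F.obj (Φ₁.F.obj M)).cx q).X p) V)
    (fun p => (sMap (((Φ₂.F.obj (Φ₁.F.obj M)).cx q).d p (p + 1)) V).toAddMonoidHom)
    (shortPairs n E (N - q).toNat) where
  G c p := C.Component M V q c p
  co c p := (C.co M V hV q c p).toAddMonoidHom
  ins c p := (C.inc M V hV q c p).toAddMonoidHom
  sum_ins p z := C.sum_inc hV hM hB z
  co_of_notMem c p z h := C.co_of_notMem hV hM h z
  co_d_ins c c' p m h₁ h₂ h₃ := C.coord₂_d_ins₂_of_not_lead hV (add_sub_cancel _ _)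
    (add_sub_cancel _ _) (add_sub_cancel _ _) (add_sub_cancel _ _) (add_sub_cancel _ _)
    (add_sub_cancel _ _) (add_sub_cancel _ _) (add_sub_cancel _ _) rfl h₁ h₂ h₃ m
  bij c c' p hl := by
    obtain ⟨r, s₁, s₂, -⟩ := id hl
    obtain ⟨hr₂, hr₁⟩ := (C.arr.step_iff r).2 ⟨s₁, s₂⟩
    have d₂ := (C.step₂ hV r).da hr₂
    have d₁ := (C.step₁ hV r).da hr₁
    have l₂ := (C.step₂ hV r).di hr₂
    have l₁ := (C.step₁ hV r).di hr₁
    have key : ∀ (b b' j j' : ℤ) (_ : b' = b) (_ : j' = j) (g₁ : C.B₂.da (C.g c) + (p - C.B₂.da (C.g c)) = p)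
      (g₂ : C.B₂.v * len (C.g c) + (q - C.B₂.v * len (C.g c)) = q)
      (g₃ : C.B₁.da (C.h c) + b = p - C.B₂.da (C.g c))
      (g₄ : C.B₁.v * len (C.h c) + j = q - C.B₂.v * len (C.g c))
      (k₁ : C.B₂.da (C.g c') + (p + 1 - C.B₂.da (C.g c')) = p + 1)
      (k₂ : C.B₂.v * len (C.g c') + (q - C.B₂.v * len (C.g c')) = q)
      (k₃ : C.B₁.da (C.h c') + b' = p + 1 - C.B₂.da (C.g c'))
      (k₄ : C.B₁.v * len (C.h c') + j' = q - C.B₂.v * len (C.g c')),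
      Function.Bijective fun m : SSec ((M.cx j).X b) V =>
        (coord₂ C.B₁ C.B₂ Φ₁ Φ₂ (C.g c') (C.h c') k₁ k₂ k₃ k₄).app V hV
          (sMap (((Φ₂.F.obj (Φ₁.F.obj M)).cx q).d p (p + 1)) V
            ((ins₂ C.B₁ C.B₂ Φ₁ Φ₂ (C.g c) (C.h c) g₁ g₂ g₃ g₄).app V hV m)) := by
      rintro b _ j _ rfl rfl g₁ g₂ g₃ g₄ k₁ k₂ k₃ k₄
      obtain ⟨u, hu⟩ := C.exists_coord₂_d_ins₂_of_lead hV g₁ g₂ g₃ g₄ (M := M) rfl hl k₁ k₂ k₃ k₄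
      rw [funext hu]
      exact MulAction.bijective u
    have hε := C.D₂.hε r.1
    have hw := C.D₂.hw
    exact key _ _ _ _ (by omega) (by omega) (add_sub_cancel _ _) (add_sub_cancel _ _)
      (add_sub_cancel _ _) (add_sub_cancel _ _) (add_sub_cancel _ _) (add_sub_cancel _ _)
      (add_sub_cancel _ _) (add_sub_cancel _ _)
  d_d p z := by
    change sMap _ V (sMap _ V z) = 0
    rw [← sMap_comp, HomologicalComplex.d_comp_d, sMap_zero]
  key_eq c c' hl := by
    obtain ⟨r, s₁, s₂, h3, -⟩ := id hl
    obtain ⟨hr₂, hr₁⟩ := (C.arr.step_iff r).2 ⟨s₁, s₂⟩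
    have d₂ := (C.step₂ hV r).da hr₂
    have d₁ := (C.step₁ hV r).da hr₁
    have l₂ := (C.step₂ hV r).di hr₂
    have l₁ := (C.step₁ hV r).di hr₁
    have hε := C.D₂.hε r.1
    have hw := C.D₂.hw
    have hl2 : len c.2 = len c'.2 + 1 := by rw [s₂, len_add, len_ex]
    have hlow : lowDegree c = lowDegree c' := lowDegree_eq s₁ s₂ h3
    have e₁ : C.D₁.w * (C.B₂.v * len (C.g c) + C.B₁.v * len (C.h c)) =
        C.D₁.w * (C.B₂.v * len (C.g c') + C.B₁.v * len (C.h c')) := by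
      rw [l₂, l₁]; linear_combination -C.D₁.w * hw
    have e₂ : C.B₂.da (C.g c) + C.B₁.da (C.h c) + (len c.2 : ℤ) =
        C.B₂.da (C.g c') + C.B₁.da (C.h c') + (len c'.2 : ℤ) := by
      rw [d₂, d₁, hl2]; push_cast; linear_combination -hε
    rw [key, key, e₁, e₂, hlow]
  lead_fun _ _ _ := Lead.fun
  lead_inj _ _ _ := Lead.inj
  lead_lead _ _ _ := Lead.not_lead fun j => by simp [LocalFrame.degX, LocalFrame.degY]

/-- A cocycle can be changed by a coboundary so that its components other than that of the trivial pair of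
exponents vanish. If the twist of the inner functor lowers the internal degree, the trivial pair is the
largest one, and its component has to vanish beforehand in order to vanish afterwards. -/
lemma exists_primitive (z : SSec (((Φ₂.F.obj (Φ₁.F.obj M)).cx q).X (p + 1)) V)
    (hz : sMap (((Φ₂.F.obj (Φ₁.F.obj M)).cx q).d (p + 1) (p + 1 + 1)) V z = 0)
    (h₀ : 0 < C.D₁.w ∨ (C.D₁.w < 0 ∧ C.co M V hV q 0 (p + 1) z = 0)) :
    ∃ w : SSec (((Φ₂.F.obj (Φ₁.F.obj M)).cx q).X p) V,
      (∀ c, c ≠ 0 → C.co M V hV q c (p + 1) (z - sMap (((Φ₂.F.obj (Φ₁.F.obj M)).cx q).d p (p + 1)) V w) = 0) ∧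
      (C.D₁.w < 0 → C.co M V hV q 0 (p + 1)
        (z - sMap (((Φ₂.F.obj (Φ₁.F.obj M)).cx q).d p (p + 1)) V w) = 0) := by
  classical
  have hdeg (j : E.J n) : E.degY j + E.degX j = 1 := by simp [LocalFrame.degX, LocalFrame.degY]
  have hpair : ∀ c ∈ (shortPairs n E (N - q).toNat).erase 0,
      ∃ c' ∈ (shortPairs n E (N - q).toNat).erase 0, Lead E.degY E.degX c c' ∨ Lead E.degY E.degX c' c := by
    intro c hc
    obtain ⟨hc0, hc⟩ := Finset.mem_erase.1 hc
    obtain ⟨hl, h1, h2⟩ := mem_shortPairs.1 hc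
    obtain ⟨c', h1', h2', hs, h⟩ := exists_lead hdeg h1 h2 hc0
    have hlen : len c.1 + len c.2 = len c'.1 + len c'.2 := by
      rw [len, len, len, len, ← Finset.sum_add_distrib, ← Finset.sum_add_distrib]
      exact Finset.sum_congr rfl fun j _ => hs j
    refine ⟨c', Finset.mem_erase.2 ⟨?_, mem_shortPairs.2 ⟨by omega, h1', h2'⟩⟩, h⟩
    rintro rfl
    refine hc0 (Prod.ext (funext fun x => ?_) (funext fun x => ?_)) <;>
    · have := hs x
      change _ = 0 + 0 at this
      change _ = 0
      omega
  obtain ⟨w, hw, hw₀⟩ := (C.cellComplex hV hM hB q).exists_eq 0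
    ((shortPairs n E (N - q).toNat).erase 0) (Finset.notMem_erase _ _) hpair
    (fun c _ c' hc' _ => or_iff_not_imp_right.2 fun h => Finset.mem_erase.2 ⟨h, hc'⟩) p z hz
    (fun c hc hc0 => C.co_of_notMem hV hM (fun h => hc (Finset.mem_erase.2 ⟨hc0, h⟩)) z)
    (h₀.imp (fun h c hc => ((C.key_zero_iff (Finset.mem_erase.1 hc).1).1 h).not_gt) fun h =>
      ⟨h.2, fun c hc => ((C.key_zero_iff (Finset.mem_erase.1 hc).1).2 h.1).not_gt⟩)
  exact ⟨w, fun c hc => hw c hc, fun h => hw₀ (h₀.resolve_left h.not_gt).2 fun c hc =>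
    ((C.key_zero_iff (Finset.mem_erase.1 hc).1).2 h).not_gt⟩

/-- If the twist of the inner functor raises the internal degree, a cocycle is cohomologous to one in the
component of the trivial pair of exponents. -/
lemma exists_eq_inc (hw : 0 < C.D₁.w) (z : SSec (((Φ₂.F.obj (Φ₁.F.obj M)).cx q).X (p + 1)) V)
    (hz : sMap (((Φ₂.F.obj (Φ₁.F.obj M)).cx q).d (p + 1) (p + 1 + 1)) V z = 0) :
    ∃ (w : SSec (((Φ₂.F.obj (Φ₁.F.obj M)).cx q).X p) V) (m : C.Component M V q 0 (p + 1)),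
      z = sMap (((Φ₂.F.obj (Φ₁.F.obj M)).cx q).d p (p + 1)) V w + C.inc M V hV q 0 (p + 1) m := by
  obtain ⟨w, hw, -⟩ := C.exists_primitive hV hM hB z hz (Or.inl hw)
  refine ⟨w, C.co M V hV q 0 (p + 1)
    (z - sMap (((Φ₂.F.obj (Φ₁.F.obj M)).cx q).d p (p + 1)) V w), ?_⟩
  rw [← sub_eq_iff_eq_add', eq_comm]
  have h1 := C.sum_inc hV hM hB (z - sMap (((Φ₂.F.obj (Φ₁.F.obj M)).cx q).d p (p + 1)) V w)
  rw [Finset.sum_eq_single 0] at h1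
  · exact h1
  · intro c _ hc
    rw [hw c hc, map_zero]
  · intro h0
    rw [C.co_of_notMem hV hM h0, map_zero]

/-- If the twist of the inner functor lowers the internal degree, a cocycle whose component for the
trivial pair of exponents vanishes is a coboundary. -/
lemma exists_eq_d (hw : C.D₁.w < 0) (z : SSec (((Φ₂.F.obj (Φ₁.F.obj M)).cx q).X (p + 1)) V)
    (hz : sMap (((Φ₂.F.obj (Φ₁.F.obj M)).cx q).d (p + 1) (p + 1 + 1)) V z = 0)
    (h₀ : C.co M V hV q 0 (p + 1) z = 0) :
    ∃ w : SSec (((Φ₂.F.obj (Φ₁.F.obj M)).cx q).X p) V,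
      z = sMap (((Φ₂.F.obj (Φ₁.F.obj M)).cx q).d p (p + 1)) V w := by
  obtain ⟨w, hw₁, hw₂⟩ := C.exists_primitive hV hM hB z hz (Or.inr ⟨hw, h₀⟩)
  refine ⟨w, sub_eq_zero.1 ?_⟩
  rw [← C.sum_inc hV hM hB (z - sMap (((Φ₂.F.obj (Φ₁.F.obj M)).cx q).d p (p + 1)) V w)]
  refine Finset.sum_eq_zero fun c _ => ?_
  by_cases hc : c = 0
  · subst hc
    rw [hw₂ hw, map_zero]
  · rw [hw₁ c hc, map_zero]
end CompositeBasis
end Contraction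

/-! ### The composites of the two functors -/

section Steps
variable {X : TopCat.{u}} {O : Sheaf (Opens.grothendieckTopology X) CommRingCat.{u}}
variable {J : Type} [Fintype J] [LinearOrder J] {deg : J → ℤ} {W V : Opens X}
  {𝒱 : CochainComplex (PMod O) ℤ} (b : PBasis 𝒱 W deg) (hV : V ≤ W) {w : ℤ} (hw : w ≠ 0)

namespace PBasis

/-- The variable of index `j` as a section of the graded-symmetric algebra. -/
noncomputable def varSec (w : ℤ) (j : J) : Sec ((symAlg w 𝒱).obj (deg j) w) V :=
  symGen w 𝒱 (deg j) V (res _ hV (b.e (deg j) j))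

lemma coef_var_mul_pbw (j : J) (γ γ' : J → ℕ) : (b.hb hV).coef γ' ((b.hb hV).var j * (b.hb hV).pbw γ) =
    sgn deg j γ • ((b.hb hV).coef γ' ((b.hb hV).pbw (γ + ex j))) := by
  rw [HBasis.var_mul_pbw, Units.smul_def, Units.smul_def, map_zsmul]

lemma ev_mul_varSec {a i p q : ℤ} (j : J) (γ γ' : J → ℕ) (h : deg j + a = p) (h' : w + i = q)
    (ha : tdeg deg γ = a) (hi : w * len γ = i) :
    ev ((b.monBasis w hw).c p q γ') hV ((symAlg w 𝒱).mul h h' V (b.varSec hV w j) (b.monSec w a i γ hV)) =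
    sgn deg j γ • ((b.hb hV).coef γ' ((b.hb hV).pbw (γ + ex j))) := by
  refine Eq.trans ?_ (b.coef_var_mul_pbw hV j γ γ')
  exact congrArg (fun z => (b.hb hV).coef γ' ((b.hb hV).var j * z)) (if_pos ⟨ha, hi⟩)

lemma monBasis_bs (γ : J → ℕ) : (b.monBasis w hw).bs γ hV = b.monSec w (tdeg deg γ) (w * len γ) γ hV :=
  b.monSec_res w _ _ γ le_rfl hV

lemma isStep_mul (j : J) : (b.monBasis w hw).IsStep hV (deg j) w
    (fun {_ _ _ _} h h' => (symAlg w 𝒱).mul ((add_comm _ _).trans h) ((add_comm _ _).trans h') V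
      (b.varSec hV w j)) (Up j) where
  da h := by
    change tdeg deg _ = tdeg deg _ + _
    rw [h, tdeg_add, tdeg_ex]
  di h := by
    change w * _ = w * _ + w
    rw [h, len_add, len_ex]; push_cast; ring
  zero {γ γ' p q} h h' hr := by
    classical
    rw [b.monBasis_bs]
    refine (b.ev_mul_varSec hV hw j γ γ' _ _ rfl rfl).trans ?_
    rw [HBasis.coef_pbw, if_neg fun h => hr h.1, smul_zero]
  unit {γ γ' p q} h h' hr h1 h2 := by
    classical
    refine ⟨sgn deg j γ, ?_⟩
    rw [b.monBasis_bs]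
    refine (b.ev_mul_varSec hV hw j γ γ' _ _ rfl rfl).trans ?_
    rw [HBasis.coef_pbw, if_pos ⟨hr, h2⟩]

lemma isStep_flip_mul (j : J) : (b.monBasis w hw).IsStep hV (deg j) w
    (fun {_ _ _ _} h h' => ((symAlg w 𝒱).mul h h' V).flip (b.varSec hV w j)) (Up j) where
  da h := (b.isStep_mul hV hw j).da h
  di h := (b.isStep_mul hV hw j).di h
  zero {γ γ' p q} h h' hr := by
    have h1 := symAlg_comm w 𝒱 h ((add_comm _ _).trans h) h' ((add_comm _ _).trans h') V
      ((b.monBasis w hw).bs γ hV) (b.varSec hV w j)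
    refine (congrArg (ev _ hV) h1).trans ?_
    rw [DGMod.map_unit_smul]
    exact (congrArg _ ((b.isStep_mul hV hw j).zero h h' hr)).trans (smul_zero _)
  unit {γ γ' p q} h h' hr h1 h2 := by
    have h3 := symAlg_comm w 𝒱 h ((add_comm _ _).trans h) h' ((add_comm _ _).trans h') V
      ((b.monBasis w hw).bs γ hV) (b.varSec hV w j)
    obtain ⟨u, hu⟩ := (b.isStep_mul hV hw j).unit h h' hr h1 h2
    refine ⟨((b.monBasis w hw).da γ * deg j).negOnePow * u, (congrArg (ev _ hV) h3).trans ?_⟩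
    rw [DGMod.map_unit_smul, mul_smul]
    exact congrArg _ hu

lemma ev_precomp_varSec {p q : ℤ} (j : J) (γ γ' : J → ℕ) (h : -tdeg deg γ + deg j = p)
    (h' : -w * len γ + w = q) (hγ : tdeg deg γ' = -p ∧ w * len γ' = -q) :
    ev ((b.monBasis w hw).dualBasis.c p q γ') hV
      (precomp (symAlg w 𝒱) h h' V (b.varSec hV w j) ((b.monBasis w hw).dualBasis.bs γ hV)) =
    sgn deg j γ' • ((b.hb hV).coef γ ((b.hb hV).pbw (γ' + ex j))) := by
  refine Eq.trans ?_ (b.ev_mul_varSec hV hw (p := - -tdeg deg γ) (q := -(-w * len γ)) j γ' γ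
    (by omega) (by linarith) hγ.1 hγ.2)
  have h1 : res _ hV (b.monSec w (-p) (-q) γ' le_rfl) = b.monSec w (-p) (-q) γ' hV :=
    b.monSec_res w _ _ γ' le_rfl hV
  change ev ((b.monBasis w hw).c (- -tdeg deg γ) (-(-w * len γ)) γ) hV ((symAlg w 𝒱).mul _ _ V
    (res _ le_rfl (b.varSec hV w j)) (res _ hV (b.monSec w (-p) (-q) γ' le_rfl))) = _
  rw [h1, res_refl]

lemma isStep_precomp (j : J) : (b.monBasis w hw).dualBasis.IsStep hV (deg j) w
    (fun {_ _ _ _} h h' => precompL (symAlg w 𝒱) h h' V (b.varSec hV w j)) (Down j) where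
  da {γ γ'} h := by
    change -tdeg deg _ = -tdeg deg _ + _
    rw [show γ = γ' + ex j from h, tdeg_add, tdeg_ex]; ring
  di {γ γ'} h := by
    change -w * _ = -w * _ + w
    rw [show γ = γ' + ex j from h, len_add, len_ex]; push_cast; ring
  zero {γ γ' p q} h h' hr := by
    classical
    by_cases hγ : tdeg deg γ' = -p ∧ w * len γ' = -q
    · refine (b.ev_precomp_varSec hV hw j γ γ' h h' hγ).trans ?_
      rw [HBasis.coef_pbw, if_neg fun h => hr h.1, smul_zero]
    · rw [(b.monBasis w hw).dualBasis.c_zero]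
      · rfl
      · rintro ⟨-, h1, h2⟩
        exact hγ ⟨by change -tdeg deg γ' = p at h1; omega, by change -w * _ = q at h2; linarith⟩
  unit {γ γ' p q} h h' hr h1 h2 := by
    classical
    change -tdeg deg γ + _ = p at h
    change -w * _ + w = q at h'
    refine ⟨sgn deg j γ', (b.ev_precomp_varSec hV hw j γ γ' h h' ⟨?_, ?_⟩).trans ?_⟩
    · rw [show γ = γ' + ex j from hr, tdeg_add, tdeg_ex] at h; omega
    · rw [show γ = γ' + ex j from hr, len_add, len_ex] at h'; push_cast at h'; linarith
    · rw [HBasis.coef_pbw, if_pos ⟨hr, h1⟩]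

lemma isStep_dualAct (j : J) : (b.monBasis w hw).dualBasis.IsStep hV (deg j) w
    (fun {_ _ _ _} h h' => dualActL (symAlg w 𝒱) ((add_comm _ _).trans h) ((add_comm _ _).trans h') V
      (b.varSec hV w j)) (Down j) where
  da h := (b.isStep_precomp hV hw j).da h
  di h := (b.isStep_precomp hV hw j).di h
  zero {γ γ' p q} h h' hr := by
    refine (DGMod.map_unit_smul (ev ((b.monBasis w hw).dualBasis.c p q γ') hV) _ _).trans ?_
    exact (congrArg _ ((b.isStep_precomp hV hw j).zero h h' hr)).trans (smul_zero _)
  unit {γ γ' p q} h h' hr h1 h2 := by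
    obtain ⟨u, hu⟩ := (b.isStep_precomp hV hw j).unit h h' hr h1 h2
    refine ⟨(deg j * (b.monBasis w hw).dualBasis.da γ).negOnePow * u,
      (DGMod.map_unit_smul (ev ((b.monBasis w hw).dualBasis.c p q γ') hV) _ _).trans ?_⟩
    rw [mul_smul]
    exact congrArg _ hu
end PBasis

variable {n : ℕ} {𝒳 : CochainComplex (Mod O) ℤ} (h𝒳 : IsFiniteLocallyFree n 𝒳) (E : LocalFrame 𝒳 W)
variable (A : KoszulA n 𝒳) (B : KoszulB n 𝒳)

lemma LocalFrame.varSec_basisY (j : E.J n) :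
    (E.basisY h𝒳).varSec hV (-2) j = (E.restr hV).yS j.1 j.2 := by
  refine congrArg (symGen (-2) (dualComplex 𝒳) (j.1 : ℤ) V) (congrArg (res _ hV) ?_)
  exact dif_pos rfl

lemma LocalFrame.varSec_basisX (j : E.J n) :
    (E.basisX h𝒳).varSec hV 2 j = (E.restr hV).xT j.1 j.2 := by
  refine congrArg (symGen 2 (xP 𝒳) (1 - j.1 : ℤ) V) (congrArg (res _ hV) ?_)
  exact dif_pos rfl

/-- The bases for the composite `𝒜 ∘ ℬ`. -/
noncomputable def basisAB : CompositeBasis n E B.toTensorFunctor A.toTensorFunctor where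
  D₁ := twB h𝒳
  D₂ := twA h𝒳
  hΦ₁ := KoszulB.isTwisted h𝒳 B
  hΦ₂ := KoszulA.isTwisted h𝒳 A
  hw := by change (2 : ℤ) ≠ 0; norm_num
  deg₁ := E.degX
  deg₂ := E.degY
  B₁ := E.basisTd h𝒳
  B₂ := E.basisS h𝒳
  hv₁ := rfl
  hv₂ := rfl
  g := Prod.fst
  h := Prod.snd
  r₁ := Down
  r₂ := Up
  arr := .id
  step₂ hV j := by
    have h1 := (E.basisY h𝒳).isStep_flip_mul hV (w := -2) (by norm_num) j
    rw [E.varSec_basisY] at h1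
    exact h1
  step₁ hV j := by
    have h1 := (E.basisX h𝒳).isStep_dualAct hV (w := 2) (by norm_num) j
    rw [E.varSec_basisX] at h1
    exact h1

/-- The bases for the composite `ℬ ∘ 𝒜`. -/
noncomputable def basisBA : CompositeBasis n E A.toTensorFunctor B.toTensorFunctor where
  D₁ := twA h𝒳
  D₂ := twB h𝒳
  hΦ₁ := KoszulA.isTwisted h𝒳 A
  hΦ₂ := KoszulB.isTwisted h𝒳 B
  hw := by change (-2 : ℤ) ≠ 0; norm_num
  deg₁ := E.degY
  deg₂ := E.degX
  B₁ := E.basisS h𝒳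
  B₂ := E.basisTd h𝒳
  hv₁ := rfl
  hv₂ := rfl
  g := Prod.snd
  h := Prod.fst
  r₁ := Up
  r₂ := Down
  arr := .swap
  step₂ hV j := by
    have h1 := (E.basisX h𝒳).isStep_precomp hV (w := 2) (by norm_num) j
    rw [E.varSec_basisX] at h1
    exact h1
  step₁ hV j := by
    have h1 := (E.basisY h𝒳).isStep_mul hV (w := -2) (by norm_num) j
    rw [E.varSec_basisY] at h1
    exact h1
end Steps

/-! ### The pairing with sections of the algebra -/

section Pairing
variable {X : TopCat.{u}} {O : Sheaf (Opens.grothendieckTopology X) CommRingCat.{u}}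
variable {𝒜 ℬ 𝒞 : DGAlg O} (Φ : TensorFunctor (dgDual 𝒜) ℬ 𝒞) {N : DGMod ℬ} {U : Opens X}

namespace TensorFunctor
variable {a b c i j l p q p' q' : ℤ}

/-- The evaluation of the sections of `𝒜^∨` at a section of `𝒜`. -/
noncomputable def _root_.LinearKoszul.devAt (t : Sec (𝒜.obj (-a) (-i)) U) {V : Opens X} (hV : V ≤ U) :
    Sec (dgDual 𝒜 a i) V →ₗ[Fn O V] Fn O V :=
  ev (F := dual (𝒜.obj (-a) (-i))) (evSec t) hV

lemma _root_.LinearKoszul.devAt_apply (t : Sec (𝒜.obj (-a) (-i)) U) {V : Opens X} (hV : V ≤ U)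
    (φ : Sec (dgDual 𝒜 a i) V) : devAt t hV φ = dev φ le_rfl (res _ hV t) := rfl

lemma _root_.LinearKoszul.devAt_res (t : Sec (𝒜.obj (-a) (-i)) U) {V V' : Opens X} (hV : V ≤ U)
    (hV' : V' ≤ V) (φ : Sec (dgDual 𝒜 a i) V) :
    devAt t (hV'.trans hV) (res _ hV' φ) = resFn O hV' (devAt t hV φ) :=
  DualSec.app_res (F := dual (𝒜.obj (-a) (-i))) _ _ _ _ hV' φ

open scoped Classical in
/-- The bilinear map `(φ, n) ↦ φ(t) n` with values in a given bidegree. -/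
noncomputable def pairAux (N : DGMod ℬ) (t : Sec (𝒜.obj c l) U) (k : BiIdx p q) :
    LBil U (dgDual 𝒜 k.a k.i) (toP.obj ((N.cx k.j).X k.b)) (toP.obj ((N.cx q').X p')) :=
  if h : (c + 0 = -k.a ∧ l + 0 = -k.i) ∧ (0 + k.b = p' ∧ 0 + k.j = q') then
    ⟨fun V hV => (N.act h.2.1 h.2.2 V).comp ((devAt (𝒜.mul h.1.1 h.1.2 U t (𝒜.one U)) hV).smulRight
        (ℬ.one V)),
      fun {V V'} hV hV' x y => by
        rw [LinearMap.comp_apply, LinearMap.comp_apply, LinearMap.smulRight_apply,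
          LinearMap.smulRight_apply, ← N.act_res, (res (ℬ.obj 0 0) hV').map_smulₛₗ, ℬ.one_res,
          devAt_res]⟩
  else 0

/-- The local map `φ ⊗ n ↦ φ(t) n` for a section `t` of `𝒜`. -/
noncomputable def pairHom (t : Sec (𝒜.obj c l) U) (_ : p + c = p') (_ : q + l = q') :
    LHom U (toP.obj (((Φ.F.obj N).cx q).X p)) (toP.obj ((N.cx q').X p')) :=
  Φ.tmLift fun k => pairAux N t k

/-- The pairing of a section `t` of `𝒜` with the sections of `𝒜^∨ ⊗ N`. -/
noncomputable def pair (h : p + c = p') (h' : q + l = q') (V : Opens X) (t : Sec (𝒜.obj c l) V) :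
    SSec (((Φ.F.obj N).cx q).X p) V →ₗ[Fn O V] SSec ((N.cx q').X p') V :=
  (Φ.pairHom t h h').app V le_rfl

lemma pairHom_tm (t : Sec (𝒜.obj c l) U) (hc : c = -a) (hl : l = -i) (h : p + c = b) (h' : q + l = j)
    (h₁ : a + b = p) (h₁' : i + j = q) {V : Opens X} (hV : V ≤ U) (φ : Sec (dgDual 𝒜 a i) V)
    (n : SSec ((N.cx j).X b) V) : (Φ.pairHom t h h').app V hV (Φ.tm N h₁ h₁' V φ n) =
      dev φ le_rfl (𝒜.mul ((add_zero c).trans hc) ((add_zero l).trans hl) V (res _ hV t) (𝒜.one V)) • n := by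
  rw [pairHom, Φ.tmLift_tm, pairAux, dif_pos ⟨⟨(add_zero c).trans hc, (add_zero l).trans hl⟩,
    zero_add b, zero_add j⟩]
  change N.act (zero_add b) (zero_add j) V
    (devAt (𝒜.mul _ _ U t (𝒜.one U)) hV φ • ℬ.one V) n = _
  rw [devAt_apply, map_smul, LinearMap.smul_apply, N.one_act, ← 𝒜.mul_res, 𝒜.one_res]

lemma pairHom_tm_ne (t : Sec (𝒜.obj c l) U) (hne : ¬ (c = -a ∧ l = -i)) (h : p + c = p')
    (h' : q + l = q') (h₁ : a + b = p) (h₁' : i + j = q) {V : Opens X} (hV : V ≤ U)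
    (φ : Sec (dgDual 𝒜 a i) V) (n : SSec ((N.cx j).X b) V) :
    (Φ.pairHom t h h').app V hV (Φ.tm N h₁ h₁' V φ n) = 0 := by
  rw [pairHom, Φ.tmLift_tm, pairAux, dif_neg]
  · rfl
  · rintro ⟨⟨h2, h3⟩, -⟩
    exact hne ⟨by dsimp only at h2; omega, by dsimp only at h3; omega⟩

lemma pair_tm (t : Sec (𝒜.obj (-a) (-i)) U) (h : p + -a = b) (h' : q + -i = j)
    (h₁ : a + b = p) (h₁' : i + j = q) (φ : Sec (dgDual 𝒜 a i) U)
    (n : SSec ((N.cx j).X b) U) : Φ.pair h h' U t (Φ.tm N h₁ h₁' U φ n) = dev φ le_rfl t • n := by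
  refine (pairHom_tm Φ t rfl rfl h h' h₁ h₁' le_rfl φ n).trans ?_
  rw [res_refl, 𝒜.mul_one]

lemma pair_tm_ne (t : Sec (𝒜.obj c l) U) (hne : ¬ (c = -a ∧ l = -i)) (h : p + c = p')
    (h' : q + l = q') (h₁ : a + b = p) (h₁' : i + j = q) (φ : Sec (dgDual 𝒜 a i) U)
    (n : SSec ((N.cx j).X b) U) : Φ.pair h h' U t (Φ.tm N h₁ h₁' U φ n) = 0 :=
  pairHom_tm_ne Φ t hne h h' h₁ h₁' le_rfl φ n

lemma pairHom_app (t : Sec (𝒜.obj c l) U) (h : p + c = p') (h' : q + l = q') {V : Opens X} (hV : V ≤ U)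
    (z : SSec (((Φ.F.obj N).cx q).X p) V) :
    (Φ.pairHom t h h').app V hV z = Φ.pair h h' V (res _ hV t) z := by
  have : (Φ.pairHom (N := N) t h h').restr hV = Φ.pairHom (res _ hV t) h h' := by
    refine Φ.tm_ext fun {a b i j} h₁ h₁' V' hV' φ n => ?_
    change (Φ.pairHom t h h').app V' (hV'.trans hV) _ = _
    by_cases hd : c = -a ∧ l = -i
    · obtain ⟨hc, hl⟩ := hd
      obtain rfl : b = p' := by omega
      obtain rfl : j = q' := by omega
      rw [pairHom_tm Φ t hc hl, pairHom_tm Φ _ hc hl, res_res]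
    · rw [pairHom_tm_ne Φ t hd, pairHom_tm_ne Φ _ hd]
  exact congrArg (fun f => f.app V le_rfl z) this

lemma pair_zero (h : p + c = p') (h' : q + l = q') (z : SSec (((Φ.F.obj N).cx q).X p) U) :
    Φ.pair h h' U 0 z = 0 := by
  have : Φ.pairHom (N := N) (0 : Sec (𝒜.obj c l) U) h h' = 0 := by
    refine Φ.tm_ext fun {a b i j} h₁ h₁' V hV φ n => ?_
    change _ = 0
    by_cases hd : c = -a ∧ l = -i
    · obtain ⟨hc, hl⟩ := hd
      obtain rfl : b = p' := by omega
      obtain rfl : j = q' := by omega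
      rw [pairHom_tm Φ _ hc hl, map_zero, map_zero, LinearMap.zero_apply, map_zero, zero_smul]
    · rw [pairHom_tm_ne Φ _ hd]
  exact congrArg (fun f => f.app U le_rfl z) this

lemma pair_res (t : Sec (𝒜.obj c l) U) (h : p + c = p') (h' : q + l = q') {V : Opens X} (hV : V ≤ U)
    (z : SSec (((Φ.F.obj N).cx q).X p) U) :
    Φ.pair h h' V (res _ hV t) (res _ hV z) = res _ hV (Φ.pair h h' U t z) := by
  rw [← pairHom_app]
  exact (Φ.pairHom t h h').app_res le_rfl hV z

lemma pair_map {N' : DGMod ℬ} (f : N ⟶ N') (t : Sec (𝒜.obj c l) U) (h : p + c = p') (h' : q + l = q')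
    (z : SSec (((Φ.F.obj N).cx q).X p) U) :
    Φ.pair h h' U t (sMap (((Φ.F.map f).f q).f p) U z) =
      sMap ((f.f q').f p') U (Φ.pair h h' U t z) := by
  have : (Φ.pairHom t h h').comp (LHom.ofHom U (toP.map (((Φ.F.map f).f q).f p))) =
      (LHom.ofHom U (toP.map ((f.f q').f p'))).comp (Φ.pairHom t h h') := by
    refine Φ.tm_ext fun {a b i j} h₁ h₁' V hV φ n => ?_
    change (Φ.pairHom t h h').app V hV (sMap _ V _) = sMap _ V ((Φ.pairHom t h h').app V hV _)
    rw [Φ.map_tm]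
    by_cases hd : c = -a ∧ l = -i
    · obtain ⟨hc, hl⟩ := hd
      obtain rfl : b = p' := by omega
      obtain rfl : j = q' := by omega
      rw [pairHom_tm Φ t hc hl, pairHom_tm Φ t hc hl, map_smul]
    · rw [pairHom_tm_ne Φ t hd, pairHom_tm_ne Φ t hd, map_zero]
  exact congrArg (fun f => f.app U le_rfl z) this

lemma pair_tm_d {a' c' : ℤ} (ha : a + 1 = a') (hc : c + 1 = c') (t : Sec (𝒜.obj c l) U)
    {p₁ : ℤ} (h : p₁ + c = p') (h' : q + l = q') (h₁ : a' + b = p₁) (h₂ : i + j = q)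
    (h₃ : p + c' = p') (h₄ : a + b = p) (φ : Sec (dgDual 𝒜 a i) U) (n : SSec ((N.cx j).X b) U) :
    Φ.pair h h' U t (Φ.tm N h₁ h₂ U (secMap (dgDualD 𝒜 ha i) U φ) n) =
      c.negOnePow • Φ.pair h₃ h' U (secMap (𝒜.d hc l) U t) (Φ.tm N h₄ h₂ U φ n) := by
  by_cases hd : c = -a' ∧ l = -i
  · obtain ⟨rfl, rfl⟩ := hd
    obtain rfl : b = p' := by omega
    obtain rfl : j = q' := by omega
    obtain rfl : c' = -a := by omega
    rw [pair_tm, pair_tm, dev_dgDualD, ha, Int.negOnePow_neg, Units.smul_def, smul_assoc]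
    rfl
  · rw [pair_tm_ne _ _ hd, pair_tm_ne, smul_zero]
    omega

lemma pair_tm_map_d {b' p₀ : ℤ} (t : Sec (𝒜.obj c l) U)
    {p₁ : ℤ} (h : p₁ + c = p') (h' : q + l = q') (h₁ : a + b' = p₁) (h₂ : i + j = q)
    (h₃ : p + c = p₀) (h₄ : a + b = p) (φ : Sec (dgDual 𝒜 a i) U) (n : SSec ((N.cx j).X b) U) :
    a.negOnePow • Φ.pair h h' U t (Φ.tm N h₁ h₂ U φ (sMap ((N.cx j).d b b') U n)) =
      c.negOnePow • sMap ((N.cx q').d p₀ p') U (Φ.pair h₃ h' U t (Φ.tm N h₄ h₂ U φ n)) := by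
  by_cases hd : c = -a ∧ l = -i
  · obtain ⟨rfl, rfl⟩ := hd
    obtain rfl : b' = p' := by omega
    obtain rfl : b = p₀ := by omega
    obtain rfl : j = q' := by omega
    rw [pair_tm, pair_tm, map_smul, Int.negOnePow_neg]
  · rw [pair_tm_ne _ _ hd, pair_tm_ne _ _ hd, map_zero, smul_zero, smul_zero]

lemma pair_tm_precomp {e f e' f' ae ifd be jf ce lf p₁ q₁ pe qf : ℤ} (x : Sec (𝒜.obj e f) U)
    (y : Sec (ℬ.obj e' f') U) (t : Sec (𝒜.obj c l) U) (h : p₁ + c = p') (h' : q₁ + l = q')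
    (h₁ : ae + be = p₁) (h₁' : ifd + jf = q₁) (h₂ : a + e = ae) (h₂' : i + f = ifd)
    (h₃ : e' + b = be) (h₃' : f' + j = jf) (h₄ : e + c = ce) (h₄' : f + l = lf)
    (h₅ : p + ce = pe) (h₅' : q + lf = qf) (h₆ : e' + pe = p') (h₆' : f' + qf = q')
    (h₇ : a + b = p) (h₇' : i + j = q)
    (φ : Sec (dgDual 𝒜 a i) U) (n : SSec ((N.cx j).X b) U) :
    a.negOnePow • Φ.pair h h' U t (Φ.tm N h₁ h₁' U (precomp 𝒜 h₂ h₂' U x φ) (N.act h₃ h₃' U y n)) =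
      (c + e).negOnePow • N.act h₆ h₆' U y
        (Φ.pair h₅ h₅' U (𝒜.mul h₄ h₄' U x t) (Φ.tm N h₇ h₇' U φ n)) := by
  by_cases hd : c = -ae ∧ l = -ifd
  · obtain ⟨rfl, rfl⟩ := hd
    obtain rfl : be = p' := by omega
    obtain rfl : jf = q' := by omega
    obtain rfl : ce = -a := by omega
    obtain rfl : lf = -i := by omega
    obtain rfl : b = pe := by omega
    obtain rfl : j = qf := by omega
    rw [pair_tm, pair_tm, map_smul, dev_precomp, res_refl]
    congr 1
    rw [show -ae + e = -a by omega, Int.negOnePow_neg]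
  · rw [pair_tm_ne _ _ hd, pair_tm_ne, map_zero, smul_zero, smul_zero]
    omega

lemma pair_tm_dualAct {e f ae ifd ce lf p₁ q₁ : ℤ} (s : Sec (𝒜.obj e f) U)
    (t : Sec (𝒜.obj c l) U) (h : p₁ + c = p') (h' : q₁ + l = q')
    (h₁ : ae + b = p₁) (h₁' : ifd + j = q₁) (h₂ : e + a = ae) (h₂' : f + i = ifd)
    (h₄ : e + c = ce) (h₄' : f + l = lf)
    (h₅ : p + ce = p') (h₅' : q + lf = q') (h₇ : a + b = p) (h₇' : i + j = q)
    (φ : Sec (dgDual 𝒜 a i) U) (n : SSec ((N.cx j).X b) U) :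
    Φ.pair h h' U t (Φ.tm N h₁ h₁' U (dualAct 𝒜 h₂ h₂' U s φ) n) =
      (e * (e + c)).negOnePow • Φ.pair h₅ h₅' U (𝒜.mul h₄ h₄' U s t) (Φ.tm N h₇ h₇' U φ n) := by
  by_cases hd : c = -ae ∧ l = -ifd
  · obtain ⟨rfl, rfl⟩ := hd
    obtain rfl : b = p' := by omega
    obtain rfl : j = q' := by omega
    obtain rfl : ce = -a := by omega
    obtain rfl : lf = -i := by omega
    rw [pair_tm, pair_tm, dev_dualAct, res_refl, show e * (e + -ae) = -(e * a) by rw [← h₂]; ring, Int.negOnePow_neg,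
      Units.smul_def, smul_assoc]
    rfl
  · rw [pair_tm_ne _ _ hd, pair_tm_ne, smul_zero]
    omega
end TensorFunctor

namespace KoszulB
variable {n : ℕ} {𝒳 : CochainComplex (Mod O) ℤ} (h𝒳 : IsFiniteLocallyFree n 𝒳) (B : KoszulB n 𝒳)
  {N : DGMod (algS 𝒳)} {c l p q p' q' : ℤ}

lemma pair_act {e f ce lf p₁ q₁ : ℤ} (s : Sec ((algT 𝒳).obj e f) U) (t : Sec ((algT 𝒳).obj c l) U)
    (h : p₁ + c = p') (h' : q₁ + l = q') (h₁ : e + p = p₁) (h₁' : f + q = q₁) (h₄ : e + c = ce)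
    (h₄' : f + l = lf) (h₅ : p + ce = p') (h₅' : q + lf = q')
    (z : SSec (((B.F.obj N).cx q).X p) U) :
    B.pair h h' U t ((B.F.obj N).act h₁ h₁' U s z) =
      (e * (e + c)).negOnePow • B.pair h₅ h₅' U ((algT 𝒳).mul h₄ h₄' U s t) z := by
  have : (B.pairHom t h h').comp ((B.F.obj N).actL h₁ h₁' s) =
      (e * (e + c)).negOnePow • B.pairHom (N := N) ((algT 𝒳).mul h₄ h₄' U s t) h₅ h₅' := by
    refine B.tm_ext fun {a b i j} h₂ h₂' V hV φ n => ?_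
    change (B.pairHom t h h').app V hV ((B.F.obj N).act h₁ h₁' V (res _ hV s) (B.tm N h₂ h₂' V φ n)) =
      (e * (e + c)).negOnePow • (B.pairHom _ h₅ h₅').app V hV (B.tm N h₂ h₂' V φ n)
    rw [B.act_tm N h₂ h₂' h₁ h₁' rfl rfl (by omega) (by omega), B.pairHom_app, B.pairHom_app,
      ← (algT 𝒳).mul_res]
    exact B.pair_tm_dualAct (res _ hV s) (res _ hV t) h h' _ _ _ _ h₄ h₄' h₅ h₅' h₂ h₂' φ n
  have h2 := congrArg (fun f => f.app U le_rfl z) this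
  change B.pair h h' U t ((B.F.obj N).act h₁ h₁' U (res _ le_rfl s) z) = _ at h2
  rwa [res_refl] at h2

include h𝒳 in
lemma _root_.LinearKoszul.LocalFrame.xT_restr (E : LocalFrame 𝒳 U) {V : Opens X} (hV : V ≤ U)
    (e : Σ k, Fin (E.r k)) : (E.restr hV).xT e.1 e.2 = res _ hV (E.xT e.1 e.2) :=
  (twA h𝒳).Z_res E hV e

include h𝒳 in
lemma _root_.LinearKoszul.LocalFrame.yS_restr (E : LocalFrame 𝒳 U) {V : Opens X} (hV : V ≤ U)
    (e : Σ k, Fin (E.r k)) : (E.restr hV).yS e.1 e.2 = res _ hV (E.yS e.1 e.2) :=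
  (twB h𝒳).Z_res E hV e

include h𝒳 in
/-- The differential of the pairing, in terms of a frame. -/
lemma pair_d {c' p₀ p₁ : ℤ} (E : LocalFrame 𝒳 U) (t : Sec ((algT 𝒳).obj c l) U) (hp : p + 1 = p₁)
    (h : p₁ + c = p') (h' : q + l = q') (hc : c + 1 = c') (h₃ : p + c' = p') (h₄ : p + c = p₀)
    (z : SSec (((B.F.obj N).cx q).X p) U) :
    B.pair h h' U t (sMap (((B.F.obj N).cx q).d p p₁) U z) =
      c.negOnePow • (B.pair h₃ h' U (secMap ((algT 𝒳).d hc l) U t) z +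
        sMap ((N.cx q').d p₀ p') U (B.pair h₄ h' U t z) +
        ∑ e ∈ E.idx n, (1 - e.1).negOnePow • N.act (b := p + (1 - e.1 + c)) (j := q + (2 + l))
          (by omega) (by omega) U (E.yS e.1 e.2)
          (B.pair rfl rfl U ((algT 𝒳).mul rfl rfl U (E.xT e.1 e.2) t) z)) := by
  let f (e : Σ k, Fin (E.r k)) : LHom U (toP.obj (((B.F.obj N).cx q).X p)) (toP.obj ((N.cx q').X p')) :=
    (1 - e.1).negOnePow • (N.actL (b := p + (1 - e.1 + c)) (j := q + (2 + l))
      (by omega) (by omega) (E.yS e.1 e.2)).comp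
        (B.pairHom ((algT 𝒳).mul rfl rfl U (E.xT e.1 e.2) t) rfl rfl)
  let F : LHom U (toP.obj (((B.F.obj N).cx q).X p)) (toP.obj ((N.cx q').X p')) :=
    ⟨fun V hV => ∑ e ∈ E.idx n, (f e).app V hV, fun h h' x => by
      rw [LinearMap.sum_apply, LinearMap.sum_apply, map_sum]
      exact Finset.sum_congr rfl fun e _ => (f e).app_res h h' x⟩
  have hF (V : Opens X) (hV : V ≤ U) x : F.app V hV x = ∑ e ∈ E.idx n, (f e).app V hV x :=
    LinearMap.sum_apply _ _ _
  have : (B.pairHom t h h').comp (LHom.ofHom U (toP.map (((B.F.obj N).cx q).d p p₁))) =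
      c.negOnePow • (B.pairHom (secMap ((algT 𝒳).d hc l) U t) h₃ h' +
        (LHom.ofHom U (toP.map ((N.cx q').d p₀ p'))).comp (B.pairHom t h₄ h') + F) := by
    refine B.tm_ext fun {a b i j} h₁ h₁' V hV φ m => ?_
    change (B.pairHom t h h').app V hV (sMap _ V (B.tm N h₁ h₁' V φ m)) =
      c.negOnePow • ((B.pairHom _ h₃ h').app V hV _ + sMap _ V ((B.pairHom t h₄ h').app V hV _) +
        F.app V hV _)
    rw [(B.isTwisted h𝒳).d_tm' h₁ h₁' rfl rfl hp (by omega) (by omega) V (E.restr hV), hF, map_add,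
      map_add, DGMod.map_unit_smul, DGMod.map_unit_smul, map_sum, smul_add, smul_add, Finset.smul_sum,
      Finset.smul_sum]
    refine congrArg₂ (· + ·) (congrArg₂ (· + ·) ?_ ?_) (Finset.sum_congr rfl fun e _ => ?_)
    · rw [B.pairHom_app, B.pairHom_app, ← secMap_res]
      exact B.pair_tm_d rfl hc _ h h' _ h₁' h₃ h₁ φ m
    · rw [B.pairHom_app, B.pairHom_app]
      exact B.pair_tm_map_d _ h h' _ h₁' h₄ h₁ φ m
    · have h2 := B.pair_tm_precomp (N := N) (LocalFrame.xT (E.restr hV) e.1 e.2)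
        (LocalFrame.yS (E.restr hV) e.1 e.2) (res _ hV t) h h' (a := a) (i := i) (b := b) (j := j)
        (p := p) (q := q) (by omega) (by omega) rfl rfl rfl rfl rfl rfl rfl rfl (by omega) (by omega)
        h₁ h₁' φ m
      rw [B.pairHom_app]
      refine h2.trans ?_
      change _ = c.negOnePow • (1 - e.1).negOnePow • N.act _ _ V (res _ hV (E.yS e.1 e.2))
        ((B.pairHom _ rfl rfl).app V hV _)
      rw [B.pairHom_app, ← (algT 𝒳).mul_res, smul_smul, ← Int.negOnePow_add, ← E.xT_restr h𝒳 hV e, ← E.yS_restr h𝒳 hV e]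
  have h2 := congrArg (fun f => f.app U le_rfl z) this
  refine h2.trans ?_
  change c.negOnePow • (_ + _ + F.app U le_rfl z) = _
  rw [hF]
  congr 2
  refine Finset.sum_congr rfl fun e _ => ?_
  change (1 - e.1).negOnePow • N.act _ _ U (res _ le_rfl (E.yS e.1 e.2)) _ = _
  rw [res_refl]
  rfl
end KoszulB
end Pairing

/-! ### The counit -/

section Counit
variable {X : TopCat.{u}} {O : Sheaf (Opens.grothendieckTopology X) CommRingCat.{u}}

lemma DGAlg.d_one (𝒜 : DGAlg O) {c : ℤ} (h : 0 + 1 = c) (U : Opens X) :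
    secMap (𝒜.d h 0) U (𝒜.one U) = 0 := by
  obtain rfl : c = 1 := by omega
  have h2 := 𝒜.leibniz (zero_add 0) (zero_add 1) (zero_add 1) (zero_add 1) (add_zero 1) (zero_add 1)
    (zero_add 0) U (𝒜.one U) (𝒜.one U)
  rw [𝒜.one_mul, 𝒜.mul_one, 𝒜.one_mul, Int.negOnePow_zero, one_smul] at h2
  exact left_eq_add.1 h2

/-- A sign which changes when `2` is added to the internal degree. With this sign in the counit, the twists of
the two functors, which would otherwise contribute with the same sign, cancel. -/
def halfSign (j : ℤ) : ℤˣ := (j / 2).negOnePow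

lemma halfSign_add_two (j : ℤ) : halfSign (2 + j) = -halfSign j := by
  rw [halfSign, halfSign, show (2 + j) / 2 = j / 2 + 1 by omega, Int.negOnePow_succ]

variable {n : ℕ} {𝒳 : CochainComplex (Mod O) ℤ} (h𝒳 : IsFiniteLocallyFree n 𝒳) (A : KoszulA n 𝒳)
  (B : KoszulB n 𝒳) (N : DGMod (algS 𝒳)) {p q : ℤ}

/-- The counit `s ⊗ ξ ↦ ± s · ξ(1)`, where `ξ(1)` is the pairing of `ξ` with the unit of `𝒯`. -/
noncomputable def counitX (p q : ℤ) :
    ((A.F.obj (B.F.obj N)).cx q).X p ⟶ (N.cx q).X p :=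
  (A.tmLift (U := ⊤) fun k => ⟨fun V _ => halfSign k.j • (N.act k.hab k.hij V).compl₂
      (B.pair (add_zero _) (add_zero _) V ((algT 𝒳).one V)),
    fun {V V'} hV hV' s m => by
      change halfSign k.j • N.act _ _ _ _ (B.pair _ _ _ _ _) =
        res _ _ (halfSign k.j • N.act _ _ _ _ (B.pair _ _ _ _ _))
      rw [← (algT 𝒳).one_res hV', B.pair_res, N.act_res, DGMod.map_unit_smul]⟩).toHom

lemma counitX_tm {a b i j : ℤ} (h : a + b = p) (h' : i + j = q) (V : Opens X)
    (s : Sec ((algS 𝒳).obj a i) V) (z : SSec (((B.F.obj N).cx j).X b) V) :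
    sMap (counitX A B N p q) V (A.tm (B.F.obj N) h h' V s z) =
      halfSign j • N.act h h' V s (B.pair (add_zero _) (add_zero _) V ((algT 𝒳).one V) z) :=
  A.tmLift_tm _ h h' V le_top s z

include h𝒳 in
lemma counitX_d {p' : ℤ} (hp : p + 1 = p') : ((A.F.obj (B.F.obj N)).cx q).d p p' ≫ counitX A B N p' q =
    counitX A B N p q ≫ (N.cx q).d p p' := by
  refine A.hom_ext_tm_frame (hasFrames h𝒳) fun {a b i j} h h' V E s z => ?_
  change sMap (counitX A B N p' q) V (sMap (((A.F.obj (B.F.obj N)).cx q).d p p') V _) =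
    sMap ((N.cx q).d p p') V (sMap (counitX A B N p q) V _)
  rw [(A.isTwisted h𝒳).d_tm' h h' rfl rfl hp (by omega) (by omega) V E, counitX_tm, map_add, map_add,
    DGMod.map_unit_smul, DGMod.map_unit_smul, map_sum, counitX_tm, counitX_tm, DGMod.map_unit_smul,
    N.leibniz h rfl rfl hp (by omega) (by omega) h',
    B.pair_d h𝒳 E ((algT 𝒳).one V) rfl (add_zero (b + 1)) (add_zero j) (zero_add 1) rfl (add_zero b) z]
  rw [(algT 𝒳).d_one, B.pair_zero, zero_add, Int.negOnePow_zero, one_smul, map_add, smul_add, smul_add,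
    smul_add, smul_comm (halfSign j) (a.negOnePow), add_assoc]
  refine congrArg₂ (· + ·) rfl ((add_assoc _ _ _).trans
    (Eq.trans (congrArg₂ (· + ·) rfl ?_) (add_zero _)))
  rw [← smul_add, map_sum, Finset.smul_sum, ← Finset.sum_add_distrib, Finset.sum_eq_zero, smul_zero]
  intro e _
  rw [counitX_tm, show halfSign ((twA h𝒳).w' + j) = -halfSign j from halfSign_add_two j, Units.neg_smul, ← sub_eq_add_neg, sub_eq_zero]
  congr 1
  refine Eq.trans ?_ (congrArg (N.act _ _ V _) (B.pair_act (E.xT e.1 e.2) ((algT 𝒳).one V)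
    (add_zero _) (add_zero _) rfl rfl rfl rfl (by omega) (by omega) z)).symm
  rw [DGMod.map_unit_smul, DGMod.map_unit_smul,
    show (1 - e.1) * (1 - e.1 + 0) = (1 - e.1) * (1 - e.1) by rw [add_zero], Int.negOnePow_mul_self]
  congr 1
  have key : ∀ (c k : ℤ) (h₁ : b + (1 - e.1 + 0) = c) (h₂ : j + (2 + 0) = k) (h₃ : e.1 + c = b + 1)
      (h₄ : -2 + k = j) (h₅ : a + e.1 + c = p') (h₆ : i + -2 + k = q),
      N.act (by omega : a + (b + 1) = p') h' V s (N.act (b := b + (1 - e.1 + 0)) (j := j + (2 + 0))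
        (by omega) (by omega) V (E.yS e.1 e.2)
        (B.pair rfl rfl V ((algT 𝒳).mul rfl rfl V (E.xT e.1 e.2) ((algT 𝒳).one V)) z)) =
      N.act h₅ h₆ V ((algS 𝒳).mul rfl rfl V s (E.yS e.1 e.2))
        (B.pair h₁ h₂ V ((algT 𝒳).mul rfl rfl V (E.xT e.1 e.2) ((algT 𝒳).one V)) z) := by
    rintro c k rfl rfl h₃ h₄ h₅ h₆
    exact (N.mul_act rfl h₅ h₃ _ rfl h₆ h₄ h' V s (E.yS e.1 e.2) _).symm
  exact key _ _ (by omega) (by omega) (by omega) (by omega) (by omega) (by omega)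

/-- The counit `𝒮 ⊗ 𝒯^∨ ⊗ N ⟶ N` of linear Koszul duality. -/
noncomputable def counit : A.F.obj (B.F.obj N) ⟶ N where
  f q :=
    { f p := counitX A B N p q
      comm' p p' h := (counitX_d h𝒳 A B N h).symm }
  map_act {c p₀ p l q₀ q} h h' U t z := by
    have : (LHom.ofHom U (toP.map (counitX A B N p q))).comp ((A.F.obj (B.F.obj N)).actL h h' t) =
        (N.actL h h' t).comp (LHom.ofHom U (toP.map (counitX A B N p₀ q₀))) := by
      refine A.tm_ext fun {a b i j} h₁ h₁' V hV s z => ?_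
      change sMap (counitX A B N p q) V ((A.F.obj (B.F.obj N)).act h h' V (res _ hV t) _) =
        N.act h h' V (res _ hV t) (sMap (counitX A B N p₀ q₀) V _)
      rw [A.act_tm _ h₁ h₁' h h' rfl rfl (by omega) (by omega), counitX_tm, counitX_tm,
        DGMod.map_unit_smul, N.mul_act _ _ h₁ h _ _ h₁' h']
    have h2 := congrArg (fun f => f.app U le_rfl z) this
    change sMap (counitX A B N p q) U ((A.F.obj (B.F.obj N)).act h h' U (res _ le_rfl t) z) =
        N.act h h' U (res _ le_rfl t) (sMap (counitX A B N p₀ q₀) U z) at h2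
    rwa [res_refl] at h2

lemma counit_naturality {N N' : DGMod (algS 𝒳)} (f : N ⟶ N') :
    A.F.map (B.F.map f) ≫ counit h𝒳 A B N' = counit h𝒳 A B N ≫ f := by
  refine DGMod.hom_ext fun q => HomologicalComplex.hom_ext _ _ fun p => ?_
  refine A.hom_ext_tm fun {a b i j} h h' V s z => ?_
  change sMap (counitX A B N' p q) V (sMap (((A.F.map (B.F.map f)).f q).f p) V _) =
    sMap ((f.f q).f p) V (sMap (counitX A B N p q) V _)
  rw [A.map_tm, counitX_tm, counitX_tm, B.pair_map, DGMod.map_unit_smul, f.map_act]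
end Counit

/-! ### The unit on sections -/

section Unit
variable {X : TopCat.{u}} {O : Sheaf (Opens.grothendieckTopology X) CommRingCat.{u}}
variable {n : ℕ} {𝒳 : CochainComplex (Mod O) ℤ} (h𝒳 : IsFiniteLocallyFree n 𝒳)

section
variable {J : Type} [Fintype J] [LinearOrder J] {deg : J → ℤ} {W V : Opens X} {𝒜 : DGAlg O}
  (b : MonBasis 𝒜.obj W deg) {c c' l l' : ℤ}

lemma MonBasis.mul_one_e (γ : J → ℕ) (h : c + 0 = c') (h' : l + 0 = l') (hV : V ≤ W) :
    𝒜.mul h h' V (res _ hV (b.e c l γ)) (𝒜.one V) = res _ hV (b.e c' l' γ) := by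
  obtain rfl : c = c' := by omega
  obtain rfl : l = l' := by omega
  exact 𝒜.mul_one V _

lemma MonBasis.ev_c_mul_one (γ : J → ℕ) (h : c + 0 = c') (h' : l + 0 = l') (hV : V ≤ W)
    (t : Sec (𝒜.obj c l) V) :
    ev (b.c c' l' γ) hV (𝒜.mul h h' V t (𝒜.one V)) = ev (b.c c l γ) hV t := by
  obtain rfl : c = c' := by omega
  obtain rfl : l = l' := by omega
  rw [𝒜.mul_one]

/-- The coefficients with respect to the dual basis are the pairings with the basis sections. -/
lemma MonBasis.coord_dualBasis {ℬ 𝒞 : DGAlg O} (Φ : TensorFunctor (dgDual 𝒜) ℬ 𝒞) {N : DGMod ℬ}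
    {p q r j : ℤ} (γ : J → ℕ) (h : b.dualBasis.da γ + r = p) (h' : b.dualBasis.v * len γ + j = q)
    (h₁ : p + b.da γ = r) (h₁' : q + b.v * len γ = j) (hV : V ≤ W)
    (z : SSec (((Φ.F.obj N).cx q).X p) V) :
    (b.dualBasis.coord Φ γ h h').app V hV z = Φ.pair h₁ h₁' V (b.bs γ hV) z := by
  have : b.dualBasis.coord Φ γ h h' = Φ.pairHom (N := N) (b.e _ _ γ) h₁ h₁' := by
    refine Φ.tm_ext fun {a r' i j'} h₂ h₂' V hV s m => ?_
    by_cases hd : b.dualBasis.da γ = a ∧ b.dualBasis.v * len γ = i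
    · obtain rfl : r' = r := by omega
      obtain rfl : j' = j := by omega
      have e₁ : -b.da γ = a := hd.1
      have e₂ : -b.v * len γ = i := hd.2
      rw [neg_mul] at e₂
      rw [coord_tm, Φ.pairHom_tm _ (by omega) (by omega), b.mul_one_e]
      rfl
    · rw [coord_tm_ne _ Φ γ h h' h₂ h₂' hV _ _ hd, Φ.pairHom_tm_ne]
      rintro ⟨h3, h4⟩
      refine hd ⟨?_, ?_⟩
      · change -b.da γ = a
        omega
      · change -b.v * len γ = i
        rw [neg_mul]; omega
  rw [this, Φ.pairHom_app]
  rfl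
end

include h𝒳 in
/-- A section of `𝒯^∨ ⊗ N` is determined by its pairings with the sections of `𝒯`. -/
lemma KoszulB.pair_ext (B : KoszulB n 𝒳) {N : DGMod (algS 𝒳)} {k : ℤ} (hN : BoundedBy N k) {p q : ℤ}
    {U : Opens X} {z z' : SSec (((B.F.obj N).cx q).X p) U}
    (h : ∀ (V : Opens X) (hV : V ≤ U) {c l p' q' : ℤ} (h : p + c = p') (h' : q + l = q')
      (t : Sec ((algT 𝒳).obj c l) V), LocalFrame 𝒳 V →
      B.pair h h' V t (res _ hV z) = B.pair h h' V t (res _ hV z')) :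
    z = z' := by
  refine frame_ext (hasFrames h𝒳) fun V hV E => ?_
  rw [← sub_eq_zero, ← map_sub]
  refine (E.basisTd h𝒳 (n := n)).eq_zero_of_coord B.toTensorFunctor (by
    change -(2 : ℤ) < 0; norm_num) hN le_rfl fun γ _ b j h₁ h₁' => ?_
  have e₁ : -(E.basisT h𝒳 (n := n)).da γ + b = p := h₁
  have e₂ : -(E.basisT h𝒳 (n := n)).v * len γ + j = q := h₁'
  rw [neg_mul] at e₂
  refine ((E.basisT h𝒳 (n := n)).coord_dualBasis B.toTensorFunctor γ h₁ h₁' (by omega) (by omega)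
    le_rfl _).trans ?_
  rw [map_sub, map_sub, sub_eq_zero]
  exact h V hV _ _ _ E

variable (A : KoszulA n 𝒳) (B : KoszulB n 𝒳) (M : DGMod (algT 𝒳)) {c l p p' q q' : ℤ}

/-- The map `(t, m) ↦ ± 1 ⊗ t m`, which gives the values of the unit of linear Koszul duality. -/
noncomputable def unitPair (h : p + c = p') (h' : q + l = q') (U : Opens X) :
    Sec ((algT 𝒳).obj c l) U →ₗ[Fn O U] SSec ((M.cx q).X p) U →ₗ[Fn O U]
      SSec (((A.F.obj M).cx q').X p') U :=
  (c.negOnePow * halfSign q') • (M.act ((add_comm c p).trans h) ((add_comm l q).trans h') U).compr₂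
    (A.tmL M (zero_add p') (zero_add q') U ((algS 𝒳).one U))

lemma unitPair_apply (h : p + c = p') (h' : q + l = q') (U : Opens X) (t : Sec ((algT 𝒳).obj c l) U)
    (m : SSec ((M.cx q).X p) U) : unitPair A M h h' U t m = (c.negOnePow * halfSign q') •
      A.tm M (zero_add p') (zero_add q') U ((algS 𝒳).one U)
        (M.act ((add_comm c p).trans h) ((add_comm l q).trans h') U t m) := rfl

lemma unitPair_res (h : p + c = p') (h' : q + l = q') {U V : Opens X} (hV : V ≤ U)
    (t : Sec ((algT 𝒳).obj c l) U) (m : SSec ((M.cx q).X p) U) :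
    unitPair A M h h' V (res _ hV t) (res _ hV m) = res _ hV (unitPair A M h h' U t m) := by
  rw [unitPair_apply, unitPair_apply, M.act_res, ← (algS 𝒳).one_res hV, A.tm_res, DGMod.map_unit_smul]

/-- The section `z` of `𝒯^∨ ⊗ 𝒮 ⊗ M` is the image of `m` under the unit of linear Koszul duality. -/
def IsUnitSec {U : Opens X} (m : SSec ((M.cx q).X p) U)
    (z : SSec (((B.F.obj (A.F.obj M)).cx q).X p) U) : Prop :=
  ∀ (V : Opens X) (hV : V ≤ U) {c l p' q' : ℤ} (h : p + c = p') (h' : q + l = q')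
    (t : Sec ((algT 𝒳).obj c l) V), B.pair h h' V t (res _ hV z) = unitPair A M h h' V t (res _ hV m)

variable {M} {k : ℤ} (hM : BoundedBy M k)
include h𝒳 hM

/-- Over a frame, the image of `m` is the sum of `± φ_γ ⊗ 1 ⊗ x_γ m`, where `x_γ` and `φ_γ` are dual bases of
`𝒯` and `𝒯^∨`. -/
lemma exists_isUnitSec_of_frame {W V : Opens X} (E : LocalFrame 𝒳 W) (hV : V ≤ W)
    (m : SSec ((M.cx q).X p) V) : ∃ z, IsUnitSec A B M m z := by
  have hT : (E.basisT h𝒳 (n := n)).v = 2 := rfl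
  let b := E.basisT h𝒳 (n := n)
  let d := E.basisTd h𝒳 (n := n)
  refine ⟨∑ γ ∈ shortExps (E.J n) (k - q).toNat, B.tm (A.F.obj M) (b := p + b.da γ)
    (j := q + b.v * len γ)
    (by change -b.da γ + _ = p; omega) (by change -b.v * _ + _ = q; rw [neg_mul]; omega) V
    (d.bs γ hV) (unitPair A M rfl rfl V (b.bs γ hV) m), fun V' hV' c l p' q' h h' t => ?_⟩
  rw [map_sum, map_sum]
  have hterm (γ : E.J n → ℕ) : B.pair h h' V' t (res _ hV' (B.tm (A.F.obj M) (b := p + b.da γ)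
      (j := q + b.v * len γ) (by change -b.da γ + _ = p; omega)
      (by change -b.v * _ + _ = q; rw [neg_mul]; omega) V
      (d.bs γ hV) (unitPair A M rfl rfl V (b.bs γ hV) m))) =
      unitPair A M h h' V' (ev (b.c c l γ) (hV'.trans hV) t • res _ (hV'.trans hV) (b.e c l γ))
        (res _ hV' m) := by
    rw [← B.tm_res, ← unitPair_res]
    by_cases hd : b.da γ = c ∧ b.v * len γ = l
    · obtain ⟨rfl, rfl⟩ := hd
      subst h h'
      refine (B.pairHom_tm t (neg_neg _).symm (by
        change _ = -(-b.v * _); rw [neg_mul, neg_neg]) rfl rfl _ _ le_rfl _ _).trans ?_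
      rw [res_refl, map_smul, LinearMap.smul_apply]
      refine congrArg₂ (· • ·) ?_ ?_
      · change ev (b.c _ _ γ) _ _ = _
        exact b.ev_c_mul_one γ _ _ _ t
      · rw [MonBasis.bs, res_res]
    · rw [b.c_zero fun h => hd h.2]
      have : ev (0 : Sec (dual ((algT 𝒳).obj c l)) W) (hV'.trans hV) t = 0 := rfl
      rw [this, zero_smul, map_zero]
      refine B.pair_tm_ne t ?_ h h' _ _ _ _
      rintro ⟨h3, h4⟩
      refine hd ⟨?_, ?_⟩
      · change c = - -b.da γ at h3
        omega
      · change l = -(-b.v * len γ) at h4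
        rw [neg_mul] at h4; omega
  rw [Finset.sum_congr rfl fun γ _ => hterm γ]
  by_cases hq : k < q'
  · have h0 (t : Sec ((algT 𝒳).obj c l) V') : unitPair A M h h' V' t (res _ hV' m) = 0 := by
      rw [unitPair_apply, subsingleton_of_isZero (hM q' hq p') V' (M.act _ _ V' t _), ← A.tmL_apply,
        map_zero, smul_zero]
    rw [h0]
    exact Finset.sum_eq_zero fun γ _ => h0 _
  · rw [← LinearMap.sum_apply, ← map_sum, b.expand c l _ _ V' _ t]
    intro γ _ _ h4
    rw [hT] at h4
    simp only [shortExps, Set.Finite.mem_toFinset, Set.mem_ofPred_eq]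
    omega

lemma isUnitSec_unique {U : Opens X} {m : SSec ((M.cx q).X p) U}
    {z z' : SSec (((B.F.obj (A.F.obj M)).cx q).X p) U} (h : IsUnitSec A B M m z)
    (h' : IsUnitSec A B M m z') : z = z' :=
  B.pair_ext h𝒳 (TensorFunctor.boundedBy (hasMonBases_algS h𝒳) hM) fun V hV _ _ _ _ h₁ h₁' t _ =>
    (h V hV h₁ h₁' t).trans (h' V hV h₁ h₁' t).symm

omit h𝒳 hM in
lemma IsUnitSec.res {A : KoszulA n 𝒳} {B : KoszulB n 𝒳} {M : DGMod (algT 𝒳)} {U V : Opens X} (hV : V ≤ U)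
    {m : SSec ((M.cx q).X p) U}
    {z : SSec (((B.F.obj (A.F.obj M)).cx q).X p) U} (h : IsUnitSec A B M m z) :
    IsUnitSec A B M (res _ hV m) (res _ hV z) := fun V' hV' c l p' q' h₁ h₁' t => by
  rw [res_res, res_res]
  exact h V' (hV'.trans hV) h₁ h₁' t

lemma exists_isUnitSec {U : Opens X} (m : SSec ((M.cx q).X p) U) : ∃ z, IsUnitSec A B M m z := by
  obtain ⟨z, hz⟩ := exists_glue (((B.F.obj (A.F.obj M)).cx q).X p) (U := U)
    (fun W hW z => IsUnitSec A B M (LinearKoszul.res _ hW m) z)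
    (fun W hW V hV z hz => by
      have := IsUnitSec.res hV hz
      rwa [res_res] at this)
    (fun W hW z z' hz hz' => isUnitSec_unique h𝒳 A B hM hz hz')
    (fun x hx => by
      obtain ⟨W, hxW, ⟨E⟩⟩ := hasFrames h𝒳 x
      exact ⟨U ⊓ W, inf_le_left, ⟨hx, hxW⟩, exists_isUnitSec_of_frame h𝒳 A B hM E inf_le_right _⟩)
  refine ⟨z, fun V hV c l p' q' h h' t => sec_ext _ fun x hx => ?_⟩
  obtain ⟨W, hxW, ⟨E⟩⟩ := hasFrames h𝒳 x
  obtain ⟨z', hz'⟩ := exists_isUnitSec_of_frame h𝒳 A B hM E (inf_le_right : V ⊓ W ≤ W)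
    (LinearKoszul.res _ (inf_le_left.trans hV) m)
  refine ⟨V ⊓ W, inf_le_left, ⟨hx, hxW⟩, ?_⟩
  rw [← B.pair_res, res_res, hz _ _ z' hz', ← unitPair_res, res_res]
  have := hz' (V ⊓ W) le_rfl h h' (LinearKoszul.res _ inf_le_left t)
  rwa [res_refl, res_refl] at this

/-- The unit of linear Koszul duality, on sections. -/
noncomputable def unitSec (U : Opens X) :
    SSec ((M.cx q).X p) U →ₗ[Fn O U] SSec (((B.F.obj (A.F.obj M)).cx q).X p) U where
  toFun m := (exists_isUnitSec h𝒳 A B hM m).choose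
  map_add' m m' := isUnitSec_unique h𝒳 A B hM (exists_isUnitSec h𝒳 A B hM (m + m')).choose_spec
    fun V hV c l p' q' h h' t => by
      rw [map_add, map_add, map_add, map_add, (exists_isUnitSec h𝒳 A B hM m).choose_spec,
        (exists_isUnitSec h𝒳 A B hM m').choose_spec]
  map_smul' r m := isUnitSec_unique h𝒳 A B hM (exists_isUnitSec h𝒳 A B hM (r • m)).choose_spec
    fun V hV c l p' q' h h' t => by
      rw [RingHom.id_apply, (res _ hV).map_smulₛₗ, (res _ hV).map_smulₛₗ, map_smul, map_smul,
        (exists_isUnitSec h𝒳 A B hM m).choose_spec]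

lemma isUnitSec_unitSec {U : Opens X} (m : SSec ((M.cx q).X p) U) :
    IsUnitSec A B M m (unitSec h𝒳 A B hM U m) := (exists_isUnitSec h𝒳 A B hM m).choose_spec

/-- The unit of linear Koszul duality, in a given bidegree. -/
noncomputable def unitX (p q : ℤ) : (M.cx q).X p ⟶ ((B.F.obj (A.F.obj M)).cx q).X p :=
  mkSHom (unitSec h𝒳 A B hM) fun hV m => isUnitSec_unique h𝒳 A B hM (isUnitSec_unitSec h𝒳 A B hM _)
    ((isUnitSec_unitSec h𝒳 A B hM m).res hV)

lemma pair_unitX (h : p + c = p') (h' : q + l = q') {U : Opens X} (t : Sec ((algT 𝒳).obj c l) U)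
    (m : SSec ((M.cx q).X p) U) :
    B.pair h h' U t (sMap (unitX h𝒳 A B hM p q) U m) = unitPair A M h h' U t m := by
  have := isUnitSec_unitSec h𝒳 A B hM m U le_rfl h h' t
  rwa [res_refl, res_refl] at this
end Unit

/-! ### The unit as a morphism of dg-modules -/

section Unit
variable {X : TopCat.{u}} {O : Sheaf (Opens.grothendieckTopology X) CommRingCat.{u}}
variable {n : ℕ} {𝒳 : CochainComplex (Mod O) ℤ} (h𝒳 : IsFiniteLocallyFree n 𝒳)
variable (A : KoszulA n 𝒳) (B : KoszulB n 𝒳) {M : DGMod (algT 𝒳)} {c l p p' q q' : ℤ}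
include h𝒳

/-- The values of the unit satisfy the formula for the differential of the pairing: the terms with the
generators of `𝒮` cancel the twist in `𝒮 ⊗ M`. -/
lemma unitPair_d {c' p₀ p₁ : ℤ} {U : Opens X} (E : LocalFrame 𝒳 U) (t : Sec ((algT 𝒳).obj c l) U)
    (hp : p + 1 = p₁) (h : p₁ + c = p') (h' : q + l = q') (hc : c + 1 = c') (h₃ : p + c' = p')
    (h₄ : p + c = p₀) (m : SSec ((M.cx q).X p) U) :
    unitPair A M h h' U t (sMap ((M.cx q).d p p₁) U m) =
      c.negOnePow • (unitPair A M h₃ h' U (secMap ((algT 𝒳).d hc l) U t) m +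
        sMap (((A.F.obj M).cx q').d p₀ p') U (unitPair A M h₄ h' U t m) +
        ∑ e ∈ E.idx n, (1 - e.1).negOnePow • (A.F.obj M).act (b := p + (1 - e.1 + c)) (j := q + (2 + l))
          (by omega) (by omega) U (E.yS e.1 e.2)
          (unitPair A M rfl rfl U ((algT 𝒳).mul rfl rfl U (E.xT e.1 e.2) t) m)) := by
  have hd : sMap (((A.F.obj M).cx q').d p₀ p') U (unitPair A M h₄ h' U t m) =
      (c.negOnePow * halfSign q') • (A.tm M (zero_add p') (zero_add q') U ((algS 𝒳).one U)
        (sMap ((M.cx q').d p₀ p') U (M.act ((add_comm c p).trans h₄) ((add_comm l q).trans h') U t m)) +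
        ∑ e ∈ E.idx n, A.tm M (b := 1 - e.1 + p₀) (j := 2 + q') (by omega) (by omega) U
          ((algS 𝒳).mul rfl rfl U ((algS 𝒳).one U) (E.yS e.1 e.2))
          (M.act rfl rfl U (E.xT e.1 e.2) (M.act ((add_comm c p).trans h₄) ((add_comm l q).trans h') U t m))) := by
    rw [unitPair_apply, DGMod.map_unit_smul, (A.isTwisted h𝒳).d_tm' (zero_add p₀) (zero_add q') (zero_add 1)
      (by omega : p₀ + 1 = p') (by omega) (by omega) (by omega) U E]
    refine congrArg (_ • ·) ?_
    rw [Int.negOnePow_zero, one_smul, one_smul]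
    refine congrArg₂ (· + ·) ((congrArg (· + _) ?_).trans (zero_add _)) rfl
    refine (congrArg (fun s => A.tmL M _ (zero_add q') U s _) ((algS 𝒳).d_one (zero_add 1) U)).trans ?_
    rw [map_zero, LinearMap.zero_apply]
  have hs (e : Σ k, Fin (E.r k)) : (1 - e.1).negOnePow • (A.F.obj M).act (b := p + (1 - e.1 + c))
      (j := q + (2 + l)) (by omega : e.1 + _ = p') (by omega : -2 + _ = q') U (E.yS e.1 e.2)
          (unitPair A M rfl rfl U ((algT 𝒳).mul rfl rfl U (E.xT e.1 e.2) t) m) =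
      -((c.negOnePow * halfSign q') • A.tm M (b := 1 - e.1 + p₀) (j := 2 + q') (by omega) (by omega) U
          ((algS 𝒳).mul rfl rfl U ((algS 𝒳).one U) (E.yS e.1 e.2))
          (M.act rfl rfl U (E.xT e.1 e.2) (M.act ((add_comm c p).trans h₄) ((add_comm l q).trans h') U t m))) := by
    have key : ∀ (r s r' s' a i : ℤ) (h₁ : p + (1 - e.1 + c) = r) (h₂ : q + (2 + l) = s) (h₃ : e.1 + r = p')
        (h₄' : -2 + s = q') (h₅ : 1 - e.1 + p₀ = r') (h₆ : 2 + q' = s') (h₇ : 0 + e.1 = a) (h₈ : 0 + -2 = i)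
        (h₉ : a + r' = p') (h₁₀ : i + s' = q'),
        (1 - e.1).negOnePow • (A.F.obj M).act h₃ h₄' U (E.yS e.1 e.2)
          (unitPair A M h₁ h₂ U ((algT 𝒳).mul rfl rfl U (E.xT e.1 e.2) t) m) =
        -((c.negOnePow * halfSign q') • A.tm M h₉ h₁₀ U
          ((algS 𝒳).mul h₇ h₈ U ((algS 𝒳).one U) (E.yS e.1 e.2))
          (M.act h₅ h₆ U (E.xT e.1 e.2) (M.act ((add_comm c p).trans h₄) ((add_comm l q).trans h') U t m))) := by
      intro r s r' s' a i h₁ h₂ h₃ h₄' h₅ h₆ h₇ h₈ h₉ h₁₀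
      obtain rfl : r' = r := by omega
      obtain rfl : s' = s := by omega
      obtain rfl : e.1 = a := by omega
      have hs : halfSign s' = -halfSign q' := by rw [← h₆, halfSign_add_two]
      obtain rfl : -2 = i := by omega
      rw [unitPair_apply, DGMod.map_unit_smul, A.act_tm M _ _ h₃ h₄' (add_zero e.1) (add_zero (-2)) h₃ h₄',
        (algS 𝒳).mul_one, (algS 𝒳).one_mul, M.mul_act rfl _ ((add_comm c p).trans h₄) h₅ rfl _
          ((add_comm l q).trans h') h₆, smul_smul, hs, ← Units.neg_smul]
      congr 1
      rw [Int.negOnePow_add, mul_neg, mul_neg, ← mul_assoc, ← mul_assoc, Int.units_mul_self, one_mul]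
    exact key _ _ _ _ _ _ rfl rfl (by omega) (by omega) rfl rfl rfl rfl (by omega) (by omega)
  have alg : ∀ {G : Type u} [AddCommGroup G] (σ : ℤˣ) (x y z : G),
      x + σ • (y + z) + -(σ • z) = x + σ • y := by
    intro G _ σ x y z
    rw [smul_add]; abel
  rw [hd, Finset.sum_congr rfl fun e _ => hs e, Finset.sum_neg_distrib, ← Finset.smul_sum]
  refine Eq.trans ?_ (congrArg (c.negOnePow • ·) (alg _ _ _ _)).symm
  rw [unitPair_apply, unitPair_apply,
    M.leibniz ((add_comm c p).trans h₄) hc hp (by omega : p₀ + 1 = p') ((add_comm c' p).trans h₃)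
      ((add_comm c p₁).trans h) ((add_comm l q).trans h'), ← A.tmL_apply, ← A.tmL_apply, ← A.tmL_apply,
    map_add, DGMod.map_unit_smul]
  have alg' : ∀ {G : Type u} [AddCommGroup G] (τ : ℤˣ) (x y : G), (c.negOnePow * τ) • y =
      c.negOnePow • ((c'.negOnePow * τ) • x + (c.negOnePow * τ) • (x + c.negOnePow • y)) := by
    intro G _ τ x y
    rw [← hc, Int.negOnePow_succ, smul_add (c.negOnePow * τ), neg_mul, Units.neg_smul,
      neg_add_cancel_left, smul_smul, smul_smul]
    congr 1
    calc c.negOnePow * τ = (c.negOnePow * c.negOnePow) * (c.negOnePow * τ) := by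
          rw [Int.units_mul_self, one_mul]
      _ = _ := by ac_rfl
  exact alg' _ _ _

variable {k : ℤ} (hM : BoundedBy M k)

lemma unitX_d {p₁ : ℤ} (hp : p + 1 = p₁) : unitX h𝒳 A B hM p q ≫ ((B.F.obj (A.F.obj M)).cx q).d p p₁ =
    (M.cx q).d p p₁ ≫ unitX h𝒳 A B hM p₁ q := by
  refine hom_ext_sMap fun U m => ?_
  refine B.pair_ext h𝒳 (TensorFunctor.boundedBy (hasMonBases_algS h𝒳) hM)
    fun V hV c l p' q' h h' t E => ?_
  rw [sMap_comp, sMap_comp, ← sMap_res, ← sMap_res, ← sMap_res, ← sMap_res, pair_unitX,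
    B.pair_d h𝒳 E t hp h h' rfl (by omega) rfl, unitPair_d h𝒳 A E t hp h h' rfl (by omega) rfl,
    pair_unitX, pair_unitX]
  congr 2
  exact Finset.sum_congr rfl fun e _ => by rw [pair_unitX]

lemma unitX_act {e f p₁ q₁ : ℤ} (h : e + p = p₁) (h' : f + q = q₁) {U : Opens X}
    (s : Sec ((algT 𝒳).obj e f) U) (m : SSec ((M.cx q).X p) U) :
    sMap (unitX h𝒳 A B hM p₁ q₁) U (M.act h h' U s m) =
      (B.F.obj (A.F.obj M)).act h h' U s (sMap (unitX h𝒳 A B hM p q) U m) := by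
  refine B.pair_ext h𝒳 (TensorFunctor.boundedBy (hasMonBases_algS h𝒳) hM)
    fun V hV c l p' q' h₁ h₁' t E => ?_
  rw [← sMap_res, ← M.act_res, ← DGMod.act_res, ← sMap_res, pair_unitX,
    B.pair_act (res _ hV s) t h₁ h₁' h h' rfl rfl (by omega) (by omega), pair_unitX, unitPair_apply,
    unitPair_apply, smul_smul]
  have hc := algT_comm 𝒳 (a := e) (b := c) (i := f) (j := l) rfl (add_comm c e) rfl (add_comm l f) V
    (res _ hV s) t
  rw [hc, DGMod.map_unit_smul, LinearMap.smul_apply, M.mul_act (add_comm c e) (by omega) h (by omega)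
    (add_comm l f) (by omega) h' (by omega), ← A.tmL_apply, ← A.tmL_apply, DGMod.map_unit_smul, smul_smul]
  congr 1
  rw [mul_add, Int.negOnePow_add, Int.negOnePow_mul_self, Int.negOnePow_add]
  have h1 := Int.units_mul_self e.negOnePow
  have h2 := Int.units_mul_self (e * c).negOnePow
  calc c.negOnePow * halfSign q' = (e.negOnePow * e.negOnePow) *
        ((e * c).negOnePow * (e * c).negOnePow) * (c.negOnePow * halfSign q') := by
        rw [h1, h2, one_mul, one_mul]
    _ = _ := by ac_rfl

/-- The unit `M ⟶ 𝒯^∨ ⊗ 𝒮 ⊗ M` of linear Koszul duality. -/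
noncomputable def unit : M ⟶ B.F.obj (A.F.obj M) where
  f q :=
    { f p := unitX h𝒳 A B hM p q
      comm' _ _ h := unitX_d h𝒳 A B hM h }
  map_act h h' _ t m := unitX_act h𝒳 A B hM h h' t m

lemma unit_naturality {M' : DGMod (algT 𝒳)} {k' : ℤ} (hM' : BoundedBy M' k') (f : M ⟶ M') :
    f ≫ unit h𝒳 A B hM' = unit h𝒳 A B hM ≫ B.F.map (A.F.map f) := by
  refine DGMod.hom_ext fun q => HomologicalComplex.hom_ext _ _ fun p => hom_ext_sMap fun U m => ?_
  change sMap (unitX h𝒳 A B hM' p q) U (sMap ((f.f q).f p) U m) =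
    sMap (((B.F.map (A.F.map f)).f q).f p) U (sMap (unitX h𝒳 A B hM p q) U m)
  refine B.pair_ext h𝒳 (TensorFunctor.boundedBy (hasMonBases_algS h𝒳) hM')
    fun V hV c l p' q' h h' t E => ?_
  rw [← sMap_res, ← sMap_res, ← sMap_res, ← sMap_res, B.pair_map, pair_unitX, pair_unitX,
    unitPair_apply, unitPair_apply, DGMod.map_unit_smul, A.map_tm, f.map_act]
end Unit

/-! ### The counit is a quasi-isomorphism -/

section CounitQis
variable {X : TopCat.{u}} {O : Sheaf (Opens.grothendieckTopology X) CommRingCat.{u}}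

lemma eq_zero_of_len_eq_zero {J : Type} [Fintype J] {γ : J → ℕ} (h : len γ = 0) : γ = 0 :=
  funext fun j => (Finset.sum_eq_zero_iff.1 h) j (Finset.mem_univ j)

lemma MonBasis.sec_eq_zero {J : Type} [Fintype J] [LinearOrder J] {deg : J → ℤ} {W V : Opens X}
    {P : ℤ → ℤ → PMod O} (b : MonBasis P W deg) (hV : V ≤ W) {a i : ℤ}
    (h : ∀ γ, Adm deg γ → b.da γ = a → b.v * len γ = i → False) (x : Sec (P a i) V) : x = 0 := by
  rw [← b.expand a i ∅ (fun γ h₁ h₂ h₃ => (h γ h₁ h₂ h₃).elim) V hV x]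
  exact Finset.sum_empty

variable {n : ℕ} {𝒳 : CochainComplex (Mod O) ℤ} (h𝒳 : IsFiniteLocallyFree n 𝒳) {W V : Opens X}
  (E : LocalFrame 𝒳 W) (hV : V ≤ W)

include h𝒳 E hV in
/-- The algebra `𝒮` is concentrated in nonpositive internal degrees. -/
lemma LocalFrame.algS_eq_zero {a i : ℤ} (hi : 0 < i) (x : Sec ((algS 𝒳).obj a i) V) : x = 0 :=
  (E.basisS h𝒳 (n := n)).sec_eq_zero hV (fun γ _ _ h => by
    change -2 * (len γ : ℤ) = i at h; omega) x

include h𝒳 E hV in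
/-- The coalgebra `𝒯^∨` is concentrated in nonpositive internal degrees. -/
lemma LocalFrame.dgDual_eq_zero {a i : ℤ} (hi : 0 < i) (x : Sec (dgDual (algT 𝒳) a i) V) : x = 0 :=
  (E.basisTd h𝒳 (n := n)).sec_eq_zero hV (fun γ _ _ h => by
    change -2 * (len γ : ℤ) = i at h; omega) x

include h𝒳 E hV in
lemma LocalFrame.dgDual_eq_zero' {a : ℤ} (ha : a ≠ 0) (x : Sec (dgDual (algT 𝒳) a 0) V) : x = 0 :=
  (E.basisTd h𝒳 (n := n)).sec_eq_zero hV (fun γ _ h₁ h => by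
    change -2 * (len γ : ℤ) = 0 at h
    change -tdeg _ γ = a at h₁
    rw [eq_zero_of_len_eq_zero (by omega : len γ = 0), tdeg_zero] at h₁
    exact ha (by omega)) x

lemma LocalFrame.basisS_e_zero : (E.basisS h𝒳 (n := n)).e 0 0 0 = (algS 𝒳).one W := by
  refine Subtype.ext ((if_pos ⟨tdeg_zero _, ?_⟩).trans (HBasis.pbw_zero _))
  rw [len_zero]; rfl

lemma LocalFrame.basisT_e_zero : (E.basisT h𝒳 (n := n)).e 0 0 0 = (algT 𝒳).one W := by
  refine Subtype.ext ((if_pos ⟨tdeg_zero _, ?_⟩).trans (HBasis.pbw_zero _))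
  rw [len_zero]; rfl

/-- The section of `𝒯^∨` which takes the value `1` at the unit and vanishes at the other monomials. -/
noncomputable def LocalFrame.dualOne : Sec (dgDual (algT 𝒳) 0 0) V :=
  res _ hV ((E.basisTd h𝒳 (n := n)).e 0 0 0)

variable (A : KoszulA n 𝒳) (B : KoszulB n 𝒳) {N : DGMod (algS 𝒳)} {p p' q : ℤ}

lemma LocalFrame.pair_dualOne (m : SSec ((N.cx q).X p) V) :
    B.pair (add_zero p) (add_zero q) V ((algT 𝒳).one V)
      (B.tm N (zero_add p) (zero_add q) V (E.dualOne h𝒳 hV (n := n)) m) = m := by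
  refine (B.pairHom_tm ((algT 𝒳).one V) rfl rfl (add_zero p) (add_zero q) (zero_add p) (zero_add q)
    le_rfl (E.dualOne h𝒳 hV (n := n)) m).trans ?_
  refine Eq.trans (congrArg (· • m) ?_) (one_smul _ m)
  rw [res_refl]
  refine ((E.basisT h𝒳 (n := n)).ev_c_mul_one 0 _ _ hV _).trans ?_
  rw [← (algT 𝒳).one_res hV, ← E.basisT_e_zero h𝒳]
  refine (ev_res_res _ hV _).trans ?_
  rw [(E.basisT h𝒳 (n := n)).dual_self (adm_zero _) (tdeg_zero _) (by rw [len_zero]; exact mul_zero _), map_one]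

/-- The local section `m ↦ 1 ⊗ 1^∨ ⊗ m` of the counit. -/
noncomputable def LocalFrame.counitSection (m : SSec ((N.cx q).X p) V) :
    SSec (((A.F.obj (B.F.obj N)).cx q).X p) V :=
  A.tm (B.F.obj N) (zero_add p) (zero_add q) V ((algS 𝒳).one V)
    (B.tm N (zero_add p) (zero_add q) V (E.dualOne h𝒳 hV (n := n)) m)

lemma LocalFrame.counitX_counitSection (m : SSec ((N.cx q).X p) V) :
    sMap (counitX A B N p q) V (E.counitSection h𝒳 hV A B m) = halfSign q • m := by
  rw [counitSection, counitX_tm, E.pair_dualOne, N.one_act]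

/-- The section of the counit commutes with the differential: the twists vanish, as the one on `𝒯^∨` and the
action of `𝒯` on `1^∨` land in positive internal degree. -/
lemma LocalFrame.d_counitSection (hp : p + 1 = p') (m : SSec ((N.cx q).X p) V) :
    sMap (((A.F.obj (B.F.obj N)).cx q).d p p') V (E.counitSection h𝒳 hV A B m) =
      E.counitSection h𝒳 hV A B (sMap ((N.cx q).d p p') V m) := by
  have h1 : sMap (((B.F.obj N).cx q).d p p') V
      (B.tm N (zero_add p) (zero_add q) V (E.dualOne h𝒳 hV (n := n)) m) =
      B.tm N (zero_add p') (zero_add q) V (E.dualOne h𝒳 hV (n := n)) (sMap ((N.cx q).d p p') V m) := by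
    rw [(B.isTwisted h𝒳).d_tm' (zero_add p) (zero_add q) rfl hp hp (by omega) (by omega) V (E.restr hV),
      E.dgDual_eq_zero' h𝒳 hV (by norm_num) (secMap ((twB h𝒳).dP _ _) _ _), ← B.tmL_apply, map_zero,
      LinearMap.zero_apply, zero_add, Int.negOnePow_zero, one_smul, one_smul, Finset.sum_eq_zero,
      add_zero]
    intro e _
    rw [E.dgDual_eq_zero h𝒳 hV (by change (0 : ℤ) < 0 + 2; norm_num) ((twB h𝒳).R _ _ _ _ _), ← B.tmL_apply, map_zero,
      LinearMap.zero_apply]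
  rw [counitSection, counitSection, (A.isTwisted h𝒳).d_tm' (zero_add p) (zero_add q) rfl hp hp (by omega)
    (by omega) V (E.restr hV), h1]
  rw [show secMap ((twA h𝒳).dP _ _) V ((algS 𝒳).one V) = 0 from (algS 𝒳).d_one _ V, ← A.tmL_apply, map_zero,
      LinearMap.zero_apply, zero_add, Int.negOnePow_zero, one_smul, one_smul, Finset.sum_eq_zero,
      add_zero]
  intro e _
  rw [(B.isTwisted h𝒳).act_tm _ _ _ _ _ rfl rfl (by omega) (by omega),
    E.dgDual_eq_zero h𝒳 hV (by change (0 : ℤ) < 2 + 0; norm_num) ((twB h𝒳).lact _ _ _ _ _), ← B.tmL_apply, map_zero,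
      LinearMap.zero_apply, ← A.tmL_apply, map_zero]
  rfl

lemma LocalFrame.exists_inc_eq (m : (basisAB h𝒳 E A B).Component N V q 0 p) :
    ∃ m' : SSec ((N.cx q).X p) V,
      (basisAB h𝒳 E A B).inc N V hV q 0 p m = E.counitSection h𝒳 hV A B m' := by
  have key : ∀ (a i a' i' b j b₁ j₁ : ℤ) (_ : a = 0) (_ : i = 0) (_ : a' = 0) (_ : i' = 0)
      (g : a + b = p) (g' : i + j = q) (h : a' + b₁ = b) (h' : i' + j₁ = j) (m : SSec ((N.cx j₁).X b₁) V),
      ∃ m' : SSec ((N.cx q).X p) V, A.tm (B.F.obj N) g g' V (res _ hV ((E.basisS h𝒳 (n := n)).e a i 0))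
        (B.tm N h h' V (res _ hV ((E.basisTd h𝒳 (n := n)).e a' i' 0)) m) =
          E.counitSection h𝒳 hV A B m' := by
    clear m
    rintro _ _ _ _ b j b₁ j₁ rfl rfl rfl rfl g g' h h' m
    obtain rfl : p = b := by omega
    obtain rfl : q = j := by omega
    obtain rfl : b₁ = p := by omega
    obtain rfl : j₁ = q := by omega
    refine ⟨m, ?_⟩
    rw [E.basisS_e_zero h𝒳, (algS 𝒳).one_res]
    rfl
  have hl : (len (0 : E.J n → ℕ) : ℤ) = 0 := by rw [len_zero]; rfl
  exact key _ _ _ _ _ _ _ _ (tdeg_zero _) ((congrArg _ hl).trans (mul_zero _))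
    ((congrArg Neg.neg (tdeg_zero _)).trans neg_zero) ((congrArg _ hl).trans (mul_zero _))
    (add_sub_cancel _ _) (add_sub_cancel _ _) (add_sub_cancel _ _) (add_sub_cancel _ _) m

/-- The counit is a quasi-isomorphism: locally, every cocycle is cohomologous to one of the form
`1 ⊗ 1^∨ ⊗ m`. -/
lemma quasiIso_counit {k : ℤ} (hN : BoundedBy N k) (q : ℤ) : QuasiIso ((counit h𝒳 A B N).f q) := by
  have hd (p : ℤ) {U : Opens X} (z : SSec (((A.F.obj (B.F.obj N)).cx q).X p) U) :
      sMap (counitX A B N (p + 1) q) U (sMap (((A.F.obj (B.F.obj N)).cx q).d p (p + 1)) U z) =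
        sMap ((N.cx q).d p (p + 1)) U (sMap (counitX A B N p q) U z) := by
    rw [← sMap_comp, ← sMap_comp, counitX_d h𝒳 A B N rfl]
  have hs {G : Type u} [AddCommGroup G] (x : G) : halfSign q • halfSign q • x = x := by
    rw [smul_smul, Int.units_mul_self, one_smul]
  refine quasiIso_of_sections _ (fun p U z l hz hzl x hx => ?_) (fun p U l hl x hx => ?_)
  · obtain ⟨W, hxW, ⟨E⟩⟩ := hasFrames h𝒳 x
    obtain ⟨w, m, hw⟩ := (basisAB h𝒳 E A B).exists_eq_inc (inf_le_right : U ⊓ W ≤ W) hN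
      (hasMonBases_dgDual h𝒳) (by change (0 : ℤ) < 2; norm_num) (res _ inf_le_left z)
      (by rw [sMap_res, hz, map_zero])
    obtain ⟨m', hm⟩ := E.exists_inc_eq h𝒳 (inf_le_right : U ⊓ W ≤ W) A B m
    rw [hm] at hw
    refine ⟨U ⊓ W, inf_le_left, ⟨hx, hxW⟩, w + E.counitSection h𝒳 inf_le_right A B
      (halfSign q • (res _ inf_le_left l - sMap (counitX A B N p q) _ w)), ?_⟩
    have h1 : sMap (counitX A B N (p + 1) q) U z = sMap ((N.cx q).d p (p + 1)) U l := hzl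
    have h2 := congrArg (res _ (inf_le_left : U ⊓ W ≤ U)) h1
    rw [← sMap_res, ← sMap_res, hw, map_add, hd, E.counitX_counitSection h𝒳] at h2
    rw [map_add, E.d_counitSection h𝒳 _ _ _ rfl, DGMod.map_unit_smul, map_sub, ← h2, add_sub_cancel_left, hs, hw]
  · obtain ⟨W, hxW, ⟨E⟩⟩ := hasFrames h𝒳 x
    refine ⟨U ⊓ W, inf_le_left, ⟨hx, hxW⟩, E.counitSection h𝒳 inf_le_right A B
      (halfSign q • res _ inf_le_left l), 0, ?_, ?_⟩
    · rw [E.d_counitSection h𝒳 _ _ _ rfl, DGMod.map_unit_smul, sMap_res, hl, map_zero, smul_zero]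
      have := E.d_counitSection h𝒳 (inf_le_right : U ⊓ W ≤ W) A B (N := N) (q := q) (p := p + 1) rfl 0
      have h3 := B.tmL N (zero_add (p + 1 + 1)) (zero_add q) (U ⊓ W) (E.dualOne h𝒳 inf_le_right (n := n)) |>.map_zero
      rw [LocalFrame.counitSection, ← B.tmL_apply, ← A.tmL_apply, h3]
      exact map_zero _
    · rw [map_zero, add_zero]
      refine (hs _).symm.trans (Eq.trans ?_ (E.counitX_counitSection h𝒳 _ A B _).symm)
      rfl
end CounitQis

/-! ### The unit is a quasi-isomorphism -/

section UnitQis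
variable {X : TopCat.{u}} {O : Sheaf (Opens.grothendieckTopology X) CommRingCat.{u}}
variable {n : ℕ} {𝒳 : CochainComplex (Mod O) ℤ} (h𝒳 : IsFiniteLocallyFree n 𝒳) {W V : Opens X}
  (E : LocalFrame 𝒳 W) (hV : V ≤ W) (A : KoszulA n 𝒳) (B : KoszulB n 𝒳) {M : DGMod (algT 𝒳)} {p q : ℤ}

/-- The coefficient of the unit of `𝒮` in a section of `𝒮 ⊗ M`. -/
noncomputable def LocalFrame.coordOne (p q : ℤ) :
    LHom W (toP.obj (((A.F.obj M).cx q).X p)) (toP.obj ((M.cx q).X p)) :=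
  (E.basisS h𝒳 (n := n)).coord A.toTensorFunctor 0 ((congrArg (· + p) (tdeg_zero _)).trans (zero_add p))
    ((congrArg (fun x : ℕ => -2 * (x : ℤ) + q) len_zero).trans (by simp))

lemma LocalFrame.coordOne_tm (m : SSec ((M.cx q).X p) V) :
    (E.coordOne h𝒳 A p q).app V hV (A.tm M (zero_add p) (zero_add q) V ((algS 𝒳).one V) m) = m := by
  refine ((E.basisS h𝒳 (n := n)).coord_tm _ _ _ _ _ _ hV _ _).trans ?_
  refine Eq.trans (congrArg (· • m) ?_) (one_smul _ m)
  rw [← (algS 𝒳).one_res hV, ← E.basisS_e_zero h𝒳]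
  refine (ev_res_res _ hV _).trans ?_
  rw [(E.basisS h𝒳 (n := n)).dual_self (adm_zero _) (tdeg_zero _) (by rw [len_zero]; exact mul_zero _),
    map_one]

lemma LocalFrame.coordOne_d {k : ℤ} (hM : BoundedBy M k) {p' : ℤ} (hp : p + 1 = p')
    (z : SSec (((A.F.obj M).cx q).X p) V) :
    (E.coordOne h𝒳 A p' q).app V hV (sMap (((A.F.obj M).cx q).d p p') V z) =
      sMap ((M.cx q).d p p') V ((E.coordOne h𝒳 A p q).app V hV z) := by
  refine ((A.isTwisted h𝒳).coord_d (E.basisS h𝒳 (n := n)) (by change (-2 : ℤ) ≠ 0; norm_num)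
    (by change (-2 : ℤ) < 0; norm_num) hM hp hp hV (E.restr hV) z 0
    ((congrArg (· + p) (tdeg_zero _)).trans (zero_add p)) _ _ ?_).trans ?_
  · intro γ hγ
    exfalso
    rcases Prod.Lex.toLex_lt_toLex.1 hγ with h | ⟨h, h'⟩
    · change -2 * (-2 * (len γ : ℤ)) < -2 * (-2 * (len (0 : E.J n → ℕ) : ℤ)) at h
      rw [len_zero] at h
      omega
    · change -2 * (-2 * (len γ : ℤ)) = -2 * (-2 * (len (0 : E.J n → ℕ) : ℤ)) at h
      rw [len_zero] at h
      rw [eq_zero_of_len_eq_zero (by omega : len γ = 0)] at h'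
      exact lt_irrefl _ h'
  · rw [show (E.basisS h𝒳 (n := n)).da 0 = 0 from tdeg_zero _, Int.negOnePow_zero, one_smul]
    rfl

lemma LocalFrame.coordOne_act {c l p₀ q₀ : ℤ} (hl : l < 0) (h : c + p₀ = p) (h' : l + q₀ = q)
    (s : Sec ((algS 𝒳).obj c l) V) (z : SSec (((A.F.obj M).cx q₀).X p₀) V) :
    (E.coordOne h𝒳 A p q).app V hV ((A.F.obj M).act h h' V s z) = 0 := by
  have : ((E.coordOne h𝒳 A p q).restr hV).comp ((A.F.obj M).actL h h' s) = 0 := by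
    refine A.tm_ext fun {a b i j} h₁ h₁' V' hV' t m => ?_
    change (E.coordOne h𝒳 A p q).app V' (hV'.trans hV)
      ((A.F.obj M).act h h' V' (res _ hV' s) (A.tm M h₁ h₁' V' t m)) = 0
    rw [A.act_tm _ h₁ h₁' h h' rfl rfl (by omega) (by omega)]
    by_cases hi : 0 < i
    · rw [E.algS_eq_zero h𝒳 (n := n) (hV'.trans hV) hi t, map_zero, ← A.tmL_apply, map_zero,
        LinearMap.zero_apply, map_zero]
    · refine (E.basisS h𝒳 (n := n)).coord_tm_ne _ 0 _ _ _ _ _ _ _ fun h => ?_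
      have h2 : -2 * (len (0 : E.J n → ℕ) : ℤ) = l + i := h.2
      rw [len_zero] at h2
      omega
  have h2 := congrArg (fun f => f.app V le_rfl z) this
  change (E.coordOne h𝒳 A p q).app V hV ((A.F.obj M).act h h' V (res _ le_rfl s) z) = 0 at h2
  rwa [res_refl] at h2

/-- The local retraction of the unit: pair with the unit of `𝒯` and take the coefficient of the unit
of `𝒮`. -/
noncomputable def LocalFrame.unitRetraction (z : SSec (((B.F.obj (A.F.obj M)).cx q).X p) V) :
    SSec ((M.cx q).X p) V :=
  (E.coordOne h𝒳 A p q).app V hV (B.pair (add_zero p) (add_zero q) V ((algT 𝒳).one V) z)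

lemma LocalFrame.unitRetraction_unitX {k : ℤ} (hM : BoundedBy M k) (m : SSec ((M.cx q).X p) V) :
    E.unitRetraction h𝒳 hV A B (sMap (unitX h𝒳 A B hM p q) V m) = halfSign q • m := by
  rw [unitRetraction, pair_unitX, unitPair_apply, DGMod.map_unit_smul, Int.negOnePow_zero, one_mul]
  refine congrArg _ (Eq.trans ?_ (E.coordOne_tm h𝒳 hV A m))
  exact congrArg _ (congrArg _ (M.one_act V m))

lemma LocalFrame.unitRetraction_d {k : ℤ} (hM : BoundedBy M k) {p' : ℤ} (hp : p + 1 = p')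
    (z : SSec (((B.F.obj (A.F.obj M)).cx q).X p) V) :
    E.unitRetraction h𝒳 hV A B (sMap (((B.F.obj (A.F.obj M)).cx q).d p p') V z) =
      sMap ((M.cx q).d p p') V (E.unitRetraction h𝒳 hV A B z) := by
  rw [unitRetraction, unitRetraction, B.pair_d h𝒳 (E.restr hV) ((algT 𝒳).one V) hp (add_zero p')
    (add_zero q) (zero_add 1) hp (add_zero p) z, (algT 𝒳).d_one, B.pair_zero, zero_add,
    Int.negOnePow_zero, one_smul, map_add, map_sum, E.coordOne_d h𝒳 hV A hM hp, Finset.sum_eq_zero, add_zero]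
  intro e _
  rw [DGMod.map_unit_smul, E.coordOne_act h𝒳 hV A (by norm_num), smul_zero]

lemma LocalFrame.co_eq_zero (z : SSec (((B.F.obj (A.F.obj M)).cx q).X p) V)
    (hz : E.unitRetraction h𝒳 hV A B z = 0) : (basisBA h𝒳 E A B).co M V hV q 0 p z = 0 := by
  have hp : ∀ (c l : ℤ) (_ : c = 0) (_ : l = 0) (h : p + c = p) (h' : q + l = q),
      B.pair h h' V (res _ hV ((E.basisT h𝒳 (n := n)).e c l 0)) z =
        B.pair (add_zero p) (add_zero q) V ((algT 𝒳).one V) z := by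
    rintro _ _ rfl rfl h h'
    rw [E.basisT_e_zero h𝒳, (algT 𝒳).one_res]
  have hl : (len (0 : E.J n → ℕ) : ℤ) = 0 := by rw [len_zero]; rfl
  have key : ∀ (b j b₁ j₁ : ℤ) (_ : b = p) (_ : j = q) (_ : b₁ = p) (_ : j₁ = q)
      (h : (E.basisTd h𝒳 (n := n)).da 0 + b = p) (h' : (E.basisTd h𝒳 (n := n)).v * len (0 : E.J n → ℕ) + j = q)
      (g : (E.basisS h𝒳 (n := n)).da 0 + b₁ = b)
      (g' : (E.basisS h𝒳 (n := n)).v * len (0 : E.J n → ℕ) + j₁ = j),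
      ((E.basisS h𝒳 (n := n)).coord (M := M) A.toTensorFunctor 0 g g').app V hV
        (((E.basisTd h𝒳 (n := n)).coord B.toTensorFunctor 0 h h').app V hV z) = 0 := by
    rintro _ _ _ _ rfl rfl rfl rfl h h' g g'
    refine Eq.trans (congrArg _ (((E.basisT h𝒳 (n := n)).coord_dualBasis B.toTensorFunctor 0 h h'
      ((congrArg (_ + ·) (tdeg_zero _)).trans (add_zero _))
      ((congrArg (fun x => _ + 2 * x) hl).trans (by simp)) hV z).trans (hp _ _ (tdeg_zero _) ?_ _ _))) hz
    exact (congrArg _ hl).trans (mul_zero _)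
  have h1 : (E.basisTd h𝒳 (n := n)).da 0 = 0 := (congrArg Neg.neg (tdeg_zero _)).trans neg_zero
  have h2 : (E.basisS h𝒳 (n := n)).da 0 = 0 := tdeg_zero _
  have h3 : (E.basisTd h𝒳 (n := n)).v * (len (0 : E.J n → ℕ) : ℤ) = 0 := (congrArg _ hl).trans (mul_zero _)
  have h4 : (E.basisS h𝒳 (n := n)).v * (len (0 : E.J n → ℕ) : ℤ) = 0 := (congrArg _ hl).trans (mul_zero _)
  refine key _ _ _ _ ?_ ?_ ?_ ?_ (add_sub_cancel _ _) (add_sub_cancel _ _) (add_sub_cancel _ _)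
    (add_sub_cancel _ _)
  · change p - (E.basisTd h𝒳 (n := n)).da 0 = p
    omega
  · change q - (E.basisTd h𝒳 (n := n)).v * (len (0 : E.J n → ℕ) : ℤ) = q
    omega
  · change p - (E.basisTd h𝒳 (n := n)).da 0 - (E.basisS h𝒳 (n := n)).da 0 = p
    omega
  · change q - (E.basisTd h𝒳 (n := n)).v * (len (0 : E.J n → ℕ) : ℤ) -
      (E.basisS h𝒳 (n := n)).v * (len (0 : E.J n → ℕ) : ℤ) = q
    omega

/-- The unit is a quasi-isomorphism: locally, every cocycle on which the retraction vanishes is a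
coboundary. -/
lemma quasiIso_unit {k : ℤ} (hM : BoundedBy M k) (q : ℤ) : QuasiIso ((unit h𝒳 A B hM).f q) := by
  have hd (p : ℤ) {U : Opens X} (z : SSec ((M.cx q).X p) U) :
      sMap (((B.F.obj (A.F.obj M)).cx q).d p (p + 1)) U (sMap (unitX h𝒳 A B hM p q) U z) =
        sMap (unitX h𝒳 A B hM (p + 1) q) U (sMap ((M.cx q).d p (p + 1)) U z) := by
    rw [← sMap_comp, ← sMap_comp, unitX_d h𝒳 A B hM rfl]
  have hs {G : Type u} [AddCommGroup G] (x : G) : halfSign q • halfSign q • x = x := by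
    rw [smul_smul, Int.units_mul_self, one_smul]
  refine quasiIso_of_sections _ (fun p U z l hz hzl x hx => ?_) (fun p U l hl x hx => ?_)
  · obtain ⟨W, hxW, ⟨E⟩⟩ := hasFrames h𝒳 x
    refine ⟨U ⊓ W, inf_le_left, ⟨hx, hxW⟩, halfSign q • E.unitRetraction h𝒳 inf_le_right A B
      (res _ inf_le_left l), ?_⟩
    have h1 : sMap (unitX h𝒳 A B hM (p + 1) q) U z =
      sMap (((B.F.obj (A.F.obj M)).cx q).d p (p + 1)) U l := hzl
    have h2 := congrArg (res _ (inf_le_left : U ⊓ W ≤ U)) h1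
    rw [← sMap_res, ← sMap_res] at h2
    rw [DGMod.map_unit_smul, ← E.unitRetraction_d h𝒳 inf_le_right A B hM rfl, ← h2,
      E.unitRetraction_unitX, hs]
  · obtain ⟨W, hxW, ⟨E⟩⟩ := hasFrames h𝒳 x
    set l' : SSec (((B.F.obj (A.F.obj M)).cx q).X (p + 1)) (U ⊓ W) := res _ inf_le_left l with hl'
    have hdl : sMap (((B.F.obj (A.F.obj M)).cx q).d (p + 1) (p + 1 + 1)) (U ⊓ W) l' = 0 := by
      rw [hl', sMap_res, hl, map_zero]
    have hdk : sMap ((M.cx q).d (p + 1) (p + 1 + 1)) (U ⊓ W)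
        (halfSign q • E.unitRetraction h𝒳 inf_le_right A B l') = 0 := by
      rw [DGMod.map_unit_smul, ← E.unitRetraction_d h𝒳 inf_le_right A B hM rfl, hdl]
      simp [LocalFrame.unitRetraction]
    obtain ⟨w, hw⟩ := (basisBA h𝒳 E A B).exists_eq_d (inf_le_right : U ⊓ W ≤ W) hM
      (hasMonBases_algS h𝒳) (by change (-2 : ℤ) < 0; norm_num)
      (l' - sMap (unitX h𝒳 A B hM (p + 1) q) _ (halfSign q • E.unitRetraction h𝒳 inf_le_right A B l'))
      (by rw [map_sub, hd, hdk, hdl, map_zero, sub_zero]) (E.co_eq_zero h𝒳 _ A B _ (by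
        refine Eq.trans (b := E.unitRetraction h𝒳 inf_le_right A B l' - E.unitRetraction h𝒳 inf_le_right A B
          (sMap (unitX h𝒳 A B hM (p + 1) q) _ (halfSign q • E.unitRetraction h𝒳 inf_le_right A B l'))) ?_ ?_
        · simp only [LocalFrame.unitRetraction, map_sub]
        · rw [E.unitRetraction_unitX, hs, sub_self]))
    exact ⟨U ⊓ W, inf_le_left, ⟨hx, hxW⟩, _, w, hdk, sub_eq_iff_eq_add'.1 hw⟩

/-! ### The equivalence of derived categories -/

variable {P : ObjectProperty (Mod O)} (hA : ∀ M, minus (algT 𝒳) P M → minus (algS 𝒳) P (A.F.obj M))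
  (hB : ∀ N, minus (algS 𝒳) P N → minus (algT 𝒳) P (B.F.obj N))

include h𝒳 in
lemma nonempty_unitIso (qA : PreservesQis (restrictMinus A.F hA)) (qB : PreservesQis (restrictMinus B.F hB)) :
    Nonempty (derived (restrictMinus A.F hA) qA ⋙ derived (restrictMinus B.F hB) qB ≅
      𝟭 (DMinus (algT 𝒳) P)) := by
  have hb (M : CMinus (algT 𝒳) P) : BoundedBy M.obj M.property.1.choose := M.property.1.choose_spec
  refine nonempty_derived_comp_iso' _ qA _ qB
    { app M := ObjectProperty.homMk (unit h𝒳 A B (hb M))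
      naturality M M' f := ?_ } fun M q => quasiIso_unit h𝒳 A B (hb M) q
  exact ObjectProperty.hom_ext _ (unit_naturality h𝒳 A B (hb M) (hb M') f.hom)

include h𝒳 in
lemma nonempty_counitIso (qA : PreservesQis (restrictMinus A.F hA)) (qB : PreservesQis (restrictMinus B.F hB)) :
    Nonempty (derived (restrictMinus B.F hB) qB ⋙ derived (restrictMinus A.F hA) qA ≅
      𝟭 (DMinus (algS 𝒳) P)) := by
  refine nonempty_derived_comp_iso _ qB _ qA
    { app N := ObjectProperty.homMk (counit h𝒳 A B N.obj)
      naturality N N' f := ?_ } fun N q => quasiIso_counit h𝒳 A B N.property.1.choose_spec q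
  exact ObjectProperty.hom_ext _ (counit_naturality h𝒳 A B f.hom)

/-- Over some neighbourhood of every point, `G` is a direct summand of a finite sum of modules with the
property `Q`. -/
def IsLocalSummand (Q : ObjectProperty (Mod O)) (G : Mod O) : Prop :=
  ∀ x : X, ∃ (W : Opens X) (ι : Type) (s : Finset ι) (M : ι → Mod O)
    (c : ∀ k, LHom W (toP.obj G) (toP.obj (M k))) (i : ∀ k, LHom W (toP.obj (M k)) (toP.obj G)),
    x ∈ W ∧ (∀ k, Q (M k)) ∧
      ∀ (V : Opens X) (hV : V ≤ W) (z : SSec G V), ∑ k ∈ s, (i k).app V hV ((c k).app V hV z) = z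

/-- The coefficients and the multiplications by the basis sections exhibit the components of `P ⊗ M` as local
direct summands of finite sums of components of `M`. -/
lemma TensorFunctor.minus_of_local {𝒜 ℬ : DGAlg O} {F : ℤ → ℤ → PMod O} (Φ : TensorFunctor F 𝒜 ℬ)
    (hF : HasMonBases 𝒳 F) (hP : ∀ G, IsLocalSummand P G → P G) (M : DGMod 𝒜) (hM : minus 𝒜 P M) :
    minus ℬ P (Φ.F.obj M) := by
  obtain ⟨⟨N, hN⟩, hM⟩ := hM
  refine ⟨⟨N, Φ.boundedBy hF hN⟩, fun q p => hP _ fun x => ?_⟩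
  obtain ⟨W, hx, -, J, _, _, deg, B, hv⟩ := hF x
  exact ⟨W, J → ℕ, shortExps J (N - q).toNat, fun γ => (M.cx (q - B.v * len γ)).X (p - B.da γ),
    fun γ => B.coord Φ γ (add_sub_cancel _ _) (add_sub_cancel _ _),
    fun γ => B.ins Φ γ (add_sub_cancel _ _) (add_sub_cancel _ _), hx, fun γ => hM _ _,
    fun V hV z => B.sum_coord Φ hN _ (fun γ _ hγ => B.mem_shortExps hv hγ) hV z⟩

include h𝒳 in
/-- Linear Koszul duality for the dg-modules whose components have a property that passes to local
direct summands of finite sums. -/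
lemma koszulDuality_of_local (hP : ∀ G, IsLocalSummand P G → P G) : KoszulDuality n 𝒳 P := by
  have hF := hasFrames h𝒳
  have hS := hasMonBases_algS h𝒳
  have hT := hasMonBases_dgDual h𝒳
  refine ⟨nonempty_koszulA h𝒳 hF, nonempty_koszulB h𝒳 hF, fun A B =>
    ⟨A.minus_of_local hS hP, B.minus_of_local hT hP, A.preservesShortExact hS _,
      B.preservesShortExact hT _, ?_⟩⟩
  have qA := (A.isTwisted h𝒳).preservesQis hF hS (by change (-2 : ℤ) ≠ 0; norm_num)
    (A.minus_of_local hS hP)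
  have qB := (B.isTwisted h𝒳).preservesQis hF hT (by change (2 : ℤ) ≠ 0; norm_num)
    (B.minus_of_local hT hP)
  exact ⟨qA, qB, (A.isTwisted h𝒳).isTriangulated hF _ qA, (B.isTwisted h𝒳).isTriangulated hF _ qB,
    nonempty_unitIso h𝒳 A B _ _ qA qB, nonempty_counitIso h𝒳 A B _ _ qA qB⟩
end UnitQis

/-! ### Quasi-coherent modules -/

section Quasicoherent
open AlgebraicGeometry

/-- If `T` is an additive endofunctor with a natural transformation `ε` to the identity, then `ε` is
invertible at a direct summand of a finite sum of objects at which it is invertible. -/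
lemma isIso_app_of_sum_eq_id {C : Type*} [Category* C] [Preadditive C] {T : C ⥤ C} [T.Additive]
    (ε : T ⟶ 𝟭 C) {ι : Type*} (s : Finset ι) {G : C} {M : ι → C} (c : ∀ k, G ⟶ M k)
    (i : ∀ k, M k ⟶ G) (h : ∑ k ∈ s, c k ≫ i k = 𝟙 G) (hM : ∀ k, IsIso (ε.app (M k))) :
    IsIso (ε.app G) := by
  refine ⟨∑ k ∈ s, c k ≫ inv (ε.app (M k)) ≫ T.map (i k), ?_, ?_⟩
  · have h1 (k : ι) : ε.app G ≫ c k ≫ inv (ε.app (M k)) ≫ T.map (i k) = T.map (c k ≫ i k) := by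
      have := ε.naturality (c k)
      dsimp only [Functor.id_map, Functor.id_obj] at this ⊢
      rw [← Category.assoc, ← this, Category.assoc, IsIso.hom_inv_id_assoc, T.map_comp]
    refine (Preadditive.comp_sum _ _ _).trans ?_
    rw [Finset.sum_congr rfl fun k _ => h1 k, ← T.map_sum, h, T.map_id]
  · have h1 (k : ι) : (c k ≫ inv (ε.app (M k)) ≫ T.map (i k)) ≫ ε.app G = c k ≫ i k := by
      have := ε.naturality (i k)
      dsimp only [Functor.id_map, Functor.id_obj] at this ⊢
      rw [Category.assoc, Category.assoc, this, IsIso.inv_hom_id_assoc]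
    refine (Preadditive.sum_comp _ _ _).trans ?_
    rw [Finset.sum_congr rfl fun k _ => h1 k, h]
    rfl

variable {X : Scheme.{u}} {W : X.Opens}

/-- The morphism between restrictions along an open immersion that is induced by a local map. -/
noncomputable def LHom.restrictHom {Y : Scheme.{u}} (f : Y ⟶ X) [IsOpenImmersion f] (hf : f.opensRange ≤ W)
    {G H : Mod X.sheaf} (φ : LHom W (toP.obj G) (toP.obj H)) :
    (Scheme.Modules.restrictFunctor f).obj G ⟶ (Scheme.Modules.restrictFunctor f).obj H :=
  SheafOfModules.Hom.mk
    { app V := ModuleCat.ofHom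
        (X := ((Scheme.Modules.restrictFunctor f).obj G).val.obj V)
        (Y := ((Scheme.Modules.restrictFunctor f).obj H).val.obj V)
        { toFun x := φ.app (f ''ᵁ V.unop) ((f.image_le_opensRange V.unop).trans hf) x
          map_add' x y := map_add (φ.app (f ''ᵁ V.unop) _) x y
          map_smul' r x := (φ.app (f ''ᵁ V.unop) _).map_smul
            ((f.appIso V.unop).inv r) x }
      naturality {V V'} g := by
        ext x
        exact φ.app_res _ (f.image_mono (leOfHom g.unop)) x }

/-- A module on the spectrum of a ring is quasi-coherent if it is a direct summand of a finite sum of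
quasi-coherent modules. -/
lemma exists_tilde_iso {R : CommRingCat.{u}} {ι : Type*} (s : Finset ι) {G : (Spec R).Modules}
    {M : ι → (Spec R).Modules} (c : ∀ k, G ⟶ M k) (i : ∀ k, M k ⟶ G)
    (h : ∑ k ∈ s, c k ≫ i k = 𝟙 G) (hM : ∀ k, (M k).IsQuasicoherent) :
    ∃ N : ModuleCat R, Nonempty (tilde N ≅ G) := by
  have : (moduleSpecΓFunctor (R := R)).Additive := tilde.adjunction.right_adjoint_additive
  have := isIso_app_of_sum_eq_id (T := moduleSpecΓFunctor ⋙ tilde.functor R)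
    (tilde.adjunction (R := R)).counit s c i h fun k => by
      have := hM k
      exact inferInstanceAs (IsIso (Scheme.Modules.fromTildeΓ (M k)))
  exact ⟨_, ⟨@asIso _ _ _ _ _ this⟩⟩

/-- A presentation over an affine open subset from one over its spectrum. -/
lemma nonempty_presentation_over {U : X.Opens} (hU : IsAffineOpen U) {G : X.Modules}
    (P : SheafOfModules.Presentation (G.restrict hU.fromSpec)) :
    Nonempty (SheafOfModules.Presentation (SheafOfModules.over G U)) := by
  let e : ((G.restrict hU.fromSpec).restrict hU.isoSpec.hom) ≅ G.restrict U.ι :=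
    (Scheme.Modules.restrictFunctorComp hU.isoSpec.hom hU.fromSpec).symm.app G ≪≫
      (Scheme.Modules.restrictFunctorCongr hU.isoSpec_hom_fromSpec).app G
  let e' : (Scheme.Modules.overEquiv U).inverse.obj (G.restrict U.ι) ≅ SheafOfModules.over G U :=
    (Scheme.Modules.overEquiv U).inverse.mapIso ((Scheme.Modules.overFunctorEquiv U).symm.app G) ≪≫
      ((Scheme.Modules.overEquiv U).unitIso.symm.app _)
  let P₁ := Scheme.Modules.presentationRestrict hU.isoSpec.hom P
  let P₂ : SheafOfModules.Presentation (G.restrict U.ι) := @SheafOfModules.Presentation.ofIsIso.{u, u, u} _ _ _ _ _ _ _ _ e.hom (Iso.isIso_hom e) P₁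
  let F : SheafOfModules.{u} (U : Scheme.{u}).ringCatSheaf ⥤
    SheafOfModules.{u} (X.ringCatSheaf.over U) := (Scheme.Modules.overEquiv U).inverse
  have : PreservesColimitsOfSize.{u, u} F :=
    (Scheme.Modules.overEquiv U).symm.toAdjunction.leftAdjoint_preservesColimits
  let P₃ := P₂.map F
    (U.sheafOfModulesEquivOverInverseUnit X.ringCatSheaf).symm
  exact ⟨SheafOfModules.Presentation.ofIsIso.{u, u, u} e'.hom P₃⟩

/-- A module is quasi-coherent if it is locally a direct summand of a finite sum of quasi-coherent
modules. -/
lemma isQuasicoherent_of_isLocalSummand (G : Mod X.sheaf)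
    (h : IsLocalSummand (fun M => SheafOfModules.IsQuasicoherent.{u} (R := X.ringCatSheaf) M) G) :
    SheafOfModules.IsQuasicoherent.{u} (R := X.ringCatSheaf) G := by
  have h1 (x : X) : ∃ (U : X.Opens), x ∈ U ∧ Nonempty (SheafOfModules.Presentation
      (SheafOfModules.over G U)) := by
    obtain ⟨W, ι, s, M, c, i, hx, hM, hs⟩ := h x
    obtain ⟨U, hU', hxU, hUW⟩ := Opens.isBasis_iff_nbhd.1 X.isBasis_affineOpens hx
    have hU : IsAffineOpen U := hU'
    refine ⟨U, hxU, ?_⟩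
    have hr : Scheme.Hom.opensRange hU.fromSpec ≤ W := hU.opensRange_fromSpec.le.trans hUW
    obtain ⟨N, ⟨e⟩⟩ := exists_tilde_iso s (fun k => (c k).restrictHom hU.fromSpec hr)
      (fun k => (i k).restrictHom hU.fromSpec hr) (by
        refine Scheme.Modules.hom_ext _ _ fun V => ?_
        ext z
        let f : (Scheme.Modules.restrict G hU.fromSpec ⟶ Scheme.Modules.restrict G hU.fromSpec) →+
            Γ(Scheme.Modules.restrict G hU.fromSpec, V) :=
          { toFun φ := φ.app V z
            map_zero' := rfl
            map_add' _ _ := rfl }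
        exact (map_sum f _ s).trans
          (hs (hU.fromSpec ''ᵁ V) ((hU.fromSpec.image_le_opensRange V).trans hr) z)) fun k => by
        have := hM k
        exact Scheme.Modules.isQuasicoherent_restrictFunctor hU.fromSpec (M k)
    exact nonempty_presentation_over hU
      (@SheafOfModules.Presentation.ofIsIso.{u, u, u} _ _ _ _ _ _ _ _ e.hom (Iso.isIso_hom e)
      (presentationTilde.{u} _ .univ (by simp) _ (Submodule.span_eq _)))
  choose U hxU P using h1
  let q : SheafOfModules.QuasicoherentData.{u} (R := X.ringCatSheaf) G :=
    { I := X
      X := U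
      coversTop := (Opens.coversTop_iff X U).2 (by
        rw [IsOpenCover, eq_top_iff]
        exact fun x _ => Opens.mem_iSup.2 ⟨x, hxU x⟩)
      presentation x := (P x).some }
  exact q.isQuasicoherent

/-- Linear Koszul duality for quasi-coherent modules on a scheme. -/
lemma koszulDuality_isQuasicoherent {n : ℕ} {𝒳 : CochainComplex (Mod X.sheaf) ℤ}
    (h𝒳 : IsFiniteLocallyFree n 𝒳) :
    KoszulDuality n 𝒳 (fun M => SheafOfModules.IsQuasicoherent M) :=
  koszulDuality_of_local h𝒳 isQuasicoherent_of_isLocalSummand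
end Quasicoherent

end LinearKoszul

theorem theorem1p1 :
    (∀ (X : TopCat.{u}) (O : Sheaf (Opens.grothendieckTopology X) CommRingCat.{u}) (n : ℕ)
      (𝒳 : CochainComplex (LinearKoszul.Mod O) ℤ), LinearKoszul.IsFiniteLocallyFree n 𝒳 →
      LinearKoszul.KoszulDuality n 𝒳 ⊤) ∧
    (∀ (X : AlgebraicGeometry.Scheme.{u}) (n : ℕ)
      (𝒳 : CochainComplex (LinearKoszul.Mod X.sheaf) ℤ), LinearKoszul.IsFiniteLocallyFree n 𝒳 →
      LinearKoszul.KoszulDuality n 𝒳 (fun M => SheafOfModules.IsQuasicoherent M)) :=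
  ⟨fun _ _ _ _ h𝒳 => LinearKoszul.koszulDuality_of_local h𝒳 fun _ _ => trivial,
    fun _ _ _ h𝒳 => LinearKoszul.koszulDuality_isQuasicoherent h𝒳⟩
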